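/- **Setting.** Let $\mathcal C$ be a triangulated category, $v\colon K(\mathcal C)\to\Lambda$ a surjective homomorphism from its Grothendieck group to a lattice of finite rank, and fix an inner product on $\Lambda\otimes\mathbb R$; write $Z(c)$ for $Z(v([c]))$. For a slicing $P$ of $\mathcal C$ and $I\subset\mathbb R$ let $P(I)$ be the full subcategory of objects all of whose Harder–Narasimhan factors have phase in $I$, and let $\phi^{+}_P(c)$, $\phi^-_P(c)$ be the maximal and minimal phase of $c\neq0$. $P$ is locally finite if for some $0<\epsilon<\tfrac12$ every quasi-abelian category $P(\phi-\epsilon,\phi+\epsilon)$ is artinian and noetherian for strict subobjects. An object is stable if it is non-zero and has no proper non-zero strict subobjects in some $P(\phi)$. The set $\mathrm{Slice}(\mathcal C)$ of locally finite slicings has the metric $d(P,Q)=\sup_{c\ne0}\max\{|\phi_P^-(c)-\phi_Q^-(c)|,|\phi_P^+(c)-\phi_Q^+(c)|\}$ (possibly infinite), and $\mathrm{Hom}(\Lambda,\mathbb C)$ the operator norm. A pair $(P,Z)\in\mathrm{Slice}(\mathcal C)\times\mathrm{Hom}(\Lambda,\mathbb C)$ is a *stability condition* if $Z(c)\in\mathbb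 R_{>0}e^{i\pi\phi}$ for $0\ne c\in P(\phi)$ and there is $K>0$ with $|Z(c)|\ge\|v(c)\|/K$ for all semistable $c$. It is a *lax stability condition* if $Z(c)\in\mathbb R_{\ge0}e^{i\pi\phi}$ for $0\neq c\in P(\phi)$ and there is $K>0$ with $|Z(s)|\ge\|v(s)\|/K$ for all stable $s$ with $Z(s)\ne0$. Let $\mathrm{Stab}(\mathcal C)$ be the space of stability conditions and $\mathrm{LStab}(\mathcal C)$ the space of lax stability conditions in the closure of $\mathrm{Stab}(\mathcal C)$. The mass of an object is the sum of the $|Z|$ of its Harder–Narasimhan factors. Let $\mathrm{QStab}(\mathcal C)$ be the topological quotient of $\mathrm{LStab}(\mathcal C)$ that identifies two points if they have the same charge $Z$ and lie in the same connected component of the fibre of $(P,Z)\mapsto Z$, and let $\mathrm{QStab}(\mathcal C)^*$ be the subspace of classes for which some object has positive mass. The universal cover $G$ of $GL_2^+(\mathbb R)$, whose elements are pairs $g=(T,\theta)$ with $T\in GL_2^+(\mathbb R)$ and $\theta\colon\mathbb R\to\mathbb R$ increasing with $\theta(t+1)=\theta(t)+1$ inducing the same map as $T$ on $\mathbb R/2\mathbb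 Z=(\mathbb R^2\setminus 0)/\mathbb R_{>0}$, acts by $(P,Z)\cdot g=(P\circ\theta,T^{-1}\circ Z)$. The subgroup $\mathbb C\subset G$ acts by $(P,Z)\cdot z=(P(\,\cdot+\mathrm{Re}\,z),e^{-i\pi z}Z)$. The quotients $\mathrm{Stab}(\mathcal C)/\mathbb C$ and $\mathrm{QStab}(\mathcal C)^*/\mathbb C$ have the quotient topology. Let $\sigma=(P,Z)\in\mathrm{Stab}(\mathcal C)$ have phase diagram $\Phi_\sigma=\{\phi+\mathbb Z: P(\phi)\ne0\}\subset\mathbb R/\mathbb Z$ with at least two points. **The subsets of the disk.** Let $\mathbb D$ be the open unit disk, let $\mathbb D_\sigma=\mathbb D\cup\{e^{2\pi i\phi}:\phi\notin\overline{\Phi_\sigma}\}$, and let $\mathbb D_\sigma^Q$ be the union of $\mathbb D$ and the points $e^{2\pi i\phi}$ such that for some $\epsilon>0$ either (a) $P(\phi-\epsilon,\phi)=0$ and no simple object of $P[\phi,\phi+1)$ lies in $P(\phi,\phi+\epsilon)$, or (b) $P(\phi,\phi+\epsilon)=0$ and no simple object of $P(\phi,\phi+1]$ lies in $P(\phi+1-\epsilon,\phi+1)$.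 Let $f(w)=i\frac{1+w}{1-w}$ and let $M_w\in\mathrm{End}_{\mathbb R}(\mathbb C)$ be given by $M_w(1)=1$, $M_w(i)=f(w)$ for $w\neq1$ and $M_1(1)=0$, $M_1(i)=-1$. Put $Z_w=M_w\circ Z$. * For $w\in\mathbb D$ let $\sigma_w=(P_w,Z_w)$ be the stability condition with $P_w(0,1]=P(0,1]$. * For $w=e^{2\pi i\phi}$ with $\phi\in[0,1)$ and $P(\phi)=0$ let $\sigma_w=(P_w,Z_w)$ with $P_w(1)=P(\phi,\phi+1]$ and $P_w(\theta)=0$ for $0<\theta<1$. * For $w=e^{2\pi i\phi}$ with $\phi\in[0,1)$ and $P(\phi)\ne0$, and $\psi\in[0,1]$, let $\sigma^\psi_w=(P^\psi_w,Z_w)$ with $P_w^\psi(1)\supset P(\phi,\phi+1)$, $P_w^\psi(\psi)\supset P(\phi)$ and all other slices with phase in $(0,1]$ zero. Call $\psi$ *allowed* at $\phi$ if (1) $\phi$ is an isolated point of $\Phi_\sigma$ and $\psi\in[0,1]$; or (2) $\phi$ is an accumulation point of $\Phi_\sigma$, $P(\phi-\epsilon,\phi)=0$ for some $\epsilon>0$,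 and $\psi=1$; or (3) $\phi$ is an accumulation point of $\Phi_\sigma$, $P(\phi,\phi+\epsilon)=0$ for some $\epsilon>0$, and $\psi=0$. **The topology.** Let $S=\mathbb D^Q_\sigma\setminus\mathbb D_\sigma$ and let $\beta\colon\widetilde{\mathbb C}\to\mathbb C$ be the oriented real blow-up at the points of $S$, i.e. $\widetilde{\mathbb C}=\{(z,(u_s)_{s\in S}): |u_s|=1,\ z-s=|z-s|u_s\}\subset\mathbb C\times(S^1)^S$ with the subspace topology and $\beta(z,u)=z$. Let $\widetilde{\mathbb D}{}^Q_\sigma\subset\beta^{-1}(\mathbb D^Q_\sigma)$ be the subspace of points over $\mathbb D_\sigma$ and of points over $w=e^{2\pi i\phi}\in S$ whose unit tangent vector $u_w$ is such that $\psi=\frac1\pi\arg(-i\bar w u_w)$ is allowed at $\phi$. (For $w\ne1$ this is $\frac1\pi\arg d_wf(u_w)$; at $w=1$ it is $\frac1\pi\arg d_1(-1/f)(u_1)$.) Equip $\mathbb D_\sigma^Q$ with the quotient topology from $\beta\colon\widetilde{\mathbb D}{}^Q_\sigma\to\mathbb D^Q_\sigma$, and $\mathbb D_\sigma$ with the subspace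 topology from $\mathbb D_\sigma^Q$. **Theorem.** 1. $\mathbb D_\sigma\subset\mathbb D_\sigma^Q$. For $w\in\mathbb D_\sigma$, $\sigma_w$ is a stability condition in $\mathrm{LStab}(\mathcal C)$; put $\bar\sigma_w=[\sigma_w]$. For $w=e^{2\pi i\phi}\in\mathbb D^Q_\sigma\setminus\mathbb D_\sigma$ there is an allowed $\psi$ at $\phi$, and for every allowed $\psi$ the pair $\sigma_w^\psi$ lies in $\mathrm{LStab}(\mathcal C)$; its class $[\sigma_w^\psi]\in\mathrm{QStab}(\mathcal C)^*$ does not depend on the choice of the allowed $\psi$; put $\bar\sigma_w=[\sigma_w^\psi]$. 2. The map $w\mapsto\bar\sigma_w\cdot\mathbb C$ is a homeomorphism from $\mathbb D^Q_\sigma$ onto the closure of $(\sigma\cdot G)/\mathbb C$ in $\mathrm{QStab}(\mathcal C)^*/\mathbb C$, and $w\mapsto\sigma_w\cdot\mathbb C$ is a homeomorphism from $\mathbb D_\sigma$ onto the closure of $(\sigma\cdot G)/\mathbb C$ in $\mathrm{Stab}(\mathcal C)/\mathbb C$. 3. The orbit $\sigma\cdot G$ is closed in $\mathrm{Stab}(\mathcal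 C)$ if and only if $\Phi_\sigma$ is dense in $\mathbb R/\mathbb Z$, and it is closed in $\mathrm{QStab}(\mathcal C)^*$ if and only if $\Phi_\sigma$ is dense. -/

import Mathlib

universe u₁ u₂ u₃

open CategoryTheory CategoryTheory.Limits CategoryTheory.Pretriangulated
open scoped Topology ENNReal

noncomputable section

namespace LaxStability

/-! ### Strict monomorphisms, stable objects and length categories -/

section Strict

variable {A : Type u₁} [Category.{u₂} A] [HasZeroMorphisms A]

/-- A strict monomorphism. In a quasi-abelian category the monomorphisms whose canonical map from
the coimage to the image is invertible are exactly those which are the kernel of some morphism. -/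
def IsStrictMono {X Y : A} (f : X ⟶ Y) : Prop := Nonempty (NormalMono f)

/-- A (quasi-abelian) category is a length category if it is artinian and noetherian: descending
and ascending chains of strict subobjects of any object stabilise. -/
def IsLengthCategory (A : Type u₁) [Category.{u₂} A] [HasZeroMorphisms A] : Prop :=
  ∀ X : A, WellFoundedLT {S : Subobject X // IsStrictMono S.arrow} ∧
    WellFoundedGT {S : Subobject X // IsStrictMono S.arrow}

/-- A non-zero object without proper non-zero strict subobjects. -/
def IsStrictSimple (X : A) : Prop :=
  ¬ IsZero X ∧ ∀ (Y : A) (f : Y ⟶ X), IsStrictMono f → IsZero Y ∨ IsIso f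

end Strict

/-! ### The Grothendieck group and slicings of a triangulated category -/

section Triangulated

variable (C : Type u₁) [Category.{u₂} C] [Preadditive C] [HasZeroObject C] [HasShift C ℤ]
  [∀ n : ℤ, (shiftFunctor C n).Additive] [Pretriangulated C]

/-- The relations `[Y] = [X] + [Z]` for the distinguished triangles `X ⟶ Y ⟶ Z ⟶ X⟦1⟧`. -/
def k0Relations : Set (FreeAbelianGroup C) :=
  {r | ∃ T ∈ distTriang C, r = FreeAbelianGroup.of T.obj₂ -
    (FreeAbelianGroup.of T.obj₁ + FreeAbelianGroup.of T.obj₃)}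

/-- The Grothendieck group `K(C)` of a triangulated category. -/
abbrev K0 : Type u₁ := FreeAbelianGroup C ⧸ AddSubgroup.closure (k0Relations C)

variable {C}

/-- The class of an object in the Grothendieck group. -/
def K0.mk (X : C) : K0 C := QuotientAddGroup.mk (FreeAbelianGroup.of X)

/-- A Harder–Narasimhan filtration `0 = c₀ ⟶ c₁ ⟶ ⋯ ⟶ cₙ = X` with non-zero cones `aᵢ` in
`P φᵢ`, where `φ₁ > φ₂ > ⋯ > φₙ`. -/
structure HNFiltration (P : ℝ → ObjectProperty C) (X : C) where
  n : ℕ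
  obj : Fin (n + 1) → C
  factor : Fin n → C
  phase : Fin n → ℝ
  isZero_zero : IsZero (obj 0)
  iso_last : Nonempty (obj (Fin.last n) ≅ X)
  triangle : ∀ i : Fin n, ∃ (f : obj i.castSucc ⟶ obj i.succ) (g : obj i.succ ⟶ factor i)
    (h : factor i ⟶ (obj i.castSucc)⟦(1 : ℤ)⟧), Triangle.mk f g h ∈ distTriang C
  phase_anti : StrictAnti phase
  semistable : ∀ i, P (phase i) (factor i)
  factor_nonzero : ∀ i, ¬ IsZero (factor i)

variable (C)

/-- A slicing of a triangulated category. -/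
structure Slicing where
  /-- the strictly full subcategory of semistable objects of phase `φ` -/
  P : ℝ → ObjectProperty C
  iso_closed : ∀ φ, (P φ).IsClosedUnderIsomorphisms
  zero_mem : ∀ φ X, IsZero X → P φ X
  biprod_mem : ∀ φ X Y, P φ X → P φ Y → P φ (X ⊞ Y)
  shift : ∀ φ X, P (φ + 1) (X⟦(1 : ℤ)⟧) ↔ P φ X
  hom_zero : ∀ (φ φ' : ℝ) (X Y : C), φ' < φ → P φ X → P φ' Y → ∀ f : X ⟶ Y, f = 0
  exists_hn : ∀ X : C, Nonempty (HNFiltration P X)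

variable {C}

namespace Slicing

variable (P : Slicing C)

/-- The (essentially unique) HN filtration of an object. -/
def hn (X : C) : HNFiltration P.P X := (P.exists_hn X).some

/-- The maximal phase `φ⁺` of a non-zero object. -/
def phiPlus (X : C) : ℝ := ⨆ i, (P.hn X).phase i

/-- The minimal phase `φ⁻` of a non-zero object. -/
def phiMinus (X : C) : ℝ := ⨅ i, (P.hn X).phase i

/-- The full subcategory `P(I)` on the objects whose semistable factors have phases in `I`. -/
def interval (I : Set ℝ) : ObjectProperty C := fun X =>
  ∃ F : HNFiltration P.P X, ∀ i, F.phase i ∈ I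

/-- The subcategory `P φ` is zero. -/
def SliceZero (φ : ℝ) : Prop := ∀ X, P.P φ X → IsZero X

/-- The subcategory `P(I)` is zero. -/
def IntervalZero (I : Set ℝ) : Prop := ∀ X, P.interval I X → IsZero X

/-- An object `X` is stable of phase `φ` if it is simple in the quasi-abelian category `P φ`. -/
def IsStable (φ : ℝ) (X : C) : Prop :=
  ∃ h : P.P φ X, IsStrictSimple (⟨X, h⟩ : (P.P φ).FullSubcategory)

/-- Local finiteness; the bound `ε < 1 / 2` makes the categories `P(φ - ε, φ + ε)` quasi-abelian. -/
def LocallyFinite : Prop :=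
  ∃ ε : ℝ, 0 < ε ∧ ε < 1 / 2 ∧
    ∀ φ : ℝ, IsLengthCategory (P.interval (Set.Ioo (φ - ε) (φ + ε))).FullSubcategory

/-- `X` is a simple object of the category `P(I)` (used for the hearts `P[φ, φ + 1)` and
`P(φ, φ + 1]`, which are abelian). -/
def IsSimpleIn (I : Set ℝ) (X : C) : Prop :=
  ∃ h : P.interval I X, Simple (⟨X, h⟩ : (P.interval I).FullSubcategory)

end Slicing

variable (C)

/-- The space `Slice(C)` of locally finite slicings. -/
def Slice := {P : Slicing C // P.LocallyFinite}

variable {C}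

/-- The distance of two slicings, the supremum over `X ≠ 0` of
`max (|φ⁻_P X - φ⁻_Q X|, |φ⁺_P X - φ⁺_Q X|)`; it may be infinite. -/
def sliceEDist (P Q : Slicing C) : ℝ≥0∞ :=
  ⨆ (X : C) (_ : ¬ IsZero X),
    max (edist (P.phiMinus X) (Q.phiMinus X)) (edist (P.phiPlus X) (Q.phiPlus X))

instance : PseudoEMetricSpace (Slice C) where
  edist P Q := sliceEDist P.1 Q.1
  edist_self P := by simp [sliceEDist]
  edist_comm P Q := by simp only [sliceEDist, edist_comm]
  edist_triangle P Q R := by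
    refine iSup₂_le fun X hX => ?_
    have h1 : max (edist (P.1.phiMinus X) (Q.1.phiMinus X))
        (edist (P.1.phiPlus X) (Q.1.phiPlus X)) ≤ sliceEDist P.1 Q.1 :=
      le_iSup₂_of_le X hX le_rfl
    have h2 : max (edist (Q.1.phiMinus X) (R.1.phiMinus X))
        (edist (Q.1.phiPlus X) (R.1.phiPlus X)) ≤ sliceEDist Q.1 R.1 :=
      le_iSup₂_of_le X hX le_rfl
    refine max_le ?_ ?_
    · exact (edist_triangle _ (Q.1.phiMinus X) _).trans
        (add_le_add ((le_max_left _ _).trans h1) ((le_max_left _ _).trans h2))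
    · exact (edist_triangle _ (Q.1.phiPlus X) _).trans
        (add_le_add ((le_max_right _ _).trans h1) ((le_max_right _ _).trans h2))

/-! ### Classical, lax and quotient stability conditions

The finite rank lattice `Λ` with an inner product on `Λ ⊗ ℝ` is given as a `ℤ`-lattice `L` in a
Euclidean space `V = Λ ⊗ ℝ`. A charge `Λ → ℂ` is then the same as an `ℝ`-linear map `V → ℂ`, and
`Hom(Λ, ℂ)` carries the operator norm. -/

/-- The space `Slice(C) × Hom(Λ, ℂ)`. -/
abbrev StabData (C : Type u₁) [Category.{u₂} C] [Preadditive C] [HasZeroObject C] [HasShift C ℤ]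
    [∀ n : ℤ, (shiftFunctor C n).Additive] [Pretriangulated C]
    (V : Type u₃) [NormedAddCommGroup V] [InnerProductSpace ℝ V] :=
  Slice C × (V →L[ℝ] ℂ)

variable {V : Type u₃} [NormedAddCommGroup V] [InnerProductSpace ℝ V] {L : Submodule ℤ V}

namespace StabData

/-- The slicing of a pair `(P, Z)`. -/
abbrev slicing (τ : StabData C V) : Slicing C := τ.1.1

/-- The charge of a pair `(P, Z)`. -/
abbrev charge (τ : StabData C V) : V →L[ℝ] ℂ := τ.2

end StabData

/-- The class `v(X)` of an object in the lattice, as a vector of `Λ ⊗ ℝ`. -/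
def cls (v : K0 C →+ L) (X : C) : V := (v (K0.mk X) : V)

/-- `(P, Z)` is a stability condition: a pre-stability condition with the support property. -/
def IsStabilityCondition (v : K0 C →+ L) (τ : StabData C V) : Prop :=
  (∀ φ X, τ.slicing.P φ X → ¬ IsZero X → ∃ m : ℝ, 0 < m ∧
    τ.charge (cls v X) = m * Complex.exp (Complex.I * Real.pi * φ)) ∧
  ∃ K : ℝ, 0 < K ∧ ∀ φ X, τ.slicing.P φ X → 1 / K * ‖cls v X‖ ≤ ‖τ.charge (cls v X)‖

/-- `(P, Z)` is a lax stability condition: a lax pre-stability condition with the support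
property for massive stable objects. -/
def IsLaxStabilityCondition (v : K0 C →+ L) (τ : StabData C V) : Prop :=
  (∀ φ X, τ.slicing.P φ X → ¬ IsZero X → ∃ m : ℝ, 0 ≤ m ∧
    τ.charge (cls v X) = m * Complex.exp (Complex.I * Real.pi * φ)) ∧
  ∃ K : ℝ, 0 < K ∧ ∀ φ X, τ.slicing.IsStable φ X → τ.charge (cls v X) ≠ 0 →
    1 / K * ‖cls v X‖ ≤ ‖τ.charge (cls v X)‖

/-- The mass of an object, the sum of the masses of its semistable factors. -/
def mass (v : K0 C →+ L) (τ : StabData C V) (X : C) : ℝ :=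
  ∑ i, ‖τ.charge (cls v ((τ.slicing.hn X).factor i))‖

/-- The space `Stab(C)` of stability conditions, a subspace of `Slice(C) × Hom(Λ, ℂ)`. -/
abbrev Stab (v : K0 C →+ L) := {τ : StabData C V // IsStabilityCondition v τ}

/-- The space `LStab(C)` of lax stability conditions in the closure of `Stab(C)`. -/
abbrev LStab (v : K0 C →+ L) :=
  {τ : StabData C V // IsLaxStabilityCondition v τ ∧ τ ∈ closure {ρ | IsStabilityCondition v ρ}}

/-- Two points of `LStab(C)` are equivalent if they have the same charge and lie in the same
connected component of the fibre of the charge map. -/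
def lStabSetoid (v : K0 C →+ L) : Setoid (LStab v) where
  r σ τ := τ ∈ connectedComponentIn {ρ : LStab v | ρ.1.charge = σ.1.charge} σ
  iseqv :=
    { refl := fun σ => mem_connectedComponentIn rfl
      symm := by
        intro σ τ h
        have hc : τ.1.charge = σ.1.charge := connectedComponentIn_subset {ρ : LStab v | ρ.1.charge = σ.1.charge} σ h
        change σ ∈ connectedComponentIn {ρ : LStab v | ρ.1.charge = τ.1.charge} τ
        rw [hc, ← connectedComponentIn_eq h]
        exact mem_connectedComponentIn rfl
      trans := by
        intro σ τ ρ h h'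
        have hc : τ.1.charge = σ.1.charge := connectedComponentIn_subset {ρ : LStab v | ρ.1.charge = σ.1.charge} σ h
        change ρ ∈ connectedComponentIn {ρ : LStab v | ρ.1.charge = τ.1.charge} τ at h'
        rw [hc, ← connectedComponentIn_eq h] at h'
        exact h' }

/-- The space `QStab(C)` of quotient stability conditions, with the quotient topology. -/
abbrev QStab (v : K0 C →+ L) := Quotient (lStabSetoid v)

/-- The class of a lax stability condition in `QStab(C)`. -/
def QStab.mk (v : K0 C →+ L) (τ : LStab v) : QStab v := Quotient.mk (lStabSetoid v) τ

/-- The space `QStab(C)^*`: the strata where all objects are massless are removed. -/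
abbrev QStabStar (v : K0 C →+ L) :=
  {q : QStab v // ∃ τ : LStab v, q = QStab.mk v τ ∧ ∃ X : C, 0 < mass v τ.1 X}

/-! ### Group actions -/

/-- The universal cover `G` of `GL₂⁺(ℝ)`: pairs `(T, θ)` of an orientation preserving linear
automorphism of `ℝ² = ℂ` and an increasing map `θ` with `θ (t + 1) = θ t + 1` inducing the same map
on the circle of rays. -/
structure GTilde where
  T : ℂ ≃L[ℝ] ℂ
  θ : ℝ → ℝ
  det_pos : 0 < LinearMap.det (T.toLinearEquiv : ℂ →ₗ[ℝ] ℂ)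
  θ_mono : StrictMono θ
  θ_add_one : ∀ t, θ (t + 1) = θ t + 1
  compat : ∀ t : ℝ, ∃ r : ℝ, 0 < r ∧
    T (Complex.exp (Complex.I * Real.pi * t)) = r * Complex.exp (Complex.I * Real.pi * θ t)

/-- `τ = σ · g`, where `(P, Z) · g = (P ∘ θ_g, T_g⁻¹ ∘ Z)`. -/
def IsGTranslate (g : GTilde) (σ τ : StabData C V) : Prop :=
  (∀ φ, τ.slicing.P φ = σ.slicing.P (g.θ φ)) ∧
    τ.charge = (g.T.symm : ℂ →L[ℝ] ℂ).comp σ.charge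

/-- `τ` lies in the orbit `σ · G`. -/
def InGOrbit (σ τ : StabData C V) : Prop := ∃ g : GTilde, IsGTranslate g σ τ

/-- `σ` and `τ` lie in the same `ℂ`-orbit, where
`(P, Z) · z = (P(φ + Re z), exp(-i π z) Z)` for `z` in `ℂ`. -/
def SameCOrbit (σ τ : StabData C V) : Prop :=
  ∃ z : ℂ, (∀ φ, τ.slicing.P φ = σ.slicing.P (φ + z.re)) ∧
    τ.charge = Complex.exp (-(Complex.I * Real.pi * z)) • σ.charge

/-- The quotient `Stab(C) / ℂ` with the quotient topology. -/
abbrev StabModC (v : K0 C →+ L) := Quot fun σ τ : Stab v => SameCOrbit σ.1 τ.1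

/-- The quotient `QStab(C)^* / ℂ` with the quotient topology; the `ℂ`-action on classes is
`[σ] · z = [σ · z]`. -/
abbrev QStabStarModC (v : K0 C →+ L) :=
  Quot fun p q : QStabStar v =>
    ∃ σ τ : LStab v, p.1 = QStab.mk v σ ∧ q.1 = QStab.mk v τ ∧ SameCOrbit σ.1 τ.1

/-- The point `x` of `QStab(C)^* / ℂ` is the `ℂ`-orbit `[τ] · ℂ`. -/
def IsClassOf (v : K0 C →+ L) (x : QStabStarModC v) (τ : LStab v) : Prop :=
  ∃ q : QStabStar v, q.1 = QStab.mk v τ ∧ x = Quot.mk _ q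

/-- The orbit `σ · G` in `Stab(C)`. -/
def orbitStab (v : K0 C →+ L) (σ : Stab v) : Set (Stab v) := {τ | InGOrbit σ.1 τ.1}

/-- The image of the orbit `σ · G` in `Stab(C) / ℂ`. -/
def orbitStabModC (v : K0 C →+ L) (σ : Stab v) : Set (StabModC v) :=
  {x | ∃ τ ∈ orbitStab v σ, x = Quot.mk _ τ}

/-- The orbit `σ · G` in `QStab(C)^*`. -/
def orbitQStabStar (v : K0 C →+ L) (σ : Stab v) : Set (QStabStar v) :=
  {q | ∃ τ : LStab v, InGOrbit σ.1 τ.1 ∧ q.1 = QStab.mk v τ}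

/-- The image of the orbit `σ · G` in `QStab(C)^* / ℂ`. -/
def orbitQStabStarModC (v : K0 C →+ L) (σ : Stab v) : Set (QStabStarModC v) :=
  {x | ∃ q ∈ orbitQStabStar v σ, x = Quot.mk _ q}

/-! ### The phase diagram and the subsets of the closed disk -/

/-- The phase diagram `{φ + ℤ : P φ ≠ 0}` in `ℝ / ℤ`. -/
def phaseDiagram (P : Slicing C) : Set UnitAddCircle :=
  {x | ∃ φ : ℝ, x = (φ : UnitAddCircle) ∧ ¬ P.SliceZero φ}

/-- The point `exp(2 π i φ)`. -/
def bdry (φ : ℝ) : ℂ := Complex.exp (2 * Real.pi * Complex.I * φ)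

/-- The open disk together with the boundary points whose phase is not in the closure of the
phase diagram. -/
def diskSet (P : Slicing C) : Set ℂ :=
  Metric.ball 0 1 ∪ {w | ∃ φ : ℝ, w = bdry φ ∧ (φ : UnitAddCircle) ∉ closure (phaseDiagram P)}

/-- `P(φ - ε, φ) = 0` and no simple object of `P[φ, φ + 1)` lies in `P(φ, φ + ε)`. -/
def GapBelow (P : Slicing C) (φ ε : ℝ) : Prop :=
  P.IntervalZero (Set.Ioo (φ - ε) φ) ∧
    ∀ X, P.IsSimpleIn (Set.Ico φ (φ + 1)) X → ¬ P.interval (Set.Ioo φ (φ + ε)) X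

/-- `P(φ, φ + ε) = 0` and no simple object of `P(φ, φ + 1]` lies in `P(φ + 1 - ε, φ + 1)`. -/
def GapAbove (P : Slicing C) (φ ε : ℝ) : Prop :=
  P.IntervalZero (Set.Ioo φ (φ + ε)) ∧
    ∀ X, P.IsSimpleIn (Set.Ioc φ (φ + 1)) X → ¬ P.interval (Set.Ioo (φ + 1 - ε) (φ + 1)) X

/-- The open disk together with the boundary points `exp(2 π i φ)` such that `GapBelow` or
`GapAbove` holds at `φ` for some `ε > 0`. -/
def quotDiskSet (P : Slicing C) : Set ℂ :=
  Metric.ball 0 1 ∪ {w | ∃ φ ε : ℝ, w = bdry φ ∧ 0 < ε ∧ (GapBelow P φ ε ∨ GapAbove P φ ε)}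

/-- The boundary points at which objects become massless; these are blown up. -/
def blowUpCentre (P : Slicing C) : Set ℂ := quotDiskSet P \ diskSet P

/-- The phases `ψ` of the massless objects `P φ` which are allowed in the orbit closure:
`φ` is an isolated point of the phase diagram and `ψ ∈ [0, 1]`, or it is an accumulation point
which is not approached from below and `ψ = 1`, or it is an accumulation point which is not
approached from above and `ψ = 0`. -/
def AllowedPhase (P : Slicing C) (φ ψ : ℝ) : Prop :=
  ((φ : UnitAddCircle) ∈ phaseDiagram P ∧
    ¬ AccPt (φ : UnitAddCircle) (Filter.principal (phaseDiagram P)) ∧ ψ ∈ Set.Icc (0 : ℝ) 1) ∨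
  (AccPt (φ : UnitAddCircle) (Filter.principal (phaseDiagram P)) ∧
    (∃ ε : ℝ, 0 < ε ∧ P.IntervalZero (Set.Ioo (φ - ε) φ)) ∧ ψ = 1) ∨
  (AccPt (φ : UnitAddCircle) (Filter.principal (phaseDiagram P)) ∧
    (∃ ε : ℝ, 0 < ε ∧ P.IntervalZero (Set.Ioo φ (φ + ε))) ∧ ψ = 0)

/-- The identification `f(w) = i (1 + w) / (1 - w)` of the disk with the upper half-plane. -/
def toUpper (w : ℂ) : ℂ := Complex.I * ((1 + w) / (1 - w))

/-- The real linear map `M_w` with `M_w(1) = 1` and `M_w(i) = f(w)` for `w ≠ 1`, and with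
`M_1(1) = 0` and `M_1(i) = -1`. -/
def discMap (w : ℂ) : ℂ →L[ℝ] ℂ :=
  open Classical in
  Complex.reCLM.smulRight (if w = 1 then (0 : ℂ) else 1) +
    Complex.imCLM.smulRight (if w = 1 then (-1 : ℂ) else toUpper w)

/-- The phase `ψ = (1 / π) arg (d_w f (v))` of a tangent vector `v` at a point `w` of the unit
circle. By `hasDerivAt_toUpper`, `d_w f` is multiplication by a positive multiple of `-i w̄` when
`w ≠ 1`; by `hasDerivAt_neg_inv_toUpper` the same holds at `w = 1`, where `f(1) = ∞`, for the
coordinate `-1 / f` of the upper half-plane around `∞`. -/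
def tangentPhase (w v : ℂ) : ℝ :=
  1 / Real.pi * Complex.arg (-Complex.I * (starRingEnd ℂ) w * v)

theorem hasDerivAt_toUpper {w : ℂ} (hw : ‖w‖ = 1) (h1 : w ≠ 1) :
    HasDerivAt toUpper (((2 / ‖1 - w‖ ^ 2 : ℝ) : ℂ) * (-Complex.I * (starRingEnd ℂ) w)) w := by
  have h : (1 : ℂ) - w ≠ 0 := sub_ne_zero.mpr (Ne.symm h1)
  have hd : HasDerivAt toUpper (Complex.I * ((1 * (1 - w) - (1 + w) * (-1)) / (1 - w) ^ 2)) w := by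
    have a : HasDerivAt (fun z : ℂ => 1 + z) 1 w := (hasDerivAt_id w).const_add 1
    have b : HasDerivAt (fun z : ℂ => 1 - z) (-1) w := (hasDerivAt_id w).const_sub 1
    exact (a.div b h).const_mul Complex.I
  convert hd using 1
  have hww : w * (starRingEnd ℂ) w = 1 := by
    rw [Complex.mul_conj, Complex.normSq_eq_norm_sq, hw]; simp
  have hc : (1 : ℂ) - (starRingEnd ℂ) w ≠ 0 := by
    have := (map_ne_zero (starRingEnd ℂ)).mpr h
    simpa using this
  have hn : ((‖1 - w‖ ^ 2 : ℝ) : ℂ) = (1 - w) * (1 - (starRingEnd ℂ) w) := by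
    rw [← Complex.normSq_eq_norm_sq, ← Complex.mul_conj]; simp
  rw [Complex.ofReal_div, hn]
  field_simp
  push_cast
  linear_combination (2 : ℂ) * hww

theorem hasDerivAt_neg_inv_toUpper :
    HasDerivAt (fun z => -(toUpper z)⁻¹) (((1 / 2 : ℝ) : ℂ) * (-Complex.I * (starRingEnd ℂ) 1))
      1 := by
  have hfun : (fun z : ℂ => -(toUpper z)⁻¹) = fun z => Complex.I * ((1 - z) / (1 + z)) := by
    funext z
    simp [toUpper, mul_comm]
  rw [hfun]
  have a : HasDerivAt (fun z : ℂ => 1 + z) 1 1 := (hasDerivAt_id (1 : ℂ)).const_add 1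
  have b : HasDerivAt (fun z : ℂ => 1 - z) (-1) 1 := (hasDerivAt_id (1 : ℂ)).const_sub 1
  have hd : HasDerivAt (fun z : ℂ => Complex.I * ((1 - z) / (1 + z)))
      (Complex.I * (((-1) * (1 + 1) - (1 - 1) * 1) / (1 + 1) ^ 2)) 1 :=
    (b.div a (by norm_num)).const_mul Complex.I
  convert hd using 1
  push_cast
  simp only [map_one]
  ring

/-- The oriented real blow-up of `ℂ` at the points of `S`: over `z ∉ S` there is one point, and
over `s ∈ S` there is the circle of unit tangent vectors at `s`. The topology is that of a subspace
of the product, i.e. convergence is convergence in `ℂ` and of the directions seen from each point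
of `S`. -/
def realBlowUp (S : Set ℂ) : Set (ℂ × (S → ℂ)) :=
  {p | ∀ s : S, ‖p.2 s‖ = 1 ∧ p.1 - s = (‖p.1 - s‖ : ℂ) * p.2 s}

/-- The subspace of the real blow-up lying over `quotDiskSet P`, where only those unit tangent
vectors are kept whose phase is allowed. -/
def BlownUpDisk (P : Slicing C) : Type :=
  {p : ℂ × (blowUpCentre P → ℂ) // p ∈ realBlowUp (blowUpCentre P) ∧ p.1 ∈ quotDiskSet P ∧
    ∀ (h : p.1 ∈ blowUpCentre P) (φ : ℝ), p.1 = bdry φ →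
      AllowedPhase P φ (tangentPhase p.1 (p.2 ⟨p.1, h⟩))}

instance (P : Slicing C) : TopologicalSpace (BlownUpDisk P) :=
  instTopologicalSpaceSubtype

/-- The set `quotDiskSet P`, as a type which will carry the quotient topology. -/
structure QuotDisk (P : Slicing C) : Type where
  pt : ℂ
  mem : pt ∈ quotDiskSet P

/-- The blow-down map `β`. -/
def blowDown (P : Slicing C) (p : BlownUpDisk P) : QuotDisk P := ⟨p.1.1, p.2.2.1⟩

/-- The quotient topology with respect to the blow-down map. -/
instance (P : Slicing C) : TopologicalSpace (QuotDisk P) :=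
  TopologicalSpace.coinduced (blowDown P) inferInstance

/-- The subspace of `QuotDisk P` of points in `diskSet P`. -/
abbrev ClassicalDisk (P : Slicing C) := {w : QuotDisk P // w.pt ∈ diskSet P}

/-! ### The points of the orbit closure -/

/-- `τ = σ_w = (P_w, Z_w)` for `w` in the open disk, or `w = exp(2 π i φ)` with `P φ = 0`. The charge
is `Z_w = M_w ∘ Z`. In the disk `P_w(0, 1] = P(0, 1]`; on the circle `P_w 1 = P(φ, φ + 1]` for the
representative `φ ∈ [0, 1)`, and the slices of phase in `(0, 1)` vanish. -/
def IsSigma (σ : StabData C V) (w : ℂ) (τ : StabData C V) : Prop :=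
  τ.charge = (discMap w).comp σ.charge ∧
  (‖w‖ < 1 → τ.slicing.interval (Set.Ioc 0 1) = σ.slicing.interval (Set.Ioc 0 1)) ∧
  (∀ φ ∈ Set.Ico (0 : ℝ) 1, w = bdry φ → σ.slicing.SliceZero φ ∧
    τ.slicing.P 1 = σ.slicing.interval (Set.Ioc φ (φ + 1)) ∧
    ∀ θ ∈ Set.Ioo (0 : ℝ) 1, τ.slicing.SliceZero θ)

/-- `τ = σ_w^ψ = (P_w^ψ, Z_w)` for `w = exp(2 π i φ)` with `φ ∈ [0, 1)` and `P φ ≠ 0`: the charge is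
`Z_w = M_w ∘ Z`, the slices `P_w^ψ 1` and `P_w^ψ ψ` contain `P(φ, φ + 1)` and `P φ` respectively, and
all other slices of phase in `(0, 1]` vanish. -/
def IsSigmaPsi (σ : StabData C V) (φ ψ : ℝ) (τ : StabData C V) : Prop :=
  ¬ σ.slicing.SliceZero φ ∧
  τ.charge = (discMap (bdry φ)).comp σ.charge ∧
  σ.slicing.interval (Set.Ioo φ (φ + 1)) ≤ τ.slicing.P 1 ∧
  σ.slicing.P φ ≤ τ.slicing.P ψ ∧
  ∀ θ ∈ Set.Ioc (0 : ℝ) 1, θ ≠ 1 → θ ≠ ψ → τ.slicing.SliceZero θ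

end Triangulated

end LaxStability

end

/-! Up to a non-zero complex factor, `discMap w` is the map `nMap w : z ↦ z - w * conj z`
(`discMap_eq`), which multiplies the ray of phase `t` by `1 - w e^{-2πit}`. For `‖w‖ ≤ 1` this
factor has non-negative real part, so the induced map of phases has a preferred lift `phaseFun w`,
at distance at most `1/2` from the identity wherever the factor does not vanish. For `‖w‖ < 1` the
lift is an increasing homeomorphism of degree one, and every orientation preserving real linear
automorphism of `ℂ` is a multiple of such an `nMap w`; hence `(σ · G) / ℂ` is the open disk. At `w =
e^{2πiφ}` the factor vanishes exactly at the phases `φ + ℤ`, and elsewhere the lift is a step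
function, constantly `φ + 1/2` on `(φ, φ + 1)`. The value `φ - 1/2 + ψ` at `φ` is the only freedom
left; it is read off from the direction in the real blow-up at `w`. All limits are therefore
push-forwards `Slicing.map` of one slicing along monotone maps of degree one.

The distance between two push-forwards is bounded by the supremum, over the phases that occur, of
the distance of the two maps. By monotonicity this supremum is controlled by the values at the ends
of a window on which the limiting map is constant (`exists_window`), whence the blown up disk maps
continuously to pairs of slicings and charges. Conversely the charge determines `w`, and the phases
of the objects becoming massless determine the directions, so this map is inducing
(`tendsto_of_tendsto_point`).

Let a sequence in the orbit converge to a lax stability condition of non-zero charge. After a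
normalisation by `ℂ` the charges converge to some `w` (`exists_tendsto_coefficients`,
`exists_act_mem_closure`). If `w = e^{2πiφ}`, uniform convergence of the continuous lifts forbids
phases accumulating at `φ` from both sides, and fixes `ψ` when they accumulate from one side. The
slice of phase `φ + 1/2` is then `P[φ, φ + 1)` or `P(φ, φ + 1]`, its stable objects are the simple
objects of that heart, and the support property for massive stable objects keeps their phases away
from `φ` (`exists_phase_gap`): these are conditions (a) and (b). Conversely (a) and (b) give local
finiteness and the lax support property (`IsSupported.lax_stepLift`).

In the quotient, a property that survives small changes of the slicing at fixed charge is constant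
on components of fibres (`iff_of_fibreRel`). Three uses carry the argument. A stability condition is
alone in its component (`FibreRel.eq_of_isStab`). Massless objects persist along a component and in
limits, so a convergent sequence of classes over blow-up centres eventually stays over one centre
(`eventually_pt_eq_of_tendsto`). `MassiveBelow` detects the even integer by which a number in `ℂ` is
ambiguous once its exponential factor is known (`exists_fibreRel_of_tendsto`). Both disks thus embed
as closed subsets (`isClosedEmbedding_toStar`, `isClosedEmbedding_toStab`), and the interior is
dense (`dense_interior`), so the images are the orbit closures. The orbit is closed exactly when the
disk has no boundary point, that is, when the phases are dense. -/

noncomputable section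

namespace LaxStability

/-! ### Extension closures -/

section ExtensionClosure

variable {C : Type u₁} [Category.{u₂} C] [Preadditive C] [HasZeroObject C] [HasShift C ℤ]
  [∀ n : ℤ, (shiftFunctor C n).Additive] [Pretriangulated C]

/-- `X` is an extension of `B` by `A`: there is a distinguished triangle `A ⟶ X ⟶ B ⟶ A⟦1⟧`. -/
def IsExt (A X B : C) : Prop :=
  ∃ (f : A ⟶ X) (g : X ⟶ B) (h : B ⟶ A⟦(1 : ℤ)⟧), Triangle.mk f g h ∈ distTriang C

theorem exists_lift_of_comp_eq_zero {A X B W : C} {f : A ⟶ X} {g : X ⟶ B} {h : B ⟶ A⟦(1 : ℤ)⟧}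
    (hT : Triangle.mk f g h ∈ distTriang C) (u : W ⟶ X) (hu : u ≫ g = 0) :
    ∃ l : W ⟶ A, u = l ≫ f := Triangle.coyoneda_exact₂ _ hT u hu

theorem exists_desc_of_comp_eq_zero {A X B W : C} {f : A ⟶ X} {g : X ⟶ B} {h : B ⟶ A⟦(1 : ℤ)⟧}
    (hT : Triangle.mk f g h ∈ distTriang C) (u : X ⟶ W) (hu : f ≫ u = 0) :
    ∃ l : B ⟶ W, u = g ≫ l := Triangle.yoneda_exact₂ _ hT u hu

theorem exists_desc_shift_of_comp_eq_zero {A X B W : C} {f : A ⟶ X} {g : X ⟶ B}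
    {h : B ⟶ A⟦(1 : ℤ)⟧} (hT : Triangle.mk f g h ∈ distTriang C) (u : B ⟶ W) (hu : g ≫ u = 0) :
    ∃ l : A⟦(1 : ℤ)⟧ ⟶ W, u = h ≫ l := Triangle.yoneda_exact₃ _ hT u hu

theorem exists_lift_shift_of_comp_eq_zero {A X B W : C} {f : A ⟶ X} {g : X ⟶ B}
    {h : B ⟶ A⟦(1 : ℤ)⟧} (hT : Triangle.mk f g h ∈ distTriang C) (u : W ⟶ A) (hu : u ≫ f = 0) :
    ∃ (k : B⟦(-1 : ℤ)⟧ ⟶ A) (l : W ⟶ B⟦(-1 : ℤ)⟧), u = l ≫ k :=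
  have ⟨l, hl⟩ := Triangle.coyoneda_exact₂ _ (inv_rot_of_distTriang _ hT) u hu
  ⟨_, l, hl⟩

theorem isExt_zero_left {Z : C} (hZ : IsZero Z) (X : C) : IsExt Z X X := by
  refine ⟨0, 𝟙 X, 0, ?_⟩
  rw [Triangle.distinguished_iff_of_isZero₁ _ hZ]
  exact inferInstanceAs (IsIso (𝟙 X))

theorem isExt_zero_right {Z : C} (hZ : IsZero Z) (X : C) : IsExt X X Z := by
  refine ⟨𝟙 X, 0, 0, ?_⟩
  rw [Triangle.distinguished_iff_of_isZero₃ _ hZ]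
  exact inferInstanceAs (IsIso (𝟙 X))

theorem isExt_of_iso_left {A X : C} (e : A ≅ X) {Z : C} (hZ : IsZero Z) : IsExt A X Z := by
  refine ⟨e.hom, 0, 0, ?_⟩
  rw [Triangle.distinguished_iff_of_isZero₃ _ hZ]
  exact inferInstanceAs (IsIso e.hom)

theorem IsExt.iso {A A' X X' B B' : C} (h : IsExt A X B) (a : A ≅ A') (x : X ≅ X') (b : B ≅ B') :
    IsExt A' X' B' := by
  obtain ⟨f, g, k, hT⟩ := h
  refine ⟨a.inv ≫ f ≫ x.hom, x.inv ≫ g ≫ b.hom, b.inv ≫ k ≫ a.hom⟦(1 : ℤ)⟧', ?_⟩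
  refine isomorphic_distinguished _ hT _ ?_
  refine (Triangle.isoMk _ _ a x b (Iso.hom_inv_id_assoc _ _).symm
    (Iso.hom_inv_id_assoc _ _).symm ?_).symm
  change k ≫ a.hom⟦(1 : ℤ)⟧' = b.hom ≫ b.inv ≫ k ≫ a.hom⟦(1 : ℤ)⟧'
  rw [Iso.hom_inv_id_assoc]

theorem IsExt.rotate {A X B : C} (h : IsExt A X B) : IsExt X B (A⟦(1 : ℤ)⟧) := by
  obtain ⟨f, g, k, hT⟩ := h
  exact ⟨_, _, _, rot_of_distTriang _ hT⟩

theorem IsExt.invRotate {A X B : C} (h : IsExt A X B) : IsExt (B⟦(-1 : ℤ)⟧) A X := by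
  obtain ⟨f, g, k, hT⟩ := h
  exact ⟨_, _, _, inv_rot_of_distTriang _ hT⟩

theorem IsExt.shift {A X B : C} (h : IsExt A X B) (n : ℤ) : IsExt (A⟦n⟧) (X⟦n⟧) (B⟦n⟧) := by
  obtain ⟨f, g, k, hT⟩ := h
  exact ⟨_, _, _, Triangle.shift_distinguished _ hT n⟩

theorem IsExt.isZero₂ {A X B : C} (h : IsExt A X B) (hA : IsZero A) (hB : IsZero B) :
    IsZero X := by
  obtain ⟨f, g, k, hT⟩ := h
  exact Triangle.isZero₂_of_isZero₁₃ _ hT hA hB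

theorem IsExt.isZero₃ {A X B : C} (h : IsExt A X B) (hA : IsZero A) (hX : IsZero X) :
    IsZero B := by
  obtain ⟨f, g, k, hT⟩ := h
  exact Triangle.isZero₃_of_isZero₁₂ _ hT hA hX

theorem IsExt.iso_left {A X B : C} (h : IsExt A X B) (hB : IsZero B) : Nonempty (A ≅ X) := by
  obtain ⟨f, g, k, hT⟩ := h
  have : IsIso f := (Triangle.isZero₃_iff_isIso₁ _ hT).1 hB
  exact ⟨asIso f⟩

theorem IsExt.iso_right {A X B : C} (h : IsExt A X B) (hA : IsZero A) : Nonempty (X ≅ B) := by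
  obtain ⟨f, g, k, hT⟩ := h
  have : IsIso g := (Triangle.isZero₁_iff_isIso₂ _ hT).1 hA
  exact ⟨asIso g⟩

/-- When the first map vanishes, exactness factors the identity of `A` through `B⟦-1⟧`, and the
second hypothesis kills that factorisation. -/
theorem IsExt.isZero_left_of_hom {A X B : C} (h : IsExt A X B) (h₁ : ∀ f : A ⟶ X, f = 0)
    (h₂ : ∀ f : A ⟶ B⟦(-1 : ℤ)⟧, f = 0) : IsZero A := by
  obtain ⟨f, g, k, hT⟩ := h
  obtain ⟨m, l, hl⟩ := exists_lift_shift_of_comp_eq_zero hT (𝟙 A) (by rw [h₁ f, comp_zero])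
  rw [IsZero.iff_id_eq_zero, hl, h₂ l, zero_comp]

theorem IsExt.isZero_right_of_hom {A X B : C} (h : IsExt A X B) (h₁ : ∀ f : X ⟶ B, f = 0)
    (h₂ : ∀ f : A⟦(1 : ℤ)⟧ ⟶ B, f = 0) : IsZero B := by
  obtain ⟨f, g, k, hT⟩ := h
  obtain ⟨l, hl⟩ := exists_desc_shift_of_comp_eq_zero hT (𝟙 B) (by rw [h₁ g, zero_comp])
  rw [IsZero.iff_id_eq_zero, hl, h₂ l, comp_zero]

section Octahedra

variable [IsTriangulated C]

/-- The octahedral axiom as third isomorphism theorem: `E` plays the role of `Y / A`, filtered by `X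
/ A` and `Y / X`. -/
theorem IsExt.comp_left {A X B Y D : C} (h : IsExt A X B) (h' : IsExt X Y D) :
    ∃ E, IsExt A Y E ∧ IsExt B E D := by
  obtain ⟨f, g, k, hT⟩ := h
  obtain ⟨f', g', k', hT'⟩ := h'
  obtain ⟨E, a, b, hE⟩ := distinguished_cocone_triangle (f ≫ f')
  exact ⟨E, ⟨_, _, _, hE⟩, ⟨_, _, _, (Triangulated.someOctahedron rfl hT hT' hE).mem⟩⟩

/-- `Y'` plays the role of the preimage in `Y` of the subobject `Z'` of `Z`. -/
theorem IsExt.comp_right {X Y Z Z' S : C} (h : IsExt X Y Z) (h' : IsExt Z' Z S) :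
    ∃ Y', IsExt X Y' Z' ∧ IsExt Y' Y S := by
  obtain ⟨f, g, k, hT⟩ := h
  obtain ⟨f', g', k', hT'⟩ := h'
  obtain ⟨E, a, b, hE⟩ := distinguished_cocone_triangle₁ (g ≫ g')
  exact ⟨E, ⟨_, _, _, (Triangulated.someOctahedron' rfl hT hT' hE).mem⟩, ⟨_, _, _, hE⟩⟩

end Octahedra

/-- The closure of a class of objects under extensions. -/
inductive ExtCl (𝒮 : ObjectProperty C) : ObjectProperty C
  | zero {X : C} : IsZero X → ExtCl 𝒮 X
  | ext {A X S : C} : IsExt A X S → ExtCl 𝒮 A → 𝒮 S → ExtCl 𝒮 X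

namespace ExtCl

variable {𝒮 𝒯 : ObjectProperty C}

theorem single {X : C} (h : 𝒮 X) : ExtCl 𝒮 X :=
  .ext (isExt_zero_left (isZero_zero C) X) (.zero (isZero_zero C)) h

theorem mono {X : C} (h : ExtCl 𝒮 X) (hST : ∀ Y, 𝒮 Y → 𝒯 Y) : ExtCl 𝒯 X := by
  induction h with
  | zero h => exact .zero h
  | ext h _ hS ih => exact .ext h ih (hST _ hS)

theorem of_iso {X Y : C} (h : ExtCl 𝒮 X) (e : X ≅ Y) : ExtCl 𝒮 Y := by
  cases h with
  | zero h => exact .zero (h.of_iso e.symm)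
  | ext h hA hS => exact .ext (h.iso (Iso.refl _) e (Iso.refl _)) hA hS

theorem shift {X : C} (h : ExtCl 𝒮 X) (n : ℤ) (hST : ∀ Y, 𝒮 Y → 𝒯 (Y⟦n⟧)) :
    ExtCl 𝒯 (X⟦n⟧) := by
  induction h with
  | zero h => exact .zero ((shiftFunctor C n).map_isZero h)
  | ext h _ hS ih => exact .ext (h.shift n) ih (hST _ hS)

theorem hom_eq_zero {X Y : C} (hX : ExtCl 𝒮 X) (hY : ExtCl 𝒯 Y)
    (hST : ∀ A B, 𝒮 A → 𝒯 B → ∀ f : A ⟶ B, f = 0) (f : X ⟶ Y) : f = 0 := by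
  have key : ∀ S, 𝒮 S → ∀ g : S ⟶ Y, g = 0 := by
    intro S hS
    clear hX f
    induction hY with
    | zero h => exact fun g => h.eq_of_tgt _ _
    | ext h _ hT ih =>
      intro g
      obtain ⟨a, b, c, hd⟩ := h
      obtain ⟨l, hl⟩ := exists_lift_of_comp_eq_zero hd g (hST _ _ hS hT _)
      rw [hl, ih l, zero_comp]
  induction hX with
  | zero h => exact h.eq_of_src _ _
  | ext h _ hS ih =>
    obtain ⟨a, b, c, hd⟩ := h
    obtain ⟨l, hl⟩ := exists_desc_of_comp_eq_zero hd f (ih _)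
    rw [hl, key _ hS l, comp_zero]

variable [IsTriangulated C]

/-- `ExtCl` appends factors only at the right end, so the last factor of `B` is moved outside by
`IsExt.comp_right` until `B` is exhausted. -/
theorem of_isExt {A X B : C} (h : IsExt A X B) (hA : ExtCl 𝒮 A) (hB : ExtCl 𝒮 B) :
    ExtCl 𝒮 X := by
  induction hB generalizing X with
  | zero hB =>
    obtain ⟨e⟩ := h.iso_left hB
    exact hA.of_iso e
  | ext h' _ hS ih =>
    obtain ⟨Y', h₁, h₂⟩ := h.comp_right h'
    exact .ext h₂ (ih h₁) hS

theorem bind {X : C} (h : ExtCl 𝒮 X) (hST : ∀ Y, 𝒮 Y → ExtCl 𝒯 Y) : ExtCl 𝒯 X := by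
  induction h with
  | zero h => exact .zero h
  | ext h _ hS ih => exact of_isExt h ih (hST _ hS)

end ExtCl

end ExtensionClosure

/-! ### Harder–Narasimhan filtrations -/

section HN

variable {C : Type u₁} [Category.{u₂} C] [Preadditive C] [HasZeroObject C] [HasShift C ℤ]
  [∀ n : ℤ, (shiftFunctor C n).Additive] [Pretriangulated C]

namespace HNFiltration

variable {P : ℝ → ObjectProperty C} {X : C}

theorem isExt_step (F : HNFiltration P X) (i : Fin F.n) :
    IsExt (F.obj i.castSucc) (F.obj i.succ) (F.factor i) := F.triangle i

theorem extCl_obj (F : HNFiltration P X) (k : ℕ) (hk : k < F.n + 1) :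
    ExtCl (fun Y => ∃ i : Fin F.n, (i : ℕ) < k ∧ P (F.phase i) Y) (F.obj ⟨k, hk⟩) := by
  induction k with
  | zero => exact .zero F.isZero_zero
  | succ k ih =>
    have hk' : k < F.n := by omega
    refine .ext (F.isExt_step ⟨k, hk'⟩) ?_ ⟨⟨k, hk'⟩, by simp, F.semistable _⟩
    exact (ih (by omega)).mono fun Y ⟨i, hi, hY⟩ => ⟨i, by omega, hY⟩

theorem extCl (F : HNFiltration P X) : ExtCl (fun Y => ∃ i : Fin F.n, P (F.phase i) Y) X :=
  ((F.extCl_obj F.n (by omega)).of_iso F.iso_last.some).mono fun _ ⟨i, _, h⟩ => ⟨i, h⟩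

theorem extCl_set (F : HNFiltration P X) {J : Set ℝ} (h : ∀ i, F.phase i ∈ J) :
    ExtCl (fun Y => ∃ φ ∈ J, P φ Y) X :=
  F.extCl.mono fun _ ⟨i, hi⟩ => ⟨_, h i, hi⟩

variable [IsTriangulated C]

theorem exists_isExt_obj (F : HNFiltration P X) (k j : ℕ) (hkj : k ≤ j) (hj : j < F.n + 1) :
    ∃ B, IsExt (F.obj ⟨k, by omega⟩) (F.obj ⟨j, hj⟩) B ∧
      ExtCl (fun Y => ∃ i : Fin F.n, k ≤ (i : ℕ) ∧ P (F.phase i) Y) B := by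
  induction j, hkj using Nat.le_induction with
  | base => exact ⟨_, isExt_zero_right (Limits.isZero_zero C) _, .zero (Limits.isZero_zero C)⟩
  | succ j hkj ih =>
    obtain ⟨B, hB, hB'⟩ := ih (by omega)
    have hj' : j < F.n := by omega
    obtain ⟨E, h₁, h₂⟩ := hB.comp_left (F.isExt_step ⟨j, hj'⟩)
    exact ⟨E, h₁, .ext h₂ hB' ⟨⟨j, hj'⟩, hkj, F.semistable _⟩⟩

theorem exists_isExt (F : HNFiltration P X) (k : ℕ) (hk : k < F.n + 1) :
    ∃ B, IsExt (F.obj ⟨k, hk⟩) X B ∧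
      ExtCl (fun Y => ∃ i : Fin F.n, k ≤ (i : ℕ) ∧ P (F.phase i) Y) B := by
  obtain ⟨B, h, hB⟩ := F.exists_isExt_obj k F.n (by omega) (by omega)
  exact ⟨B, h.iso (Iso.refl _) F.iso_last.some (Iso.refl _), hB⟩

end HNFiltration

/-- The filtration obtained by adding one more factor. -/
def HNFiltration.snoc {P : ℝ → ObjectProperty C} {A X B : C} (F : HNFiltration P A)
    (h : IsExt A X B) (φ : ℝ) (hφ : ∀ i, φ < F.phase i) (hB : P φ B) (hB' : ¬ IsZero B) :
    HNFiltration P X where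
  n := F.n + 1
  obj := Fin.snoc F.obj X
  factor := Fin.snoc F.factor B
  phase := Fin.snoc F.phase φ
  isZero_zero := by
    have : (0 : Fin (F.n + 1 + 1)) = (0 : Fin (F.n + 1)).castSucc := rfl
    rw [this, Fin.snoc_castSucc]
    exact F.isZero_zero
  iso_last := ⟨eqToIso (by simp)⟩
  triangle i := by
    change IsExt _ _ _
    induction i using Fin.lastCases with
    | last =>
      simp only [Fin.snoc_castSucc, Fin.snoc_last, Fin.succ_last]
      exact h.iso F.iso_last.some.symm (Iso.refl _) (Iso.refl _)
    | cast i =>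
      rw [Fin.succ_castSucc]
      simp only [Fin.snoc_castSucc]
      exact F.isExt_step i
  phase_anti := by
    intro i j hij
    induction j using Fin.lastCases with
    | last =>
      induction i using Fin.lastCases with
      | last => exact absurd hij (lt_irrefl _)
      | cast i => simpa using hφ i
    | cast j =>
      induction i using Fin.lastCases with
      | last => exact absurd hij (not_lt.2 (Fin.le_last _))
      | cast i => simpa using F.phase_anti (by simpa using hij)
  semistable i := by
    induction i using Fin.lastCases with
    | last => simpa using hB
    | cast i => simpa using F.semistable i
  factor_nonzero i := by
    induction i using Fin.lastCases with
    | last => simpa using hB'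
    | cast i => simpa using F.factor_nonzero i

/-- The empty filtration of a zero object. -/
def HNFiltration.ofIsZero (P : ℝ → ObjectProperty C) {X : C} (h : IsZero X) :
    HNFiltration P X where
  n := 0
  obj _ := X
  factor := Fin.elim0
  phase := Fin.elim0
  isZero_zero := h
  iso_last := ⟨Iso.refl _⟩
  triangle i := i.elim0
  phase_anti i := i.elim0
  semistable i := i.elim0
  factor_nonzero i := i.elim0

end HN

end LaxStability

end

noncomputable section

set_option linter.unusedSectionVars false

namespace LaxStability

/-! ### Extension closed subcategories of a slicing -/

section Slicings

variable {C : Type u₁} [Category.{u₂} C] [Preadditive C] [HasZeroObject C] [HasShift C ℤ]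
  [∀ n : ℤ, (shiftFunctor C n).Additive] [Pretriangulated C]

namespace Slicing

theorem ext_P {P Q : Slicing C} (h : ∀ φ, P.P φ = Q.P φ) : P = Q := by
  obtain ⟨p, _⟩ := P
  obtain ⟨q, _⟩ := Q
  obtain rfl : p = q := funext h
  rfl

variable (P : Slicing C)

/-- The extension closure of the semistable objects with phase in `I`. -/
def cl (I : Set ℝ) : ObjectProperty C := ExtCl fun X => ∃ φ ∈ I, P.P φ X

/-- The set of phases of non-zero semistable objects. -/
def phases : Set ℝ := {t | ¬ P.SliceZero t}

variable {P}

theorem cl_mono {I J : Set ℝ} (h : I ⊆ J) {X : C} (hX : P.cl I X) : P.cl J X :=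
  ExtCl.mono hX fun _ ⟨φ, hφ, h'⟩ => ⟨φ, h hφ, h'⟩

theorem cl_single {φ : ℝ} {I : Set ℝ} (hφ : φ ∈ I) {X : C} (hX : P.P φ X) : P.cl I X :=
  ExtCl.single ⟨φ, hφ, hX⟩

theorem cl_self {φ : ℝ} {X : C} (hX : P.P φ X) : P.cl {φ} X := cl_single (Set.mem_singleton φ) hX

/-- A zero factor can be dropped without changing the object. Thanks to this, later estimates are
needed only at phases that really occur. -/
theorem cl_inter_phases {I : Set ℝ} {X : C} (hX : P.cl I X) : P.cl (I ∩ P.phases) X := by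
  induction hX with
  | zero h => exact .zero h
  | @ext A Y S h _ hS ih =>
    obtain ⟨φ, hφ, hS⟩ := hS
    by_cases hz : IsZero S
    · obtain ⟨e⟩ := h.iso_left hz
      exact ExtCl.of_iso ih e
    · exact .ext h ih ⟨φ, ⟨hφ, fun h' => hz (h' _ hS)⟩, hS⟩

theorem isZero_of_cl {I : Set ℝ} (h : ∀ t ∈ I, P.SliceZero t) {X : C} (hX : P.cl I X) :
    IsZero X := by
  induction hX with
  | zero h => exact h
  | ext h' _ hS ih => exact h'.isZero₂ ih (h _ hS.choose_spec.1 _ hS.choose_spec.2)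

theorem P_shift_neg {φ : ℝ} {X : C} (hX : P.P φ X) : P.P (φ - 1) (X⟦(-1 : ℤ)⟧) := by
  have e : (X⟦(-1 : ℤ)⟧)⟦(1 : ℤ)⟧ ≅ X := shiftNegShift X (1 : ℤ)
  have := P.iso_closed
  have h : P.P (φ - 1 + 1) ((X⟦(-1 : ℤ)⟧)⟦(1 : ℤ)⟧) := by
    rw [sub_add_cancel]; exact (P.P φ).prop_of_iso e.symm hX
  exact (P.shift _ _).1 h

theorem P_shift_int {φ : ℝ} {X : C} (n : ℤ) (hX : P.P φ X) : P.P (φ + n) (X⟦n⟧) := by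
  have := P.iso_closed
  induction n using Int.induction_on with
  | zero =>
    simpa using (P.P φ).prop_of_iso ((shiftFunctorZero C ℤ).app X).symm hX
  | succ n ih =>
    have h := (P.shift _ _).2 ih
    have e := (shiftFunctorAdd' C (n : ℤ) 1 (n + 1) rfl).app X
    have := (P.P _).prop_of_iso e.symm h
    rw [show φ + ((n + 1 : ℤ) : ℝ) = φ + ((n : ℤ) : ℝ) + 1 by push_cast; ring]
    exact this
  | pred n ih =>
    have h := P_shift_neg ih
    have e := (shiftFunctorAdd' C (-(n : ℤ)) (-1) (-n - 1) rfl).app X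
    have := (P.P _).prop_of_iso e.symm h
    rw [show φ + ((-(n : ℤ) - 1 : ℤ) : ℝ) = φ + ((-(n : ℤ) : ℤ) : ℝ) - 1 by push_cast; ring]
    exact this

theorem cl_shift {I J : Set ℝ} (n : ℤ) (h : ∀ φ ∈ I, φ + n ∈ J) {X : C} (hX : P.cl I X) :
    P.cl J (X⟦n⟧) :=
  ExtCl.shift hX n fun _ ⟨φ, hφ, hY⟩ => ⟨_, h φ hφ, P_shift_int n hY⟩

theorem isZero_of_isZero_shift {X : C} {n : ℤ} (h : IsZero (X⟦n⟧)) : IsZero X :=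
  ((shiftFunctor C (-n)).map_isZero h).of_iso (shiftShiftNeg X n).symm

theorem sliceZero_add_int {t : ℝ} (n : ℤ) (h : P.SliceZero t) : P.SliceZero (t + n) := by
  intro X hX
  refine isZero_of_isZero_shift (n := -n) (h _ ?_)
  simpa using P_shift_int (-n) hX

theorem add_int_mem_phases_iff {t : ℝ} (n : ℤ) : t + n ∈ P.phases ↔ t ∈ P.phases := by
  refine ⟨fun h h' => h (sliceZero_add_int n h'), fun h h' => h ?_⟩
  simpa using sliceZero_add_int (-n) h'

theorem cl_hom_eq_zero {I J : Set ℝ} (h : ∀ a ∈ I, ∀ b ∈ J, b < a) {X Y : C} (hX : P.cl I X)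
    (hY : P.cl J Y) (f : X ⟶ Y) : f = 0 :=
  ExtCl.hom_eq_zero hX hY
    (fun _ _ ⟨a, ha, hA⟩ ⟨b, hb, hB⟩ => P.hom_zero a b _ _ (h a ha b hb) hA hB) f

variable [IsTriangulated C]

theorem cl_isExt {I : Set ℝ} {A X B : C} (h : IsExt A X B) (hA : P.cl I A) (hB : P.cl I B) :
    P.cl I X := ExtCl.of_isExt h hA hB

/-- If the top Harder–Narasimhan phase exceeded all of `J`, there would be no map from the top
factor to an extension of objects with phases in `J`, and that factor would vanish. The bottom
factor is dual, and convexity of `J` covers the phases between. This makes the flexible `cl`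
interchangeable with `interval`. -/
theorem cl_phases_iff {X : C} (F : HNFiltration P.P X) {J : Set ℝ} (hJ : J.OrdConnected) :
    P.cl J X ↔ ∀ i, F.phase i ∈ J := by
  refine ⟨fun hX => ?_, fun h => F.extCl_set h⟩
  intro i
  have hn : 0 < F.n := i.pos
  have top : ∃ b ∈ J, F.phase ⟨0, hn⟩ ≤ b := by
    by_contra! hcon
    obtain ⟨B, hB, hB'⟩ := F.exists_isExt 1 (by omega)
    have hs := F.isExt_step ⟨0, hn⟩
    have h1 : P.cl {F.phase ⟨0, hn⟩} (F.obj ⟨1, by omega⟩) :=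
      .ext hs (.zero F.isZero_zero) ⟨_, rfl, F.semistable _⟩
    have hB1 : P.cl (Set.Iio (F.phase ⟨0, hn⟩)) B := by
      refine ExtCl.mono hB' fun Y ⟨j, hj, hY⟩ => ⟨_, F.phase_anti ?_, hY⟩
      exact Fin.lt_def.2 (Nat.lt_of_succ_le hj)
    have hz : IsZero (F.obj ⟨1, by omega⟩) := by
      refine hB.isZero_left_of_hom (cl_hom_eq_zero ?_ h1 hX)
        (cl_hom_eq_zero ?_ h1 (cl_shift (J := Set.Iio (F.phase ⟨0, hn⟩)) (-1) ?_ hB1))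
      · rintro a rfl b hb; exact hcon b hb
      · rintro a rfl b hb; exact hb
      · intro φ hφ; simp only [Set.mem_Iio] at *; push_cast; linarith
    exact F.factor_nonzero _ (hs.isZero₃ F.isZero_zero hz)
  have bot : ∃ b ∈ J, b ≤ F.phase ⟨F.n - 1, by omega⟩ := by
    by_contra! hcon
    have hs := F.isExt_step ⟨F.n - 1, by omega⟩
    have e : F.obj (Fin.succ ⟨F.n - 1, by omega⟩) ≅ X := by
      refine eqToIso (congrArg F.obj ?_) ≪≫ F.iso_last.some
      ext; simp; omega
    have hs' := hs.iso (Iso.refl _) e (Iso.refl _)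
    have hA : P.cl (Set.Ioi (F.phase ⟨F.n - 1, by omega⟩)) (F.obj ⟨F.n - 1, by omega⟩) := by
      refine ExtCl.mono (F.extCl_obj (F.n - 1) (by omega)) fun Y ⟨j, hj, hY⟩ =>
        ⟨_, F.phase_anti ?_, hY⟩
      exact Fin.lt_def.2 hj
    have hf := F.semistable ⟨F.n - 1, by omega⟩
    refine F.factor_nonzero _ (hs'.isZero_right_of_hom
      (cl_hom_eq_zero (J := {F.phase ⟨F.n - 1, by omega⟩}) ?_ hX (cl_self hf))
      (cl_hom_eq_zero (J := {F.phase ⟨F.n - 1, by omega⟩}) ?_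
        (cl_shift (J := Set.Ioi (F.phase ⟨F.n - 1, by omega⟩)) 1 ?_ hA) (cl_self hf)))
    · rintro a ha b rfl; exact hcon a ha
    · rintro a ha b rfl; exact ha
    · intro φ hφ; simp only [Set.mem_Ioi] at *; push_cast; linarith
  obtain ⟨b, hb, hb'⟩ := top
  obtain ⟨c, hc, hc'⟩ := bot
  refine hJ.out hc hb ⟨hc'.trans (F.phase_anti.antitone ?_), (F.phase_anti.antitone ?_).trans hb'⟩
  · exact Fin.le_def.2 (by simp; omega)
  · exact Fin.le_def.2 (by simp)

theorem interval_eq_cl {I : Set ℝ} (hI : I.OrdConnected) : P.interval I = P.cl I := by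
  funext X
  refine propext ⟨fun ⟨F, hF⟩ => (cl_phases_iff F hI).2 hF, fun h => ⟨P.hn X, ?_⟩⟩
  exact (cl_phases_iff _ hI).1 h

theorem cl_singleton (φ : ℝ) : P.cl {φ} = P.P φ := by
  funext X
  refine propext ⟨fun h => ?_, cl_self⟩
  have := P.iso_closed
  induction h with
  | zero h => exact P.zero_mem _ _ h
  | @ext A Y S h hA hS ih =>
    have hY : P.cl {φ} Y := .ext h hA hS
    have hF := (cl_phases_iff (P.hn Y) Set.ordConnected_singleton).1 hY
    set F := P.hn Y
    have hs : Subsingleton (Fin F.n) :=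
      ⟨fun i j => F.phase_anti.injective ((hF i).trans (hF j).symm)⟩
    have hn : F.n ≤ 1 := by simpa using Fintype.card_le_one_iff_subsingleton.2 hs
    obtain hn | hn : F.n = 0 ∨ F.n = 1 := by omega
    · refine P.zero_mem _ _ ?_
      have : Fin.last F.n = 0 := by ext; simp [hn]
      have hz := F.isZero_zero
      rw [← this] at hz
      exact hz.of_iso F.iso_last.some.symm
    · have hs := F.isExt_step ⟨0, by omega⟩
      obtain ⟨e⟩ := hs.iso_right F.isZero_zero
      have e' : F.obj (Fin.succ ⟨0, by omega⟩) ≅ Y := by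
        refine eqToIso (congrArg F.obj ?_) ≪≫ F.iso_last.some
        ext; simp [hn]
      have := F.semistable ⟨0, by omega⟩
      rw [hF] at this
      exact (P.P φ).prop_of_iso (e.symm ≪≫ e') this

theorem interval_singleton (φ : ℝ) : P.interval {φ} = P.P φ := by
  rw [interval_eq_cl Set.ordConnected_singleton, cl_singleton]

theorem intervalZero_iff {I : Set ℝ} : P.IntervalZero I ↔ ∀ t ∈ I, P.SliceZero t := by
  constructor
  · intro h t ht X hX
    rw [← interval_singleton] at hX
    obtain ⟨F, hF⟩ := hX
    exact h X ⟨F, fun i => by rw [hF i]; exact ht⟩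
  · rintro h X ⟨F, hF⟩
    exact isZero_of_cl h (F.extCl_set hF)

/-- Phases decrease along the filtration, so those in an upper set form an initial segment; the
filtration is cut at its end. -/
theorem exists_truncation {J U : Set ℝ} (hJ : J.OrdConnected) (hU : IsUpperSet U) {X : C}
    (hX : P.cl J X) : ∃ A B, IsExt A X B ∧ P.cl (J ∩ U) A ∧ P.cl (J ∩ Uᶜ) B := by
  classical
  set F := P.hn X
  have hF := (cl_phases_iff F hJ).1 hX
  have hk : ∃ k ≤ F.n, ∀ i : Fin F.n, (i : ℕ) < k ↔ F.phase i ∈ U := by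
    by_cases h : ∀ i, F.phase i ∈ U
    · exact ⟨F.n, le_rfl, fun i => by simp [h i]⟩
    · push Not at h
      have h' : ∃ k, ∃ hk : k < F.n, F.phase ⟨k, hk⟩ ∉ U := ⟨_, h.choose.2, h.choose_spec⟩
      refine ⟨Nat.find h', (Nat.find_spec h').1.le, fun i => ⟨fun hi => ?_, fun hi => ?_⟩⟩
      · by_contra hc
        exact Nat.find_min h' hi ⟨i.2, hc⟩
      · by_contra hc
        obtain ⟨hk, hk'⟩ := Nat.find_spec h'
        exact hk' (hU (F.phase_anti.antitone (Fin.le_def.2 (not_lt.1 hc))) hi)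
  obtain ⟨k, hkn, hk⟩ := hk
  obtain ⟨B, h, hB⟩ := F.exists_isExt k (by omega)
  refine ⟨_, B, h, ?_, ?_⟩
  · exact ExtCl.mono (F.extCl_obj k _) fun Y ⟨i, hi, hY⟩ => ⟨_, ⟨hF i, (hk i).1 hi⟩, hY⟩
  · exact ExtCl.mono hB fun Y ⟨i, hi, hY⟩ =>
      ⟨_, ⟨hF i, fun h' => absurd ((hk i).2 h') (by omega)⟩, hY⟩

theorem hn_pos {X : C} (hX : ¬ IsZero X) (F : HNFiltration P.P X) : 0 < F.n := by
  by_contra h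
  have h0 : F.n = 0 := by omega
  have : Fin.last F.n = 0 := by ext; simp [h0]
  have hz := F.isZero_zero
  rw [← this] at hz
  exact hX (hz.of_iso F.iso_last.some.symm)

theorem phase_le_phiPlus (X : C) (i : Fin (P.hn X).n) : (P.hn X).phase i ≤ P.phiPlus X :=
  le_ciSup (Set.finite_range _).bddAbove i

theorem phiMinus_le_phase (X : C) (i : Fin (P.hn X).n) : P.phiMinus X ≤ (P.hn X).phase i :=
  ciInf_le (Set.finite_range _).bddBelow i

theorem exists_phase_eq_phiPlus {X : C} (hX : ¬ IsZero X) :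
    ∃ i, (P.hn X).phase i = P.phiPlus X := by
  have : Nonempty (Fin (P.hn X).n) := ⟨⟨0, hn_pos hX _⟩⟩
  exact exists_eq_ciSup_of_finite

theorem exists_phase_eq_phiMinus {X : C} (hX : ¬ IsZero X) :
    ∃ i, (P.hn X).phase i = P.phiMinus X := by
  have : Nonempty (Fin (P.hn X).n) := ⟨⟨0, hn_pos hX _⟩⟩
  exact exists_eq_ciInf_of_finite

theorem phiMinus_le_phiPlus {X : C} (hX : ¬ IsZero X) : P.phiMinus X ≤ P.phiPlus X :=
  (phiMinus_le_phase X ⟨0, hn_pos hX _⟩).trans (phase_le_phiPlus X _)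

theorem cl_iff {X : C} (hX : ¬ IsZero X) {J : Set ℝ} (hJ : J.OrdConnected) :
    P.cl J X ↔ P.phiMinus X ∈ J ∧ P.phiPlus X ∈ J := by
  rw [cl_phases_iff (P.hn X) hJ]
  constructor
  · intro h
    obtain ⟨i, hi⟩ := exists_phase_eq_phiPlus (P := P) hX
    obtain ⟨j, hj⟩ := exists_phase_eq_phiMinus (P := P) hX
    exact ⟨hj ▸ h j, hi ▸ h i⟩
  · exact fun h i => hJ.out h.1 h.2 ⟨phiMinus_le_phase X i, phase_le_phiPlus X i⟩

theorem phiPlus_mem_phases {X : C} (hX : ¬ IsZero X) : P.phiPlus X ∈ P.phases := by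
  obtain ⟨i, hi⟩ := exists_phase_eq_phiPlus (P := P) hX
  exact fun h => (P.hn X).factor_nonzero i (h _ (hi ▸ (P.hn X).semistable i))

theorem phiMinus_mem_phases {X : C} (hX : ¬ IsZero X) : P.phiMinus X ∈ P.phases := by
  obtain ⟨i, hi⟩ := exists_phase_eq_phiMinus (P := P) hX
  exact fun h => (P.hn X).factor_nonzero i (h _ (hi ▸ (P.hn X).semistable i))

theorem phiPlus_eq {φ : ℝ} {X : C} (hX : ¬ IsZero X) (h : P.P φ X) : P.phiPlus X = φ :=
  ((cl_iff hX Set.ordConnected_singleton).1 (cl_self h)).2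

theorem phiMinus_eq {φ : ℝ} {X : C} (hX : ¬ IsZero X) (h : P.P φ X) : P.phiMinus X = φ :=
  ((cl_iff hX Set.ordConnected_singleton).1 (cl_self h)).1

theorem P_iff {φ : ℝ} {X : C} (hX : ¬ IsZero X) :
    P.P φ X ↔ P.phiMinus X = φ ∧ P.phiPlus X = φ := by
  rw [← cl_singleton, cl_iff hX Set.ordConnected_singleton]; rfl

theorem exists_top_factor {X : C} (hX : ¬ IsZero X) : ∃ A B, IsExt A X B ∧
    P.P (P.phiPlus X) A ∧ ¬ IsZero A ∧ P.cl (Set.Ico (P.phiMinus X) (P.phiPlus X)) B := by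
  have h : P.cl (Set.Icc (P.phiMinus X) (P.phiPlus X)) X :=
    (cl_iff hX Set.ordConnected_Icc).2
      ⟨⟨le_rfl, phiMinus_le_phiPlus hX⟩, ⟨phiMinus_le_phiPlus hX, le_rfl⟩⟩
  obtain ⟨A, B, hE, hA, hB⟩ :=
    exists_truncation Set.ordConnected_Icc (isUpperSet_Ici (P.phiPlus X)) h
  have hB' : P.cl (Set.Ico (P.phiMinus X) (P.phiPlus X)) B :=
    cl_mono (fun t ht => Set.mem_Ico.2 ⟨ht.1.1, by simpa using ht.2⟩) hB
  refine ⟨A, B, hE, ?_, fun hz => ?_, hB'⟩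
  · rw [← cl_singleton]
    exact cl_mono (fun t ht => le_antisymm ht.1.2 ht.2) hA
  · obtain ⟨e⟩ := hE.iso_right hz
    have := (cl_iff hX Set.ordConnected_Ico).1 (ExtCl.of_iso hB' e.symm)
    exact lt_irrefl _ this.2.2

/-! ### The push-forward of a slicing -/

/-- Since `h` need not be injective, factors whose phases have the same image are merged into one.
The induction splits off the last such block. -/
theorem exists_hn_map (h : CircleDeg1Lift) (n : ℕ) (X : C) (F : HNFiltration P.P X)
    (hn : F.n = n) : ∃ G : HNFiltration (fun φ => P.cl (h ⁻¹' {φ})) X,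
      ∀ i, ∃ j, h (F.phase j) = G.phase i := by
  induction n using Nat.strong_induction_on generalizing X F with
  | _ n ih =>
    by_cases h0 : n = 0
    · refine ⟨HNFiltration.ofIsZero _ ?_, fun i => i.elim0⟩
      have : Fin.last F.n = 0 := by ext; simp [hn, h0]
      have hz := F.isZero_zero
      rw [← this] at hz
      exact hz.of_iso F.iso_last.some.symm
    classical
    set m := h (F.phase ⟨n - 1, by omega⟩) with hm
    -- The first index of the last block, on which `h` takes its smallest value `m`.
    have h' : ∃ k, ∃ hk : k < F.n, h (F.phase ⟨k, hk⟩) = m := ⟨n - 1, by omega, rfl⟩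
    set k := Nat.find h' with hkdef
    obtain ⟨hk, hk'⟩ : ∃ hk : k < F.n, h (F.phase ⟨k, hk⟩) = m := Nat.find_spec h'
    have hge : ∀ i, m ≤ h (F.phase i) := fun i => by
      rw [hm]
      exact h.monotone (F.phase_anti.antitone (Fin.le_def.2 (by simp; omega)))
    obtain ⟨B, hE, hB⟩ := F.exists_isExt k (by omega)
    let F' : HNFiltration P.P (F.obj ⟨k, by omega⟩) :=
      { n := k
        obj := fun i => F.obj ⟨i, by omega⟩
        factor := fun i => F.factor ⟨i, by omega⟩
        phase := fun i => F.phase ⟨i, by omega⟩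
        isZero_zero := F.isZero_zero
        iso_last := ⟨Iso.refl _⟩
        triangle := fun i => F.triangle ⟨i, by omega⟩
        phase_anti := fun i j hij => F.phase_anti (Fin.lt_def.2 hij)
        semistable := fun i => F.semistable _
        factor_nonzero := fun i => F.factor_nonzero _ }
    obtain ⟨G, hG⟩ := ih k (by omega) _ F' rfl
    have hB' : P.cl (h ⁻¹' {m}) B := by
      refine ExtCl.mono hB fun Y ⟨i, hi, hY⟩ => ⟨_, le_antisymm ?_ (hge i), hY⟩
      rw [← hk']
      exact h.monotone (F.phase_anti.antitone (Fin.le_def.2 hi))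
    -- If the block were zero, `X` would be built from phases with image above `m`, contradicting
    -- its Harder–Narasimhan phase of index `k`.
    have hBz : ¬ IsZero B := by
      intro hz
      obtain ⟨e⟩ := hE.iso_left hz
      have h1 : P.cl (h ⁻¹' (Set.Ioi m)) X := by
        refine ExtCl.of_iso (ExtCl.mono (F.extCl_obj k _) fun Y ⟨i, hi, hY⟩ => ⟨_, ?_, hY⟩) e
        exact lt_of_le_of_ne (hge i) fun heq => Nat.find_min h' hi ⟨i.2, heq.symm⟩
      have h2 := (cl_phases_iff F (Set.ordConnected_Ioi.preimage_mono h.monotone)).1 h1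
        ⟨k, hk⟩
      rw [Set.mem_preimage, hk'] at h2
      exact lt_irrefl _ (Set.mem_Ioi.1 h2)
    have hlt : ∀ i, m < G.phase i := fun i => by
      obtain ⟨j, hj⟩ := hG i
      rw [← hj]
      exact lt_of_le_of_ne (hge _) fun heq =>
        Nat.find_min h' j.2 ⟨lt_of_lt_of_le j.2 hk.le, heq.symm⟩
    refine ⟨G.snoc hE m hlt hB' hBz, fun i => ?_⟩
    induction i using Fin.lastCases with
    | last => exact ⟨⟨k, hk⟩, by simp [HNFiltration.snoc, hk']⟩
    | cast i =>
      obtain ⟨j, hj⟩ := hG i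
      exact ⟨⟨j, lt_of_lt_of_le j.2 hk.le⟩, by simpa [HNFiltration.snoc, F'] using hj⟩

variable (P) in
/-- The push-forward of a slicing along a monotone map of degree one. -/
def map (h : CircleDeg1Lift) : Slicing C where
  P φ := P.cl (h ⁻¹' {φ})
  iso_closed φ := ⟨fun e hX => ExtCl.of_iso hX e⟩
  zero_mem φ X hX := .zero hX
  biprod_mem φ X Y hX hY :=
    cl_isExt ⟨_, _, _, binaryBiproductTriangle_distinguished X Y⟩ hX hY
  shift φ X := by
    refine ⟨fun hX => ?_, fun hX => cl_shift 1 ?_ hX⟩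
    · refine ExtCl.of_iso (cl_shift (-1) (J := h ⁻¹' {φ}) ?_ hX) (shiftShiftNeg X (1 : ℤ))
      intro t ht
      have : h (t + (-1 : ℤ)) = h t + (-1 : ℤ) := h.map_add_int t (-1)
      simp only [Set.mem_preimage, Set.mem_singleton_iff] at *
      rw [this, ht]; push_cast; ring
    · intro t ht
      simp only [Set.mem_preimage, Set.mem_singleton_iff] at *
      rw [h.map_add_int, ht]; push_cast; ring
  hom_zero φ φ' X Y hlt hX hY f := by
    refine cl_hom_eq_zero (fun a ha b hb => ?_) hX hY f
    by_contra hc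
    have := h.monotone (not_lt.1 hc)
    simp only [Set.mem_preimage, Set.mem_singleton_iff] at ha hb
    linarith
  exists_hn X := by
    obtain ⟨G, -⟩ := exists_hn_map h _ X (P.hn X) rfl
    exact ⟨G⟩

variable (h : CircleDeg1Lift)

theorem map_P (φ : ℝ) : (P.map h).P φ = P.cl (h ⁻¹' {φ}) := rfl

theorem map_cl (I : Set ℝ) : (P.map h).cl I = P.cl (h ⁻¹' I) := by
  funext X
  refine propext ⟨fun hX => ExtCl.bind hX ?_, fun hX => ExtCl.mono hX ?_⟩
  · rintro Y ⟨φ, hφ, hY⟩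
    exact cl_mono (fun t ht => by
      simp only [Set.mem_preimage, Set.mem_singleton_iff] at *; rwa [ht]) hY
  · rintro Y ⟨φ, hφ, hY⟩
    exact ⟨h φ, hφ, cl_single (I := h ⁻¹' {h φ}) rfl hY⟩

theorem map_interval {I : Set ℝ} (hI : I.OrdConnected) :
    (P.map h).interval I = P.interval (h ⁻¹' I) := by
  rw [interval_eq_cl hI, interval_eq_cl (hI.preimage_mono h.monotone), map_cl]

/-- The maximal phase is determined by which half-lines have the object in their subcategory, and
preimages of half-lines under a monotone map are order connected. -/
theorem map_phiPlus {X : C} (hX : ¬ IsZero X) : (P.map h).phiPlus X = h (P.phiPlus X) := by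
  refine eq_of_forall_ge_iff fun a => ?_
  have h1 := cl_iff (P := P.map h) hX (Set.ordConnected_Iic (a := a))
  rw [map_cl, cl_iff hX (Set.ordConnected_Iic.preimage_mono h.monotone)] at h1
  constructor
  · exact fun h2 => (h1.2 ⟨(phiMinus_le_phiPlus hX).trans h2, h2⟩).2
  · exact fun h2 => (h1.1 ⟨(h.monotone (phiMinus_le_phiPlus hX)).trans h2, h2⟩).2

theorem map_phiMinus {X : C} (hX : ¬ IsZero X) : (P.map h).phiMinus X = h (P.phiMinus X) := by
  refine eq_of_forall_le_iff fun a => ?_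
  have h1 := cl_iff (P := P.map h) hX (Set.ordConnected_Ici (a := a))
  rw [map_cl, cl_iff hX (Set.ordConnected_Ici.preimage_mono h.monotone)] at h1
  constructor
  · exact fun h2 => (h1.2 ⟨h2, le_trans h2 (phiMinus_le_phiPlus hX)⟩).1
  · exact fun h2 => (h1.1 ⟨h2, le_trans h2 (h.monotone (phiMinus_le_phiPlus hX))⟩).1

theorem map_congr {h k : CircleDeg1Lift} (hk : ∀ t ∈ P.phases, h t = k t) :
    P.map h = P.map k := by
  refine ext_P fun φ => ?_
  funext X
  refine propext ⟨fun hX => ?_, fun hX => ?_⟩ <;>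
  · refine cl_mono ?_ (cl_inter_phases hX)
    intro t ht
    have := hk t ht.2
    have := ht.1
    simp only [Set.mem_preimage, Set.mem_singleton_iff] at *
    linarith

end Slicing

/-! ### The metric on slicings -/

variable [IsTriangulated C]

/-- The extreme phases of an object are themselves phases of the slicing, so it suffices to compare
the two maps on `P.phases`. -/
theorem sliceEDist_map_le (P : Slicing C) (h k : CircleDeg1Lift) {ε : ℝ}
    (hε : ∀ t ∈ P.phases, |h t - k t| ≤ ε) :
    sliceEDist (P.map h) (P.map k) ≤ ENNReal.ofReal ε := by
  refine iSup₂_le fun X hX => ?_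
  rw [Slicing.map_phiPlus _ hX, Slicing.map_phiPlus _ hX, Slicing.map_phiMinus _ hX,
    Slicing.map_phiMinus _ hX, edist_dist, edist_dist, Real.dist_eq, Real.dist_eq]
  exact max_le (ENNReal.ofReal_le_ofReal (hε _ (Slicing.phiMinus_mem_phases hX)))
    (ENNReal.ofReal_le_ofReal (hε _ (Slicing.phiPlus_mem_phases hX)))

theorem abs_phiPlus_sub_lt {P Q : Slicing C} {ε : ℝ} (h : sliceEDist P Q < ENNReal.ofReal ε)
    {X : C} (hX : ¬ IsZero X) : |P.phiPlus X - Q.phiPlus X| < ε := by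
  have h1 : edist (P.phiPlus X) (Q.phiPlus X) < ENNReal.ofReal ε :=
    lt_of_le_of_lt ((le_max_right _ _).trans (le_iSup₂_of_le (f := fun (X : C)
      (_ : ¬ IsZero X) => max (edist (P.phiMinus X) (Q.phiMinus X))
        (edist (P.phiPlus X) (Q.phiPlus X))) X hX le_rfl)) h
  rw [edist_dist, Real.dist_eq] at h1
  exact (ENNReal.ofReal_lt_ofReal_iff_of_nonneg (abs_nonneg _)).1 h1

theorem abs_phiMinus_sub_lt {P Q : Slicing C} {ε : ℝ} (h : sliceEDist P Q < ENNReal.ofReal ε)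
    {X : C} (hX : ¬ IsZero X) : |P.phiMinus X - Q.phiMinus X| < ε := by
  have h1 : edist (P.phiMinus X) (Q.phiMinus X) < ENNReal.ofReal ε :=
    lt_of_le_of_lt ((le_max_left _ _).trans (le_iSup₂_of_le (f := fun (X : C)
      (_ : ¬ IsZero X) => max (edist (P.phiMinus X) (Q.phiMinus X))
        (edist (P.phiPlus X) (Q.phiPlus X))) X hX le_rfl)) h
  rw [edist_dist, Real.dist_eq] at h1
  exact (ENNReal.ofReal_lt_ofReal_iff_of_nonneg (abs_nonneg _)).1 h1

theorem Slicing.cl_of_sliceEDist_lt {P Q : Slicing C} {ε : ℝ}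
    (h : sliceEDist P Q < ENNReal.ofReal ε) {I J : Set ℝ} (hI : I.OrdConnected)
    (hJ : J.OrdConnected) (hIJ : ∀ s ∈ I, ∀ t, |s - t| < ε → t ∈ J) {X : C} (hX : P.cl I X) :
    Q.cl J X := by
  by_cases hz : IsZero X
  · exact .zero hz
  rw [cl_iff hz hI] at hX
  rw [cl_iff hz hJ]
  exact ⟨hIJ _ hX.1 _ (abs_phiMinus_sub_lt h hz), hIJ _ hX.2 _ (abs_phiPlus_sub_lt h hz)⟩

theorem eq_of_sliceEDist_eq_zero {P Q : Slicing C} (h : sliceEDist P Q = 0) : P = Q := by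
  have hp : ∀ X : C, ¬ IsZero X → P.phiPlus X = Q.phiPlus X ∧ P.phiMinus X = Q.phiMinus X := by
    intro X hX
    have key : ∀ ε > 0, |P.phiPlus X - Q.phiPlus X| < ε ∧ |P.phiMinus X - Q.phiMinus X| < ε :=
      fun ε hε => by
        have : sliceEDist P Q < ENNReal.ofReal ε := by rw [h]; simpa using hε
        exact ⟨abs_phiPlus_sub_lt this hX, abs_phiMinus_sub_lt this hX⟩
    constructor
    · by_contra hne
      exact lt_irrefl _ (key _ (abs_pos.2 (sub_ne_zero.2 hne))).1
    · by_contra hne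
      exact lt_irrefl _ (key _ (abs_pos.2 (sub_ne_zero.2 hne))).2
  refine Slicing.ext_P fun φ => ?_
  funext X
  by_cases hX : IsZero X
  · exact propext ⟨fun _ => Q.zero_mem _ _ hX, fun _ => P.zero_mem _ _ hX⟩
  · rw [Slicing.P_iff hX, Slicing.P_iff hX, (hp X hX).1, (hp X hX).2]

end Slicings

end LaxStability

end

noncomputable section

open scoped ZeroObject

set_option linter.unusedSectionVars false

namespace LaxStability

/-! ### Strict subobjects -/

theorem IsStrictMono.of_comp {A : Type u₁} [Category.{u₂} A] [HasZeroMorphisms A] {X Y Z : A}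
    {f : X ⟶ Y} {g : Y ⟶ Z} [Mono g] (h : IsStrictMono (f ≫ g)) : IsStrictMono f := by
  obtain ⟨W, k, w, hl⟩ := h
  refine ⟨⟨W, g ≫ k, by simpa using w, ?_⟩⟩
  refine KernelFork.IsLimit.ofι _ _ (fun {T} t ht => hl.lift (KernelFork.ofι (t ≫ g)
    (by simpa using ht))) (fun {T} t ht => ?_) (fun {T} t ht m hm => ?_)
  · have := hl.fac (KernelFork.ofι (t ≫ g) (by simpa using ht)) WalkingParallelPair.zero
    rw [← cancel_mono g]
    simpa using this
  · refine Fork.IsLimit.hom_ext hl ?_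
    have := hl.fac (KernelFork.ofι (t ≫ g) (by simpa using ht)) WalkingParallelPair.zero
    simp only [Fork.ofι_pt, Fork.app_zero_eq_ι, Fork.ι_ofι] at this
    rw [Fork.ι_ofι, this, ← hm, Category.assoc]

theorem IsStrictMono.iso_comp {A : Type u₁} [Category.{u₂} A] [HasZeroMorphisms A] {X Y Z : A}
    {f : Y ⟶ Z} (h : IsStrictMono f) (e : X ≅ Y) : IsStrictMono (e.hom ≫ f) := by
  obtain ⟨W, k, w, hl⟩ := h
  refine ⟨⟨W, k, by simp [w], ?_⟩⟩
  exact IsLimit.ofIsoLimit hl (Fork.ext e.symm (by simp))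

section

variable {C : Type u₁} [Category.{u₂} C] [Preadditive C] [HasZeroObject C] [HasShift C ℤ]
  [∀ n : ℤ, (shiftFunctor C n).Additive] [Pretriangulated C]

/-- The object `X` is a simple object of the full subcategory `𝒬` with respect to strict
monomorphisms. -/
def StrictSimpleIn (𝒬 : ObjectProperty C) (X : C) : Prop :=
  ∃ h : 𝒬 X, IsStrictSimple (⟨X, h⟩ : 𝒬.FullSubcategory)

theorem isZero_mk_iff {𝒬 : ObjectProperty C} {X : C} (h : 𝒬 X) :
    IsZero (⟨X, h⟩ : 𝒬.FullSubcategory) ↔ IsZero X := by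
  rw [IsZero.iff_id_eq_zero, IsZero.iff_id_eq_zero]
  exact ⟨fun h => congrArg (fun f => f.hom) h, fun h => ObjectProperty.hom_ext _ h⟩

/-- An extension closed full subcategory without negative self-extensions in which morphisms have
kernels, and the cokernels of these, given by distinguished triangles. -/
structure HasStrictKernels (𝒬 : ObjectProperty C) : Prop where
  zero {Z : C} : IsZero Z → 𝒬 Z
  of_isExt {A X B : C} : IsExt A X B → 𝒬 A → 𝒬 B → 𝒬 X
  hom_eq_zero {A B : C} : 𝒬 A → 𝒬 B → ∀ f : A ⟶ B⟦(-1 : ℤ)⟧, f = 0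
  exists_kernel {X W : C} : 𝒬 X → 𝒬 W → ∀ g : X ⟶ W, ∃ (A B : C) (f : A ⟶ X) (k : X ⟶ B)
    (l : B ⟶ A⟦(1 : ℤ)⟧), 𝒬 A ∧ 𝒬 B ∧ Triangle.mk f k l ∈ distTriang C ∧ f ≫ g = 0 ∧
      ∀ T, 𝒬 T → ∀ t : T ⟶ X, t ≫ g = 0 → ∃ s : T ⟶ A, t = s ≫ f

variable {𝒬 : ObjectProperty C}

/-- The difference of the two lifts factors through `B⟦-1⟧`, to which `T` has no non-zero map. -/
theorem HasStrictKernels.eq_of_comp_eq (hQ : HasStrictKernels 𝒬) {A X B T : C} {f : A ⟶ X}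
    {g : X ⟶ B} {h : B ⟶ A⟦(1 : ℤ)⟧} (hT : Triangle.mk f g h ∈ distTriang C) (hB : 𝒬 B)
    (hTQ : 𝒬 T) {u v : T ⟶ A} (huv : u ≫ f = v ≫ f) : u = v := by
  obtain ⟨m, l, hl⟩ := exists_lift_shift_of_comp_eq_zero hT (u - v)
    (by rw [Preadditive.sub_comp, huv, sub_self])
  rw [hQ.hom_eq_zero hTQ hB l, zero_comp] at hl
  exact sub_eq_zero.1 hl

theorem HasStrictKernels.isStrictMono (hQ : HasStrictKernels 𝒬) {A X B : C} {f : A ⟶ X}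
    {g : X ⟶ B} {h : B ⟶ A⟦(1 : ℤ)⟧} (hT : Triangle.mk f g h ∈ distTriang C) (hA : 𝒬 A)
    (hX : 𝒬 X) (hB : 𝒬 B) :
    IsStrictMono (ObjectProperty.homMk f : (⟨A, hA⟩ : 𝒬.FullSubcategory) ⟶ ⟨X, hX⟩) := by
  have hfg : f ≫ g = 0 := comp_distTriang_mor_zero₁₂ _ hT
  refine ⟨⟨⟨B, hB⟩, ObjectProperty.homMk g, ObjectProperty.hom_ext _ hfg, ?_⟩⟩
  have key : ∀ {T : 𝒬.FullSubcategory} (t : T ⟶ (⟨X, hX⟩ : 𝒬.FullSubcategory))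
      (_ : t ≫ (ObjectProperty.homMk g : (⟨X, hX⟩ : 𝒬.FullSubcategory) ⟶ ⟨B, hB⟩) = 0),
      ∃ l : T.obj ⟶ A, t.hom = l ≫ f := fun t ht =>
    exists_lift_of_comp_eq_zero hT t.hom (congrArg (fun f => f.hom) ht)
  refine KernelFork.IsLimit.ofι _ _ (fun t ht => ObjectProperty.homMk (key t ht).choose)
    (fun t ht => ObjectProperty.hom_ext _ (key t ht).choose_spec.symm)
    (fun {T} t ht m hm => ObjectProperty.hom_ext _ ?_)
  refine hQ.eq_of_comp_eq hT hB T.property ?_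
  have h1 : m.hom ≫ f = t.hom := congrArg (fun f => f.hom) hm
  exact h1.trans (key t ht).choose_spec

/-- A strict monomorphism is the kernel of some `g`. The kernel of `g` supplied by `exists_kernel`
has the same universal property and comes with a triangle, which is transported along the resulting
isomorphism. -/
theorem HasStrictKernels.exists_triangle (hQ : HasStrictKernels 𝒬) {Y X : 𝒬.FullSubcategory}
    (f : Y ⟶ X) (hf : IsStrictMono f) : ∃ (B : C) (g : X.obj ⟶ B) (h : B ⟶ Y.obj⟦(1 : ℤ)⟧),
      𝒬 B ∧ Triangle.mk f.hom g h ∈ distTriang C := by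
  obtain ⟨W, g, w, hl⟩ := hf
  obtain ⟨A, B, f', k, l, hA, hB, hT, hfg, hu⟩ := hQ.exists_kernel X.property W.property g.hom
  obtain ⟨s, hs⟩ := hu _ Y.property f.hom (congrArg (fun f => f.hom) w)
  let f'' : (⟨A, hA⟩ : 𝒬.FullSubcategory) ⟶ X := ObjectProperty.homMk f'
  obtain ⟨s', hs'⟩ : ∃ s' : (⟨A, hA⟩ : 𝒬.FullSubcategory) ⟶ Y, s' ≫ f = f'' :=
    ⟨_, Fork.IsLimit.lift_ι' hl f'' (by rw [comp_zero]; exact ObjectProperty.hom_ext _ hfg)⟩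
  have hs'' : s'.hom ≫ f.hom = f' := congrArg (fun f => f.hom) hs'
  have h1 : s'.hom ≫ s = 𝟙 A := by
    refine hQ.eq_of_comp_eq hT hB hA ?_
    rw [Category.assoc, ← hs, hs'', Category.id_comp]
  have h2 : s ≫ s'.hom = 𝟙 Y.obj := by
    have : (ObjectProperty.homMk s : Y ⟶ (⟨A, hA⟩ : 𝒬.FullSubcategory)) ≫ s' = 𝟙 Y := by
      refine Fork.IsLimit.hom_ext hl (ObjectProperty.hom_ext _ ?_)
      change (s ≫ s'.hom) ≫ f.hom = 𝟙 Y.obj ≫ f.hom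
      rw [Category.assoc, hs'', ← hs, Category.id_comp]
    exact congrArg (fun f => f.hom) this
  let e : A ≅ Y.obj := ⟨s'.hom, s, h1, h2⟩
  refine ⟨B, k, l ≫ e.hom⟦(1 : ℤ)⟧', hB, isomorphic_distinguished _ hT _ ?_⟩
  refine (Triangle.isoMk (Triangle.mk f' k l) (Triangle.mk f.hom k (l ≫ e.hom⟦(1 : ℤ)⟧')) e
    (Iso.refl X.obj) (Iso.refl B) ?_ ?_ ?_).symm
  · change f' ≫ 𝟙 _ = s'.hom ≫ f.hom
    rw [hs'', Category.comp_id]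
  · change k ≫ 𝟙 _ = 𝟙 _ ≫ k
    rw [Category.comp_id, Category.id_comp]
  · change l ≫ e.hom⟦(1 : ℤ)⟧' = 𝟙 _ ≫ l ≫ e.hom⟦(1 : ℤ)⟧'
    rw [Category.id_comp]

theorem isIso_of_isExt_left {A X B : C} {f : A ⟶ X} {g : X ⟶ B} {h : B ⟶ A⟦(1 : ℤ)⟧}
    (hT : Triangle.mk f g h ∈ distTriang C) : IsZero B ↔ IsIso f :=
  Triangle.isZero₃_iff_isIso₁ _ hT

theorem isIso_iff_hom {X Y : 𝒬.FullSubcategory} (f : X ⟶ Y) : IsIso f ↔ IsIso f.hom := by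
  constructor
  · intro h
    exact inferInstanceAs (IsIso (𝒬.ι.map f))
  · intro h
    have : IsIso (𝒬.ι.map f) := h
    exact isIso_of_fully_faithful 𝒬.ι f

/-- Strict subobjects correspond to triangles inside `𝒬`, so simplicity can be tested, and moved
along shifts, without mentioning subobjects. -/
theorem HasStrictKernels.strictSimpleIn_iff (hQ : HasStrictKernels 𝒬) {X : C} :
    StrictSimpleIn 𝒬 X ↔ 𝒬 X ∧ ¬ IsZero X ∧
      ∀ A B, 𝒬 A → 𝒬 B → IsExt A X B → IsZero A ∨ IsZero B := by
  constructor
  · rintro ⟨hX, h0, h⟩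
    refine ⟨hX, fun hz => h0 ((isZero_mk_iff hX).2 hz), fun A B hA hB ⟨f, g, k, hT⟩ => ?_⟩
    refine (h _ _ (hQ.isStrictMono hT hA hX hB)).imp (isZero_mk_iff hA).1 fun hi => ?_
    exact (isIso_of_isExt_left hT).2 ((isIso_iff_hom _).1 hi)
  · rintro ⟨hX, h0, h⟩
    refine ⟨hX, fun hz => h0 ((isZero_mk_iff hX).1 hz), fun Y f hf => ?_⟩
    obtain ⟨B, g, k, hB, hT⟩ := hQ.exists_triangle f hf
    refine (h _ _ Y.property hB ⟨_, _, _, hT⟩).imp (isZero_mk_iff Y.property).2 fun hz => ?_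
    exact (isIso_iff_hom _).2 ((isIso_of_isExt_left hT).1 hz)

/-- `⌊ℓ / κ⌋` is a length: it strictly increases along strict subobjects, because a non-zero
quotient contributes at least `κ`, and it is bounded by its value at `X`. -/
theorem HasStrictKernels.isLengthCategory (hQ : HasStrictKernels 𝒬) (ℓ : C → ℝ) {κ : ℝ}
    (hκ : 0 < κ) (hadd : ∀ A X B, IsExt A X B → ℓ X = ℓ A + ℓ B)
    (hpos : ∀ X, 𝒬 X → ¬ IsZero X → κ ≤ ℓ X) : IsLengthCategory 𝒬.FullSubcategory := by
  intro X
  have h0 : ∀ Z : C, IsZero Z → ℓ Z = 0 := fun Z hZ => by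
    have := hadd Z Z Z (isExt_zero_right hZ Z)
    linarith
  have hnn : ∀ Y, 𝒬 Y → 0 ≤ ℓ Y := fun Y hY => by
    by_cases hz : IsZero Y
    · exact (h0 Y hz).ge
    · exact hκ.le.trans (hpos Y hY hz)
  let m : {S : Subobject X // IsStrictMono S.arrow} → ℕ :=
    fun S => ⌊ℓ (S.1 : 𝒬.FullSubcategory).obj / κ⌋₊
  have hm : StrictMono m := by
    intro S T hST
    have hle : S.1 ≤ T.1 := hST.le
    have hstr : IsStrictMono (S.1.ofLE T.1 hle) := by
      refine IsStrictMono.of_comp (g := T.1.arrow) ?_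
      rw [Subobject.ofLE_arrow]; exact S.2
    obtain ⟨B, g, k, hB, hT⟩ := hQ.exists_triangle _ hstr
    have hBz : ¬ IsZero B := fun hz => by
      have hi := (isIso_iff_hom _).2 ((isIso_of_isExt_left hT).1 hz)
      refine not_le_of_gt hST ?_
      exact Subobject.le_of_comm (inv (S.1.ofLE T.1 hle)) (by simp)
    have h1 := hadd _ _ _ ⟨_, _, _, hT⟩
    have h2 := hpos B hB hBz
    refine Nat.lt_of_succ_le ((Nat.le_floor_iff (div_nonneg (hnn _ (T.1 :
      𝒬.FullSubcategory).property) hκ.le)).2 ?_)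
    have h3 := Nat.floor_le (div_nonneg (hnn _ (S.1 : 𝒬.FullSubcategory).property) hκ.le)
    rw [Nat.succ_eq_add_one, Nat.cast_add, Nat.cast_one, h1, add_div]
    have : 1 ≤ ℓ B / κ := by rwa [le_div_iff₀ hκ, one_mul]
    exact add_le_add h3 this
  have hb : ∀ S, m S ≤ ⌊ℓ X.obj / κ⌋₊ := by
    intro S
    obtain ⟨B, g, k, hB, hT⟩ := hQ.exists_triangle _ S.2
    have h1 := hadd _ _ _ ⟨_, _, _, hT⟩
    refine Nat.floor_le_floor (div_le_div_of_nonneg_right ?_ hκ.le)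
    have := hnn B hB
    linarith
  refine ⟨hm.wellFoundedLT, ?_⟩
  have hm' : StrictAnti fun S => ⌊ℓ X.obj / κ⌋₊ - m S := fun S T hST => by
    have := hm hST
    have := hb T
    dsimp only
    omega
  exact hm'.wellFoundedGT

section Simple

variable [IsTriangulated C]

/-- An object that is not simple splits into two pieces whose `ℓ` is smaller by at least `κ`; a
simple subobject of the subobject and a simple quotient of the quotient work for the whole. -/
theorem HasStrictKernels.exists_simple (hQ : HasStrictKernels 𝒬) (ℓ : C → ℝ) {κ : ℝ}
    (hκ : 0 < κ) (hadd : ∀ A X B, IsExt A X B → ℓ X = ℓ A + ℓ B)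
    (hpos : ∀ X, 𝒬 X → ¬ IsZero X → κ ≤ ℓ X) {X : C} (hX : 𝒬 X) (hX0 : ¬ IsZero X) :
    (∃ S R, StrictSimpleIn 𝒬 S ∧ 𝒬 R ∧ IsExt S X R) ∧
      ∃ K S, StrictSimpleIn 𝒬 S ∧ 𝒬 K ∧ IsExt K X S := by
  obtain ⟨n, hn⟩ := exists_nat_gt (ℓ X / κ)
  rw [div_lt_iff₀ hκ] at hn
  induction n generalizing X with
  | zero =>
    have := hpos X hX hX0
    simp only [Nat.cast_zero, zero_mul] at hn
    linarith
  | succ n ih =>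
    by_cases hs : StrictSimpleIn 𝒬 X
    · exact ⟨⟨X, _, hs, hQ.zero (isZero_zero C), isExt_zero_right (isZero_zero C) X⟩,
        ⟨_, X, hs, hQ.zero (isZero_zero C), isExt_zero_left (isZero_zero C) X⟩⟩
    · rw [hQ.strictSimpleIn_iff] at hs
      push Not at hs
      obtain ⟨A, B, hA, hB, hE, hA0, hB0⟩ := hs hX hX0
      have h1 := hadd _ _ _ hE
      have h2 := hpos A hA hA0
      have h3 := hpos B hB hB0
      push_cast at hn
      obtain ⟨⟨S, R, hS, hR, hSR⟩, -⟩ := ih hA hA0 (by linarith)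
      obtain ⟨-, K, S', hS', hK', hK⟩ := ih hB hB0 (by linarith)
      obtain ⟨E, hE1, hE1'⟩ := hSR.comp_left hE
      obtain ⟨Y, hE2', hE2⟩ := hE.comp_right hK
      exact ⟨⟨S, E, hS, hQ.of_isExt hE1' hR hB, hE1⟩, Y, S', hS', hQ.of_isExt hE2' hA hK', hE2⟩

end Simple

/-! ### Intervals of a slicing of length at most one -/

namespace Slicing

variable [IsTriangulated C] {P : Slicing C}

/-- The condition that a set of phases is contained in an interval of length one. -/
def Short (I : Set ℝ) : Prop := I.OrdConnected ∧ ∀ x ∈ I, ∀ y ∈ I, x - 1 < y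

theorem short_Ioo {a b : ℝ} (h : b ≤ a + 1) : Short (Set.Ioo a b) :=
  ⟨Set.ordConnected_Ioo, fun x hx y hy => by linarith [hx.2, hy.1]⟩

theorem short_Ico (a : ℝ) : Short (Set.Ico a (a + 1)) :=
  ⟨Set.ordConnected_Ico, fun x hx y hy => by linarith [hx.2, hy.1]⟩

theorem short_Ioc (a : ℝ) : Short (Set.Ioc a (a + 1)) :=
  ⟨Set.ordConnected_Ioc, fun x hx y hy => by linarith [hx.2, hy.1]⟩

theorem short_singleton (a : ℝ) : Short ({a} : Set ℝ) :=
  ⟨Set.ordConnected_singleton, by rintro x rfl y rfl; linarith⟩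

/-- The truncation of the third vertex of a triangle on a morphism in `P(I)`. -/
theorem exists_truncation_cocone {I : Set ℝ} (hI : Short I) {F X W : C} (hX : P.cl I X)
    (hW : P.cl I W) (hF : IsExt F X W) : ∃ A D, IsExt A F D ∧ P.cl I A ∧
      P.cl {t | (∀ x ∈ I, t < x) ∧ ∃ x ∈ I, x ≤ t + 1} D := by
  have hW' : P.cl {t | t + 1 ∈ I} (W⟦(-1 : ℤ)⟧) :=
    cl_shift (-1) (fun t ht => by simpa using ht) hW
  -- The convex hull of `I` and `I - 1`, hence of the phases of `X` and of `W⟦-1⟧`.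
  let L : Set ℝ := {t | (∃ x ∈ I, t ≤ x) ∧ ∃ x ∈ I, x ≤ t + 1}
  have hL : L.OrdConnected := by
    refine ⟨fun a ha b hb t ht => ?_⟩
    obtain ⟨x, hx, hx'⟩ := ha.2
    obtain ⟨y, hy, hy'⟩ := hb.1
    exact ⟨⟨y, hy, ht.2.trans hy'⟩, x, hx, by linarith [ht.1]⟩
  have hFL : P.cl L F := by
    refine cl_isExt hF.invRotate (cl_mono (fun t ht => ?_) hW') (cl_mono (fun t ht => ?_) hX)
    · exact ⟨⟨_, ht, by linarith⟩, _, ht, le_rfl⟩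
    · exact ⟨⟨_, ht, le_rfl⟩, _, ht, by linarith⟩
  let U : Set ℝ := {t | ∃ x ∈ I, x ≤ t}
  have hU : IsUpperSet U := fun a b hab ⟨x, hx, hx'⟩ => ⟨x, hx, hx'.trans hab⟩
  obtain ⟨A, D, hE, hA, hD⟩ := exists_truncation hL hU hFL
  refine ⟨A, D, hE, cl_mono ?_ hA, cl_mono ?_ hD⟩
  · rintro t ⟨⟨⟨x, hx, hx'⟩, -⟩, y, hy, hy'⟩
    exact hI.1.out hy hx ⟨hy', hx'⟩
  · rintro t ⟨⟨-, h⟩, h'⟩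
    refine ⟨fun x hx => ?_, h⟩
    by_contra hc
    exact h' ⟨x, hx, not_lt.1 hc⟩

theorem cl_hom_shift_eq_zero {I : Set ℝ} (hI : Short I) {A B : C} (hA : P.cl I A)
    (hB : P.cl I B) (f : A ⟶ B⟦(-1 : ℤ)⟧) : f = 0 := by
  have hB' : P.cl {t | t + 1 ∈ I} (B⟦(-1 : ℤ)⟧) :=
    cl_shift (-1) (fun t ht => by simpa using ht) hB
  refine cl_hom_eq_zero (fun a ha b hb => ?_) hA hB' f
  have := hI.2 _ hb _ ha
  linarith

/-- The kernel of `g` is the truncation `A` to `I` of the fibre `F`: the remainder `D` has phases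
below `I`, so it receives no maps from `P(I)`. The cone `B` of `A ⟶ X` has phases bounded below by
`I`, as an extension of `A⟦1⟧` by `X`, and bounded above by `I`, as an extension of `W` by `D`. -/
theorem hasStrictKernels {I : Set ℝ} (hI : Short I) : HasStrictKernels (P.cl I) where
  zero h := .zero h
  of_isExt := cl_isExt
  hom_eq_zero := cl_hom_shift_eq_zero hI
  exists_kernel := by
    intro X W hX hW g
    obtain ⟨F, i, w, hT⟩ := distinguished_cocone_triangle₁ g
    obtain ⟨A, D, ⟨a, d, d', hE⟩, hA, hD⟩ := exists_truncation_cocone hI hX hW ⟨_, _, _, hT⟩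
    obtain ⟨B, k, l, hB⟩ := distinguished_cocone_triangle (a ≫ i)
    have hDB : IsExt D B W := ⟨_, _, _, (Triangulated.someOctahedron rfl hE hT hB).mem⟩
    have hBU : P.cl {t | ∃ x ∈ I, x ≤ t} B := by
      have h1 : I ⊆ {t | ∃ x ∈ I, x ≤ t} := fun t ht => ⟨t, ht, le_rfl⟩
      have h2 : ∀ t ∈ I, t + (1 : ℤ) ∈ {t : ℝ | ∃ x ∈ I, x ≤ t} :=
        fun t ht => ⟨t, ht, by push_cast; linarith⟩
      exact cl_isExt (IsExt.rotate ⟨_, _, _, hB⟩) (cl_mono h1 hX) (cl_shift 1 h2 hA)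
    have hBL : P.cl {t | ∃ x ∈ I, t ≤ x} B := by
      have h1 : I ⊆ {t | ∃ x ∈ I, t ≤ x} := fun t ht => ⟨t, ht, le_rfl⟩
      refine cl_isExt hDB (cl_mono (fun t ht => ?_) hD) (cl_mono h1 hW)
      obtain ⟨x, hx, -⟩ := ht.2
      exact ⟨x, hx, (ht.1 x hx).le⟩
    have hBI : P.cl I B := by
      by_cases hz : IsZero B
      · exact .zero hz
      have hU : {t : ℝ | ∃ x ∈ I, x ≤ t}.OrdConnected :=
        IsUpperSet.ordConnected fun a b hab ⟨x, hx, hx'⟩ => ⟨x, hx, hx'.trans hab⟩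
      have hL : {t : ℝ | ∃ x ∈ I, t ≤ x}.OrdConnected :=
        IsLowerSet.ordConnected fun a b hab ⟨x, hx, hx'⟩ => ⟨x, hx, hab.trans hx'⟩
      obtain ⟨⟨x, hx, hx'⟩, y, hy, hy'⟩ := (cl_iff hz hU).1 hBU
      obtain ⟨⟨z, hz1, hz'⟩, w, hw, hw'⟩ := (cl_iff hz hL).1 hBL
      exact (cl_iff hz hI.1).2 ⟨hI.1.out hx hz1 ⟨hx', hz'⟩, hI.1.out hy hw ⟨hy', hw'⟩⟩
    have hig : i ≫ g = 0 := comp_distTriang_mor_zero₁₂ _ hT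
    refine ⟨A, B, a ≫ i, k, l, hA, hBI, hB, by rw [Category.assoc, hig, comp_zero], ?_⟩
    intro T hTI t ht
    obtain ⟨s, hs⟩ := exists_lift_of_comp_eq_zero hT t ht
    obtain ⟨r, hr⟩ := exists_lift_of_comp_eq_zero hE s
      (cl_hom_eq_zero (fun x hx y hy => hy.1 x hx) hTI hD _)
    exact ⟨r, by rw [hs, hr, Category.assoc]⟩

/-- The top Harder–Narasimhan factor is a non-zero strict subobject, so it is the whole object. -/
theorem exists_semistable_of_strictSimpleIn {I : Set ℝ} (hI : Short I) {X : C}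
    (h : StrictSimpleIn (P.cl I) X) : ∃ t ∈ I, P.P t X := by
  obtain ⟨hX, h0, h⟩ := (hasStrictKernels hI).strictSimpleIn_iff.1 h
  have hI' := (cl_iff h0 hI.1).1 hX
  obtain ⟨A, B, hE, hA, hA0, hB⟩ := exists_top_factor (P := P) h0
  rcases h A B (cl_single hI'.2 hA)
    (cl_mono (fun t ht => hI.1.out hI'.1 hI'.2 ⟨ht.1, ht.2.le⟩) hB) hE with h1 | h1
  · exact absurd h1 hA0
  · obtain ⟨e⟩ := hE.iso_left h1
    have := P.iso_closed
    exact ⟨_, hI'.2, (P.P _).prop_of_iso e hA⟩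

/-- The hypothesis `hI'` holds for half-open unit intervals, where every monomorphism is strict: the
truncation of its fibre to `I` vanishes, so the fibre has phases just below `I` and its shift, the
cone, lies in `P(I)`. -/
theorem simple_of_strictSimpleIn {I : Set ℝ} (hI : Short I)
    (hI' : ∀ t, (∀ x ∈ I, t < x) → (∃ x ∈ I, x ≤ t + 1) → t + 1 ∈ I) {X : C}
    (h : StrictSimpleIn (P.cl I) X) :
    ∃ h : P.cl I X, Simple (⟨X, h⟩ : (P.cl I).FullSubcategory) := by
  obtain ⟨hX, h0, h⟩ := h
  refine ⟨hX, ⟨fun {Y} f hf => ⟨fun hi h' => h0 ?_, fun hne => ?_⟩⟩⟩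
  · subst h'
    rw [IsZero.iff_id_eq_zero, ← IsIso.inv_hom_id (0 : Y ⟶ (⟨X, hX⟩ : (P.cl I).FullSubcategory)),
      comp_zero]
  · obtain ⟨F, i, w, hT⟩ := distinguished_cocone_triangle₁ f.hom
    obtain ⟨A, D, ⟨a, d, d', hE⟩, hA, hD⟩ :=
      exists_truncation_cocone hI Y.property hX ⟨_, _, _, hT⟩
    have hai : a ≫ i = 0 := by
      let u : (⟨A, hA⟩ : (P.cl I).FullSubcategory) ⟶ Y := ObjectProperty.homMk (a ≫ i)
      have : u = 0 := by
        rw [← cancel_mono f, zero_comp]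
        refine ObjectProperty.hom_ext _ ?_
        change (a ≫ i) ≫ f.hom = 0
        rw [Category.assoc, show i ≫ f.hom = 0 from comp_distTriang_mor_zero₁₂ _ hT, comp_zero]
      exact congrArg (fun f => f.hom) this
    have ha : a = 0 := by
      obtain ⟨m, l, hl⟩ := exists_lift_shift_of_comp_eq_zero hT a hai
      rw [hl, cl_hom_shift_eq_zero hI hA hX l, zero_comp]
    have hAz : IsZero A := by
      rw [IsZero.iff_id_eq_zero]
      obtain ⟨m, l, hl⟩ := exists_lift_shift_of_comp_eq_zero hE (𝟙 A) (by rw [ha, comp_zero])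
      have hD' : P.cl {t | ∀ x ∈ I, t < x} (D⟦(-1 : ℤ)⟧) :=
        cl_shift (I := {t | (∀ x ∈ I, t < x) ∧ ∃ x ∈ I, x ≤ t + 1}) (J := {t | ∀ x ∈ I, t < x}) (-1)
          (fun t ht x hx => by have := ht.1 x hx; push_cast; linarith) hD
      rw [hl, cl_hom_eq_zero (J := {t | ∀ x ∈ I, t < x}) (fun x hx y hy => hy x hx) hA hD' l, zero_comp]
    obtain ⟨e⟩ := IsExt.iso_right ⟨_, _, _, hE⟩ hAz
    have hF : P.cl I (F⟦(1 : ℤ)⟧) :=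
      cl_shift 1 (fun t ht => by simpa using hI' t ht.1 ht.2) (ExtCl.of_iso hD e.symm)
    have hstr : IsStrictMono f := (hasStrictKernels hI).isStrictMono
      (rot_of_distTriang _ hT) Y.property hX hF
    refine (h _ f hstr).resolve_left fun hz => hne (hz.eq_of_src _ _)

theorem strictSimpleIn_of_simple {𝒬 : ObjectProperty C} {X : C}
    (h : ∃ h : 𝒬 X, Simple (⟨X, h⟩ : 𝒬.FullSubcategory)) : StrictSimpleIn 𝒬 X := by
  obtain ⟨hX, hs⟩ := h
  refine ⟨hX, Simple.not_isZero _, fun Y f ⟨hf⟩ => ?_⟩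
  have : Mono f := mono_of_isLimit_fork hf.isLimit
  by_cases h0 : f = 0
  · left
    rw [IsZero.iff_id_eq_zero, ← cancel_mono f, h0, comp_zero, comp_zero]
  · exact .inr (isIso_of_mono_of_nonzero h0)

theorem isSimpleIn_iff {I : Set ℝ} (hI : Short I)
    (hI' : ∀ t, (∀ x ∈ I, t < x) → (∃ x ∈ I, x ≤ t + 1) → t + 1 ∈ I) {X : C} :
    P.IsSimpleIn I X ↔ StrictSimpleIn (P.cl I) X := by
  unfold IsSimpleIn
  rw [interval_eq_cl hI.1]
  exact ⟨strictSimpleIn_of_simple, simple_of_strictSimpleIn hI hI'⟩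

theorem isSimpleIn_Ico_iff {a : ℝ} {X : C} :
    P.IsSimpleIn (Set.Ico a (a + 1)) X ↔ StrictSimpleIn (P.cl (Set.Ico a (a + 1))) X :=
  isSimpleIn_iff (short_Ico a) fun t h1 ⟨x, hx, hx'⟩ =>
    ⟨hx.1.trans hx', by linarith [h1 a ⟨le_rfl, by linarith⟩]⟩

theorem isSimpleIn_Ioc_iff {a : ℝ} {X : C} :
    P.IsSimpleIn (Set.Ioc a (a + 1)) X ↔ StrictSimpleIn (P.cl (Set.Ioc a (a + 1))) X := by
  refine isSimpleIn_iff (short_Ioc a) fun t h1 ⟨x, hx, hx'⟩ => ⟨hx.1.trans_le hx', ?_⟩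
  by_contra hc
  have h2 : a < t := by linarith
  rcases le_or_gt t (a + 1) with h3 | h3
  · exact lt_irrefl _ (h1 t ⟨h2, h3⟩)
  · linarith [h1 (a + 1) ⟨by linarith, le_rfl⟩]

theorem isStable_iff {φ : ℝ} {X : C} : P.IsStable φ X ↔ StrictSimpleIn (P.P φ) X := Iff.rfl

/-! ### Jordan–Hölder filtrations -/

/-- The chain conditions applied to a class `p` of strict subobjects, phrased through morphisms of
`C` so that `p` may ask for more than membership of `𝒬`. -/
theorem exists_extremal {𝒬 : ObjectProperty C} (hQ : HasStrictKernels 𝒬)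
    (hlen : IsLengthCategory 𝒬.FullSubcategory) {X : C} (hX : 𝒬 X)
    (p : ∀ A : C, (A ⟶ X) → Prop) (hp : ∀ A f, p A f → 𝒬 A ∧ ∃ (B : C) (g : X ⟶ B)
      (h : B ⟶ A⟦(1 : ℤ)⟧), 𝒬 B ∧ Triangle.mk f g h ∈ distTriang C) (hne : ∃ A f, p A f) :
    (∃ A f, p A f ∧ ∀ A' f', p A' f' → ∀ u : A' ⟶ A, u ≫ f = f' → IsIso u) ∧
    ∃ A f, p A f ∧ ∀ A' f', p A' f' → ∀ u : A ⟶ A', u ≫ f' = f → IsIso u := by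
  let X' : 𝒬.FullSubcategory := ⟨X, hX⟩
  have hm : ∀ A (f : A ⟶ X) (h : p A f),
      Mono (ObjectProperty.homMk f : (⟨A, (hp A f h).1⟩ : 𝒬.FullSubcategory) ⟶ X') := by
    intro A f h
    obtain ⟨hA, B, g, k, hB, hT⟩ := hp A f h
    obtain ⟨hn⟩ := hQ.isStrictMono hT hA hX hB
    exact mono_of_isLimit_fork hn.isLimit
  let S : ∀ A (f : A ⟶ X), p A f → {S : Subobject X' // IsStrictMono S.arrow} := fun A f h =>
    haveI := hm A f h
    ⟨Subobject.mk (ObjectProperty.homMk f : (⟨A, (hp A f h).1⟩ : 𝒬.FullSubcategory) ⟶ X'), by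
      obtain ⟨hA, B, g, k, hB, hT⟩ := hp A f h
      have h1 := (hQ.isStrictMono hT hA hX hB).iso_comp (Subobject.underlyingIso
        (ObjectProperty.homMk f : (⟨A, hA⟩ : 𝒬.FullSubcategory) ⟶ X'))
      rwa [Subobject.underlyingIso_hom_comp_eq_mk] at h1⟩
  have hiso : ∀ A f (h : p A f) A' f' (h' : p A' f') (u : A' ⟶ A), u ≫ f = f' →
      S A' f' h' ≤ S A f h ∧ (S A f h ≤ S A' f' h' → IsIso u) := by
    intro A f h A' f' h' u hu
    have := hm A f h
    have := hm A' f' h'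
    let u' : (⟨A', (hp A' f' h').1⟩ : 𝒬.FullSubcategory) ⟶ ⟨A, (hp A f h).1⟩ :=
      ObjectProperty.homMk u
    have hu' : u' ≫ (ObjectProperty.homMk f : (⟨A, (hp A f h).1⟩ : 𝒬.FullSubcategory) ⟶ X') =
      ObjectProperty.homMk f' := ObjectProperty.hom_ext _ hu
    refine ⟨Subobject.mk_le_mk_of_comm u' hu', fun hle => ?_⟩
    let v := Subobject.ofMkLEMk _ _ hle
    have hv := Subobject.ofMkLEMk_comp hle
    have : IsIso u' := by
      refine ⟨v, ?_, ?_⟩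
      · rw [← cancel_mono (ObjectProperty.homMk f' : (⟨A', (hp A' f' h').1⟩ :
          𝒬.FullSubcategory) ⟶ X'), Category.assoc, Category.id_comp]
        exact (congrArg (u' ≫ ·) hv).trans hu'
      · rw [← cancel_mono (ObjectProperty.homMk f : (⟨A, (hp A f h).1⟩ :
          𝒬.FullSubcategory) ⟶ X'), Category.assoc, Category.id_comp]
        exact (congrArg (v ≫ ·) hu').trans hv
    exact (isIso_iff_hom u').1 this
  let R : Set {S : Subobject X' // IsStrictMono S.arrow} := {T | ∃ A f h, T = S A f h}
  have hR : R.Nonempty := by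
    obtain ⟨A, f, h⟩ := hne
    exact ⟨_, A, f, h, rfl⟩
  constructor
  · obtain ⟨_, ⟨A, f, h, rfl⟩, hmin⟩ := (hlen X').1.wf.has_min R hR
    refine ⟨A, f, h, fun A' f' h' u hu => (hiso A f h A' f' h' u hu).2 ?_⟩
    have h1 := hmin _ ⟨A', f', h', rfl⟩
    have h2 := (hiso A f h A' f' h' u hu).1
    by_contra hc
    exact h1 (lt_of_le_not_ge h2 hc)
  · obtain ⟨_, ⟨A, f, h, rfl⟩, hmax⟩ := (hlen X').2.wf.has_min R hR
    refine ⟨A, f, h, fun A' f' h' u hu => (hiso A' f' h' A f h u hu).2 ?_⟩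
    have h1 := hmax _ ⟨A', f', h', rfl⟩
    have h2 := (hiso A' f' h' A f h u hu).1
    by_contra hc
    exact h1 (lt_of_le_not_ge h2 hc)

/-- Local finiteness concerns `P(φ - ε, φ + ε)` rather than `P φ`. The chain conditions are
therefore applied in the larger category, to those strict subobjects which lie in `P φ` together
with their quotients. -/
theorem extCl_isStable (hP : P.LocallyFinite) {φ : ℝ} {X : C} (hX : P.P φ X) :
    ExtCl (P.IsStable φ) X := by
  obtain ⟨ε, hε, hε', hlen⟩ := hP
  have hsh : Short (Set.Ioo (φ - ε) (φ + ε)) := short_Ioo (by linarith)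
  have hQ := hasStrictKernels (P := P) hsh
  have hlen := hlen φ
  rw [interval_eq_cl hsh.1] at hlen
  have hsub : ∀ {Y}, P.P φ Y → P.cl (Set.Ioo (φ - ε) (φ + ε)) Y := fun hY =>
    cl_single (I := Set.Ioo (φ - ε) (φ + ε)) ⟨by linarith, by linarith⟩ hY
  have hext : ∀ {A Y B}, IsExt A Y B → P.P φ A → P.P φ B → P.P φ Y := fun h hA hB => by
    rw [← cl_singleton] at *
    exact cl_isExt h hA hB
  have hstable : ∀ {Y}, P.IsStable φ Y ↔ P.P φ Y ∧ ¬ IsZero Y ∧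
      ∀ A B, P.P φ A → P.P φ B → IsExt A Y B → IsZero A ∨ IsZero B := fun {Y} => by
    have := (hasStrictKernels (P := P) (short_singleton φ)).strictSimpleIn_iff (X := Y)
    rwa [cl_singleton] at this
  have step : ∀ {Y}, P.P φ Y → ¬ IsZero Y → ∃ S R, P.IsStable φ S ∧ P.P φ R ∧ IsExt S Y R := by
    intro Y hY hY0
    -- A minimal non-zero subobject of this kind is stable.
    obtain ⟨⟨A, f, ⟨hA, hA0, R, g, k, hR, hT⟩, hmin⟩, -⟩ := exists_extremal hQ hlen (hsub hY)
      (fun A f => P.P φ A ∧ ¬ IsZero A ∧ ∃ (B : C) (g : Y ⟶ B) (h : B ⟶ A⟦(1 : ℤ)⟧), P.P φ B ∧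
        Triangle.mk f g h ∈ distTriang C)
      (fun A f ⟨hA, _, B, g, h, hB, hT⟩ => ⟨hsub hA, B, g, h, hsub hB, hT⟩)
      ⟨Y, 𝟙 Y, hY, hY0, _, _, _, P.zero_mem _ _ (isZero_zero C), contractible_distinguished Y⟩
    refine ⟨A, R, hstable.2 ⟨hA, hA0, fun B D hB hD ⟨b, d, d', hbd⟩ => ?_⟩, hR, ⟨_, _, _, hT⟩⟩
    by_contra! hc
    obtain ⟨E, e, e', hE⟩ := distinguished_cocone_triangle (b ≫ f)
    have hDE : IsExt D E R := ⟨_, _, _, (Triangulated.someOctahedron rfl hbd hT hE).mem⟩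
    exact hc.2 ((isIso_of_isExt_left hbd).2
      (hmin B (b ≫ f) ⟨hB, hc.1, E, e, e', hext hDE hD hR, hE⟩ b rfl))
  have hz : IsExt (0 : C) X X := isExt_zero_left (isZero_zero C) X
  obtain ⟨z, z', z'', hz⟩ := hz
  -- A maximal subobject among those built from stable ones is everything: otherwise the preimage of
  -- a stable subobject of the quotient would be larger.
  obtain ⟨-, A, f, ⟨hA, hA', R, g, k, hR, hT⟩, hmax⟩ := exists_extremal hQ hlen (hsub hX)
    (fun A f => P.P φ A ∧ ExtCl (P.IsStable φ) A ∧ ∃ (B : C) (g : X ⟶ B)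
      (h : B ⟶ A⟦(1 : ℤ)⟧), P.P φ B ∧ Triangle.mk f g h ∈ distTriang C)
    (fun A f ⟨hA, _, B, g, h, hB, hT⟩ => ⟨hsub hA, B, g, h, hsub hB, hT⟩)
    ⟨0, z, P.zero_mem _ _ (isZero_zero C), .zero (isZero_zero C), X, z', z'', hX, hz⟩
  by_cases hR0 : IsZero R
  · obtain ⟨e⟩ := IsExt.iso_left ⟨_, _, _, hT⟩ hR0
    exact hA'.of_iso e
  · exfalso
    obtain ⟨S, R', hS, hR', ⟨s, r, r', hSR⟩⟩ := step hR hR0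
    obtain ⟨Y, y, y', hY⟩ := distinguished_cocone_triangle₁ (g ≫ r)
    have oct := Triangulated.someOctahedron' rfl hT hSR hY
    have hAYS : Triangle.mk oct.m₁ oct.m₃ _ ∈ distTriang C := oct.mem
    have hcomm : oct.m₁ ≫ y = f := oct.comm₁
    have hS' := hstable.1 hS
    have := hmax Y y ⟨hext ⟨_, _, _, hAYS⟩ hA hS'.1,
      ExtCl.of_isExt ⟨_, _, _, hAYS⟩ hA' (.single hS), R', _, _, hR', hY⟩ oct.m₁ hcomm
    exact hS'.2.1 ((isIso_of_isExt_left hAYS).2 this)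

end Slicing

end

end LaxStability

end

noncomputable section

open scoped ZeroObject

set_option linter.unusedSectionVars false

namespace LaxStability

/-! ### Rays -/

/-- The unit vector of phase `t`. -/
def ray (t : ℝ) : ℂ := Complex.exp (Complex.I * Real.pi * t)

theorem ray_eq (t : ℝ) : ray t = Complex.exp (Complex.I * Real.pi * t) := rfl

theorem ray_eq' (t : ℝ) : ray t = Complex.exp ((Real.pi * t : ℝ) * Complex.I) := by
  rw [ray]; push_cast; ring_nf

theorem norm_ray (t : ℝ) : ‖ray t‖ = 1 := by
  rw [ray_eq', Complex.norm_exp_ofReal_mul_I]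

theorem ray_ne_zero (t : ℝ) : ray t ≠ 0 := Complex.exp_ne_zero _

theorem ray_add (s t : ℝ) : ray (s + t) = ray s * ray t := by
  rw [ray, ray, ray, ← Complex.exp_add]; push_cast; ring_nf

theorem ray_zero : ray 0 = 1 := by simp [ray]

theorem ray_neg (t : ℝ) : ray (-t) = (ray t)⁻¹ := by
  rw [ray, ray, ← Complex.exp_neg]; push_cast; ring_nf

theorem ray_sub (s t : ℝ) : ray (s - t) = ray s * (ray t)⁻¹ := by
  rw [sub_eq_add_neg, ray_add, ray_neg]

theorem ray_re (t : ℝ) : (ray t).re = Real.cos (Real.pi * t) := by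
  rw [ray_eq', Complex.exp_ofReal_mul_I_re]

theorem ray_im (t : ℝ) : (ray t).im = Real.sin (Real.pi * t) := by
  rw [ray_eq', Complex.exp_ofReal_mul_I_im]

theorem conj_ray (t : ℝ) : (starRingEnd ℂ) (ray t) = (ray t)⁻¹ := by
  rw [← ray_neg]
  apply Complex.ext
  · rw [Complex.conj_re, ray_re, ray_re, mul_neg, Real.cos_neg]
  · rw [Complex.conj_im, ray_im, ray_im, mul_neg, Real.sin_neg]

theorem ray_one : ray 1 = -1 := by
  apply Complex.ext
  · rw [ray_re]; simp
  · rw [ray_im]; simp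

theorem ray_eq_ray_iff {s t : ℝ} : ray s = ray t ↔ ∃ n : ℤ, s = t + 2 * n := by
  rw [ray, ray, Complex.exp_eq_exp_iff_exists_int]
  refine exists_congr fun n => ?_
  have hne : Complex.I * (Real.pi : ℂ) ≠ 0 :=
    mul_ne_zero Complex.I_ne_zero (by exact_mod_cast Real.pi_ne_zero)
  constructor
  · intro h
    have : Complex.I * (Real.pi : ℂ) * s = Complex.I * Real.pi * ((t + 2 * n : ℝ) : ℂ) := by
      rw [h]; push_cast; ring
    exact_mod_cast mul_left_cancel₀ hne this
  · rintro rfl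
    push_cast; ring

theorem continuous_ray : Continuous ray := by
  unfold ray; fun_prop

theorem ray_arg_mul_norm (z : ℂ) : (‖z‖ : ℂ) * ray (Complex.arg z / Real.pi) = z := by
  rw [ray_eq', mul_div_cancel₀ _ Real.pi_ne_zero, Complex.norm_mul_exp_arg_mul_I]

/-! ### Classes of objects -/

section

variable {C : Type u₁} [Category.{u₂} C] [Preadditive C] [HasZeroObject C] [HasShift C ℤ]
  [∀ n : ℤ, (shiftFunctor C n).Additive] [Pretriangulated C]
  {V : Type u₃} [NormedAddCommGroup V] [InnerProductSpace ℝ V] {L : Submodule ℤ V}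
  (v : K0 C →+ L)

theorem cls_isExt {A X B : C} (h : IsExt A X B) : cls v X = cls v A + cls v B := by
  obtain ⟨f, g, k, hT⟩ := h
  have : K0.mk X = K0.mk A + K0.mk B := by
    refine (QuotientAddGroup.eq_iff_sub_mem).2 (AddSubgroup.subset_closure ?_)
    exact ⟨_, hT, rfl⟩
  rw [cls, this, map_add]; rfl

theorem cls_isZero {X : C} (h : IsZero X) : cls v X = 0 := by
  have := cls_isExt v (isExt_zero_right h X)
  simpa using this

theorem cls_iso {X Y : C} (e : X ≅ Y) : cls v X = cls v Y := by
  have h := cls_isExt v (isExt_of_iso_left e (isZero_zero C))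
  rw [cls_isZero v (isZero_zero C), add_zero] at h
  exact h.symm

/-- The right side is additive and the left side subadditive, so the inequality passes from the
factors to their extensions. All mass estimates use a linear functional in this way. -/
theorem norm_cls_le_of_extCl {𝒮 : ObjectProperty C} {c : ℝ} (hc : 0 ≤ c) (ℓ : V →ₗ[ℝ] ℝ)
    (h : ∀ S, 𝒮 S → c * ‖cls v S‖ ≤ ℓ (cls v S)) {X : C} (hX : ExtCl 𝒮 X) :
    c * ‖cls v X‖ ≤ ℓ (cls v X) := by
  induction hX with
  | zero hz => simp [cls_isZero v hz]
  | ext hE _ hS ih =>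
    rw [cls_isExt v hE, map_add]
    calc c * ‖_ + _‖ ≤ c * (‖_‖ + ‖_‖) := mul_le_mul_of_nonneg_left (norm_add_le _ _) hc
      _ ≤ _ := by rw [mul_add]; exact add_le_add ih (h _ hS)

theorem map_cls_nonneg_of_extCl {𝒮 : ObjectProperty C} (ℓ : V →ₗ[ℝ] ℝ)
    (h : ∀ S, 𝒮 S → 0 ≤ ℓ (cls v S)) {X : C} (hX : ExtCl 𝒮 X) : 0 ≤ ℓ (cls v X) := by
  simpa using norm_cls_le_of_extCl v le_rfl ℓ (by simpa using h) hX

theorem map_cls_eq_zero_of_extCl {W : Type*} [AddCommGroup W] [Module ℝ W]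
    {𝒮 : ObjectProperty C} (ℓ : V →ₗ[ℝ] W) (h : ∀ S, 𝒮 S → ℓ (cls v S) = 0) {X : C}
    (hX : ExtCl 𝒮 X) : ℓ (cls v X) = 0 := by
  induction hX with
  | zero hz => simp [cls_isZero v hz]
  | ext hE _ hS ih => rw [cls_isExt v hE, map_add, ih, h _ hS, add_zero]

theorem le_map_cls_of_extCl {𝒮 : ObjectProperty C} {κ : ℝ} (hκ : 0 ≤ κ) (ℓ : V →ₗ[ℝ] ℝ)
    (h : ∀ S, 𝒮 S → ¬ IsZero S → κ ≤ ℓ (cls v S)) {X : C} (hX : ExtCl 𝒮 X)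
    (hX0 : ¬ IsZero X) : κ ≤ ℓ (cls v X) := by
  have h0 : ∀ S, 𝒮 S → 0 ≤ ℓ (cls v S) := fun S hS => by
    by_cases hz : IsZero S
    · simp [cls_isZero v hz]
    · exact hκ.trans (h S hS hz)
  induction hX with
  | zero hz => exact absurd hz hX0
  | @ext A Y S hE hA hS ih =>
    rw [cls_isExt v hE, map_add]
    by_cases hz : IsZero S
    · have hA0 : ¬ IsZero A := fun h' => hX0 (hE.isZero₂ h' hz)
      linarith [ih hA0, h0 S hS]
    · linarith [map_cls_nonneg_of_extCl v ℓ h0 hA, h S hS hz]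

/-- The linear functional `Re (e^{-iπx} ·)`. -/
def rayFunctional (x : ℝ) : ℂ →ₗ[ℝ] ℝ :=
  Complex.reLm.comp (LinearMap.mulLeft ℝ (ray (-x)))

theorem rayFunctional_apply (x : ℝ) (z : ℂ) : rayFunctional x z = (ray (-x) * z).re := rfl

theorem rayFunctional_smul_ray (x t r : ℝ) :
    rayFunctional x (r * ray t) = r * Real.cos (Real.pi * (t - x)) := by
  rw [rayFunctional_apply, mul_left_comm, ← ray_add, Complex.re_ofReal_mul, ray_re]
  ring_nf

theorem rayFunctional_le_norm (x : ℝ) (z : ℂ) : rayFunctional x z ≤ ‖z‖ := by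
  rw [rayFunctional_apply]
  refine (Complex.re_le_norm _).trans ?_
  rw [norm_mul, norm_ray, one_mul]

theorem exists_norm_lower_bound [DiscreteTopology L] :
    ∃ κ : ℝ, 0 < κ ∧ ∀ x : L, x ≠ 0 → κ ≤ ‖(x : V)‖ := by
  obtain ⟨κ, hκ, h⟩ := Metric.isOpen_iff.1 (isOpen_discrete ({0} : Set L)) 0 rfl
  refine ⟨κ, hκ, fun x hx => ?_⟩
  by_contra hc
  exact hx (h (by simpa [dist_eq_norm] using hc))

end

/-! ### Stability conditions and push-forwards -/

section

variable {C : Type u₁} [Category.{u₂} C] [Preadditive C] [HasZeroObject C] [HasShift C ℤ]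
  [∀ n : ℤ, (shiftFunctor C n).Additive] [Pretriangulated C] [IsTriangulated C]
  {V : Type u₃} [NormedAddCommGroup V] [InnerProductSpace ℝ V] {L : Submodule ℤ V}
  {v : K0 C →+ L}

/-- A slicing with a charge which is a stability condition, but for local finiteness; the
constants are those of the support property and of a lower bound for the mass. -/
structure IsSupported (v : K0 C →+ L) (P : Slicing C) (Z : V →L[ℝ] ℂ) (k κ : ℝ) : Prop where
  k_pos : 0 < k
  κ_pos : 0 < κ
  charge_eq : ∀ φ X, P.P φ X → Z (cls v X) = ‖Z (cls v X)‖ * ray φ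
  norm_le : ∀ φ X, P.P φ X → k * ‖cls v X‖ ≤ ‖Z (cls v X)‖
  le_norm : ∀ φ X, P.P φ X → ¬ IsZero X → κ ≤ ‖Z (cls v X)‖

theorem norm_ofReal_mul_ray {m : ℝ} (hm : 0 ≤ m) (φ : ℝ) : ‖(m : ℂ) * ray φ‖ = m := by
  rw [norm_mul, norm_ray, mul_one, Complex.norm_real, Real.norm_of_nonneg hm]

/-- The lower bound `κ` for masses comes from discreteness of the lattice: a non-zero semistable
object has non-zero charge, hence a non-zero class. -/
theorem IsStabilityCondition.isSupported [DiscreteTopology L] {τ : StabData C V}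
    (h : IsStabilityCondition v τ) : ∃ k κ, IsSupported v τ.slicing τ.charge k κ := by
  obtain ⟨h1, K, hK, h2⟩ := h
  obtain ⟨κ, hκ, hL⟩ := exists_norm_lower_bound (L := L)
  refine ⟨1 / K, 1 / K * κ, by positivity, by positivity, fun φ X hX => ?_, h2,
    fun φ X hX hX0 => ?_⟩
  · by_cases hX0 : IsZero X
    · simp [cls_isZero v hX0]
    · obtain ⟨m, hm, hm'⟩ := h1 φ X hX hX0
      rw [← ray_eq] at hm'
      rw [hm', norm_ofReal_mul_ray hm.le]
  · refine le_trans (mul_le_mul_of_nonneg_left (hL _ ?_) (by positivity)) (h2 φ X hX)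
    intro h0
    obtain ⟨m, hm, hm'⟩ := h1 φ X hX hX0
    have : cls v X = 0 := by rw [cls, h0]; rfl
    rw [this, map_zero, eq_comm, mul_eq_zero] at hm'
    rcases hm' with h | h
    · exact hm.ne' (by exact_mod_cast h)
    · exact Complex.exp_ne_zero _ h

namespace IsSupported

variable {P : Slicing C} {Z : V →L[ℝ] ℂ} {k κ : ℝ} (hP : IsSupported v P Z k κ)

include hP

theorem norm_cls_le {I : Set ℝ} {c : ℝ} (hc : 0 ≤ c) (ℓ : ℂ →ₗ[ℝ] ℝ)
    (h : ∀ t ∈ I, t ∈ P.phases → c ≤ ℓ (ray t)) {X : C} (hX : P.cl I X) :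
    c * k * ‖cls v X‖ ≤ ℓ (Z (cls v X)) := by
  refine norm_cls_le_of_extCl v (mul_nonneg hc hP.k_pos.le) (ℓ.comp (Z : V →ₗ[ℝ] ℂ))
    ?_ (Slicing.cl_inter_phases hX)
  rintro S ⟨t, ht, hS⟩
  change _ ≤ ℓ (Z (cls v S))
  rw [hP.charge_eq t S hS, ← Complex.real_smul, map_smul, smul_eq_mul, mul_assoc]
  have h1 := hP.norm_le t S hS
  have h2 := h t ht.1 ht.2
  calc c * (k * ‖cls v S‖) ≤ c * ‖Z (cls v S)‖ := mul_le_mul_of_nonneg_left h1 hc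
    _ ≤ ‖Z (cls v S)‖ * ℓ (ray t) := by
      rw [mul_comm]; exact mul_le_mul_of_nonneg_left h2 (norm_nonneg _)

theorem le_map {I : Set ℝ} {c : ℝ} (hc : 0 ≤ c) (ℓ : ℂ →ₗ[ℝ] ℝ)
    (h : ∀ t ∈ I, t ∈ P.phases → c ≤ ℓ (ray t)) {X : C} (hX : P.cl I X) (hX0 : ¬ IsZero X) :
    c * κ ≤ ℓ (Z (cls v X)) := by
  refine le_map_cls_of_extCl v (mul_nonneg hc hP.κ_pos.le) (ℓ.comp (Z : V →ₗ[ℝ] ℂ))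
    ?_ (Slicing.cl_inter_phases hX) hX0
  rintro S ⟨t, ht, hS⟩ hS0
  change _ ≤ ℓ (Z (cls v S))
  rw [hP.charge_eq t S hS, ← Complex.real_smul, map_smul, smul_eq_mul]
  have h1 := hP.le_norm t S hS hS0
  have h2 := h t ht.1 ht.2
  calc c * κ ≤ c * ‖Z (cls v S)‖ := mul_le_mul_of_nonneg_left h1 hc
    _ ≤ ‖Z (cls v S)‖ * ℓ (ray t) := by
      rw [mul_comm]; exact mul_le_mul_of_nonneg_left h2 (norm_nonneg _)

/-- The functional `ℓ ∘ Z` serves as a length function on the objects whose pushed-forward phases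
lie near `x`. It must be positive on the original rays, not on their images, so it survives a
degeneration of the charge. -/
theorem locallyFinite_map (h : CircleDeg1Lift) {η c : ℝ} (hη : 0 < η) (hη' : η < 1 / 2)
    (hc : 0 < c) (H : ∀ x : ℝ, ∃ ℓ : ℂ →ₗ[ℝ] ℝ, ∀ t ∈ P.phases,
      h t ∈ Set.Ioo (x - η) (x + η) → c ≤ ℓ (ray t)) : (P.map h).LocallyFinite := by
  refine ⟨η, hη, hη', fun x => ?_⟩
  obtain ⟨ℓ, hℓ⟩ := H x
  rw [Slicing.interval_eq_cl Set.ordConnected_Ioo]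
  refine (Slicing.hasStrictKernels (Slicing.short_Ioo (by linarith))).isLengthCategory
    (fun X => ℓ (Z (cls v X))) (mul_pos hc hP.κ_pos) (fun A X B hE => ?_) (fun X hX hX0 => ?_)
  · simp only [cls_isExt v hE, map_add]
  · rw [Slicing.map_cl] at hX
    exact hP.le_map hc.le ℓ (fun t ht ht' => hℓ t ht' ht) hX hX0

theorem charge_map {h : CircleDeg1Lift} {T : ℂ →L[ℝ] ℂ} {r : ℝ → ℝ}
    (hr : ∀ t ∈ P.phases, 0 ≤ r t ∧ T (ray t) = r t * ray (h t)) {φ : ℝ} {X : C}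
    (hX : (P.map h).P φ X) : T (Z (cls v X)) = ‖T (Z (cls v X))‖ * ray φ := by
  have : ∃ m : ℝ, 0 ≤ m ∧ T (Z (cls v X)) = m * ray φ := by
    have hX' := Slicing.cl_inter_phases hX
    clear hX
    induction hX' with
    | zero hz => exact ⟨0, le_rfl, by simp [cls_isZero v hz]⟩
    | @ext A Y S hE _ hS ih =>
      obtain ⟨m, hm, hm'⟩ := ih
      obtain ⟨t, ht, hS⟩ := hS
      obtain ⟨h1, h2⟩ := hr t ht.2
      refine ⟨m + ‖Z (cls v S)‖ * r t, add_nonneg hm (mul_nonneg (norm_nonneg _) h1), ?_⟩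
      have hq : T (Z (cls v S)) = ‖Z (cls v S)‖ * (r t * ray φ) := by
        conv_lhs => rw [hP.charge_eq t S hS, ← Complex.real_smul, map_smul, h2,
          show h t = φ from ht.1, Complex.real_smul]
      rw [cls_isExt v hE, map_add, map_add, hm', hq]
      push_cast
      ring
  obtain ⟨m, hm, hm'⟩ := this
  rw [hm', norm_ofReal_mul_ray hm]

theorem stab_map {h : CircleDeg1Lift} {T : ℂ →L[ℝ] ℂ} {r : ℝ → ℝ} {c : ℝ} (hc : 0 < c)
    (hr : ∀ t ∈ P.phases, c ≤ r t ∧ T (ray t) = r t * ray (h t)) :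
    ∃ hl : (P.map h).LocallyFinite,
      IsStabilityCondition v ((⟨P.map h, hl⟩, T.comp Z) : StabData C V) := by
  have key : ∀ x t, t ∈ P.phases → h t = x → c ≤ rayFunctional x (T (ray t)) := by
    rintro x t ht rfl
    rw [(hr t ht).2, rayFunctional_smul_ray]
    simpa using (hr t ht).1
  have hl : (P.map h).LocallyFinite := by
    -- Rays with phase within `1/4` of `x` have projection at least `cos (π/4) = √2/2` onto the ray
    -- of `x`.
    refine hP.locallyFinite_map h (η := 1 / 4) (c := c * (√2 / 2)) (by norm_num) (by norm_num)
      (by positivity) fun x => ⟨(rayFunctional x).comp (T : ℂ →ₗ[ℝ] ℂ), fun t ht hx => ?_⟩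
    change _ ≤ rayFunctional x (T (ray t))
    rw [(hr t ht).2, rayFunctional_smul_ray, ← Real.cos_pi_div_four]
    refine mul_le_mul (hr t ht).1 ?_ ?_ (hc.le.trans (hr t ht).1)
    · rw [← Real.cos_abs (Real.pi * (h t - x))]
      refine Real.cos_le_cos_of_nonneg_of_le_pi (abs_nonneg _) (by linarith [Real.pi_pos]) ?_
      rw [abs_mul, abs_of_pos Real.pi_pos]
      have : |h t - x| ≤ 1 / 4 := abs_le.2 ⟨by linarith [hx.1], by linarith [hx.2]⟩
      nlinarith [Real.pi_pos]
    · rw [Real.cos_pi_div_four]; positivity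
  refine ⟨hl, fun φ X hX hX0 => ⟨_, ?_, hP.charge_map (fun t ht =>
    ⟨hc.le.trans (hr t ht).1, (hr t ht).2⟩) hX⟩, 1 / (c * k), ?_, fun φ X hX => ?_⟩
  · have h1 := hP.le_map hc.le ((rayFunctional φ).comp (T : ℂ →ₗ[ℝ] ℂ))
      (fun t ht ht' => key φ t ht' ht) hX hX0
    exact (mul_pos hc hP.κ_pos).trans_le (h1.trans (rayFunctional_le_norm _ _))
  · have := hP.k_pos
    positivity
  · rw [one_div_one_div]
    exact (hP.norm_cls_le hc.le ((rayFunctional φ).comp (T : ℂ →ₗ[ℝ] ℂ))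
      (fun t ht ht' => key φ t ht' ht) hX).trans (rayFunctional_le_norm _ _)

/-- A stable object of the push-forward is simple in `P(h⁻¹{φ})`, hence semistable of one phase `t`
for `P`, and its mass is scaled exactly by `r t`. So only the values of `r` at phases of such simple
objects must avoid small positive numbers. -/
theorem lax_map {h : CircleDeg1Lift} {T : ℂ →L[ℝ] ℂ} {r : ℝ → ℝ} {c : ℝ} (hc : 0 < c)
    (hr : ∀ t ∈ P.phases, 0 ≤ r t ∧ T (ray t) = r t * ray (h t))
    (hs : ∀ φ t X, h t = φ → P.P t X → StrictSimpleIn (P.cl (h ⁻¹' {φ})) X → r t = 0 ∨ c ≤ r t)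
    (hl : (P.map h).LocallyFinite) :
    IsLaxStabilityCondition v ((⟨P.map h, hl⟩, T.comp Z) : StabData C V) := by
  refine ⟨fun φ X hX hX0 => ⟨_, norm_nonneg _, hP.charge_map hr hX⟩, 1 / (c * k), ?_,
    fun φ X hX hX0 => ?_⟩
  · have := hP.k_pos
    positivity
  · have hsh : Slicing.Short (h ⁻¹' {φ}) := by
      refine ⟨Set.ordConnected_singleton.preimage_mono h.monotone, fun x hx y hy => ?_⟩
      by_contra hc
      have h1 := h.monotone (not_lt.1 hc)
      have h2 := h.map_sub_int x 1
      simp only [Set.mem_preimage, Set.mem_singleton_iff] at hx hy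
      push_cast at h2
      linarith
    have hX' : StrictSimpleIn (P.cl (h ⁻¹' {φ})) X := hX
    obtain ⟨t, ht, htX⟩ := Slicing.exists_semistable_of_strictSimpleIn hsh hX'
    have hXz : ¬ IsZero X := ((Slicing.hasStrictKernels hsh).strictSimpleIn_iff.1 hX').2.1
    have htp : t ∈ P.phases := fun h' => hXz (h' _ htX)
    change 1 / (1 / (c * k)) * _ ≤ ‖T (Z (cls v X))‖
    change T (Z (cls v X)) ≠ 0 at hX0
    have hval : ‖T (Z (cls v X))‖ = ‖Z (cls v X)‖ * r t := by
      rw [hP.charge_eq t X htX, ← Complex.real_smul, map_smul, norm_smul, (hr t htp).2,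
        norm_ofReal_mul_ray (hr t htp).1, norm_smul, norm_ray]
      simp
    have hct : c ≤ r t := by
      refine (hs φ t X ht htX hX').resolve_left fun h0 => hX0 ?_
      rw [← norm_eq_zero, hval, h0, mul_zero]
    rw [one_div_one_div, hval, mul_assoc, mul_comm]
    exact mul_le_mul (hP.norm_le t X htX) hct hc.le (norm_nonneg _)

end IsSupported

theorem IsStabilityCondition.isLax {τ : StabData C V} (h : IsStabilityCondition v τ) :
    IsLaxStabilityCondition v τ := by
  obtain ⟨h1, K, hK, h2⟩ := h
  refine ⟨fun φ X hX hX0 => ?_, K, hK, fun φ X hX _ => h2 φ X hX.choose⟩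
  obtain ⟨m, hm, h⟩ := h1 φ X hX hX0
  exact ⟨m, hm.le, h⟩

/-! ### The action of `ℂ` -/

/-- The translation by `a`. -/
def shiftLift (a : ℝ) : CircleDeg1Lift where
  toFun t := t + a
  monotone' _ _ h := by simpa using h
  map_add_one' t := by ring

@[simp] theorem shiftLift_apply (a t : ℝ) : shiftLift a t = t + a := rfl

theorem shiftLift_preimage_singleton (a φ : ℝ) : shiftLift a ⁻¹' {φ} = {φ - a} := by
  ext t
  simp [eq_sub_iff_add_eq]

theorem Slicing.map_shiftLift_P (P : Slicing C) (a φ : ℝ) :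
    (P.map (shiftLift a)).P φ = P.P (φ - a) := by
  rw [map_P, shiftLift_preimage_singleton, cl_singleton]

theorem Slicing.LocallyFinite.shift {P : Slicing C} (hP : P.LocallyFinite) (a : ℝ) :
    (P.map (shiftLift a)).LocallyFinite := by
  obtain ⟨ε, h1, h2, h⟩ := hP
  refine ⟨ε, h1, h2, fun φ => ?_⟩
  have : shiftLift a ⁻¹' Set.Ioo (φ - ε) (φ + ε) = Set.Ioo (φ - a - ε) (φ - a + ε) := by
    ext t
    simp only [Set.mem_preimage, shiftLift_apply, Set.mem_Ioo]
    constructor <;> rintro ⟨h, h'⟩ <;> constructor <;> linarith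
  rw [map_interval _ Set.ordConnected_Ioo, this]
  exact h _

/-- The action of `z` in `ℂ`. -/
def act (z : ℂ) (τ : StabData C V) : StabData C V :=
  (⟨τ.slicing.map (shiftLift (-z.re)), τ.1.2.shift _⟩,
    Complex.exp (-(Complex.I * Real.pi * z)) • τ.charge)

theorem act_P (z : ℂ) (τ : StabData C V) (φ : ℝ) :
    (act z τ).slicing.P φ = τ.slicing.P (φ + z.re) := by
  change (τ.slicing.map _).P φ = _
  rw [Slicing.map_shiftLift_P, sub_neg_eq_add]

theorem act_charge (z : ℂ) (τ : StabData C V) :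
    (act z τ).charge = Complex.exp (-(Complex.I * Real.pi * z)) • τ.charge := rfl

theorem stabData_ext {τ ρ : StabData C V} (h : ∀ φ, τ.slicing.P φ = ρ.slicing.P φ)
    (h' : τ.charge = ρ.charge) : τ = ρ :=
  Prod.ext (Subtype.ext (Slicing.ext_P h)) h'

theorem sameCOrbit_iff {σ τ : StabData C V} : SameCOrbit σ τ ↔ ∃ z, τ = act z σ := by
  refine exists_congr fun z => ⟨fun ⟨h1, h2⟩ => stabData_ext (fun φ => ?_) h2, ?_⟩
  · rw [act_P, h1]
  · rintro rfl
    exact ⟨fun φ => act_P z σ φ, rfl⟩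

theorem act_act (z w : ℂ) (τ : StabData C V) : act z (act w τ) = act (z + w) τ := by
  refine stabData_ext (fun φ => ?_) ?_
  · rw [act_P, act_P, act_P, Complex.add_re, add_assoc]
  · rw [act_charge, act_charge, act_charge, smul_smul, ← Complex.exp_add]
    ring_nf

theorem act_zero (τ : StabData C V) : act 0 τ = τ := by
  refine stabData_ext (fun φ => ?_) ?_
  · rw [act_P]; simp
  · rw [act_charge]; simp

theorem norm_exp_act (z : ℂ) :
    Complex.exp (-(Complex.I * Real.pi * z)) = Real.exp (Real.pi * z.im) * ray (-z.re) := by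
  rw [ray, Complex.ofReal_exp, ← Complex.exp_add]
  congr 1
  apply Complex.ext <;> simp

theorem act_charge_eq {z : ℂ} {τ : StabData C V} {x : V} {m φ : ℝ}
    (h : τ.charge x = m * Complex.exp (Complex.I * Real.pi * ((φ + z.re : ℝ) : ℂ))) :
    (act z τ).charge x = ((Real.exp (Real.pi * z.im) * m : ℝ) : ℂ) *
      Complex.exp (Complex.I * Real.pi * φ) := by
  rw [act_charge, smul_apply, h, ← ray_eq, ← ray_eq, norm_exp_act, smul_eq_mul,
    ray_add, ray_neg]
  push_cast
  field_simp [ray_ne_zero]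

theorem norm_act_charge (z : ℂ) (τ : StabData C V) (x : V) :
    ‖(act z τ).charge x‖ = Real.exp (Real.pi * z.im) * ‖τ.charge x‖ := by
  rw [act_charge, smul_apply, norm_exp_act, norm_smul, norm_mul, norm_ray,
    Complex.norm_real, Real.norm_of_nonneg (Real.exp_pos _).le, mul_one]

theorem IsStabilityCondition.act {τ : StabData C V} (h : IsStabilityCondition v τ) (z : ℂ) :
    IsStabilityCondition v (act z τ) := by
  obtain ⟨h1, K, hK, h2⟩ := h
  refine ⟨fun φ X hX hX0 => ?_, K / Real.exp (Real.pi * z.im), by positivity, fun φ X hX => ?_⟩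
  · rw [act_P] at hX
    obtain ⟨m, hm, hm'⟩ := h1 _ X hX hX0
    exact ⟨_, mul_pos (Real.exp_pos _) hm, act_charge_eq hm'⟩
  · rw [act_P] at hX
    rw [norm_act_charge, one_div_div, div_eq_mul_one_div, mul_assoc]
    exact mul_le_mul_of_nonneg_left (h2 _ X hX) (Real.exp_pos _).le

theorem IsLaxStabilityCondition.act {τ : StabData C V} (h : IsLaxStabilityCondition v τ) (z : ℂ) :
    IsLaxStabilityCondition v (act z τ) := by
  obtain ⟨h1, K, hK, h2⟩ := h
  refine ⟨fun φ X hX hX0 => ?_, K / Real.exp (Real.pi * z.im), by positivity,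
    fun φ X hX hX0 => ?_⟩
  · rw [act_P] at hX
    obtain ⟨m, hm, hm'⟩ := h1 _ X hX hX0
    exact ⟨_, mul_nonneg (Real.exp_pos _).le hm, act_charge_eq hm'⟩
  · rw [Slicing.isStable_iff, act_P] at hX
    rw [← norm_pos_iff, norm_act_charge] at hX0
    rw [norm_act_charge, one_div_div, div_eq_mul_one_div, mul_assoc]
    refine mul_le_mul_of_nonneg_left (h2 _ X hX ?_) (Real.exp_pos _).le
    exact norm_pos_iff.1 (pos_of_mul_pos_right hX0 (Real.exp_pos _).le)

end

end LaxStability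

end

noncomputable section

open scoped ZeroObject

set_option linter.unusedSectionVars false

namespace LaxStability

/-! ### The linear maps `z ↦ z - w * conj z` and their action on rays -/

/-- The real linear map `z ↦ z - w * conj z`. -/
def nMap (w : ℂ) : ℂ →L[ℝ] ℂ :=
  ContinuousLinearMap.id ℝ ℂ - w • (Complex.conjCLE : ℂ →L[ℝ] ℂ)

theorem nMap_apply (w z : ℂ) : nMap w z = z - w * (starRingEnd ℂ) z := by
  simp [nMap]

theorem continuous_nMap : Continuous nMap := by
  unfold nMap
  fun_prop

/-- The factor by which `nMap w` scales and rotates the ray of phase `t`. -/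
def rotFactor (w : ℂ) (t : ℝ) : ℂ := 1 - w * ray (-(2 * t))

theorem nMap_ray (w : ℂ) (t : ℝ) : nMap w (ray t) = ray t * rotFactor w t := by
  have : ray (-(2 * t)) = (ray t)⁻¹ * (ray t)⁻¹ := by
    rw [ray_neg, two_mul, ray_add, mul_inv]
  rw [nMap_apply, conj_ray, rotFactor, this]
  field_simp [ray_ne_zero]

theorem rotFactor_re_nonneg {w : ℂ} (hw : ‖w‖ ≤ 1) (t : ℝ) : 0 ≤ (rotFactor w t).re := by
  have h1 : (w * ray (-(2 * t))).re ≤ 1 := by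
    refine (Complex.re_le_norm _).trans ?_
    rwa [norm_mul, norm_ray, mul_one]
  rw [rotFactor, Complex.sub_re, Complex.one_re]
  linarith

theorem rotFactor_re_pos {w : ℂ} (hw : ‖w‖ < 1) (t : ℝ) : 0 < (rotFactor w t).re := by
  have h1 : (w * ray (-(2 * t))).re < 1 := by
    refine (Complex.re_le_norm _).trans_lt ?_
    rwa [norm_mul, norm_ray, mul_one]
  rw [rotFactor, Complex.sub_re, Complex.one_re]
  linarith

theorem rotFactor_eq_zero_iff {w : ℂ} {t : ℝ} : rotFactor w t = 0 ↔ w = ray (2 * t) := by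
  rw [rotFactor, ray_neg, sub_eq_zero, eq_comm, mul_inv_eq_one₀ (ray_ne_zero _)]

theorem mem_slitPlane_of_re_nonneg {z : ℂ} (h : 0 ≤ z.re) (h0 : z ≠ 0) :
    z ∈ Complex.slitPlane := by
  rw [Complex.mem_slitPlane_iff]
  by_contra! hc
  exact h0 (Complex.ext (le_antisymm hc.1 h) hc.2)

theorem one_sub_norm_le_norm_rotFactor (w : ℂ) (t : ℝ) : 1 - ‖w‖ ≤ ‖rotFactor w t‖ := by
  have := norm_sub_norm_le (1 : ℂ) (w * ray (-(2 * t)))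
  rwa [norm_one, norm_mul, norm_ray, mul_one] at this

/-- The phase of the image of the ray of phase `t` under `nMap w`. -/
def phaseFun (w : ℂ) (t : ℝ) : ℝ := t + Complex.arg (rotFactor w t) / Real.pi

theorem nMap_ray_eq (w : ℂ) (t : ℝ) :
    nMap w (ray t) = ‖rotFactor w t‖ * ray (phaseFun w t) := by
  rw [nMap_ray, phaseFun, ray_add, mul_left_comm, ray_arg_mul_norm]

theorem rotFactor_add_one (w : ℂ) (t : ℝ) : rotFactor w (t + 1) = rotFactor w t := by
  have : ray (-(2 * (t + 1))) = ray (-(2 * t)) := by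
    rw [ray_eq_ray_iff]; exact ⟨-1, by push_cast; ring⟩
  rw [rotFactor, this, rotFactor]

theorem phaseFun_add_one (w : ℂ) (t : ℝ) : phaseFun w (t + 1) = phaseFun w t + 1 := by
  rw [phaseFun, rotFactor_add_one, phaseFun]; ring

theorem abs_phaseFun_sub_lt {w : ℂ} (hw : ‖w‖ < 1) (t : ℝ) : |phaseFun w t - t| < 1 / 2 := by
  rw [phaseFun, add_sub_cancel_left, abs_div, abs_of_pos Real.pi_pos, div_lt_iff₀ Real.pi_pos]
  have := Complex.abs_arg_lt_pi_div_two_iff.2 (.inl (rotFactor_re_pos hw t))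
  linarith

/-- Both sides measure oriented area; `1 - ‖w‖ ^ 2` is the determinant of `nMap w`. -/
theorem im_conj_nMap_mul (w a b : ℂ) : ((starRingEnd ℂ) (nMap w a) * nMap w b).im =
    (1 - ‖w‖ ^ 2) * ((starRingEnd ℂ) a * b).im := by
  rw [nMap_apply, nMap_apply, ← Complex.normSq_eq_norm_sq, Complex.normSq_apply]
  simp
  ring

/-- Positivity of the determinant makes the sine of `π` times the difference of the image phases
positive. As both displacements are less than `1/2`, that difference exceeds `-1`, so it cannot be
non-positive. -/
theorem phaseFun_lt {w : ℂ} (hw : ‖w‖ < 1) {s t : ℝ} (hst : s < t) (hst' : t < s + 1) :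
    phaseFun w s < phaseFun w t := by
  have h1 := im_conj_nMap_mul w (ray s) (ray t)
  have hn : ∀ t, 0 < ‖rotFactor w t‖ := fun t =>
    lt_of_lt_of_le (by linarith) (one_sub_norm_le_norm_rotFactor w t)
  have h2 : (starRingEnd ℂ) (nMap w (ray s)) * nMap w (ray t) =
      ((‖rotFactor w s‖ * ‖rotFactor w t‖ : ℝ) : ℂ) * ray (phaseFun w t - phaseFun w s) := by
    rw [nMap_ray_eq, nMap_ray_eq, map_mul, Complex.conj_ofReal, conj_ray, ray_sub]
    push_cast; ring
  rw [h2, Complex.im_ofReal_mul, conj_ray, mul_comm (ray s)⁻¹, ← ray_sub, ray_im, ray_im] at h1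
  have h3 : 0 < Real.sin (Real.pi * (t - s)) :=
    Real.sin_pos_of_pos_of_lt_pi (mul_pos Real.pi_pos (by linarith))
      (by nlinarith [Real.pi_pos])
  have h4 : 0 < 1 - ‖w‖ ^ 2 := by nlinarith [norm_nonneg w]
  have h5 : 0 < Real.sin (Real.pi * (phaseFun w t - phaseFun w s)) :=
    pos_of_mul_pos_right (h1 ▸ mul_pos h4 h3) (mul_pos (hn s) (hn t)).le
  by_contra hc
  have h6 := abs_lt.1 (abs_phaseFun_sub_lt hw s)
  have h7 := abs_lt.1 (abs_phaseFun_sub_lt hw t)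
  refine absurd h5 (not_lt.2 (Real.sin_nonpos_of_nonpos_of_neg_pi_le ?_ ?_)) <;>
  nlinarith [Real.pi_pos]

theorem strictMono_phaseFun {w : ℂ} (hw : ‖w‖ < 1) : StrictMono (phaseFun w) := by
  have key : ∀ (n : ℕ) (s t : ℝ), s < t → t - s < n / 2 → phaseFun w s < phaseFun w t := by
    intro n
    induction n with
    | zero => intro s t h h'; simp at h'; linarith
    | succ n ih =>
      intro s t h h'
      by_cases hd : t < s + 1
      · exact phaseFun_lt hw h hd
      · have h1 : phaseFun w (t - 1 / 2) < phaseFun w t := phaseFun_lt hw (by linarith) (by linarith)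
        push_cast at h'
        exact (ih s (t - 1 / 2) (by linarith) (by linarith)).trans h1
  intro s t h
  obtain ⟨n, hn⟩ := exists_nat_gt ((t - s) * 2)
  exact key n s t h (by linarith)

theorem continuous_phaseFun {w : ℂ} (hw : ‖w‖ < 1) : Continuous (phaseFun w) := by
  have h1 : Continuous (rotFactor w) := by
    unfold rotFactor
    exact continuous_const.sub (continuous_const.mul (continuous_ray.comp (by fun_prop)))
  have h2 : Continuous fun t => Complex.arg (rotFactor w t) := by
    refine continuous_iff_continuousAt.2 fun t => ?_
    exact (Complex.continuousAt_arg (.inl (rotFactor_re_pos hw t))).comp h1.continuousAt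
  unfold phaseFun
  exact continuous_id.add (h2.div_const _)

/-- The lift of the circle homeomorphism induced by `nMap w`. -/
def phaseLift (w : ℂ) (hw : ‖w‖ < 1) : CircleDeg1Lift where
  toFun := phaseFun w
  monotone' := (strictMono_phaseFun hw).monotone
  map_add_one' := phaseFun_add_one w

theorem phaseLift_apply {w : ℂ} (hw : ‖w‖ < 1) (t : ℝ) : phaseLift w hw t = phaseFun w t := rfl

theorem continuousAt_phaseFun {w : ℂ} (hw : ‖w‖ ≤ 1) {t : ℝ} (h : rotFactor w t ≠ 0) :
    ContinuousAt (fun w => phaseFun w t) w := by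
  unfold phaseFun
  refine continuousAt_const.add (ContinuousAt.div_const ?_ _)
  refine ContinuousAt.comp (f := fun w => rotFactor w t) (Complex.continuousAt_arg
    (mem_slitPlane_of_re_nonneg (rotFactor_re_nonneg hw t) h)) ?_
  unfold rotFactor
  fun_prop

/-- For `‖w'‖ ≤ r < 1` all rotation factors lie in the closed ball of radius `r` about `1`, a
compact subset of the slit plane on which the argument is uniformly continuous. This gives
uniformity in `t`. -/
theorem eventually_abs_phaseFun_sub_lt {w : ℂ} (hw : ‖w‖ < 1) {ε : ℝ} (hε : 0 < ε) :
    ∀ᶠ w' in 𝓝 w, ∀ t, |phaseFun w' t - phaseFun w t| < ε := by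
  obtain ⟨r, hr, hr'⟩ := exists_between hw
  have hK : IsCompact (Metric.closedBall (1 : ℂ) r) := isCompact_closedBall _ _
  have hsub : Metric.closedBall (1 : ℂ) r ⊆ Complex.slitPlane := fun z hz => by
    left
    have h1 : ‖z - 1‖ ≤ r := by simpa [dist_eq_norm] using hz
    have h2 := (Complex.abs_re_le_norm (z - 1)).trans h1
    simp only [Complex.sub_re, Complex.one_re] at h2
    have := (abs_le.1 h2).1
    linarith
  have hu := hK.uniformContinuousOn_of_continuous
    (fun z hz => (Complex.continuousAt_arg (hsub hz)).continuousWithinAt)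
  obtain ⟨δ, hδ, hu⟩ := Metric.uniformContinuousOn_iff.1 hu (ε * Real.pi)
    (mul_pos hε Real.pi_pos)
  have hq : ∀ w t, ‖w‖ ≤ r → rotFactor w t ∈ Metric.closedBall (1 : ℂ) r := fun w t h => by
    rw [Metric.mem_closedBall, dist_eq_norm, rotFactor, sub_sub_cancel_left, norm_neg, norm_mul,
      norm_ray, mul_one]
    exact h
  have h1 : ∀ᶠ w' in 𝓝 w, ‖w'‖ < r := continuous_norm.continuousAt.eventually_lt_const hr
  filter_upwards [h1, Metric.ball_mem_nhds w hδ] with w' hw' hd t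
  have h2 := hu _ (hq w' t hw'.le) _ (hq w t hr.le) (by
    rw [dist_eq_norm, rotFactor, rotFactor, sub_sub_sub_cancel_left, ← sub_mul, norm_mul, norm_ray,
      mul_one, ← dist_eq_norm, dist_comm]
    exact hd)
  rw [Real.dist_eq] at h2
  rw [phaseFun, phaseFun, add_sub_add_left_eq_sub, ← sub_div, abs_div, abs_of_pos Real.pi_pos,
    div_lt_iff₀ Real.pi_pos]
  exact h2

/-! ### Step functions -/

/-- The monotone map of degree one with value `φ + 1 / 2` on `(φ, φ + 1)` and `φ - 1 / 2 + ψ` at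
`φ`; here `ψ` is replaced by the nearest point of `[0, 1]`. -/
def stepLift (φ ψ : ℝ) : CircleDeg1Lift where
  toFun t := open Classical in
    φ - 1 / 2 + ⌈t - φ⌉ + if ∃ n : ℤ, t - φ = n then max 0 (min 1 ψ) else 0
  monotone' := by
    intro s t hst
    have h0 : 0 ≤ max 0 (min 1 ψ) := le_max_left _ _
    have h1 : max 0 (min 1 ψ) ≤ 1 := max_le zero_le_one (min_le_left _ _)
    dsimp only
    rcases hst.eq_or_lt with rfl | hlt
    · exact le_rfl
    by_cases hs : ∃ n : ℤ, s - φ = n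
    · obtain ⟨n, hn⟩ := hs
      have h2 : (n : ℝ) + 1 ≤ ⌈t - φ⌉ := by
        have : n < ⌈t - φ⌉ := by rw [Int.lt_ceil]; linarith
        exact_mod_cast this
      have h3 : ⌈s - φ⌉ = n := by rw [hn]; exact Int.ceil_intCast n
      rw [if_pos ⟨n, hn⟩, h3]
      split_ifs <;> linarith
    · rw [if_neg hs]
      have h2 : (⌈s - φ⌉ : ℝ) ≤ ⌈t - φ⌉ := by
        exact_mod_cast Int.ceil_mono (by linarith)
      split_ifs <;> linarith
  map_add_one' := by
    intro t
    have h1 : (∃ n : ℤ, t + 1 - φ = n) ↔ ∃ n : ℤ, t - φ = n := by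
      constructor
      · rintro ⟨n, hn⟩; exact ⟨n - 1, by push_cast; linarith⟩
      · rintro ⟨n, hn⟩; exact ⟨n + 1, by push_cast; linarith⟩
    have h2 : ⌈t + 1 - φ⌉ = ⌈t - φ⌉ + 1 := by
      rw [show t + 1 - φ = t - φ + 1 by ring, Int.ceil_add_one]
    by_cases h : ∃ n : ℤ, t - φ = n
    · rw [if_pos h, if_pos (h1.2 h), h2]
      push_cast; ring
    · rw [if_neg h, if_neg (mt h1.1 h), h2]
      push_cast; ring

open Classical in
theorem stepLift_apply (φ ψ t : ℝ) : stepLift φ ψ t =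
    φ - 1 / 2 + ⌈t - φ⌉ + if ∃ n : ℤ, t - φ = n then max 0 (min 1 ψ) else 0 := rfl

theorem stepLift_of_mem_Ioo {φ t : ℝ} (ψ : ℝ) (h : t ∈ Set.Ioo φ (φ + 1)) :
    stepLift φ ψ t = φ + 1 / 2 := by
  have h1 : ⌈t - φ⌉ = 1 := by
    rw [Int.ceil_eq_iff]; push_cast; constructor <;> linarith [h.1, h.2]
  have h2 : ¬ ∃ n : ℤ, t - φ = n := by
    rintro ⟨n, hn⟩
    have h3 : (0 : ℝ) < n := by linarith [h.1]
    have h4 : (n : ℝ) < 1 := by linarith [h.2]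
    have h5 : 0 < n := by exact_mod_cast h3
    have h6 : n < 1 := by exact_mod_cast h4
    omega
  rw [stepLift_apply, if_neg h2, h1]
  push_cast; ring

theorem stepLift_self {φ ψ : ℝ} (hψ : ψ ∈ Set.Icc (0 : ℝ) 1) :
    stepLift φ ψ φ = φ - 1 / 2 + ψ := by
  rw [stepLift_apply, if_pos ⟨0, by simp⟩, sub_self, Int.ceil_zero, min_eq_right hψ.2, max_eq_right hψ.1]
  simp

theorem exists_int_add_mem_Ico (φ t : ℝ) : ∃ (n : ℤ) (s : ℝ), s ∈ Set.Ico φ (φ + 1) ∧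
    t = s + n := by
  refine ⟨⌊t - φ⌋, t - ⌊t - φ⌋, ⟨?_, ?_⟩, by ring⟩
  · linarith [Int.floor_le (t - φ)]
  · linarith [Int.lt_floor_add_one (t - φ)]

theorem rotFactor_add_int (w : ℂ) (t : ℝ) (n : ℤ) : rotFactor w (t + n) = rotFactor w t := by
  have : ray (-(2 * (t + n))) = ray (-(2 * t)) := by
    rw [ray_eq_ray_iff]; exact ⟨-n, by push_cast; ring⟩
  rw [rotFactor, this, rotFactor]

theorem phaseFun_add_int (w : ℂ) (t : ℝ) (n : ℤ) : phaseFun w (t + n) = phaseFun w t + n := by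
  rw [phaseFun, rotFactor_add_int, phaseFun]; ring

/-- The factor is the chord between two points of the circle. Its phase `φ + 1/2 - t` cancels the
phase `t` of the ray, which is why the phase map becomes constant on `(φ, φ + 1)`. -/
theorem rotFactor_boundary (φ t : ℝ) : rotFactor (ray (2 * φ)) t =
    ((2 * Real.sin (Real.pi * (t - φ)) : ℝ) : ℂ) * ray (φ + 1 / 2 - t) := by
  have h1 : rotFactor (ray (2 * φ)) t = (ray (t - φ) - ray (φ - t)) * ray (φ - t) := by
    rw [rotFactor, sub_mul, ← ray_add, ← ray_add, ← ray_add, ← ray_zero]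
    ring_nf
  have h2 : ray (t - φ) - ray (φ - t) =
      ((2 * Real.sin (Real.pi * (t - φ)) : ℝ) : ℂ) * ray (1 / 2) := by
    apply Complex.ext
    · rw [Complex.sub_re, Complex.re_ofReal_mul, ray_re, ray_re, ray_re,
        show Real.pi * (φ - t) = -(Real.pi * (t - φ)) by ring, Real.cos_neg,
        show Real.pi * (1 / 2) = Real.pi / 2 by ring, Real.cos_pi_div_two]
      ring
    · rw [Complex.sub_im, Complex.im_ofReal_mul, ray_im, ray_im, ray_im,
        show Real.pi * (φ - t) = -(Real.pi * (t - φ)) by ring, Real.sin_neg,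
        show Real.pi * (1 / 2) = Real.pi / 2 by ring, Real.sin_pi_div_two]
      ring
  rw [h1, h2, mul_assoc, ← ray_add]
  ring_nf

theorem phaseFun_boundary {φ t : ℝ} (h : t ∈ Set.Ioo φ (φ + 1)) :
    phaseFun (ray (2 * φ)) t = φ + 1 / 2 := by
  have hs : 0 < Real.sin (Real.pi * (t - φ)) :=
    Real.sin_pos_of_pos_of_lt_pi (mul_pos Real.pi_pos (by linarith [h.1]))
      (by nlinarith [Real.pi_pos, h.2])
  rw [phaseFun, rotFactor_boundary, Complex.arg_real_mul _ (by positivity), ray_eq',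
    Complex.arg_exp_mul_I, (toIocMod_eq_self _).2, mul_div_cancel_left₀ _ Real.pi_ne_zero]
  · ring
  · constructor <;> nlinarith [Real.pi_pos, h.1, h.2]

theorem norm_rotFactor_boundary (φ t : ℝ) :
    ‖rotFactor (ray (2 * φ)) t‖ = 2 * |Real.sin (Real.pi * (t - φ))| := by
  rw [rotFactor_boundary, norm_mul, norm_ray, mul_one, Complex.norm_real, Real.norm_eq_abs,
    abs_mul, abs_two]

theorem stepLift_eq_phaseFun {φ t : ℝ} (ψ : ℝ) (h : rotFactor (ray (2 * φ)) t ≠ 0) :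
    stepLift φ ψ t = phaseFun (ray (2 * φ)) t := by
  obtain ⟨n, s, hs, rfl⟩ := exists_int_add_mem_Ico φ t
  rw [rotFactor_add_int] at h
  rw [phaseFun_add_int, (stepLift φ ψ).map_add_int]
  have hs' : s ∈ Set.Ioo φ (φ + 1) := by
    refine ⟨lt_of_le_of_ne hs.1 ?_, hs.2⟩
    rintro rfl
    exact h (rotFactor_eq_zero_iff.2 rfl)
  rw [stepLift_of_mem_Ioo ψ hs', phaseFun_boundary hs']

/-- At the phases `φ + ℤ` both sides vanish, so the charge puts no constraint on `ψ`. -/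
theorem nMap_ray_boundary (φ ψ t : ℝ) : nMap (ray (2 * φ)) (ray t) =
    ‖rotFactor (ray (2 * φ)) t‖ * ray (stepLift φ ψ t) := by
  by_cases h : rotFactor (ray (2 * φ)) t = 0
  · rw [nMap_ray, h]; simp
  · rw [stepLift_eq_phaseFun ψ h, nMap_ray_eq]

/-- A lower bound for the mass of rays away from the ray which is killed. -/
theorem le_norm_rotFactor_boundary {φ t ε : ℝ} (hε : 0 < ε) (hε' : ε ≤ 1 / 2)
    (h : ∀ n : ℤ, ε ≤ |t - φ - n|) :
    2 * Real.sin (Real.pi * ε) ≤ ‖rotFactor (ray (2 * φ)) t‖ := by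
  obtain ⟨n, s, hs, rfl⟩ := exists_int_add_mem_Ico φ t
  rw [rotFactor_add_int, norm_rotFactor_boundary]
  have h1 : ε ≤ s - φ := by
    have := h n
    rwa [show s + n - φ - n = s - φ by ring, abs_of_nonneg (by linarith [hs.1])] at this
  have h2 : s - φ ≤ 1 - ε := by
    have := h (n + 1)
    rw [show s + n - φ - ((n + 1 : ℤ) : ℝ) = s - φ - 1 by push_cast; ring,
      abs_of_nonpos (by linarith [hs.2])] at this
    linarith
  refine mul_le_mul_of_nonneg_left (le_trans ?_ (le_abs_self _)) zero_le_two
  rcases le_total (s - φ) (1 / 2) with h3 | h3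
  · exact Real.sin_le_sin_of_le_of_le_pi_div_two (by nlinarith [Real.pi_pos])
      (by nlinarith [Real.pi_pos]) (by nlinarith [Real.pi_pos])
  · rw [← Real.sin_pi_sub (Real.pi * (s - φ))]
    exact Real.sin_le_sin_of_le_of_le_pi_div_two (by nlinarith [Real.pi_pos])
      (by nlinarith [Real.pi_pos]) (by nlinarith [Real.pi_pos])

theorem bdry_eq_ray (φ : ℝ) : bdry φ = ray (2 * φ) := by
  rw [bdry, ray]; push_cast; ring_nf

theorem norm_bdry (φ : ℝ) : ‖bdry φ‖ = 1 := by rw [bdry_eq_ray, norm_ray]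

theorem bdry_eq_bdry_iff {φ φ' : ℝ} : bdry φ = bdry φ' ↔ ∃ n : ℤ, φ = φ' + n := by
  rw [bdry_eq_ray, bdry_eq_ray, ray_eq_ray_iff]
  exact exists_congr fun n => ⟨fun h => by linarith, fun h => by linarith⟩

theorem exists_bdry_eq {w : ℂ} (hw : ‖w‖ = 1) : ∃ φ ∈ Set.Ico (0 : ℝ) 1, w = bdry φ := by
  obtain ⟨n, s, hs, h⟩ := exists_int_add_mem_Ico 0 (Complex.arg w / Real.pi / 2)
  refine ⟨s, by simpa using hs, ?_⟩
  have : bdry s = bdry (Complex.arg w / Real.pi / 2) :=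
    bdry_eq_bdry_iff.2 ⟨-n, by rw [h]; push_cast; ring⟩
  rw [this, bdry_eq_ray, mul_div_cancel₀ _ two_ne_zero]
  have h2 := ray_arg_mul_norm w
  rw [hw] at h2
  simpa using h2.symm

end LaxStability

end

noncomputable section

open scoped ZeroObject

set_option linter.unusedSectionVars false

namespace LaxStability

/-! ### The phase diagram on the real line -/

section PhaseDiagram

theorem coe_eq_coe_iff {a b : ℝ} : (a : UnitAddCircle) = b ↔ ∃ n : ℤ, a = b + n := by
  rw [← sub_eq_zero, ← AddCircle.coe_sub, AddCircle.coe_eq_zero_iff]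
  refine exists_congr fun n => ?_
  rw [zsmul_eq_mul, mul_one]
  constructor <;> intro h <;> linarith

theorem frequently_nhds_coe {φ : ℝ} {p : UnitAddCircle → Prop} :
    (∃ᶠ x in 𝓝 (φ : UnitAddCircle), p x) ↔
      ∀ ε > 0, ∃ t : ℝ, |t - φ| < ε ∧ p (t : UnitAddCircle) := by
  have h : 𝓝 (φ : UnitAddCircle) = Filter.map (fun t : ℝ => (t : UnitAddCircle)) (𝓝 φ) :=
    QuotientAddGroup.nhds_eq (AddSubgroup.zmultiples (1 : ℝ)) φ
  rw [h, Filter.frequently_map, Metric.nhds_basis_ball.frequently_iff]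
  rfl

variable {C : Type u₁} [Category.{u₂} C] [Preadditive C] [HasZeroObject C] [HasShift C ℤ]
  [∀ n : ℤ, (shiftFunctor C n).Additive] [Pretriangulated C] {P : Slicing C}

theorem coe_mem_phaseDiagram_iff {φ : ℝ} :
    (φ : UnitAddCircle) ∈ phaseDiagram P ↔ φ ∈ P.phases := by
  constructor
  · rintro ⟨t, h, ht⟩
    obtain ⟨n, rfl⟩ := coe_eq_coe_iff.1 h
    exact (Slicing.add_int_mem_phases_iff n).2 ht
  · exact fun h => ⟨φ, rfl, h⟩

theorem coe_mem_closure_iff {φ : ℝ} : (φ : UnitAddCircle) ∈ closure (phaseDiagram P) ↔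
    ∀ ε > 0, ∃ t ∈ P.phases, |t - φ| < ε := by
  rw [mem_closure_iff_frequently, frequently_nhds_coe]
  refine forall₂_congr fun ε _ => exists_congr fun t => ?_
  rw [coe_mem_phaseDiagram_iff, and_comm]

theorem accPt_iff {φ : ℝ} : AccPt (φ : UnitAddCircle) (Filter.principal (phaseDiagram P)) ↔
    ∀ ε > 0, ∃ t ∈ P.phases, t ≠ φ ∧ |t - φ| < ε := by
  rw [accPt_iff_frequently, frequently_nhds_coe]
  constructor
  · intro h ε hε
    obtain ⟨t, ht, h1, h2⟩ := h ε hε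
    exact ⟨t, coe_mem_phaseDiagram_iff.1 h2, fun h => h1 (by rw [h]), ht⟩
  · intro h ε hε
    obtain ⟨t, ht, h1, h2⟩ := h (min ε 1) (lt_min hε one_pos)
    refine ⟨t, h2.trans_le (min_le_left _ _), fun h3 => h1 ?_, coe_mem_phaseDiagram_iff.2 ht⟩
    obtain ⟨n, rfl⟩ := coe_eq_coe_iff.1 h3
    have h4 : |(n : ℝ)| < 1 := by simpa using h2.trans_le (min_le_right _ _)
    have h5 : |n| < 1 := by exact_mod_cast h4
    rw [Int.abs_lt_one_iff.1 h5]; simp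

theorem not_accPt_iff {φ : ℝ} : ¬ AccPt (φ : UnitAddCircle) (Filter.principal (phaseDiagram P)) ↔
    ∃ ε > 0, ∀ t ∈ P.phases, |t - φ| < ε → t = φ := by
  rw [accPt_iff]
  push Not
  refine exists_congr fun ε => and_congr_right fun _ => forall₂_congr fun t _ => ?_
  rw [← not_imp_not, not_le, not_ne_iff]

theorem dense_phaseDiagram_iff : Dense (phaseDiagram P) ↔
    ∀ φ ε : ℝ, 0 < ε → ∃ t ∈ P.phases, |t - φ| < ε := by
  constructor
  · exact fun h φ => coe_mem_closure_iff.1 (h φ)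
  · intro h x
    induction x using QuotientAddGroup.induction_on with
    | H φ => exact coe_mem_closure_iff.2 (h φ)

variable [IsTriangulated C]

theorem intervalZero_iff_not_mem {I : Set ℝ} : P.IntervalZero I ↔ ∀ t ∈ I, t ∉ P.phases := by
  rw [Slicing.intervalZero_iff]
  exact forall₂_congr fun t _ => (not_not (a := P.SliceZero t)).symm

end PhaseDiagram

/-! ### Gaps in the phase diagram -/

section Gaps

variable {C : Type u₁} [Category.{u₂} C] [Preadditive C] [HasZeroObject C] [HasShift C ℤ]
  [∀ n : ℤ, (shiftFunctor C n).Additive] [Pretriangulated C] [IsTriangulated C] {P : Slicing C}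

theorem strictSimpleIn_shift {I J : Set ℝ} (hI : Slicing.Short I) (hJ : Slicing.Short J) (n : ℤ)
    (hIJ : ∀ t, t ∈ I ↔ t + n ∈ J) {X : C} (h : StrictSimpleIn (P.cl I) X) :
    StrictSimpleIn (P.cl J) (X⟦n⟧) := by
  rw [(Slicing.hasStrictKernels hI).strictSimpleIn_iff] at h
  rw [(Slicing.hasStrictKernels hJ).strictSimpleIn_iff]
  have hJI : ∀ t ∈ J, t + ((-n : ℤ) : ℝ) ∈ I := fun t ht => by
    rw [hIJ]; push_cast; rwa [neg_add_cancel_right]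
  refine ⟨Slicing.cl_shift n (fun t ht => (hIJ t).1 ht) h.1,
    fun h0 => h.2.1 (Slicing.isZero_of_isZero_shift h0), fun A B hA hB hE => ?_⟩
  have e : (X⟦n⟧)⟦-n⟧ ≅ X := (shiftEquiv C n).unitIso.symm.app X
  rcases h.2.2 _ _ (Slicing.cl_shift (-n) hJI hA) (Slicing.cl_shift (-n) hJI hB)
    ((hE.shift (-n)).iso (Iso.refl _) e (Iso.refl _)) with h | h
  · exact .inl (Slicing.isZero_of_isZero_shift h)
  · exact .inr (Slicing.isZero_of_isZero_shift h)

/-- There are no phases in `(φ - ε, φ)`, and no simple objects of `P[φ, φ + 1)` of phase in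
`(φ, φ + ε)`. -/
def LowGap (P : Slicing C) (φ ε : ℝ) : Prop :=
  (∀ t ∈ Set.Ioo (φ - ε) φ, t ∉ P.phases) ∧
    ∀ X t, StrictSimpleIn (P.cl (Set.Ico φ (φ + 1))) X → P.P t X → t ∉ Set.Ioo φ (φ + ε)

/-- There are no phases in `(φ, φ + ε)`, and no simple objects of `P(φ, φ + 1]` of phase in
`(φ + 1 - ε, φ + 1)`. -/
def HighGap (P : Slicing C) (φ ε : ℝ) : Prop :=
  (∀ t ∈ Set.Ioo φ (φ + ε), t ∉ P.phases) ∧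
    ∀ X t, StrictSimpleIn (P.cl (Set.Ioc φ (φ + 1))) X → P.P t X →
      t ∉ Set.Ioo (φ + 1 - ε) (φ + 1)

/-- A simple object of a short interval is semistable, so its membership of `P(J)` only depends on
one phase. -/
theorem forall_not_interval_iff {I J : Set ℝ} (hI : Slicing.Short I) (hJ : J.OrdConnected) :
    (∀ X, StrictSimpleIn (P.cl I) X → ¬ P.interval J X) ↔
      ∀ X t, StrictSimpleIn (P.cl I) X → P.P t X → t ∉ J := by
  rw [Slicing.interval_eq_cl hJ]
  refine forall_congr' fun X => ⟨fun h t h1 h2 h3 => h h1 (Slicing.cl_single h3 h2),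
    fun h h1 h2 => ?_⟩
  obtain ⟨t, -, ht⟩ := Slicing.exists_semistable_of_strictSimpleIn hI h1
  have h0 : ¬ IsZero X := ((Slicing.hasStrictKernels hI).strictSimpleIn_iff.1 h1).2.1
  refine h t h1 ht ?_
  have := ((Slicing.cl_iff h0 hJ).1 h2).1
  rwa [Slicing.phiMinus_eq h0 ht] at this

theorem gapBelow_iff {φ ε : ℝ} : GapBelow P φ ε ↔ LowGap P φ ε := by
  rw [GapBelow, LowGap, intervalZero_iff_not_mem]
  simp only [Slicing.isSimpleIn_Ico_iff]
  rw [forall_not_interval_iff (Slicing.short_Ico φ) Set.ordConnected_Ioo]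

theorem gapAbove_iff {φ ε : ℝ} : GapAbove P φ ε ↔ HighGap P φ ε := by
  rw [GapAbove, HighGap, intervalZero_iff_not_mem]
  simp only [Slicing.isSimpleIn_Ioc_iff]
  rw [forall_not_interval_iff (Slicing.short_Ioc φ) Set.ordConnected_Ioo]

theorem LowGap.mono {φ ε ε' : ℝ} (h : LowGap P φ ε) (hε : ε' ≤ ε) : LowGap P φ ε' :=
  ⟨fun t ht => h.1 t ⟨by linarith [ht.1], ht.2⟩,
    fun X t h1 h2 h3 => h.2 X t h1 h2 ⟨h3.1, by linarith [h3.2]⟩⟩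

theorem HighGap.mono {φ ε ε' : ℝ} (h : HighGap P φ ε) (hε : ε' ≤ ε) : HighGap P φ ε' :=
  ⟨fun t ht => h.1 t ⟨ht.1, by linarith [ht.2]⟩,
    fun X t h1 h2 h3 => h.2 X t h1 h2 ⟨by linarith [h3.1], h3.2⟩⟩

theorem LowGap.add_int {φ ε : ℝ} (h : LowGap P φ ε) (n : ℤ) : LowGap P (φ + n) ε := by
  refine ⟨fun t ht ht' => h.1 (t - n) ⟨by linarith [ht.1], by linarith [ht.2]⟩ ?_,
    fun X t h1 h2 h3 => h.2 (X⟦-n⟧) (t - n) ?_ ?_ ⟨by linarith [h3.1], by linarith [h3.2]⟩⟩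
  · rw [← Slicing.add_int_mem_phases_iff n, sub_add_cancel]; exact ht'
  · refine strictSimpleIn_shift (Slicing.short_Ico _) (Slicing.short_Ico _) (-n) (fun t => ?_) h1
    simp only [Set.mem_Ico]; push_cast
    constructor <;> rintro ⟨a, b⟩ <;> constructor <;> linarith
  · have := Slicing.P_shift_int (-n) h2
    push_cast at this; rwa [← sub_eq_add_neg] at this

theorem HighGap.add_int {φ ε : ℝ} (h : HighGap P φ ε) (n : ℤ) : HighGap P (φ + n) ε := by
  refine ⟨fun t ht ht' => h.1 (t - n) ⟨by linarith [ht.1], by linarith [ht.2]⟩ ?_,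
    fun X t h1 h2 h3 => h.2 (X⟦-n⟧) (t - n) ?_ ?_ ⟨by linarith [h3.1], by linarith [h3.2]⟩⟩
  · rw [← Slicing.add_int_mem_phases_iff n, sub_add_cancel]; exact ht'
  · refine strictSimpleIn_shift (Slicing.short_Ioc _) (Slicing.short_Ioc _) (-n) (fun t => ?_) h1
    simp only [Set.mem_Ioc]; push_cast
    constructor <;> rintro ⟨a, b⟩ <;> constructor <;> linarith
  · have := Slicing.P_shift_int (-n) h2
    push_cast at this; rwa [← sub_eq_add_neg] at this

theorem lowGap_of_isolated {φ ε : ℝ}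
    (h : ∀ t ∈ P.phases, |t - φ| < ε → t = φ) : LowGap P φ ε := by
  refine ⟨fun t ht ht' => ht.2.ne (h t ht' (abs_lt.2 ⟨by linarith [ht.1], by linarith [ht.1, ht.2]⟩)),
    fun X t h1 h2 h3 => h3.1.ne' (h t (fun h0 => ?_) (abs_lt.2 ⟨by linarith [h3.1, h3.2],
      by linarith [h3.2]⟩))⟩
  exact ((Slicing.hasStrictKernels (Slicing.short_Ico φ)).strictSimpleIn_iff.1 h1).2.1 (h0 X h2)

theorem bdry_mem_diskSet_iff {φ : ℝ} :
    bdry φ ∈ diskSet P ↔ ∃ ε > 0, ∀ t ∈ P.phases, ε ≤ |t - φ| := by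
  have h1 : (∃ ε > 0, ∀ t ∈ P.phases, ε ≤ |t - φ|) ↔
      (φ : UnitAddCircle) ∉ closure (phaseDiagram P) := by
    rw [coe_mem_closure_iff]; push Not; rfl
  rw [h1, diskSet, Set.mem_union, or_iff_right (by simp [norm_bdry])]
  constructor
  · rintro ⟨φ', h, h'⟩
    obtain ⟨n, rfl⟩ := bdry_eq_bdry_iff.1 h
    rwa [coe_eq_coe_iff.2 ⟨n, rfl⟩]
  · exact fun h => ⟨φ, rfl, h⟩

theorem bdry_mem_quotDiskSet_iff {φ : ℝ} :
    bdry φ ∈ quotDiskSet P ↔ ∃ ε > 0, LowGap P φ ε ∨ HighGap P φ ε := by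
  rw [quotDiskSet, Set.mem_union, or_iff_right (by simp [norm_bdry])]
  simp only [Set.mem_ofPred_eq, gapBelow_iff, gapAbove_iff]
  constructor
  · rintro ⟨φ', ε, h, hε, h'⟩
    obtain ⟨n, rfl⟩ := bdry_eq_bdry_iff.1 h
    exact ⟨ε, hε, h'.imp (fun h => h.add_int n) (fun h => h.add_int n)⟩
  · rintro ⟨ε, hε, h⟩
    exact ⟨φ, ε, rfl, hε, h⟩

theorem norm_le_one_of_mem_quotDiskSet {w : ℂ} (h : w ∈ quotDiskSet P) : ‖w‖ ≤ 1 := by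
  rcases h with h | ⟨φ, ε, rfl, -⟩
  · simpa using (Metric.mem_ball.1 h).le
  · exact (norm_bdry φ).le

theorem diskSet_subset_quotDiskSet : diskSet P ⊆ quotDiskSet P := by
  rintro w (h | ⟨φ, rfl, h⟩)
  · exact .inl h
  · obtain ⟨ε, hε, h⟩ := bdry_mem_diskSet_iff.1 (Or.inr ⟨φ, rfl, h⟩)
    refine bdry_mem_quotDiskSet_iff.2 ⟨min ε 1, lt_min hε one_pos, .inl ?_⟩
    exact lowGap_of_isolated fun t ht ht' =>
      absurd (ht'.trans_le (min_le_left _ _)) (not_lt.2 (h t ht))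

theorem bdry_mem_blowUpCentre_iff {φ : ℝ} : bdry φ ∈ blowUpCentre P ↔
    (∃ ε > 0, LowGap P φ ε ∨ HighGap P φ ε) ∧ ∀ ε > 0, ∃ t ∈ P.phases, |t - φ| < ε := by
  rw [blowUpCentre, Set.mem_sdiff, bdry_mem_quotDiskSet_iff, bdry_mem_diskSet_iff]
  push Not; rfl

theorem norm_eq_one_of_mem_blowUpCentre {w : ℂ} (h : w ∈ blowUpCentre P) : ‖w‖ = 1 := by
  refine le_antisymm (norm_le_one_of_mem_quotDiskSet h.1) (not_lt.1 fun h1 => h.2 (.inl ?_))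
  simpa using h1

end Gaps

/-! ### Gaps of stability conditions -/

section Supported

variable {C : Type u₁} [Category.{u₂} C] [Preadditive C] [HasZeroObject C] [HasShift C ℤ]
  [∀ n : ℤ, (shiftFunctor C n).Additive] [Pretriangulated C] [IsTriangulated C]
  {V : Type u₃} [NormedAddCommGroup V] [InnerProductSpace ℝ V] {L : Submodule ℤ V}
  {v : K0 C →+ L} {P : Slicing C} {Z : V →L[ℝ] ℂ} {k κ : ℝ} (hP : IsSupported v P Z k κ)

include hP

theorem IsSupported.isZero_of_eq_zero {φ : ℝ} {X : C} (hX : P.P φ X) (h : Z (cls v X) = 0) :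
    IsZero X := by
  by_contra h0
  have := hP.le_norm φ X hX h0
  rw [h, norm_zero] at this
  linarith [hP.κ_pos]

-- The functional is centred at the midpoint of the window, whose half-length is `(1 - ε) / 2`, and
-- `cos (π (1 - ε) / 2) = sin (π ε / 2)`.
omit hP in
theorem le_rayFunctional_window {a t ε : ℝ} (hε : 0 < ε)
    (h : t ∈ Set.Icc a (a + 1 - ε)) :
    Real.sin (Real.pi * (ε / 2)) ≤ rayFunctional (a + (1 - ε) / 2) (ray t) := by
  have h1 := rayFunctional_smul_ray (a + (1 - ε) / 2) t 1
  rw [Complex.ofReal_one, one_mul, one_mul] at h1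
  rw [h1, ← Real.cos_pi_div_two_sub, ← Real.cos_abs (Real.pi * (t - _))]
  have h2 : |t - (a + (1 - ε) / 2)| ≤ (1 - ε) / 2 :=
    abs_le.2 ⟨by linarith [h.1], by linarith [h.2]⟩
  apply Real.cos_le_cos_of_nonneg_of_le_pi (abs_nonneg _)
  · nlinarith [Real.pi_pos]
  · rw [abs_mul, abs_of_pos Real.pi_pos]; nlinarith [Real.pi_pos]

omit hP in
theorem sin_pi_mul_half_pos {ε : ℝ} (hε : 0 < ε) (hε' : ε ≤ 1) :
    0 < Real.sin (Real.pi * (ε / 2)) :=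
  Real.sin_pos_of_pos_of_lt_pi (by positivity) (by nlinarith [Real.pi_pos])

theorem IsSupported.exists_simple_of_window {I : Set ℝ} (hI : Slicing.Short I) {a ε : ℝ}
    (hε : 0 < ε) (hε' : ε ≤ 1) (h : ∀ t ∈ I, t ∈ P.phases → t ∈ Set.Icc a (a + 1 - ε)) {X : C}
    (hX : P.cl I X) (hX0 : ¬ IsZero X) :
    (∃ S R, StrictSimpleIn (P.cl I) S ∧ P.cl I R ∧ IsExt S X R) ∧
      ∃ K S, StrictSimpleIn (P.cl I) S ∧ P.cl I K ∧ IsExt K X S := by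
  have hs := sin_pi_mul_half_pos hε hε'
  refine (Slicing.hasStrictKernels hI).exists_simple
    (fun X => rayFunctional (a + (1 - ε) / 2) (Z (cls v X))) (mul_pos hs hP.κ_pos)
    (fun A X B hE => ?_) (fun X hX hX0 => ?_) hX hX0
  · simp only [cls_isExt v hE, map_add]
  · exact hP.le_map hs.le _ (fun t ht ht' => le_rayFunctional_window hε (h t ht ht')) hX hX0

/-- Suppose `φ` is not a phase. Phases then accumulate from above; an object `X` of such a phase `t`
contains a simple object `S` of `P[φ, φ + 1)`, whose phase is neither `φ` nor in `(φ, φ + ε)`, hence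
larger than `t`. Then `S` has no non-zero map to `X`, a contradiction. -/
theorem IsSupported.mem_phases_of_lowGap {φ ε : ℝ} (hε : 0 < ε) (h : LowGap P φ ε)
    (hc : ∀ ε > 0, ∃ t ∈ P.phases, |t - φ| < ε) : φ ∈ P.phases := by
  by_contra hφ
  wlog hε' : ε ≤ 1 / 2 generalizing ε
  · exact this (lt_min hε one_half_pos) (h.mono (min_le_left _ _)) (min_le_right _ _)
  obtain ⟨t, ht, htφ⟩ := hc ε hε
  have h1 : φ < t := by
    by_contra! h2
    rcases h2.eq_or_lt with rfl | h2
    · exact hφ ht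
    · exact h.1 t ⟨by linarith [(abs_lt.1 htφ).1], h2⟩ ht
  have h2 : t < φ + ε := by linarith [(abs_lt.1 htφ).2]
  obtain ⟨X, hX, hX0⟩ : ∃ X, P.P t X ∧ ¬ IsZero X := by
    simpa [Slicing.phases, Slicing.SliceZero] using ht
  have hw : ∀ t ∈ Set.Ico φ (φ + 1), t ∈ P.phases → t ∈ Set.Icc φ (φ + 1 - ε) := by
    refine fun t ht ht' => ⟨ht.1, not_lt.1 fun h3 => ?_⟩
    refine (h.add_int 1).1 t ⟨?_, ?_⟩ ht' <;> push_cast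
    · linarith
    · exact ht.2
  obtain ⟨⟨S, R, hS, hR, hE⟩, -⟩ := hP.exists_simple_of_window (Slicing.short_Ico φ) hε
    (by linarith) hw (Slicing.cl_single (Set.mem_Ico.2 ⟨h1.le, by linarith⟩) hX) hX0
  obtain ⟨s, hs, hsS⟩ := Slicing.exists_semistable_of_strictSimpleIn (Slicing.short_Ico φ) hS
  have hS0 : ¬ IsZero S :=
    ((Slicing.hasStrictKernels (Slicing.short_Ico φ)).strictSimpleIn_iff.1 hS).2.1
  have h3 : t < s := by
    by_contra! h4
    refine h.2 S s hS hsS ⟨lt_of_le_of_ne hs.1 ?_, by linarith⟩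
    rintro rfl
    exact hφ fun h0 => hS0 (h0 S hsS)
  refine hS0 (hE.isZero_left_of_hom (P.hom_zero _ _ _ _ h3 hsS hX) ?_)
  exact Slicing.cl_hom_shift_eq_zero (Slicing.short_Ico φ) (Slicing.cl_single hs hsS) hR

/-- Dual to the previous argument, with a simple quotient in `P(φ, φ + 1]` of an object of phase `t
+ 1` just below `φ + 1`. -/
theorem IsSupported.mem_phases_of_highGap {φ ε : ℝ} (hε : 0 < ε) (h : HighGap P φ ε)
    (hc : ∀ ε > 0, ∃ t ∈ P.phases, |t - φ| < ε) : φ ∈ P.phases := by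
  by_contra hφ
  wlog hε' : ε ≤ 1 / 2 generalizing ε
  · exact this (lt_min hε one_half_pos) (h.mono (min_le_left _ _)) (min_le_right _ _)
  obtain ⟨t, ht, htφ⟩ := hc ε hε
  have h1 : t < φ := by
    by_contra! h2
    rcases h2.eq_or_lt with rfl | h2
    · exact hφ ht
    · exact h.1 t ⟨h2, by linarith [(abs_lt.1 htφ).2]⟩ ht
  have h2 : φ - ε < t := by linarith [(abs_lt.1 htφ).1]
  have ht1 : t + (1 : ℤ) ∈ P.phases := (Slicing.add_int_mem_phases_iff 1).2 ht
  push_cast at ht1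
  obtain ⟨X, hX, hX0⟩ : ∃ X, P.P (t + 1) X ∧ ¬ IsZero X := by
    simpa [Slicing.phases, Slicing.SliceZero] using ht1
  have hw : ∀ t ∈ Set.Ioc φ (φ + 1), t ∈ P.phases → t ∈ Set.Icc (φ + ε) (φ + ε + 1 - ε) := by
    refine fun t ht ht' => ⟨not_lt.1 fun h3 => h.1 t ⟨ht.1, h3⟩ ht', by linarith [ht.2]⟩
  obtain ⟨-, K, S, hS, hK, hE⟩ := hP.exists_simple_of_window (Slicing.short_Ioc φ) hε
    (by linarith) hw (Slicing.cl_single (Set.mem_Ioc.2 ⟨by linarith, by linarith⟩) hX) hX0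
  obtain ⟨s, hs, hsS⟩ := Slicing.exists_semistable_of_strictSimpleIn (Slicing.short_Ioc φ) hS
  have hS0 : ¬ IsZero S :=
    ((Slicing.hasStrictKernels (Slicing.short_Ioc φ)).strictSimpleIn_iff.1 hS).2.1
  have h3 : s < t + 1 := by
    by_contra! h4
    refine h.2 S s hS hsS ⟨by linarith, lt_of_le_of_ne hs.2 ?_⟩
    rintro rfl
    refine hφ ((Slicing.add_int_mem_phases_iff 1).1 ?_)
    push_cast
    exact fun h0 => hS0 (h0 S hsS)
  refine hS0 (hE.isZero_right_of_hom (P.hom_zero _ _ _ _ h3 hX hsS) ?_)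
  have hK1 : P.cl (Set.Ioc (φ + 1) (φ + 1 + 1)) (K⟦(1 : ℤ)⟧) :=
    Slicing.cl_shift 1 (fun t ht => by push_cast; exact ⟨by linarith [ht.1], by linarith [ht.2]⟩) hK
  exact Slicing.cl_hom_eq_zero (fun a ha b hb => by linarith [ha.1, hb.2]) hK1
    (Slicing.cl_single hs hsS)

theorem IsSupported.mem_phases_of_mem_blowUpCentre {φ : ℝ} (h : bdry φ ∈ blowUpCentre P) :
    φ ∈ P.phases := by
  obtain ⟨⟨ε, hε, h | h⟩, hc⟩ := bdry_mem_blowUpCentre_iff.1 h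
  · exact hP.mem_phases_of_lowGap hε h hc
  · exact hP.mem_phases_of_highGap hε h hc

theorem IsSupported.bdry_mem_blowUpCentre_iff {φ : ℝ} : bdry φ ∈ blowUpCentre P ↔
    (∃ ε > 0, LowGap P φ ε ∨ HighGap P φ ε) ∧ φ ∈ P.phases := by
  refine ⟨fun h => ⟨(LaxStability.bdry_mem_blowUpCentre_iff.1 h).1,
    hP.mem_phases_of_mem_blowUpCentre h⟩, fun h => LaxStability.bdry_mem_blowUpCentre_iff.2
    ⟨h.1, fun ε hε => ⟨φ, h.2, by simpa using hε⟩⟩⟩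

omit hP in
theorem allowedPhase_iff {φ ψ : ℝ} : AllowedPhase P φ ψ ↔
    (φ ∈ P.phases ∧ (∃ ε > 0, ∀ t ∈ P.phases, |t - φ| < ε → t = φ) ∧ ψ ∈ Set.Icc (0 : ℝ) 1) ∨
    ((∀ ε > 0, ∃ t ∈ P.phases, t ≠ φ ∧ |t - φ| < ε) ∧
      (∃ ε > 0, ∀ t ∈ Set.Ioo (φ - ε) φ, t ∉ P.phases) ∧ ψ = 1) ∨
    ((∀ ε > 0, ∃ t ∈ P.phases, t ≠ φ ∧ |t - φ| < ε) ∧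
      (∃ ε > 0, ∀ t ∈ Set.Ioo φ (φ + ε), t ∉ P.phases) ∧ ψ = 0) := by
  rw [AllowedPhase, not_accPt_iff, accPt_iff, coe_mem_phaseDiagram_iff]
  simp only [intervalZero_iff_not_mem]

omit hP in
theorem AllowedPhase.mem_Icc {φ ψ : ℝ} (h : AllowedPhase P φ ψ) : ψ ∈ Set.Icc (0 : ℝ) 1 := by
  rcases h with ⟨-, -, h⟩ | ⟨-, -, rfl⟩ | ⟨-, -, rfl⟩
  · exact h
  · simp
  · simp

omit hP in
theorem AllowedPhase.add_int {φ ψ : ℝ} (h : AllowedPhase P φ ψ) (n : ℤ) :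
    AllowedPhase P (φ + n) ψ := by
  have h1 : ((φ + n : ℝ) : UnitAddCircle) = φ := coe_eq_coe_iff.2 ⟨n, rfl⟩
  have h2 : ∀ t : ℝ, t - n ∈ P.phases ↔ t ∈ P.phases := fun t => by
    rw [← Slicing.add_int_mem_phases_iff n, sub_add_cancel]
  rw [AllowedPhase, h1]
  refine h.imp id (Or.imp (And.imp_right (And.imp_left ?_)) (And.imp_right (And.imp_left ?_)))
  all_goals
    rintro ⟨ε, hε, h⟩
    refine ⟨ε, hε, ?_⟩
    rw [intervalZero_iff_not_mem] at h ⊢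
    intro t ht ht'
    exact h (t - n) ⟨by linarith [ht.1], by linarith [ht.2]⟩ ((h2 t).2 ht')

omit hP in
/-- The possible behaviour of a stability condition near a point of the blow-up centre, together
with the allowed phases. -/
def LaxGap (P : Slicing C) (φ ψ ε : ℝ) : Prop :=
  (ψ ∈ Set.Icc (0 : ℝ) 1 ∧ ∀ t ∈ P.phases, |t - φ| < ε → t = φ) ∨
    (ψ = 1 ∧ LowGap P φ ε) ∨ (ψ = 0 ∧ HighGap P φ ε)

omit hP in
theorem AllowedPhase.exists_laxGap {φ ψ : ℝ} (h : AllowedPhase P φ ψ)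
    (hw : bdry φ ∈ quotDiskSet P) : ∃ ε > 0, ε ≤ 1 / 2 ∧ LaxGap P φ ψ ε := by
  obtain ⟨ε₁, hε₁, hg⟩ := bdry_mem_quotDiskSet_iff.1 hw
  -- An accumulation point cannot have gaps on both sides, so the allowed `ψ` decides which of the
  -- two gap conditions holds.
  have key : (∀ ε > 0, ∃ t ∈ P.phases, t ≠ φ ∧ |t - φ| < ε) →
      (∃ ε > 0, ∀ t ∈ Set.Ioo (φ - ε) φ, t ∉ P.phases) →
      (∃ ε > 0, ∀ t ∈ Set.Ioo φ (φ + ε), t ∉ P.phases) → False := by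
    rintro h ⟨ε, hε, h1⟩ ⟨ε', hε', h2⟩
    obtain ⟨t, ht, hne, hlt⟩ := h (min ε ε') (lt_min hε hε')
    have h3 := abs_lt.1 hlt
    rcases hne.lt_or_gt with h4 | h4
    · exact h1 t ⟨by linarith [min_le_left ε ε'], h4⟩ ht
    · exact h2 t ⟨h4, by linarith [min_le_right ε ε']⟩ ht
  rcases allowedPhase_iff.1 h with ⟨-, ⟨ε, hε, h1⟩, h2⟩ | ⟨h1, h2, rfl⟩ | ⟨h1, h2, rfl⟩
  · exact ⟨min ε (1 / 2), lt_min hε one_half_pos, min_le_right _ _,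
      .inl ⟨h2, fun t ht ht' => h1 t ht (ht'.trans_le (min_le_left _ _))⟩⟩
  · rcases hg with hg | hg
    · exact ⟨min ε₁ (1 / 2), lt_min hε₁ one_half_pos, min_le_right _ _,
        .inr (.inl ⟨rfl, hg.mono (min_le_left _ _)⟩)⟩
    · exact (key h1 h2 ⟨ε₁, hε₁, hg.1⟩).elim
  · rcases hg with hg | hg
    · exact (key h1 ⟨ε₁, hε₁, hg.1⟩ h2).elim
    · exact ⟨min ε₁ (1 / 2), lt_min hε₁ one_half_pos, min_le_right _ _,
        .inr (.inr ⟨rfl, hg.mono (min_le_left _ _)⟩)⟩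

theorem IsSupported.exists_allowedPhase {φ : ℝ} (h : bdry φ ∈ blowUpCentre P) :
    ∃ ψ, AllowedPhase P φ ψ := by
  obtain ⟨⟨ε, hε, h1⟩, hφ⟩ := hP.bdry_mem_blowUpCentre_iff.1 h
  by_cases hacc : ∀ ε > 0, ∃ t ∈ P.phases, t ≠ φ ∧ |t - φ| < ε
  · rcases h1 with h1 | h1
    · exact ⟨1, allowedPhase_iff.2 (.inr (.inl ⟨hacc, ⟨ε, hε, h1.1⟩, rfl⟩))⟩
    · exact ⟨0, allowedPhase_iff.2 (.inr (.inr ⟨hacc, ⟨ε, hε, h1.1⟩, rfl⟩))⟩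
  · rw [← accPt_iff, not_accPt_iff] at hacc
    exact ⟨0, allowedPhase_iff.2 (.inl ⟨hφ, hacc, by simp⟩)⟩

/-! ### Degenerations of stability conditions -/

/-- Image intervals with different indices are at least `1/2` apart, so an interval of radius `1/8`
meets at most one of them. All relevant original phases then share one window shorter than `1`, on
which a single functional is positive. -/
theorem IsSupported.locallyFinite_map_of_window (h : CircleDeg1Lift) {a b ε : ℝ} (hε : 0 < ε)
    (hε' : ε ≤ 1) (hw : ∀ t ∈ P.phases, ∃ n : ℤ, t ∈ Set.Icc (a + n) (a + n + 1 - ε) ∧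
      h t ∈ Set.Icc (b + n) (b + n + 1 / 2)) : (P.map h).LocallyFinite := by
  refine hP.locallyFinite_map h (η := 1 / 8) (by norm_num) (by norm_num)
    (sin_pi_mul_half_pos hε hε') fun x => ?_
  by_cases hx : ∃ t ∈ P.phases, h t ∈ Set.Ioo (x - 1 / 8) (x + 1 / 8)
  · obtain ⟨t, ht, htx⟩ := hx
    obtain ⟨n, -, hn⟩ := hw t ht
    refine ⟨rayFunctional (a + n + (1 - ε) / 2), fun s hs hsx => ?_⟩
    obtain ⟨m, hm, hm'⟩ := hw s hs
    have h1 : n = m := by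
      have h2 : (n : ℝ) < m + 1 := by linarith [hn.1, hm'.2, htx.2, hsx.1]
      have h3 : (m : ℝ) < n + 1 := by linarith [hn.2, hm'.1, htx.1, hsx.2]
      have h4 : n < m + 1 := by exact_mod_cast h2
      have h5 : m < n + 1 := by exact_mod_cast h3
      omega
    rw [h1]
    exact le_rayFunctional_window hε hm
  · push Not at hx
    exact ⟨0, fun t ht ht' => (hx t ht ht').elim⟩

omit hP in
theorem stepLift_mem_Icc {φ ψ : ℝ} (hψ : ψ ∈ Set.Icc (0 : ℝ) 1) {t : ℝ}
    (ht : t ∈ Set.Ico φ (φ + 1)) :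
    (t = φ ∧ stepLift φ ψ t = φ - 1 / 2 + ψ) ∨ (φ < t ∧ stepLift φ ψ t = φ + 1 / 2) := by
  rcases ht.1.eq_or_lt with rfl | h
  · exact .inl ⟨rfl, stepLift_self hψ⟩
  · exact .inr ⟨h, stepLift_of_mem_Ioo ψ ⟨h, ht.2⟩⟩

/-- For `ψ ≥ 1/2` the value at `φ` is grouped with the plateau to its right: the window is `[φ, φ +
1 - ε]`, with images in `[φ, φ + 1/2]`. -/
theorem IsSupported.locallyFinite_stepLift_of_low {φ ψ ε : ℝ} (hψ : ψ ∈ Set.Icc (1 / 2 : ℝ) 1)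
    (hε : 0 < ε) (hε' : ε ≤ 1 / 2) (h : ∀ t ∈ Set.Ioo (φ - ε) φ, t ∉ P.phases) :
    (P.map (stepLift φ ψ)).LocallyFinite := by
  refine hP.locallyFinite_map_of_window _ (a := φ) (b := φ) hε (by linarith) fun t ht => ?_
  obtain ⟨n, s, hs, rfl⟩ := exists_int_add_mem_Ico φ t
  rw [Slicing.add_int_mem_phases_iff] at ht
  have h1 : s ≤ φ + 1 - ε := not_lt.1 fun h1 => h (s - 1) ⟨by linarith, by linarith [hs.2]⟩ (by
    rw [← Slicing.add_int_mem_phases_iff 1]; push_cast; rwa [sub_add_cancel])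
  refine ⟨n, ⟨by linarith [hs.1], by linarith⟩, ?_⟩
  rw [(stepLift φ ψ).map_add_int]
  rcases stepLift_mem_Icc ⟨by linarith [hψ.1], hψ.2⟩ hs with ⟨-, h2⟩ | ⟨-, h2⟩ <;> rw [h2] <;>
    constructor <;> linarith [hψ.1, hψ.2]

/-- For `ψ ≤ 1/2` the value at `φ + 1` is grouped with the plateau to its left: the window is `[φ +
ε, φ + 1]`, with images in `[φ + 1/2, φ + 1]`. -/
theorem IsSupported.locallyFinite_stepLift_of_high {φ ψ ε : ℝ} (hψ : ψ ∈ Set.Icc (0 : ℝ) (1 / 2))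
    (hε : 0 < ε) (hε' : ε ≤ 1 / 2) (h : ∀ t ∈ Set.Ioo φ (φ + ε), t ∉ P.phases) :
    (P.map (stepLift φ ψ)).LocallyFinite := by
  refine hP.locallyFinite_map_of_window _ (a := φ + ε) (b := φ + 1 / 2) hε (by linarith)
    fun t ht => ?_
  obtain ⟨n, s, hs, rfl⟩ := exists_int_add_mem_Ico φ t
  rw [Slicing.add_int_mem_phases_iff] at ht
  rw [(stepLift φ ψ).map_add_int]
  rcases stepLift_mem_Icc ⟨hψ.1, by linarith [hψ.2]⟩ hs with ⟨h1, h2⟩ | ⟨h1, h2⟩ <;> rw [h2]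
  · refine ⟨n - 1, ?_, ?_⟩ <;> push_cast <;> constructor <;> linarith [hψ.1, hψ.2]
  · have h3 : φ + ε ≤ s := not_lt.1 fun h3 => h s ⟨h1, h3⟩ ht
    refine ⟨n, ?_, ?_⟩ <;> constructor <;> linarith [hs.2]

theorem IsSupported.locallyFinite_stepLift {φ ψ ε : ℝ} (hε : 0 < ε) (hε' : ε ≤ 1 / 2)
    (h : LaxGap P φ ψ ε) : (P.map (stepLift φ ψ)).LocallyFinite := by
  rcases h with ⟨hψ, h⟩ | ⟨rfl, h⟩ | ⟨rfl, h⟩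
  · rcases le_total ψ (1 / 2) with h1 | h1
    · exact hP.locallyFinite_stepLift_of_high ⟨hψ.1, h1⟩ hε hε' fun t ht ht' =>
        ht.1.ne' (h t ht' (abs_lt.2 ⟨by linarith [ht.1], by linarith [ht.2]⟩))
    · exact hP.locallyFinite_stepLift_of_low ⟨h1, hψ.2⟩ hε hε' fun t ht ht' =>
        ht.2.ne (h t ht' (abs_lt.2 ⟨by linarith [ht.1], by linarith [ht.2]⟩))
  · exact hP.locallyFinite_stepLift_of_low (by norm_num) hε hε' h.1
  · exact hP.locallyFinite_stepLift_of_high (by norm_num) hε hε' h.1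

theorem IsSupported.stab_phaseLift {w : ℂ} (hw : ‖w‖ < 1) :
    ∃ hl : (P.map (phaseLift w hw)).LocallyFinite,
      IsStabilityCondition v ((⟨P.map (phaseLift w hw), hl⟩, (nMap w).comp Z) : StabData C V) :=
  hP.stab_map (c := 1 - ‖w‖) (r := fun t => ‖rotFactor w t‖) (by linarith)
    fun t _ => ⟨one_sub_norm_le_norm_rotFactor w t, nMap_ray_eq w t⟩

theorem IsSupported.stab_stepLift {φ ψ ε : ℝ} (hε : 0 < ε) (h : ∀ t ∈ P.phases, ε ≤ |t - φ|) :
    ∃ hl : (P.map (stepLift φ ψ)).LocallyFinite, IsStabilityCondition v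
      ((⟨P.map (stepLift φ ψ), hl⟩, (nMap (ray (2 * φ))).comp Z) : StabData C V) := by
  have hpos := sin_pi_mul_half_pos (ε := 2 * min ε (1 / 2)) (by positivity)
    (by linarith [min_le_right ε (1 / 2)])
  rw [mul_div_cancel_left₀ _ two_ne_zero] at hpos
  refine hP.stab_map (c := 2 * Real.sin (Real.pi * min ε (1 / 2)))
    (r := fun t => ‖rotFactor (ray (2 * φ)) t‖) (by positivity) fun t ht => ⟨?_,
      nMap_ray_boundary φ ψ t⟩
  refine le_norm_rotFactor_boundary (by positivity) (min_le_right _ _) fun n => ?_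
  refine (min_le_left _ _).trans ?_
  have := h (t + ((-n : ℤ) : ℝ)) ((Slicing.add_int_mem_phases_iff (-n)).2 ht)
  push_cast at this
  rwa [show t + -(n : ℝ) - φ = t - φ - n by ring] at this

end Supported

end LaxStability

end

noncomputable section

open scoped ZeroObject

set_option linter.unusedSectionVars false

namespace LaxStability

/-! ### The slicings parametrised by the blown up disk -/

theorem bdry_arg {w : ℂ} (hw : ‖w‖ = 1) : bdry (Complex.arg w / Real.pi / 2) = w := by
  rw [bdry_eq_ray, mul_div_cancel₀ _ two_ne_zero]
  simpa [hw] using ray_arg_mul_norm w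

theorem arg_ray {a : ℝ} (ha : a ∈ Set.Ioc (-1 : ℝ) 1) : Complex.arg (ray a) / Real.pi = a := by
  rw [ray_eq', Complex.arg_exp_mul_I, (toIocMod_eq_self _).2,
    mul_div_cancel_left₀ _ Real.pi_ne_zero]
  constructor <;> nlinarith [Real.pi_pos, ha.1, ha.2]

theorem ray_add_arg {z : ℂ} (hz : ‖z‖ = 1) : ray (Complex.arg z / Real.pi) = z := by
  simpa [hz] using ray_arg_mul_norm z

theorem stepLift_add_int (φ ψ : ℝ) (n : ℤ) : stepLift (φ + n) ψ = stepLift φ ψ := by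
  ext t
  have h1 : ⌈t - (φ + n)⌉ = ⌈t - φ⌉ - n := by
    rw [← sub_sub, Int.ceil_sub_intCast]
  have h2 : (∃ m : ℤ, t - (φ + n) = m) ↔ ∃ m : ℤ, t - φ = m := by
    constructor
    · rintro ⟨m, hm⟩; exact ⟨m + n, by push_cast; linarith⟩
    · rintro ⟨m, hm⟩; exact ⟨m - n, by push_cast; linarith⟩
  rw [stepLift_apply, stepLift_apply, h1]
  by_cases h : ∃ m : ℤ, t - φ = m
  · rw [if_pos h, if_pos (h2.2 h)]; push_cast; ring
  · rw [if_neg h, if_neg (mt h2.1 h)]; push_cast; ring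

theorem rotFactor_bdry_ne_zero {φ t : ℝ} (h : t ∈ Set.Ioo φ (φ + 1)) :
    rotFactor (bdry φ) t ≠ 0 := by
  rw [ne_eq, rotFactor_eq_zero_iff, ← bdry_eq_ray, bdry_eq_bdry_iff]
  rintro ⟨n, hn⟩
  have h1 : (-1 : ℝ) < n := by linarith [h.2]
  have h2 : (n : ℝ) < 0 := by linarith [h.1]
  have h3 : -1 < n := by exact_mod_cast h1
  have h4 : n < 0 := by exact_mod_cast h2
  omega

section BlownUp

variable {C : Type u₁} [Category.{u₂} C] [Preadditive C] [HasZeroObject C] [HasShift C ℤ]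
  [∀ n : ℤ, (shiftFunctor C n).Additive] [Pretriangulated C] {P : Slicing C}

namespace BlownUpDisk

/-- The image of a point of the blown up disk in the disk. -/
abbrev pt (p : BlownUpDisk P) : ℂ := p.1.1

/-- The direction in which a point of the blown up disk is seen from a centre of the blow-up. -/
abbrev dir (p : BlownUpDisk P) : blowUpCentre P → ℂ := p.1.2

theorem continuous_pt : Continuous (pt : BlownUpDisk P → ℂ) :=
  continuous_fst.comp continuous_subtype_val

theorem continuous_dir : Continuous (dir : BlownUpDisk P → blowUpCentre P → ℂ) :=
  continuous_snd.comp continuous_subtype_val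

theorem norm_dir (p : BlownUpDisk P) (s : blowUpCentre P) : ‖p.dir s‖ = 1 := (p.2.1 s).1

theorem pt_sub (p : BlownUpDisk P) (s : blowUpCentre P) :
    p.pt - s = (‖p.pt - s‖ : ℂ) * p.dir s := (p.2.1 s).2

open Classical in
/-- The phase of the objects becoming massless; it is zero if there are none. -/
def angle (p : BlownUpDisk P) : ℝ :=
  if h : p.pt ∈ blowUpCentre P then tangentPhase p.pt (p.dir ⟨p.pt, h⟩) else 0

theorem allowedPhase (p : BlownUpDisk P) {φ : ℝ} (h : p.pt = bdry φ) (hs : bdry φ ∈ blowUpCentre P) :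
    AllowedPhase P φ p.angle := by
  rw [angle, dif_pos (by rwa [h])]
  exact p.2.2.2 _ φ h

open Classical in
/-- The map of phases given by a point of the blown up disk. -/
def lift (p : BlownUpDisk P) : CircleDeg1Lift :=
  if h : ‖p.pt‖ < 1 then phaseLift p.pt h
  else stepLift (Complex.arg p.pt / Real.pi / 2) p.angle

theorem lift_of_norm_lt {p : BlownUpDisk P} (h : ‖p.pt‖ < 1) : p.lift = phaseLift p.pt h :=
  dif_pos h

theorem lift_of_eq_bdry {p : BlownUpDisk P} {φ : ℝ} (h : p.pt = bdry φ) :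
    p.lift = stepLift φ p.angle := by
  rw [lift, dif_neg (by rw [h, norm_bdry]; exact lt_irrefl 1)]
  have h1 := bdry_arg (w := p.pt) (by rw [h, norm_bdry])
  obtain ⟨n, hn⟩ := bdry_eq_bdry_iff.1 (h1.trans h)
  rw [hn, stepLift_add_int]

/-- The direction in which the ray of phase `t` is rotated. -/
def factor (p : BlownUpDisk P) (t : ℝ) : ℂ :=
  open Classical in
  if h : ray (2 * t) ∈ blowUpCentre P then
    -(starRingEnd ℂ) (ray (2 * t)) * p.dir ⟨ray (2 * t), h⟩
  else rotFactor p.pt t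

theorem continuous_factor (t : ℝ) : Continuous fun p : BlownUpDisk P => p.factor t := by
  by_cases h : ray (2 * t) ∈ blowUpCentre P
  · simp only [factor, dif_pos h]
    exact continuous_const.mul ((continuous_apply _).comp continuous_dir)
  · simp only [factor, dif_neg h, rotFactor]
    exact continuous_const.sub (continuous_pt.mul continuous_const)

variable [IsTriangulated C]

theorem norm_pt_le (p : BlownUpDisk P) : ‖p.pt‖ ≤ 1 := norm_le_one_of_mem_quotDiskSet p.2.2.1

theorem exists_pt_eq_bdry {p : BlownUpDisk P} (h : ¬ ‖p.pt‖ < 1) : ∃ φ, p.pt = bdry φ := by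
  obtain ⟨φ, -, h⟩ := exists_bdry_eq (le_antisymm p.norm_pt_le (not_lt.1 h))
  exact ⟨φ, h⟩

theorem lift_eq_phaseFun (p : BlownUpDisk P) {t : ℝ} (h : rotFactor p.pt t ≠ 0) :
    p.lift t = phaseFun p.pt t := by
  by_cases h1 : ‖p.pt‖ < 1
  · rw [lift_of_norm_lt h1]; rfl
  · obtain ⟨φ, hφ⟩ := exists_pt_eq_bdry h1
    rw [lift_of_eq_bdry hφ, hφ, bdry_eq_ray]
    refine stepLift_eq_phaseFun _ ?_
    rwa [← bdry_eq_ray, ← hφ]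

/-- Away from the centre `s = e^{2πit}`, the rotation factor is `‖p.pt - s‖` times `-conj s` times
the direction seen from `s`. Dropping the positive length changes no argument and leaves a function
that does not vanish over `s` either. -/
theorem factor_spec (p : BlownUpDisk P) {t : ℝ} (ht : t ∈ P.phases) :
    0 ≤ (p.factor t).re ∧ p.factor t ≠ 0 ∧ p.lift t = t + Complex.arg (p.factor t) / Real.pi := by
  by_cases h0 : rotFactor p.pt t = 0
  · have h1 : p.pt = ray (2 * t) := rotFactor_eq_zero_iff.1 h0
    -- A boundary point whose phase occurs cannot lie in `diskSet P`, so it is a blow-up centre.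
    have h2 : ray (2 * t) ∈ blowUpCentre P := by
      refine ⟨h1 ▸ p.2.2.1, ?_⟩
      rw [← bdry_eq_ray, bdry_mem_diskSet_iff]
      rintro ⟨ε, hε, h⟩
      have := h t ht
      rw [sub_self, abs_zero] at this
      linarith
    have h3 := (p.allowedPhase (φ := t) (by rw [h1, bdry_eq_ray])
      (by rwa [bdry_eq_ray])).mem_Icc
    have h4 : p.factor t = ray (p.angle - 1 / 2) := by
      -- The convention `-i w̄ u` in `tangentPhase` differs from the factor `-w̄ u` by `i`, a
      -- rotation by `1/2`; this matches the value `φ - 1/2 + ψ` of the step map.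
      have h5 : ray p.angle = Complex.I * p.factor t := by
        rw [angle, dif_pos (by rwa [h1]), tangentPhase, factor, dif_pos h2, one_div,
          inv_mul_eq_div, ray_add_arg]
        · simp only [h1]; ring
        · rw [norm_mul, norm_mul, norm_dir, RCLike.norm_conj, h1, norm_ray]; simp
      rw [sub_eq_add_neg, ray_add, h5, ray_neg]
      have : ray (1 / 2) = Complex.I := by
        apply Complex.ext
        · rw [ray_re, show Real.pi * (1 / 2) = Real.pi / 2 by ring, Real.cos_pi_div_two]; rfl
        · rw [ray_im, show Real.pi * (1 / 2) = Real.pi / 2 by ring, Real.sin_pi_div_two]; rfl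
      rw [this, mul_comm, ← mul_assoc, inv_mul_cancel₀ Complex.I_ne_zero, one_mul]
    rw [h4, arg_ray ⟨by linarith [h3.1], by linarith [h3.2]⟩,
      lift_of_eq_bdry (h1.trans (bdry_eq_ray t).symm), stepLift_self h3]
    refine ⟨?_, ray_ne_zero _, by ring⟩
    rw [ray_re]
    refine Real.cos_nonneg_of_neg_pi_div_two_le_of_le ?_ ?_ <;> nlinarith [Real.pi_pos, h3.1, h3.2]
  · rw [p.lift_eq_phaseFun h0, phaseFun]
    by_cases h2 : ray (2 * t) ∈ blowUpCentre P
    · have h3 : rotFactor p.pt t = (‖p.pt - ray (2 * t)‖ : ℂ) * p.factor t := by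
        rw [factor, dif_pos h2, mul_left_comm, ← p.pt_sub ⟨_, h2⟩, conj_ray, rotFactor, ray_neg]
        field_simp [ray_ne_zero]
        ring
      have h4 : 0 < ‖p.pt - ray (2 * t)‖ :=
        norm_pos_iff.2 (sub_ne_zero.2 fun h => h0 (rotFactor_eq_zero_iff.2 h))
      have h5 := rotFactor_re_nonneg p.norm_pt_le t
      rw [h3, Complex.re_ofReal_mul] at h5
      refine ⟨nonneg_of_mul_nonneg_right h5 h4, fun h => h0 (by rw [h3, h, mul_zero]), ?_⟩
      rw [h3, Complex.arg_real_mul _ h4]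
    · rw [factor, dif_neg h2]
      exact ⟨rotFactor_re_nonneg p.norm_pt_le t, h0, rfl⟩

theorem continuousAt_lift {p₀ : BlownUpDisk P} {t : ℝ}
    (h : t ∈ P.phases ∨ rotFactor p₀.pt t ≠ 0) :
    ContinuousAt (fun p : BlownUpDisk P => p.lift t) p₀ := by
  rcases h with h | h
  · have h1 : (fun p : BlownUpDisk P => p.lift t) =
        fun p => t + Complex.arg (p.factor t) / Real.pi := funext fun p => (p.factor_spec h).2.2
    rw [h1]
    refine continuousAt_const.add (ContinuousAt.div_const ?_ _)
    exact ContinuousAt.comp (f := fun p : BlownUpDisk P => p.factor t)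
      (Complex.continuousAt_arg (mem_slitPlane_of_re_nonneg (p₀.factor_spec h).1
        (p₀.factor_spec h).2.1)) (continuous_factor t).continuousAt
  · have h1 : ContinuousAt (fun p : BlownUpDisk P => phaseFun p.pt t) p₀ :=
      ContinuousAt.comp (f := pt) (g := fun w => phaseFun w t)
        (continuousAt_phaseFun p₀.norm_pt_le h) continuous_pt.continuousAt
    refine h1.congr ?_
    have h2 : ContinuousAt (fun p : BlownUpDisk P => rotFactor p.pt t) p₀ := by
      unfold rotFactor
      exact (continuous_const.sub (continuous_pt.mul continuous_const)).continuousAt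
    filter_upwards [h2.eventually_ne h] with p hp
    exact (p.lift_eq_phaseFun hp).symm

/-- Where the monotone limit is constant on `[a, b]`, nearby monotone maps are squeezed on all of
`[a, b]` by their values at the two ends. -/
theorem eventually_abs_lift_sub_le_of_window {p₀ : BlownUpDisk P} {a b : ℝ}
    (h : p₀.lift a = p₀.lift b) (ha : a ∈ P.phases ∨ rotFactor p₀.pt a ≠ 0)
    (hb : b ∈ P.phases ∨ rotFactor p₀.pt b ≠ 0) {δ : ℝ} (hδ : 0 < δ) :
    ∀ᶠ p in 𝓝 p₀, ∀ (t : ℝ) (n : ℤ), t + n ∈ Set.Icc a b → |p.lift t - p₀.lift t| ≤ δ := by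
  filter_upwards [Metric.continuousAt_iff'.1 (continuousAt_lift ha) δ hδ,
    Metric.continuousAt_iff'.1 (continuousAt_lift hb) δ hδ] with p h1 h2 t n ht
  have h3 : p.lift t - p₀.lift t = p.lift (t + n) - p₀.lift (t + n) := by
    rw [p.lift.map_add_int, p₀.lift.map_add_int]; ring
  rw [Real.dist_eq, abs_lt] at h1 h2
  have h4 := p.lift.monotone ht.1
  have h5 := p.lift.monotone ht.2
  have h6 := p₀.lift.monotone ht.1
  have h7 := p₀.lift.monotone ht.2
  rw [h3, abs_le]
  constructor <;> linarith [h1.1, h2.2]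

end BlownUpDisk

/-! ### Uniform convergence over windows of phases, and the lax support property at boundary points.
-/

variable {V : Type u₃} [NormedAddCommGroup V] [InnerProductSpace ℝ V] {L : Submodule ℤ V}
  {v : K0 C →+ L} {Z : V →L[ℝ] ℂ} {k κ : ℝ} [IsTriangulated C]

namespace BlownUpDisk

/-- Modulo `ℤ` all phases lie in one interval where the step map is constant, or at a single point
`c`. An isolated `φ` takes the role of `c`. With a gap below, `ψ = 1` makes `φ` the left end of the
plateau; with a gap above, `ψ = 0` makes `φ + 1` its right end. If `φ` is not in the closure of the
phases, the plateau alone suffices. -/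
theorem exists_window (hP : IsSupported v P Z k κ) {p₀ : BlownUpDisk P} {φ : ℝ}
    (hφ : p₀.pt = bdry φ) :
    ∃ a b c : ℝ, p₀.lift a = p₀.lift b ∧ (a ∈ P.phases ∨ rotFactor p₀.pt a ≠ 0) ∧
      (b ∈ P.phases ∨ rotFactor p₀.pt b ≠ 0) ∧ (c ∈ P.phases ∨ rotFactor p₀.pt c ≠ 0) ∧
      ∀ t ∈ P.phases, ∃ n : ℤ, t + n ∈ Set.Icc a b ∨ t + n ∈ Set.Icc c c := by
  have hperiod : ∀ a b c : ℝ, (∀ t ∈ P.phases, t ∈ Set.Ico φ (φ + 1) →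
      (t ∈ Set.Icc a b ∨ t ∈ Set.Icc c c) ∨ (t + 1 ∈ Set.Icc a b ∨ t + 1 ∈ Set.Icc c c)) →
      ∀ t ∈ P.phases, ∃ n : ℤ, t + n ∈ Set.Icc a b ∨ t + n ∈ Set.Icc c c := by
    intro a b c h t ht
    obtain ⟨n, s, hs, rfl⟩ := exists_int_add_mem_Ico φ t
    rw [Slicing.add_int_mem_phases_iff] at ht
    rcases h s ht hs with h | h
    · exact ⟨-n, by push_cast; rwa [add_neg_cancel_right]⟩
    · exact ⟨-n + 1, by push_cast; rwa [← add_assoc, add_neg_cancel_right]⟩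
  have hsub : ∀ t ∈ P.phases, t - 1 ∈ P.phases := fun t ht => by
    have := (Slicing.add_int_mem_phases_iff (-1)).2 ht
    push_cast at this; exact this
  have hrot : ∀ t ∈ Set.Ioo φ (φ + 1), rotFactor p₀.pt t ≠ 0 := fun t ht => by
    rw [hφ]; exact rotFactor_bdry_ne_zero ht
  have hlift := lift_of_eq_bdry hφ
  by_cases hs : bdry φ ∈ blowUpCentre P
  · have hφP := hP.mem_phases_of_mem_blowUpCentre hs
    obtain ⟨ε, hε, hε', h | ⟨h1, h⟩ | ⟨h1, h⟩⟩ :=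
      (p₀.allowedPhase hφ hs).exists_laxGap hs.1
    · have ha : φ + ε ∈ Set.Ioo φ (φ + 1) := ⟨by linarith, by linarith⟩
      have hb : φ + 1 - ε ∈ Set.Ioo φ (φ + 1) := ⟨by linarith, by linarith⟩
      refine ⟨φ + ε, φ + 1 - ε, φ, ?_, .inr (hrot _ ha), .inr (hrot _ hb), .inl hφP,
        hperiod _ _ _ fun t ht ht' => ?_⟩
      · rw [hlift, stepLift_of_mem_Ioo _ ha, stepLift_of_mem_Ioo _ hb]
      · left
        by_cases h3 : t < φ + ε
        · have h4 := h.2 t ht (abs_lt.2 ⟨by linarith [ht'.1], by linarith⟩)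
          exact .inr ⟨h4.ge, h4.le⟩
        · refine .inl ⟨not_lt.1 h3, not_lt.1 fun h4 => ?_⟩
          have h5 := h.2 (t - 1) (hsub t ht) (abs_lt.2 ⟨by linarith, by linarith [ht'.2]⟩)
          linarith [ht'.2]
    · have hb : φ + 1 - ε ∈ Set.Ioo φ (φ + 1) := ⟨by linarith, by linarith⟩
      refine ⟨φ, φ + 1 - ε, φ, ?_, .inl hφP, .inr (hrot _ hb), .inl hφP,
        hperiod _ _ _ fun t ht ht' => .inl (.inl ⟨ht'.1, not_lt.1 fun h4 => ?_⟩)⟩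
      · rw [hlift, h1, stepLift_self (by simp), stepLift_of_mem_Ioo _ hb]; ring
      · exact h.1 (t - 1) ⟨by linarith, by linarith [ht'.2]⟩ (hsub t ht)
    · have ha : φ + ε ∈ Set.Ioo φ (φ + 1) := ⟨by linarith, by linarith⟩
      have hφ1 : φ + 1 ∈ P.phases := by
        have := (Slicing.add_int_mem_phases_iff 1).2 hφP
        push_cast at this; exact this
      refine ⟨φ + ε, φ + 1, φ, ?_, .inr (hrot _ ha), .inl hφ1, .inl hφP,
        hperiod _ _ _ fun t ht ht' => ?_⟩
      · rw [hlift, h1, stepLift_of_mem_Ioo _ ha, (stepLift φ 0).map_add_one,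
          stepLift_self (by simp)]
        ring
      · rcases ht'.1.eq_or_lt with rfl | h3
        · exact .inr (.inl ⟨by linarith, le_rfl⟩)
        · exact .inl (.inl ⟨not_lt.1 fun h4 => h.1 t ⟨h3, h4⟩ ht, ht'.2.le⟩)
  · have hd : bdry φ ∈ diskSet P := by
      by_contra h
      exact hs ⟨hφ ▸ p₀.2.2.1, h⟩
    obtain ⟨ε, hε, h⟩ := bdry_mem_diskSet_iff.1 hd
    have hm := min_le_left ε (1 / 2)
    have hm' := min_le_right ε (1 / 2)
    have hm0 : 0 < min ε (1 / 2) := by positivity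
    have ha : φ + min ε (1 / 2) ∈ Set.Ioo φ (φ + 1) := ⟨by linarith, by linarith⟩
    have hb : φ + 1 - min ε (1 / 2) ∈ Set.Ioo φ (φ + 1) := ⟨by linarith, by linarith⟩
    refine ⟨_, _, _, ?_, .inr (hrot _ ha), .inr (hrot _ hb), .inr (hrot _ ha),
      hperiod _ _ _ fun t ht ht' => .inl (.inl ⟨?_, ?_⟩)⟩
    · rw [hlift, stepLift_of_mem_Ioo _ ha, stepLift_of_mem_Ioo _ hb]
    · have := h t ht
      rw [abs_of_nonneg (by linarith [ht'.1])] at this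
      linarith
    · have := h (t - 1) (hsub t ht)
      rw [abs_of_nonpos (by linarith [ht'.2])] at this
      linarith

theorem eventually_abs_lift_sub_le (hP : IsSupported v P Z k κ) (p₀ : BlownUpDisk P) {δ : ℝ}
    (hδ : 0 < δ) : ∀ᶠ p in 𝓝 p₀, ∀ t ∈ P.phases, |p.lift t - p₀.lift t| ≤ δ := by
  by_cases h : ‖p₀.pt‖ < 1
  · filter_upwards [continuous_pt.continuousAt.eventually (eventually_abs_phaseFun_sub_lt h hδ),
      (continuous_norm.comp continuous_pt).continuousAt.eventually_lt_const h] with p h1 h2 t _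
    rw [lift_of_norm_lt h, lift_of_norm_lt h2]
    exact (h1 t).le
  · obtain ⟨φ, hφ⟩ := exists_pt_eq_bdry h
    obtain ⟨a, b, c, he, ha, hb, hc, H⟩ := exists_window hP hφ
    filter_upwards [eventually_abs_lift_sub_le_of_window he ha hb hδ,
      eventually_abs_lift_sub_le_of_window rfl hc hc hδ] with p h1 h2 t ht
    obtain ⟨n, hn | hn⟩ := H t ht
    · exact h1 t n hn
    · exact h2 t n hn

theorem locallyFinite_lift (hP : IsSupported v P Z k κ) (p : BlownUpDisk P) :
    (P.map p.lift).LocallyFinite := by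
  by_cases h : ‖p.pt‖ < 1
  · rw [lift_of_norm_lt h]
    exact (hP.stab_phaseLift h).1
  · obtain ⟨φ, hφ⟩ := exists_pt_eq_bdry h
    rw [lift_of_eq_bdry hφ]
    by_cases hs : bdry φ ∈ blowUpCentre P
    · obtain ⟨ε, hε, hε', hg⟩ := (p.allowedPhase hφ hs).exists_laxGap hs.1
      exact hP.locallyFinite_stepLift hε hε' hg
    · have hd : bdry φ ∈ diskSet P := by
        by_contra h
        exact hs ⟨hφ ▸ p.2.2.1, h⟩
      obtain ⟨ε, hε, h⟩ := bdry_mem_diskSet_iff.1 hd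
      exact (hP.stab_stepLift hε h).1

end BlownUpDisk

/-- For `ψ = 1` the slice of phase `φ + 1/2` is the heart `P[φ, φ + 1)`, so its stable objects are
the simple objects appearing in `LowGap`. -/
theorem stepLift_one_preimage (φ : ℝ) : stepLift φ 1 ⁻¹' {φ + 1 / 2} = Set.Ico φ (φ + 1) := by
  ext s
  obtain ⟨m, r, hr, rfl⟩ := exists_int_add_mem_Ico φ s
  have h1 : stepLift φ 1 r = φ + 1 / 2 := by
    rcases stepLift_mem_Icc (ψ := 1) (by simp) hr with ⟨-, h⟩ | ⟨-, h⟩ <;> rw [h]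
    ring
  rw [Set.mem_preimage, Set.mem_singleton_iff, (stepLift φ 1).map_add_int, h1, add_eq_left,
    Int.cast_eq_zero]
  constructor
  · rintro rfl; simpa using hr
  · rintro ⟨h3, h4⟩
    have h5 : (-1 : ℝ) < m := by linarith [hr.2]
    have h6 : (m : ℝ) < 1 := by linarith [hr.1]
    have h7 : -1 < m := by exact_mod_cast h5
    have h8 : m < 1 := by exact_mod_cast h6
    omega

/-- For `ψ = 0` the slice of phase `φ + 1/2` is `P(φ, φ + 1]`, as in `HighGap`. -/
theorem stepLift_zero_preimage (φ : ℝ) : stepLift φ 0 ⁻¹' {φ + 1 / 2} = Set.Ioc φ (φ + 1) := by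
  ext s
  obtain ⟨m, r, hr, rfl⟩ : ∃ (m : ℤ) (r : ℝ), r ∈ Set.Ioc φ (φ + 1) ∧ s = r + m := by
    refine ⟨⌈s - φ⌉ - 1, s - (⌈s - φ⌉ - 1 : ℤ), ⟨?_, ?_⟩, by ring⟩ <;> push_cast
    · linarith [Int.ceil_lt_add_one (s - φ)]
    · linarith [Int.le_ceil (s - φ)]
  have h1 : stepLift φ 0 r = φ + 1 / 2 := by
    rcases hr.2.eq_or_lt with rfl | h2
    · rw [(stepLift φ 0).map_add_one, stepLift_self (by simp)]; ring
    · exact stepLift_of_mem_Ioo 0 ⟨hr.1, h2⟩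
  rw [Set.mem_preimage, Set.mem_singleton_iff, (stepLift φ 0).map_add_int, h1, add_eq_left,
    Int.cast_eq_zero]
  constructor
  · rintro rfl; simpa using hr
  · rintro ⟨h3, h4⟩
    have h5 : (-1 : ℝ) < m := by linarith [hr.2]
    have h6 : (m : ℝ) < 1 := by linarith [hr.1]
    have h7 : -1 < m := by exact_mod_cast h5
    have h8 : m < 1 := by exact_mod_cast h6
    omega

/-- By `lax_map` it suffices that phases of simple objects are either in `φ + ℤ` or at distance at
least `ε` from it. On one side of `φ` this is the absence of phases, on the other side the absence
of simple objects. -/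
theorem IsSupported.lax_stepLift (hP : IsSupported v P Z k κ) {φ ψ ε : ℝ} (hε : 0 < ε)
    (hε' : ε ≤ 1 / 2) (h : LaxGap P φ ψ ε) (hl : (P.map (stepLift φ ψ)).LocallyFinite) :
    IsLaxStabilityCondition v
      ((⟨P.map (stepLift φ ψ), hl⟩, (nMap (ray (2 * φ))).comp Z) : StabData C V) := by
  have hpos := sin_pi_mul_half_pos (ε := 2 * ε) (by positivity) (by linarith)
  rw [mul_div_cancel_left₀ _ two_ne_zero] at hpos
  have hsub : ∀ t ∈ P.phases, ∀ n : ℤ, t - n ∈ P.phases := fun t ht n => by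
    have := (Slicing.add_int_mem_phases_iff (-n)).2 ht
    push_cast at this; exact this
  have key : ∀ t : ℝ, (∀ n : ℤ, t - φ ≠ n → ε ≤ |t - φ - n|) →
      ‖rotFactor (ray (2 * φ)) t‖ = 0 ∨
        2 * Real.sin (Real.pi * ε) ≤ ‖rotFactor (ray (2 * φ)) t‖ := by
    intro t ht
    by_cases h0 : ∃ n : ℤ, t - φ = n
    · obtain ⟨n, hn⟩ := h0
      left
      rw [norm_eq_zero, rotFactor_eq_zero_iff, ← bdry_eq_ray, ← bdry_eq_ray, bdry_eq_bdry_iff]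
      exact ⟨-n, by push_cast; linarith⟩
    · push Not at h0
      exact .inr (le_norm_rotFactor_boundary hε hε' fun n => ht n (h0 n))
  refine hP.lax_map (c := 2 * Real.sin (Real.pi * ε)) (r := fun t => ‖rotFactor (ray (2 * φ)) t‖)
    (by positivity) (fun t ht => ⟨norm_nonneg _, nMap_ray_boundary φ ψ t⟩) ?_ hl
  rintro φ' t X rfl hX hs
  have hX0 : ¬ IsZero X := fun h0 => by
    obtain ⟨h1, h2⟩ := hs
    exact h2.1 ((isZero_mk_iff h1).2 h0)
  have ht : t ∈ P.phases := fun h0 => hX0 (h0 X hX)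
  refine key t fun n hn => ?_
  by_contra! hlt
  rcases h with ⟨hψ, h⟩ | ⟨rfl, h⟩ | ⟨rfl, h⟩
  · exact hn (by linarith [h (t - n) (hsub t ht n) (by rwa [sub_right_comm])])
  · have hlt := abs_lt.1 hlt
    rcases lt_or_gt_of_ne hn with h1 | h1
    · exact h.1 (t - n) ⟨by linarith, by linarith⟩ (hsub t ht n)
    · have ht' : t ∈ stepLift (φ + n) 1 ⁻¹' {φ + n + 1 / 2} := by
        rw [stepLift_one_preimage]; exact ⟨by linarith, by linarith⟩
      rw [← stepLift_add_int φ 1 n, show stepLift (φ + n) 1 t = φ + n + 1 / 2 from ht',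
        stepLift_one_preimage] at hs
      exact (h.add_int n).2 X t hs hX ⟨by linarith, by linarith⟩
  · have hlt := abs_lt.1 hlt
    rcases lt_or_gt_of_ne hn with h1 | h1
    · have ht' : t ∈ stepLift (φ + (n - 1 : ℤ)) 0 ⁻¹' {φ + (n - 1 : ℤ) + 1 / 2} := by
        rw [stepLift_zero_preimage]; push_cast; exact ⟨by linarith, by linarith⟩
      rw [← stepLift_add_int φ 0 (n - 1),
        show stepLift (φ + (n - 1 : ℤ)) 0 t = φ + (n - 1 : ℤ) + 1 / 2 from ht',
        stepLift_zero_preimage] at hs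
      refine (h.add_int (n - 1)).2 X t hs hX ⟨?_, ?_⟩ <;> push_cast <;> linarith
    · exact h.1 (t - n) ⟨by linarith, by linarith⟩ (hsub t ht n)

end BlownUp

end LaxStability

end

noncomputable section

open scoped ZeroObject

set_option linter.unusedSectionVars false

namespace LaxStability

/-! ### The embedding of the blown up disk -/

section Topology

variable {C : Type u₁} [Category.{u₂} C] [Preadditive C] [HasZeroObject C] [HasShift C ℤ]
  [∀ n : ℤ, (shiftFunctor C n).Additive] [Pretriangulated C] [IsTriangulated C]

instance : T0Space (Slice C) := by
  refine ⟨fun P Q h => Subtype.ext (eq_of_sliceEDist_eq_zero ?_)⟩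
  exact EMetric.inseparable_iff.1 h

theorem tendsto_slice_iff {ι : Type*} {l : Filter ι} {f : ι → Slice C} {P : Slice C} :
    Filter.Tendsto f l (𝓝 P) ↔
      ∀ ε > 0, ∀ᶠ i in l, sliceEDist (f i).1 P.1 < ENNReal.ofReal ε := by
  rw [EMetric.tendsto_nhds]
  constructor
  · exact fun h ε hε => h _ (ENNReal.ofReal_pos.2 hε)
  · intro h ε hε
    obtain ⟨r, hr, hrε⟩ : ∃ r : ℝ, 0 < r ∧ ENNReal.ofReal r ≤ ε := by
      obtain ⟨r, h1, h2⟩ := ENNReal.lt_iff_exists_real_btwn.1 hε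
      exact ⟨r, ENNReal.ofReal_pos.1 h2.1, h2.2.le⟩
    exact (h r hr).mono fun i hi => hi.trans_le hrε

theorem tendsto_phiPlus {ι : Type*} {l : Filter ι} {f : ι → Slice C} {P : Slice C}
    (h : Filter.Tendsto f l (𝓝 P)) {X : C} (hX : ¬ IsZero X) :
    Filter.Tendsto (fun i => (f i).1.phiPlus X) l (𝓝 (P.1.phiPlus X)) := by
  rw [Metric.tendsto_nhds]
  intro ε hε
  exact (tendsto_slice_iff.1 h ε hε).mono fun i hi => abs_phiPlus_sub_lt hi hX

theorem tendsto_slice_map {ι : Type*} {l : Filter ι} {P : Slicing C} {f : ι → CircleDeg1Lift}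
    {g : CircleDeg1Lift} (hf : ∀ i, (P.map (f i)).LocallyFinite) (hg : (P.map g).LocallyFinite)
    (h : ∀ ε > 0, ∀ᶠ i in l, ∀ t ∈ P.phases, |f i t - g t| ≤ ε) :
    Filter.Tendsto (β := Slice C) (fun i => (⟨P.map (f i), hf i⟩ : Slice C)) l
      (𝓝 (⟨P.map g, hg⟩ : Slice C)) := by
  refine tendsto_slice_iff.2 fun ε hε => ?_
  refine (h (ε / 2) (half_pos hε)).mono fun i hi => ?_
  exact (sliceEDist_map_le P _ _ hi).trans_lt
    ((ENNReal.ofReal_lt_ofReal_iff hε).2 (half_lt_self hε))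

variable {V : Type u₃} [NormedAddCommGroup V] [InnerProductSpace ℝ V] {L : Submodule ℤ V}
  [DiscreteTopology L] {v : K0 C →+ L}

theorem exists_of_mem_phases {P : Slicing C} {t : ℝ} (h : t ∈ P.phases) :
    ∃ X, P.P t X ∧ ¬ IsZero X := by
  simpa [Slicing.phases, Slicing.SliceZero] using h

/-- Cramer's rule in the plane. -/
theorem complex_combination (p q w : ℂ) :
    w * (((starRingEnd ℂ) p * q).im : ℂ) =
      (((starRingEnd ℂ) w * q).im : ℂ) * p + (((starRingEnd ℂ) p * w).im : ℂ) * q := by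
  apply Complex.ext <;> simp <;> ring

/-- Two phases that differ modulo `ℤ` give classes whose charges are linearly independent over `ℝ`.
-/
theorem charge_surjective (σ : Stab v) (hσ : (phaseDiagram σ.1.slicing).Nontrivial) :
    Function.Surjective σ.1.charge := by
  obtain ⟨x, ⟨t, rfl, ht⟩, y, ⟨s, rfl, hs⟩, hne⟩ := hσ
  obtain ⟨k, κ, hP⟩ := σ.2.isSupported
  obtain ⟨X, hX, hX0⟩ := exists_of_mem_phases ht
  obtain ⟨Y, hY, hY0⟩ := exists_of_mem_phases hs
  have hx := hP.κ_pos.trans_le (hP.le_norm _ _ hX hX0)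
  have hy := hP.κ_pos.trans_le (hP.le_norm _ _ hY hY0)
  have hD : ((starRingEnd ℂ) (ray t) * ray s).im ≠ 0 := by
    rw [conj_ray, mul_comm, ← ray_sub, ray_im]
    intro h
    obtain ⟨n, hn⟩ := Real.sin_eq_zero_iff.1 h
    rw [mul_comm, mul_right_inj' Real.pi_ne_zero] at hn
    exact hne (coe_eq_coe_iff.2 ⟨-n, by push_cast; linarith⟩)
  intro w
  have h1 := complex_combination (ray t) (ray s) w
  set D := ((starRingEnd ℂ) (ray t) * ray s).im
  set a := ((starRingEnd ℂ) w * ray s).im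
  set b := ((starRingEnd ℂ) (ray t) * w).im
  refine ⟨(a / D / ‖σ.1.charge (cls v X)‖) • cls v X + (b / D / ‖σ.1.charge (cls v Y)‖) • cls v Y,
    ?_⟩
  have hX' := hP.charge_eq _ _ hX
  have hY' := hP.charge_eq _ _ hY
  rw [map_add, map_smul, map_smul]
  have hD' : (D : ℂ) ≠ 0 := by exact_mod_cast hD
  have hx' : (‖σ.1.charge (cls v X)‖ : ℂ) ≠ 0 := by exact_mod_cast hx.ne'
  have hy' : (‖σ.1.charge (cls v Y)‖ : ℂ) ≠ 0 := by exact_mod_cast hy.ne'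
  rw [Complex.real_smul, Complex.real_smul]
  generalize (‖σ.1.charge (cls v X)‖ : ℝ) = x at *
  generalize (‖σ.1.charge (cls v Y)‖ : ℝ) = y at *
  rw [hX', hY']
  push_cast
  field_simp
  linear_combination -h1

namespace BlownUpDisk

variable (σ : Stab v)

/-- The degeneration of a stability condition given by a point of the blown up disk. -/
def point (p : BlownUpDisk σ.1.slicing) : StabData C V :=
  (⟨σ.1.slicing.map p.lift,
    locallyFinite_lift σ.2.isSupported.choose_spec.choose_spec p⟩, (nMap p.pt).comp σ.1.charge)

theorem point_slicing (p : BlownUpDisk σ.1.slicing) :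
    (point σ p).slicing = σ.1.slicing.map p.lift := rfl

theorem point_charge (p : BlownUpDisk σ.1.slicing) :
    (point σ p).charge = (nMap p.pt).comp σ.1.charge := rfl

theorem continuous_nMap_comp (Z : V →L[ℝ] ℂ) : Continuous fun w => (nMap w).comp Z :=
  continuous_nMap.clm_comp continuous_const

theorem continuous_point : Continuous (point σ) := by
  obtain ⟨k, κ, hP⟩ := σ.2.isSupported
  refine Continuous.prodMk ?_ ((continuous_nMap_comp _).comp continuous_pt)
  refine continuous_iff_continuousAt.2 fun p₀ => ?_
  exact tendsto_slice_map _ _ fun ε hε => eventually_abs_lift_sub_le hP p₀ hε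

theorem phiPlus_point {p : BlownUpDisk σ.1.slicing} {t : ℝ} {X : C} (hX : σ.1.slicing.P t X)
    (hX0 : ¬ IsZero X) : (point σ p).slicing.phiPlus X = p.lift t := by
  rw [point_slicing, Slicing.map_phiPlus _ hX0, Slicing.phiPlus_eq hX0 hX]

theorem norm_factor_of_mem {p : BlownUpDisk σ.1.slicing} {t : ℝ}
    (h : ray (2 * t) ∈ blowUpCentre σ.1.slicing) : ‖p.factor t‖ = 1 := by
  rw [factor, dif_pos h, norm_mul, norm_dir, norm_neg, RCLike.norm_conj, norm_ray, one_mul]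

variable {σ} in
theorem dir_eq (p : BlownUpDisk σ.1.slicing) {t : ℝ} (ht : t ∈ σ.1.slicing.phases)
    (h : ray (2 * t) ∈ blowUpCentre σ.1.slicing) :
    p.dir ⟨_, h⟩ = -ray (2 * t) * ray (p.lift t - t) := by
  rw [(p.factor_spec ht).2.2, add_sub_cancel_left, ray_add_arg (norm_factor_of_mem σ h), factor,
    dif_pos h, conj_ray]
  field_simp [ray_ne_zero]

theorem tendsto_of_tendsto_coordinates {P : Slicing C} {ι : Type*} {l : Filter ι}
    {p : ι → BlownUpDisk P} {p₀ : BlownUpDisk P}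
    (h : Filter.Tendsto (fun i => (p i).pt) l (𝓝 p₀.pt))
    (h' : ∀ s, Filter.Tendsto (fun i => (p i).dir s) l (𝓝 (p₀.dir s))) :
    Filter.Tendsto p l (𝓝 p₀) :=
  tendsto_subtype_rng.2 (h.prodMk_nhds (tendsto_pi_nhds.2 h'))

theorem charge_eq_of_tendsto {ι : Type*} {l : Filter ι} {f : ι → V →L[ℝ] ℂ} {g : V →L[ℝ] ℂ}
    (h : Filter.Tendsto f l (𝓝 g)) (x : V) : Filter.Tendsto (fun i => f i x) l (𝓝 (g x)) :=
  ((ContinuousLinearMap.apply ℝ ℂ x).continuous.tendsto g).comp h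

/-- The coordinates are recovered from the image: a vector of charge `1` is sent to `1 - p.pt`, and
the maximal phase of an object of phase `φ` gives the direction at the centre `e^{2πiφ}`. -/
theorem tendsto_of_tendsto_point (hσ : (phaseDiagram σ.1.slicing).Nontrivial) {ι : Type*}
    {l : Filter ι} {p : ι → BlownUpDisk σ.1.slicing} {p₀ : BlownUpDisk σ.1.slicing}
    (h : Filter.Tendsto (fun i => point σ (p i)) l (𝓝 (point σ p₀))) :
    Filter.Tendsto p l (𝓝 p₀) := by
  obtain ⟨k, κ, hP⟩ := σ.2.isSupported
  obtain ⟨x, hx⟩ := charge_surjective σ hσ 1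
  have h1 : Filter.Tendsto (fun i => (point σ (p i)).1) l (𝓝 (point σ p₀).1) :=
    (continuous_fst.tendsto _).comp h
  have h2 : Filter.Tendsto (fun i => (point σ (p i)).2) l (𝓝 (point σ p₀).2) :=
    (continuous_snd.tendsto _).comp h
  refine tendsto_of_tendsto_coordinates ?_ ?_
  · have h3 := (charge_eq_of_tendsto h2 x).const_sub 1
    have h4 : ∀ p, 1 - (point σ p).2 x = p.pt := fun p => by
      change 1 - nMap p.pt (σ.1.charge x) = _
      rw [hx, nMap_apply]; simp
    simpa only [h4] using h3
  · rintro ⟨s, hs⟩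
    obtain ⟨φ, -, rfl⟩ := exists_bdry_eq (norm_eq_one_of_mem_blowUpCentre hs)
    have ht := hP.mem_phases_of_mem_blowUpCentre hs
    obtain ⟨X, hX, hX0⟩ := exists_of_mem_phases ht
    have h3 := tendsto_phiPlus h1 hX0
    have h4 : ∀ p, (point σ p).1.1.phiPlus X = p.lift φ := fun p => phiPlus_point σ hX hX0
    simp only [h4] at h3
    simp only [bdry_eq_ray] at hs ⊢
    simp only [dir_eq _ ht hs]
    exact ((continuous_ray.tendsto _).comp (h3.sub_const φ)).const_mul _

theorem pt_eq_bdry_of_not_lt {P : Slicing C} {p : BlownUpDisk P} (h : ¬ ‖p.pt‖ < 1) :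
    ‖p.pt‖ = 1 := le_antisymm p.norm_pt_le (not_lt.1 h)

/-- The point of the blown up disk over a point of the open disk. -/
def ofInterior (P : Slicing C) (w : ℂ) (hw : ‖w‖ < 1) : BlownUpDisk P :=
  ⟨(w, fun s => (w - s) / ‖w - s‖), by
    have h0 : ∀ s ∈ blowUpCentre P, w - s ≠ 0 := fun s hs h => by
      rw [sub_eq_zero.1 h, norm_eq_one_of_mem_blowUpCentre hs] at hw
      exact lt_irrefl _ hw
    refine ⟨fun s => ⟨?_, ?_⟩, .inl (by simpa using hw), fun h => ?_⟩
    · rw [norm_div, Complex.norm_real, norm_norm, div_self (norm_ne_zero_iff.2 (h0 s s.2))]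
    · have : (‖w - s‖ : ℂ) ≠ 0 := by exact_mod_cast norm_ne_zero_iff.2 (h0 s s.2)
      exact (mul_div_cancel₀ _ this).symm
    · exact absurd hw (by rw [norm_eq_one_of_mem_blowUpCentre h]; exact lt_irrefl _)⟩

theorem eq_ofInterior {P : Slicing C} {p : BlownUpDisk P} (h : ‖p.pt‖ < 1) :
    p = ofInterior P p.pt h := by
  refine Subtype.ext (Prod.ext rfl (funext fun s => ?_))
  have h0 : (‖p.pt - s‖ : ℂ) ≠ 0 := by
    rw [Complex.ofReal_ne_zero, norm_ne_zero_iff, sub_ne_zero]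
    rintro h1
    rw [h1, norm_eq_one_of_mem_blowUpCentre s.2] at h
    exact lt_irrefl _ h
  exact (eq_div_iff h0).2 (by rw [mul_comm]; exact (p.pt_sub s).symm)

theorem angle_dir {φ ψ : ℝ} (hψ : ψ ∈ Set.Icc (0 : ℝ) 1) :
    tangentPhase (bdry φ) (-bdry φ * ray (ψ - 1 / 2)) = ψ := by
  have h2 : ray (1 / 2) = Complex.I := by
    apply Complex.ext
    · rw [ray_re, show Real.pi * (1 / 2) = Real.pi / 2 by ring, Real.cos_pi_div_two]; rfl
    · rw [ray_im, show Real.pi * (1 / 2) = Real.pi / 2 by ring, Real.sin_pi_div_two]; rfl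
  have h1 : -Complex.I * (starRingEnd ℂ) (bdry φ) * (-bdry φ * ray (ψ - 1 / 2)) = ray ψ := by
    rw [bdry_eq_ray, conj_ray, ray_sub, h2]
    field_simp [ray_ne_zero, Complex.I_ne_zero]
  rw [tangentPhase, h1, one_div, inv_mul_eq_div, arg_ray ⟨by linarith [hψ.1], hψ.2⟩]

open Classical in
/-- The point of the blown up disk over a point of the unit circle with a given phase of the
objects becoming massless. -/
def ofBdry (P : Slicing C) (φ ψ : ℝ) (hφ : bdry φ ∈ quotDiskSet P)
    (h : bdry φ ∈ blowUpCentre P → AllowedPhase P φ ψ) : BlownUpDisk P :=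
  ⟨(bdry φ, fun s => if bdry φ = s then -bdry φ * ray (ψ - 1 / 2)
      else (bdry φ - s) / ‖bdry φ - s‖), by
    refine ⟨fun s => ?_, hφ, fun hs φ' h' => ?_⟩
    · by_cases h0 : bdry φ = s
      · simp only [if_pos h0]
        refine ⟨?_, ?_⟩
        · rw [norm_mul, norm_ray, norm_neg, norm_bdry, one_mul]
        · simp [h0]
      · simp only [if_neg h0]
        have h1 := norm_ne_zero_iff.2 (sub_ne_zero.2 h0)
        have : (‖bdry φ - s‖ : ℂ) ≠ 0 := by exact_mod_cast h1
        refine ⟨?_, (mul_div_cancel₀ _ this).symm⟩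
        rw [norm_div, Complex.norm_real, norm_norm, div_self h1]
    · have h1 := h hs
      simp only [if_pos]
      rw [angle_dir h1.mem_Icc]
      obtain ⟨n, hn⟩ := bdry_eq_bdry_iff.1 h'.symm
      rw [hn]
      exact h1.add_int n⟩

theorem ofBdry_pt {P : Slicing C} {φ ψ : ℝ} (hφ : bdry φ ∈ quotDiskSet P)
    (h : bdry φ ∈ blowUpCentre P → AllowedPhase P φ ψ) : (ofBdry P φ ψ hφ h).pt = bdry φ := rfl

theorem ofBdry_angle {P : Slicing C} {φ ψ : ℝ} (hφ : bdry φ ∈ quotDiskSet P)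
    (h : bdry φ ∈ blowUpCentre P → AllowedPhase P φ ψ) (hs : bdry φ ∈ blowUpCentre P) :
    (ofBdry P φ ψ hφ h).angle = ψ := by
  have h1 : (ofBdry P φ ψ hφ h).pt ∈ blowUpCentre P := hs
  rw [angle, dif_pos h1]
  change tangentPhase (bdry φ) (if bdry φ = bdry φ then _ else _) = ψ
  rw [if_pos rfl, angle_dir (h hs).mem_Icc]

/-- Over a boundary point that is not a centre, `φ` is not a phase and `ψ` is irrelevant. -/
theorem point_eq_of_angle {p : BlownUpDisk σ.1.slicing} {φ ψ : ℝ} (hp : p.pt = bdry φ)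
    (h : bdry φ ∈ blowUpCentre σ.1.slicing → p.angle = ψ) :
    (point σ p).slicing = σ.1.slicing.map (stepLift φ ψ) := by
  rw [point_slicing, lift_of_eq_bdry hp]
  by_cases hs : bdry φ ∈ blowUpCentre σ.1.slicing
  · rw [h hs]
  · refine Slicing.map_congr fun t ht => ?_
    have h1 : rotFactor (ray (2 * φ)) t ≠ 0 := fun h0 => hs (by
      rw [bdry_eq_ray, rotFactor_eq_zero_iff.1 h0]
      rw [rotFactor_eq_zero_iff, ← bdry_eq_ray] at h0
      refine ⟨by rw [← h0, ← hp]; exact p.2.2.1, ?_⟩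
      rw [← bdry_eq_ray, bdry_mem_diskSet_iff]
      rintro ⟨ε, hε, h2⟩
      have := h2 t ht
      rw [sub_self, abs_zero] at this
      linarith)
    rw [stepLift_eq_phaseFun _ h1, stepLift_eq_phaseFun _ h1]

theorem isLax_point (p : BlownUpDisk σ.1.slicing) : IsLaxStabilityCondition v (point σ p) := by
  obtain ⟨k, κ, hP⟩ := σ.2.isSupported
  by_cases h : ‖p.pt‖ < 1
  · obtain ⟨hl, h1⟩ := hP.stab_phaseLift h
    have h2 : point σ p = (⟨σ.1.slicing.map (phaseLift p.pt h), hl⟩,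
        (nMap p.pt).comp σ.1.charge) := by
      refine Prod.ext (Subtype.ext ?_) rfl
      change σ.1.slicing.map p.lift = _
      rw [lift_of_norm_lt h]
    rw [h2]
    exact h1.isLax
  · obtain ⟨φ, hφ⟩ := exists_pt_eq_bdry h
    have hlf : (σ.1.slicing.map (stepLift φ p.angle)).LocallyFinite := by
      rw [← point_eq_of_angle σ hφ fun _ => rfl]; exact (point σ p).1.2
    have h2 : point σ p = (⟨σ.1.slicing.map (stepLift φ p.angle), hlf⟩,
        (nMap (ray (2 * φ))).comp σ.1.charge) := by
      refine Prod.ext (Subtype.ext (point_eq_of_angle σ hφ fun _ => rfl)) ?_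
      rw [← bdry_eq_ray, ← hφ]; rfl
    rw [h2]
    by_cases hs : bdry φ ∈ blowUpCentre σ.1.slicing
    · obtain ⟨ε, hε, hε', hg⟩ := (p.allowedPhase hφ hs).exists_laxGap hs.1
      exact hP.lax_stepLift hε hε' hg hlf
    · have hd : bdry φ ∈ diskSet σ.1.slicing := by
        by_contra h
        exact hs ⟨hφ ▸ p.2.2.1, h⟩
      obtain ⟨ε, hε, h⟩ := bdry_mem_diskSet_iff.1 hd
      exact (hP.stab_stepLift hε h).2.isLax

theorem isStab_point {p : BlownUpDisk σ.1.slicing} (h : p.pt ∈ diskSet σ.1.slicing) :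
    IsStabilityCondition v (point σ p) := by
  obtain ⟨k, κ, hP⟩ := σ.2.isSupported
  by_cases h0 : ‖p.pt‖ < 1
  · obtain ⟨hl, h1⟩ := hP.stab_phaseLift h0
    have h2 : point σ p = (⟨σ.1.slicing.map (phaseLift p.pt h0), hl⟩,
        (nMap p.pt).comp σ.1.charge) := by
      refine Prod.ext (Subtype.ext ?_) rfl
      change σ.1.slicing.map p.lift = _
      rw [lift_of_norm_lt h0]
    rw [h2]
    exact h1
  · obtain ⟨φ, hφ⟩ := exists_pt_eq_bdry h0
    rw [hφ] at h
    obtain ⟨ε, hε, h⟩ := bdry_mem_diskSet_iff.1 h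
    obtain ⟨hl, h1⟩ := hP.stab_stepLift (ψ := p.angle) hε h
    have h2 : point σ p = (⟨σ.1.slicing.map (stepLift φ p.angle), hl⟩,
        (nMap (ray (2 * φ))).comp σ.1.charge) := by
      refine Prod.ext (Subtype.ext (point_eq_of_angle σ hφ fun _ => rfl)) ?_
      rw [← bdry_eq_ray, ← hφ]; rfl
    rw [h2]
    exact h1

/-- Over a centre the phase `φ` occurs, and the objects of that phase acquire charge zero. -/
theorem not_isStab_point {p : BlownUpDisk σ.1.slicing} (h : p.pt ∉ diskSet σ.1.slicing) :
    ¬ IsStabilityCondition v (point σ p) := by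
  obtain ⟨k, κ, hP⟩ := σ.2.isSupported
  intro h1
  obtain ⟨k', κ', hP'⟩ := h1.isSupported
  have h0 : ¬ ‖p.pt‖ < 1 := fun h0 => h (.inl (by simpa using h0))
  obtain ⟨φ, hφ⟩ := exists_pt_eq_bdry h0
  have hs : bdry φ ∈ blowUpCentre σ.1.slicing := ⟨hφ ▸ p.2.2.1, hφ ▸ h⟩
  obtain ⟨X, hX, hX0⟩ := exists_of_mem_phases (hP.mem_phases_of_mem_blowUpCentre hs)
  refine hX0 (hP'.isZero_of_eq_zero (φ := p.lift φ) (X := X) ?_ ?_)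
  · rw [point_slicing, Slicing.map_P]
    exact Slicing.cl_single (I := p.lift ⁻¹' {p.lift φ}) rfl hX
  · change nMap p.pt (σ.1.charge (cls v X)) = 0
    rw [hP.charge_eq _ _ hX, ← Complex.real_smul, map_smul, hφ, bdry_eq_ray, nMap_ray,
      rotFactor_eq_zero_iff.2 rfl]
    simp

theorem dense_interior (P : Slicing C) {κ k : ℝ} {Z : V →L[ℝ] ℂ} (hP : IsSupported v P Z k κ) :
    Dense {p : BlownUpDisk P | ‖p.pt‖ < 1} := by
  intro p₀
  by_cases h : ‖p₀.pt‖ < 1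
  · exact subset_closure h
  have hn : ‖p₀.pt‖ = 1 := le_antisymm p₀.norm_pt_le (not_lt.1 h)
  obtain ⟨φ, hφ⟩ := exists_pt_eq_bdry h
  -- The direction rotated so that the inward normal becomes `1`; it points into the closed
  -- half-plane because allowed phases lie in `[0, 1]`.
  obtain ⟨e, he, hen, hes⟩ : ∃ e : ℂ, 0 ≤ e.re ∧ ‖e‖ = 1 ∧
      ∀ hs : p₀.pt ∈ blowUpCentre P, p₀.dir ⟨p₀.pt, hs⟩ = -p₀.pt * e := by
    by_cases hs : p₀.pt ∈ blowUpCentre P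
    · have hs' : bdry φ ∈ blowUpCentre P := hφ ▸ hs
      have ht := hP.mem_phases_of_mem_blowUpCentre hs'
      have hs'' : ray (2 * φ) ∈ blowUpCentre P := by rwa [← bdry_eq_ray]
      have h1 : p₀.pt = ray (2 * φ) := by rw [hφ, bdry_eq_ray]
      refine ⟨p₀.factor φ, (p₀.factor_spec ht).1, ?_, fun _ => ?_⟩
      · rw [factor, dif_pos hs'', norm_mul, norm_dir, norm_neg, RCLike.norm_conj, norm_ray,
          one_mul]
      · rw [factor, dif_pos hs'', conj_ray]
        simp only [h1]
        field_simp [ray_ne_zero]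
    · exact ⟨1, by simp, by simp, fun h => absurd h hs⟩
  -- The summand `ρ` added to `e` bends the path inwards. It leaves the limiting direction unchanged
  -- and is needed when `e` is tangent to the circle, i.e. `e.re = 0`.
  let z : ℝ → ℂ := fun ρ => p₀.pt * (1 - ρ * (e + ρ))
  have hz : Filter.Tendsto z (𝓝[>] 0) (𝓝 p₀.pt) := by
    have : Continuous z := by fun_prop
    have h2 := (this.tendsto 0).mono_left (nhdsWithin_le_nhds (s := Set.Ioi (0 : ℝ)))
    simpa [z] using h2
  have hz1 : ∀ᶠ ρ in 𝓝[>] (0 : ℝ), ‖z ρ‖ < 1 := by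
    filter_upwards [Ioo_mem_nhdsGT (one_pos : (0 : ℝ) < 1)] with ρ hρ
    have h1 : ‖z ρ‖ ^ 2 = 1 - ρ ^ 2 - 2 * ρ * e.re * (1 - ρ ^ 2) + ρ ^ 4 := by
      have h2 : e.re ^ 2 + e.im ^ 2 = 1 := by
        have := Complex.sq_norm e
        rw [hen, Complex.normSq_apply] at this
        linarith
      simp only [z]
      rw [norm_mul, hn, one_mul, Complex.sq_norm, Complex.normSq_apply]
      simp
      linear_combination (ρ ^ 2) * h2
    have h3 : 0 ≤ 2 * ρ * e.re * (1 - ρ ^ 2) :=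
      mul_nonneg (mul_nonneg (by linarith [hρ.1]) he) (by nlinarith [hρ.1, hρ.2])
    have h4 : ρ ^ 4 < ρ ^ 2 := pow_lt_pow_right_of_lt_one₀ hρ.1 hρ.2 (by norm_num)
    nlinarith [norm_nonneg (z ρ)]
  refine closure_subtype.2 ?_
  refine mem_closure_of_tendsto (b := 𝓝[>] (0 : ℝ))
    (f := fun ρ => (z ρ, fun s : blowUpCentre P => (z ρ - s) / ‖z ρ - s‖)) ?_ ?_
  · refine hz.prodMk_nhds (tendsto_pi_nhds.2 fun s => ?_)
    by_cases hs : p₀.pt = s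
    · have hs' : p₀.pt ∈ blowUpCentre P := hs ▸ s.2
      have h1 : p₀.dir s = -p₀.pt * e := by
        rw [← hes hs']; congr 1; exact Subtype.ext hs.symm
      have h2 : Filter.Tendsto (fun ρ : ℝ => -p₀.pt * ((e + ρ) / ‖e + ρ‖)) (𝓝[>] 0)
          (𝓝 (p₀.dir s)) := by
        have h3 : ContinuousAt (fun ρ : ℝ => -p₀.pt * ((e + ρ) / (‖e + ρ‖ : ℂ))) 0 := by
          refine continuousAt_const.mul (ContinuousAt.div (by fun_prop) (by fun_prop) ?_)
          simp [hen]
        have h4 := h3.tendsto.mono_left (nhdsWithin_le_nhds (s := Set.Ioi (0 : ℝ)))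
        simpa [hen, h1] using h4
      refine h2.congr' ?_
      filter_upwards [self_mem_nhdsWithin] with ρ hρ
      have hρ' : (0 : ℝ) < ρ := hρ
      have h5 : z ρ - s = (ρ : ℂ) * (-p₀.pt * (e + ρ)) := by
        simp only [z]; rw [← hs]; ring
      rw [h5, norm_mul, norm_mul, norm_neg, hn, one_mul, Complex.norm_real,
        Real.norm_of_nonneg hρ'.le]
      push_cast
      rw [mul_div_mul_left _ _ (by exact_mod_cast hρ'.ne'), mul_div_assoc]
    · have h0 : (‖p₀.pt - s‖ : ℂ) ≠ 0 := by
        exact_mod_cast norm_ne_zero_iff.2 (sub_ne_zero.2 hs)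
      have h1 : p₀.dir s = (p₀.pt - s) / ‖p₀.pt - s‖ :=
        (eq_div_iff h0).2 (by rw [mul_comm]; exact (p₀.pt_sub s).symm)
      change Filter.Tendsto _ _ (𝓝 (p₀.dir s))
      rw [h1]
      exact (hz.sub_const _).div
        ((Complex.continuous_ofReal.tendsto _).comp (hz.sub_const _).norm) h0
  · exact hz1.mono fun ρ hρ => ⟨ofInterior P (z ρ) hρ, hρ, rfl⟩

theorem point_mem_closure_interior (p : BlownUpDisk σ.1.slicing) :
    point σ p ∈ closure (point σ '' {p | ‖p.pt‖ < 1}) := by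
  obtain ⟨k, κ, hP⟩ := σ.2.isSupported
  exact image_closure_subset_closure_image (continuous_point σ)
    ⟨p, dense_interior σ.1.slicing hP p, rfl⟩

theorem point_mem_closure_stab (p : BlownUpDisk σ.1.slicing) :
    point σ p ∈ closure {τ | IsStabilityCondition v τ} := by
  refine closure_mono ?_ (point_mem_closure_interior σ p)
  rintro _ ⟨q, hq, rfl⟩
  exact isStab_point σ (.inl (by simpa using hq))

end BlownUpDisk

end Topology

end LaxStability

end

noncomputable section

open scoped ZeroObject

set_option linter.unusedSectionVars false

namespace LaxStability

/-! ### Limits of degenerations -/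

theorem norm_rotFactor_boundary_le (φ t : ℝ) (m : ℤ) :
    ‖rotFactor (ray (2 * φ)) t‖ ≤ 2 * Real.pi * |t - φ - m| := by
  have h1 : ray (2 * φ) = ray (2 * (φ + m)) := by
    rw [ray_eq_ray_iff]; exact ⟨-m, by push_cast; ring⟩
  rw [h1, norm_rotFactor_boundary, mul_assoc]
  refine mul_le_mul_of_nonneg_left (Real.abs_sin_le_abs.trans ?_) zero_le_two
  rw [abs_mul, abs_of_pos Real.pi_pos, sub_sub]

section Topology

variable {C : Type u₁} [Category.{u₂} C] [Preadditive C] [HasZeroObject C] [HasShift C ℤ]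
  [∀ n : ℤ, (shiftFunctor C n).Additive] [Pretriangulated C] [IsTriangulated C]
  {V : Type u₃} [NormedAddCommGroup V] [InnerProductSpace ℝ V] {L : Submodule ℤ V}
  {v : K0 C →+ L}

theorem slicing_eq_of_phi {P Q : Slicing C} (h : ∀ X, ¬ IsZero X → P.phiPlus X = Q.phiPlus X)
    (h' : ∀ X, ¬ IsZero X → P.phiMinus X = Q.phiMinus X) : P = Q := by
  refine eq_of_sliceEDist_eq_zero ?_
  simp only [sliceEDist, ENNReal.iSup_eq_zero]
  intro X hX
  rw [h X hX, h' X hX]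
  simp

theorem sliceEDist_map_shiftLift_le (P Q : Slicing C) (a : ℝ) :
    sliceEDist (P.map (shiftLift a)) (Q.map (shiftLift a)) ≤ sliceEDist P Q := by
  refine iSup₂_le fun X hX => ?_
  rw [Slicing.map_phiMinus _ hX, Slicing.map_phiMinus _ hX, Slicing.map_phiPlus _ hX,
    Slicing.map_phiPlus _ hX]
  simp only [shiftLift_apply, edist_add_right]
  exact le_iSup₂_of_le X hX le_rfl

theorem sliceEDist_triangle (P Q R : Slice C) :
    sliceEDist P.1 R.1 ≤ sliceEDist P.1 Q.1 + sliceEDist Q.1 R.1 := edist_triangle P Q R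

theorem continuous_act : Continuous fun p : ℂ × StabData C V => act p.1 p.2 := by
  refine Continuous.prodMk ?_ ?_
  · refine continuous_iff_continuousAt.2 fun p₀ => ?_
    refine tendsto_slice_iff.2 fun ε hε => ?_
    have hs : Continuous fun p : ℂ × StabData C V => p.2.1 := continuous_fst.comp continuous_snd
    have hre : Continuous fun p : ℂ × StabData C V => p.1.re :=
      Complex.continuous_re.comp continuous_fst
    have h1 := tendsto_slice_iff.1 (hs.tendsto p₀) _ (half_pos hε)
    have h2 : ∀ᶠ p in 𝓝 p₀, |p.1.re - p₀.1.re| < ε / 2 :=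
      Metric.tendsto_nhds.1 (hre.tendsto p₀) _ (half_pos hε)
    filter_upwards [h1, h2] with p hp hp'
    refine (sliceEDist_triangle (act p.1 p.2).1 (act p.1 p₀.2).1 (act p₀.1 p₀.2).1).trans_lt ?_
    rw [← add_halves ε, ENNReal.ofReal_add (half_pos hε).le (half_pos hε).le]
    have h3 : sliceEDist (act p.1 p₀.2).1.1 (act p₀.1 p₀.2).1.1 ≤ ENNReal.ofReal (ε / 2) := ?_
    · exact ENNReal.add_lt_add_of_lt_of_le (h3.trans_lt ENNReal.ofReal_lt_top).ne
        ((sliceEDist_map_shiftLift_le _ _ _).trans_lt hp) h3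
    refine sliceEDist_map_le _ _ _ fun t _ => ?_
    rw [shiftLift_apply, shiftLift_apply]
    rw [show t + -p.1.re - (t + -p₀.1.re) = -(p.1.re - p₀.1.re) by ring, abs_neg]
    exact hp'.le
  · have : Continuous fun p : ℂ × StabData C V => Complex.exp (-(Complex.I * Real.pi * p.1)) :=
      by fun_prop
    exact this.smul (continuous_snd.comp continuous_snd)

theorem phiPlus_act (z : ℂ) (τ : StabData C V) {X : C} (hX : ¬ IsZero X) :
    (act z τ).slicing.phiPlus X = τ.slicing.phiPlus X - z.re := by
  change (τ.slicing.map _).phiPlus X = _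
  rw [Slicing.map_phiPlus _ hX, shiftLift_apply, sub_eq_add_neg]

namespace BlownUpDisk

variable [DiscreteTopology L] (σ : Stab v)

theorem dir_eq_of_ne {P : Slicing C} (p : BlownUpDisk P) {s : blowUpCentre P} (h : p.pt ≠ s) :
    p.dir s = (p.pt - s) / ‖p.pt - s‖ := by
  have h0 : (‖p.pt - s‖ : ℂ) ≠ 0 := by
    exact_mod_cast norm_ne_zero_iff.2 (sub_ne_zero.2 h)
  exact (eq_div_iff h0).2 (by rw [mul_comm]; exact (p.pt_sub s).symm)

theorem abs_lift_sub_le {P : Slicing C} (p : BlownUpDisk P) {t : ℝ} (ht : t ∈ P.phases) :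
    |p.lift t - t| ≤ 1 / 2 := by
  rw [(p.factor_spec ht).2.2, add_sub_cancel_left, abs_div, abs_of_pos Real.pi_pos,
    div_le_iff₀ Real.pi_pos]
  have := Complex.abs_arg_le_pi_div_two_iff.2 (p.factor_spec ht).1
  linarith

theorem isInducing_point (hσ : (phaseDiagram σ.1.slicing).Nontrivial) :
    Topology.IsInducing (point σ) :=
  Topology.isInducing_iff_nhds.2 fun p => le_antisymm ((continuous_point σ).tendsto p).le_comap
    (tendsto_of_tendsto_point σ hσ (p := id) Filter.tendsto_comap)

/-- Lax support bounds from below the distance of the phase of a massive stable object to the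
massless phase. -/
theorem exists_phase_gap {P : Slicing C} {Z : V →L[ℝ] ℂ} {k κ : ℝ} (hP : IsSupported v P Z k κ)
    {τ : StabData C V} (hτ : IsLaxStabilityCondition v τ) {φ : ℝ}
    (hZ : τ.charge = (nMap (bdry φ)).comp Z) :
    ∃ ε > 0, ∀ x t X, τ.slicing.IsStable x X → P.P t X → ∀ m : ℤ, t - φ ≠ m →
      |t - φ - m| < 1 → ε ≤ |t - φ - m| := by
  obtain ⟨-, K, hK, h⟩ := hτ
  have hZ0 : 0 < ‖Z‖ + 1 := by positivity
  -- The support property bounds the degenerate mass of `X` below by `‖cls v X‖ / K`, while the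
  -- chord bound gives at most `2π |t - φ - m| ‖Z‖ ‖cls v X‖`. The added `1` avoids dividing by
  -- zero.
  refine ⟨1 / (2 * Real.pi * K * (‖Z‖ + 1)), by positivity, fun x t X hX ht m hm hm1 => ?_⟩
  have hX0 : ¬ IsZero X := fun h0 => by
    obtain ⟨h1, h2⟩ := hX
    exact h2.1 ((isZero_mk_iff h1).2 h0)
  have h1 : τ.charge (cls v X) = ‖Z (cls v X)‖ * (ray t * rotFactor (ray (2 * φ)) t) := by
    rw [hZ, ContinuousLinearMap.comp_apply, hP.charge_eq _ _ ht]
    rw [← Complex.real_smul, map_smul, bdry_eq_ray, nMap_ray, Complex.real_smul, norm_smul,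
      norm_norm, norm_ray, mul_one]
  have hpos := hP.κ_pos.trans_le (hP.le_norm _ _ ht hX0)
  have hr : rotFactor (ray (2 * φ)) t ≠ 0 := by
    rw [ne_eq, rotFactor_eq_zero_iff, ← bdry_eq_ray, ← bdry_eq_ray, bdry_eq_bdry_iff]
    rintro ⟨n, hn⟩
    have h2 : t - φ - m = ((-n - m : ℤ) : ℝ) := by push_cast; linarith
    rw [h2] at hm1
    have h3 : |(-n - m : ℤ)| < 1 := by exact_mod_cast hm1
    rw [Int.abs_lt_one_iff.1 h3] at h2
    exact hm (by push_cast at h2; linarith)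
  have h2 := h x X hX (by
    rw [h1]
    exact mul_ne_zero (by exact_mod_cast hpos.ne') (mul_ne_zero (ray_ne_zero _) hr))
  rw [h1, norm_mul, norm_mul, norm_ray, one_mul, Complex.norm_real, norm_norm] at h2
  have h3 := norm_rotFactor_boundary_le φ t m
  have h4 : ‖Z (cls v X)‖ ≤ ‖Z‖ * ‖cls v X‖ := Z.le_opNorm _
  have h5 : 0 < ‖cls v X‖ := by
    rw [norm_pos_iff]
    intro h0
    rw [h0, map_zero, norm_zero] at hpos
    exact lt_irrefl _ hpos
  have h6 : 1 / K * ‖cls v X‖ ≤ (2 * Real.pi * |t - φ - m| * (‖Z‖ + 1)) * ‖cls v X‖ := by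
    refine h2.trans ?_
    calc ‖Z (cls v X)‖ * ‖rotFactor (ray (2 * φ)) t‖
        ≤ (‖Z‖ * ‖cls v X‖) * (2 * Real.pi * |t - φ - m|) :=
          mul_le_mul h4 h3 (norm_nonneg _) (by positivity)
      _ ≤ ((‖Z‖ + 1) * ‖cls v X‖) * (2 * Real.pi * |t - φ - m|) := by
          gcongr; linarith
      _ = _ := by ring
  have h7 := le_of_mul_le_mul_right h6 h5
  rw [div_le_iff₀ (by positivity)]
  rw [div_le_iff₀ hK] at h7
  linarith

theorem exists_point_of_bdry {τ : StabData C V} {φ ψ : ℝ}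
    (hq : bdry φ ∈ quotDiskSet σ.1.slicing)
    (ha : bdry φ ∈ blowUpCentre σ.1.slicing → AllowedPhase σ.1.slicing φ ψ)
    (hs : τ.slicing = σ.1.slicing.map (stepLift φ ψ))
    (hZ : τ.charge = (nMap (bdry φ)).comp σ.1.charge) : ∃ p, τ = point σ p := by
  refine ⟨ofBdry σ.1.slicing φ ψ hq ha, Prod.ext (Subtype.ext ?_) hZ⟩
  exact hs.trans (point_eq_of_angle σ (ofBdry_pt hq ha) (ofBdry_angle hq ha)).symm

/-- The limit of the charges gives `w`. In the interior nothing else happens; on the circle the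
limits of the phase maps determine the slicing, and lax support of the limit supplies the gap
condition at `w`. -/
theorem exists_point_of_mem_closure (hσ : (phaseDiagram σ.1.slicing).Nontrivial)
    {τ : StabData C V} (hτ : IsLaxStabilityCondition v τ)
    (hc : τ ∈ closure (point σ '' {p | ‖p.pt‖ < 1})) : ∃ p, τ = point σ p := by
  obtain ⟨k, κ, hP⟩ := σ.2.isSupported
  obtain ⟨x₁, hx₁⟩ := charge_surjective σ hσ 1
  obtain ⟨q, hq, hqτ⟩ := mem_closure_iff_seq_limit.1 hc
  choose p hp hpq using hq
  obtain rfl : (fun n => point σ (p n)) = q := funext hpq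
  have hs : Filter.Tendsto (fun n => (point σ (p n)).1) Filter.atTop (𝓝 τ.1) :=
    (continuous_fst.tendsto _).comp hqτ
  have hZ : Filter.Tendsto (fun n => (point σ (p n)).2) Filter.atTop (𝓝 τ.2) :=
    (continuous_snd.tendsto _).comp hqτ
  obtain ⟨w, hw⟩ : ∃ w, Filter.Tendsto (fun n => (p n).pt) Filter.atTop (𝓝 w) := by
    refine ⟨1 - τ.2 x₁, ?_⟩
    have h3 := (charge_eq_of_tendsto hZ x₁).const_sub 1
    have h4 : ∀ p, 1 - (point σ p).2 x₁ = p.pt := fun p => by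
      change 1 - nMap p.pt (σ.1.charge x₁) = _
      rw [hx₁, nMap_apply]; simp
    simpa only [h4] using h3
  have hZw : τ.charge = (nMap w).comp σ.1.charge :=
    tendsto_nhds_unique hZ (((continuous_nMap_comp σ.1.charge).tendsto w).comp hw)
  have hw1 : ‖w‖ ≤ 1 := le_of_tendsto hw.norm (Filter.Eventually.of_forall fun n => (hp n).le)
  rcases hw1.lt_or_eq with hlt | heq
  · refine ⟨ofInterior _ w hlt, tendsto_nhds_unique hqτ (((continuous_point σ).tendsto _).comp
      (tendsto_of_tendsto_coordinates hw fun s => ?_))⟩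
    have hne : w ≠ s := fun h => by
      rw [h, norm_eq_one_of_mem_blowUpCentre s.2] at hlt
      exact lt_irrefl _ hlt
    have h0 : (‖w - s‖ : ℂ) ≠ 0 := by exact_mod_cast norm_ne_zero_iff.2 (sub_ne_zero.2 hne)
    rw [dir_eq_of_ne (ofInterior σ.1.slicing w hlt) (s := s) hne]
    refine ((hw.sub_const _).div ((Complex.continuous_ofReal.tendsto _).comp
      (hw.sub_const _).norm) h0).congr' ?_
    filter_upwards [hw.eventually_ne hne] with n hn
    exact (dir_eq_of_ne _ hn).symm
  obtain ⟨φ, -, rfl⟩ := exists_bdry_eq heq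
  choose! X hX hX0 using fun t (ht : t ∈ σ.1.slicing.phases) => exists_of_mem_phases ht
  -- The limiting phase of a chosen object of phase `t`; the lifts converge to `g` uniformly on
  -- phases.
  set g : ℝ → ℝ := fun t => τ.slicing.phiPlus (X t) with hg
  have hunif : ∀ δ > 0, ∀ᶠ n in Filter.atTop, ∀ t ∈ σ.1.slicing.phases,
      |(p n).lift t - g t| < δ := by
    intro δ hδ
    refine (tendsto_slice_iff.1 hs δ hδ).mono fun n hn t ht => ?_
    rw [← phiPlus_point σ (hX t ht) (hX0 t ht)]
    exact abs_phiPlus_sub_lt hn (hX0 t ht)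
  have hlim : ∀ t ∈ σ.1.slicing.phases,
      Filter.Tendsto (fun n => (p n).lift t) Filter.atTop (𝓝 (g t)) := fun t ht =>
    Metric.tendsto_nhds.2 fun δ hδ => (hunif δ hδ).mono fun n hn => hn t ht
  have hlim' : ∀ t ∈ Set.Ioo φ (φ + 1),
      Filter.Tendsto (fun n => (p n).lift t) Filter.atTop (𝓝 (φ + 1 / 2)) := by
    intro t ht
    have h1 := (continuousAt_phaseFun heq.le (rotFactor_bdry_ne_zero ht)).tendsto.comp hw
    rw [bdry_eq_ray, phaseFun_boundary ht] at h1
    refine h1.congr fun n => ?_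
    rw [lift_of_norm_lt (hp n)]; rfl
  have hgI : ∀ t ∈ σ.1.slicing.phases, t ∈ Set.Ioo φ (φ + 1) → g t = φ + 1 / 2 :=
    fun t ht ht' => tendsto_nhds_unique (hlim t ht) (hlim' t ht')
  have hgI' : ∀ t ∈ σ.1.slicing.phases, t ∈ Set.Ioo (φ - 1) φ → g t = φ - 1 / 2 := by
    intro t ht ht'
    have h1 := (hlim' (t + 1) ⟨by linarith [ht'.1], by linarith [ht'.2]⟩).sub_const 1
    simp only [CircleDeg1Lift.map_add_one, add_sub_cancel_right] at h1
    rw [tendsto_nhds_unique (hlim t ht) h1]; ring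
  -- One continuous lift is uniformly close to `g`, so `g` oscillates little over phases near `φ`.
  have hcauchy : ∀ δ > 0, ∃ η > 0, ∀ t ∈ σ.1.slicing.phases, ∀ s ∈ σ.1.slicing.phases,
      |t - φ| < η → |s - φ| < η → |g t - g s| < δ := by
    intro δ hδ
    obtain ⟨n, hn⟩ := (hunif (δ / 4) (by positivity)).exists
    obtain ⟨η, hη, h1⟩ := Metric.continuousAt_iff.1
      ((continuous_phaseFun (hp n)).continuousAt (x := φ)) (δ / 4) (by positivity)
    have h2 : ∀ t ∈ σ.1.slicing.phases, |t - φ| < η → |g t - phaseFun (p n).pt φ| < δ / 2 := by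
      intro t ht ht'
      have h3 := h1 (x := t) ht'
      have h4 := hn t ht
      rw [lift_of_norm_lt (hp n), phaseLift_apply] at h4
      rw [Real.dist_eq, abs_lt] at h3
      rw [abs_lt] at h4 ⊢
      constructor <;> linarith [h3.1, h3.2, h4.1, h4.2]
    refine ⟨η, hη, fun t ht s hs ht' hs' => ?_⟩
    have h3 := abs_lt.1 (h2 t ht ht')
    have h4 := abs_lt.1 (h2 s hs hs')
    rw [abs_lt]
    constructor <;> linarith [h3.1, h3.2, h4.1, h4.2]
  have hslicing : ∀ ψ ∈ Set.Icc (0 : ℝ) 1, (φ ∈ σ.1.slicing.phases → g φ = φ - 1 / 2 + ψ) →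
      τ.slicing = σ.1.slicing.map (stepLift φ ψ) := by
    intro ψ hψ hgφ
    have h1 : ∀ t ∈ σ.1.slicing.phases,
        Filter.Tendsto (fun n => (p n).lift t) Filter.atTop (𝓝 (stepLift φ ψ t)) := by
      intro t ht
      obtain ⟨m, s, hs, rfl⟩ := exists_int_add_mem_Ico φ t
      simp only [CircleDeg1Lift.map_add_int]
      refine Filter.Tendsto.add_const _ ?_
      rw [Slicing.add_int_mem_phases_iff] at ht
      rcases stepLift_mem_Icc hψ hs with ⟨rfl, h⟩ | ⟨h', h⟩ <;> rw [h]
      · rw [← hgφ ht]; exact hlim _ ht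
      · exact hlim' s ⟨h', hs.2⟩
    refine slicing_eq_of_phi (fun X hX => ?_) fun X hX => ?_
    · rw [Slicing.map_phiPlus _ hX]
      refine tendsto_nhds_unique (tendsto_phiPlus hs hX) ?_
      exact (h1 _ (Slicing.phiPlus_mem_phases hX)).congr fun n =>
        (Slicing.map_phiPlus (P := σ.1.slicing) _ hX).symm
    · rw [Slicing.map_phiMinus _ hX]
      have h2 : Filter.Tendsto (fun n => (point σ (p n)).1.1.phiMinus X) Filter.atTop
          (𝓝 (τ.slicing.phiMinus X)) := by
        rw [Metric.tendsto_nhds]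
        intro ε hε
        exact (tendsto_slice_iff.1 hs ε hε).mono fun i hi => abs_phiMinus_sub_lt hi hX
      refine tendsto_nhds_unique h2 ?_
      exact (h1 _ (Slicing.phiMinus_mem_phases hX)).congr fun n =>
        (Slicing.map_phiMinus (P := σ.1.slicing) _ hX).symm
  have hgap := exists_phase_gap hP hτ hZw
  by_cases hA : ∃ ε > 0, ∀ t ∈ Set.Ioo φ (φ + ε), t ∉ σ.1.slicing.phases
  · by_cases hB : ∃ ε > 0, ∀ t ∈ Set.Ioo (φ - ε) φ, t ∉ σ.1.slicing.phases
    · obtain ⟨ε, hε, hA⟩ := hA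
      obtain ⟨ε', hε', hB⟩ := hB
      have hiso : ∀ t ∈ σ.1.slicing.phases, |t - φ| < min ε ε' → t = φ := by
        intro t ht ht'
        have h1 := abs_lt.1 ht'
        by_contra hne
        rcases lt_or_gt_of_ne hne with h | h
        · exact hB t ⟨by linarith [min_le_right ε ε'], h⟩ ht
        · exact hA t ⟨h, by linarith [min_le_left ε ε']⟩ ht
      have hq : bdry φ ∈ quotDiskSet σ.1.slicing :=
        bdry_mem_quotDiskSet_iff.2 ⟨_, lt_min hε hε', .inl (lowGap_of_isolated hiso)⟩
      by_cases hφ : φ ∈ σ.1.slicing.phases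
      · have h1 : |g φ - φ| ≤ 1 / 2 := le_of_tendsto ((hlim φ hφ).sub_const φ).abs
          (Filter.Eventually.of_forall fun n => abs_lift_sub_le _ hφ)
        have h2 := abs_le.1 h1
        have hψ : g φ - φ + 1 / 2 ∈ Set.Icc (0 : ℝ) 1 := ⟨by linarith, by linarith⟩
        refine exists_point_of_bdry σ hq (fun _ => ?_)
          (hslicing _ hψ fun _ => by ring) hZw
        exact allowedPhase_iff.2 (.inl ⟨hφ, ⟨_, lt_min hε hε', hiso⟩, hψ⟩)
      · exact exists_point_of_bdry σ (ψ := 0) hq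
          (fun h => absurd (hP.mem_phases_of_mem_blowUpCentre h) hφ)
          (hslicing _ (by simp) fun h => absurd h hφ) hZw
    -- Phases accumulate from below, where `g = φ - 1/2`. If `φ` occurs, the small oscillation
    -- forces `g φ = φ - 1/2`, that is `ψ = 0`.
    · push Not at hB
      obtain ⟨ε, hε, hA⟩ := hA
      have hsl : τ.slicing = σ.1.slicing.map (stepLift φ 0) := by
        refine hslicing _ (by simp) fun hφ => ?_
        rw [add_zero, ← sub_eq_zero, ← abs_eq_zero]
        refine le_antisymm (le_of_forall_pos_lt_add fun δ hδ => ?_) (abs_nonneg _)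
        obtain ⟨η, hη, h1⟩ := hcauchy δ hδ
        obtain ⟨t, ht, ht'⟩ := hB (min η 1) (by positivity)
        have h2 := h1 φ hφ t ht' (by simpa using hη)
          (abs_lt.2 ⟨by linarith [ht.1, min_le_left η 1], by linarith [ht.2]⟩)
        rwa [hgI' t ht' ⟨by linarith [ht.1, min_le_right η 1], ht.2⟩, ← zero_add δ] at h2
      obtain ⟨ε', hε', h⟩ := hgap
      -- The stable objects of limiting phase `φ + 1/2` are the simple objects of `P(φ, φ + 1]`, so
      -- `exists_phase_gap` applies to them at `φ + 1`.
      have hH : HighGap σ.1.slicing φ (min ε (min ε' 1)) := by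
        refine ⟨fun t ht => hA t ⟨ht.1, ht.2.trans_le (by gcongr; exact min_le_left _ _)⟩,
          fun X t hX ht ht' => ?_⟩
        have h1 : min ε (min ε' 1) ≤ ε' := (min_le_right _ _).trans (min_le_left _ _)
        have h2 : min ε (min ε' 1) ≤ 1 := (min_le_right _ _).trans (min_le_right _ _)
        have h3 := h (φ + 1 / 2) t X (by
          rw [Slicing.isStable_iff, hsl, Slicing.map_P, stepLift_zero_preimage]; exact hX) ht 1
          (by push_cast; linarith [ht'.2]) (by
            push_cast; exact abs_lt.2 ⟨by linarith [ht'.1], by linarith [ht'.2]⟩)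
        push_cast at h3
        rw [abs_of_neg (by linarith [ht'.2])] at h3
        linarith [ht'.1]
      refine exists_point_of_bdry σ (ψ := 0) (bdry_mem_quotDiskSet_iff.2
        ⟨_, by positivity, .inr hH⟩) (fun _ => allowedPhase_iff.2 (.inr (.inr
          ⟨fun η hη => ?_, ⟨ε, hε, hA⟩, rfl⟩))) hsl hZw
      obtain ⟨t, ht, ht'⟩ := hB η hη
      exact ⟨t, ht', ht.2.ne, abs_lt.2 ⟨by linarith [ht.1], by linarith [ht.2]⟩⟩
  · push Not at hA
    -- Phases accumulate from above. They cannot also accumulate from below, since `g` would jump by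
    -- `1` across `φ`.
    have hB : ∃ ε > 0, ∀ t ∈ Set.Ioo (φ - ε) φ, t ∉ σ.1.slicing.phases := by
      obtain ⟨η, hη, h1⟩ := hcauchy 1 one_pos
      refine ⟨min η 1, by positivity, fun t ht ht' => ?_⟩
      obtain ⟨s, hs, hs'⟩ := hA (min η 1) (by positivity)
      have hm := min_le_left η 1
      have hm' := min_le_right η 1
      have h2 := h1 t ht' s hs' (abs_lt.2 ⟨by linarith [ht.1], by linarith [ht.2]⟩)
        (abs_lt.2 ⟨by linarith [hs.1], by linarith [hs.2]⟩)
      rw [hgI' t ht' ⟨by linarith [ht.1], ht.2⟩, hgI s hs' ⟨hs.1, by linarith [hs.2]⟩] at h2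
      rw [abs_lt] at h2
      linarith [h2.1]
    obtain ⟨ε, hε, hB⟩ := hB
    have hsl : τ.slicing = σ.1.slicing.map (stepLift φ 1) := by
      refine hslicing _ (by simp) fun hφ => ?_
      rw [← sub_eq_zero, ← abs_eq_zero]
      refine le_antisymm (le_of_forall_pos_lt_add fun δ hδ => ?_) (abs_nonneg _)
      obtain ⟨η, hη, h1⟩ := hcauchy δ hδ
      obtain ⟨t, ht, ht'⟩ := hA (min η 1) (by positivity)
      have h2 := h1 φ hφ t ht' (by simpa using hη)
        (abs_lt.2 ⟨by linarith [ht.1], by linarith [ht.2, min_le_left η 1]⟩)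
      rw [hgI t ht' ⟨ht.1, by linarith [ht.2, min_le_right η 1]⟩] at h2
      rwa [zero_add, show φ - 1 / 2 + 1 = φ + 1 / 2 by ring]
    obtain ⟨ε', hε', h⟩ := hgap
    have hH : LowGap σ.1.slicing φ (min ε (min ε' 1)) := by
      refine ⟨fun t ht => hB t ⟨lt_of_le_of_lt (by gcongr; exact min_le_left _ _) ht.1, ht.2⟩,
        fun X t hX ht ht' => ?_⟩
      have h1 : min ε (min ε' 1) ≤ ε' := (min_le_right _ _).trans (min_le_left _ _)
      have h2 : min ε (min ε' 1) ≤ 1 := (min_le_right _ _).trans (min_le_right _ _)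
      have h3 := h (φ + 1 / 2) t X (by
        rw [Slicing.isStable_iff, hsl, Slicing.map_P, stepLift_one_preimage]; exact hX) ht 0
        (by push_cast; linarith [ht'.1]) (by
          push_cast; exact abs_lt.2 ⟨by linarith [ht'.1], by linarith [ht'.2]⟩)
      push_cast at h3
      rw [sub_zero, abs_of_pos (by linarith [ht'.1])] at h3
      linarith [ht'.2]
    refine exists_point_of_bdry σ (ψ := 1) (bdry_mem_quotDiskSet_iff.2
      ⟨_, by positivity, .inl hH⟩) (fun _ => allowedPhase_iff.2 (.inr (.inl
        ⟨fun η hη => ?_, ⟨ε, hε, hB⟩, rfl⟩))) hsl hZw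
    obtain ⟨t, ht, ht'⟩ := hA η hη
    exact ⟨t, ht', ht.1.ne', abs_lt.2 ⟨by linarith [ht.1], by linarith [ht.2]⟩⟩

/-- Evaluation at vectors of charge `1` and `i` isolates the coefficients `c` and `-c w` of `z` and
`conj z`, so both converge. Since `‖c w‖ ≤ ‖c‖`, a zero limit of `c` would force `T = 0`. -/
theorem exists_tendsto_coefficients {Z : V →L[ℝ] ℂ} (hZ : Function.Surjective Z) {c w : ℕ → ℂ}
    (hw : ∀ n, ‖w n‖ ≤ 1) {T : V →L[ℝ] ℂ} (hT : T ≠ 0)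
    (h : Filter.Tendsto (fun n => c n • (nMap (w n)).comp Z) Filter.atTop (𝓝 T)) :
    ∃ a w₀, a ≠ 0 ∧ Filter.Tendsto c Filter.atTop (𝓝 a) ∧
      Filter.Tendsto w Filter.atTop (𝓝 w₀) ∧ T = a • (nMap w₀).comp Z := by
  obtain ⟨x₁, hx₁⟩ := hZ 1
  obtain ⟨x₂, hx₂⟩ := hZ Complex.I
  have hZ1 := charge_eq_of_tendsto h x₁
  have hZ2 := charge_eq_of_tendsto h x₂
  have hval : ∀ n x, (c n • (nMap (w n)).comp Z) x = c n * (Z x - w n * (starRingEnd ℂ) (Z x)) := by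
    intro n x
    rw [smul_apply, ContinuousLinearMap.comp_apply, nMap_apply, smul_eq_mul]
  simp only [hval, hx₁, hx₂, map_one, Complex.conj_I] at hZ1 hZ2
  have ha : Filter.Tendsto c Filter.atTop (𝓝 ((T x₁ - Complex.I * T x₂) / 2)) := by
    refine ((hZ1.sub (hZ2.const_mul Complex.I)).div_const 2).congr fun n => ?_
    linear_combination (-(c n) / 2 - c n * w n / 2) * Complex.I_sq
  have hb : Filter.Tendsto (fun n => -(c n * w n)) Filter.atTop
      (𝓝 ((T x₁ + Complex.I * T x₂) / 2)) := by
    refine ((hZ1.add (hZ2.const_mul Complex.I)).div_const 2).congr fun n => ?_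
    linear_combination (c n / 2 + c n * w n / 2) * Complex.I_sq
  set a := (T x₁ - Complex.I * T x₂) / 2
  set b := (T x₁ + Complex.I * T x₂) / 2
  have hba : ‖b‖ ≤ ‖a‖ := le_of_tendsto_of_tendsto hb.norm ha.norm
    (Filter.Eventually.of_forall fun n => by
      change ‖-(c n * w n)‖ ≤ ‖c n‖
      rw [norm_neg, norm_mul]
      exact mul_le_of_le_one_right (norm_nonneg _) (hw n))
  have ha0 : a ≠ 0 := by
    intro h0
    rw [h0, norm_zero, norm_le_zero_iff] at hba
    refine hT (ContinuousLinearMap.ext fun x => ?_)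
    refine tendsto_nhds_unique (charge_eq_of_tendsto h x) ?_
    have h1 := (ha.mul_const (Z x)).add (hb.mul_const ((starRingEnd ℂ) (Z x)))
    rw [h0, hba, zero_mul, zero_mul, add_zero] at h1
    refine h1.congr fun n => ?_
    rw [hval]; ring
  have hw₀ : Filter.Tendsto w Filter.atTop (𝓝 (-b / a)) := by
    refine ((hb.neg).div ha ha0).congr' ?_
    filter_upwards [ha.eventually_ne ha0] with n hn
    change - -(c n * w n) / c n = w n
    rw [neg_neg, mul_div_cancel_left₀ _ hn]
  exact ⟨a, -b / a, ha0, ha, hw₀, tendsto_nhds_unique h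
    (ha.smul (((continuous_nMap_comp Z).tendsto _).comp hw₀))⟩

/-- The parameters `z n` stay bounded: their imaginary parts are logarithms of the convergent `‖c
n‖`, and their real parts are controlled by the phase of one object, as the lifts stay within `1/2`
of the identity. A convergent subsequence is then undone by `act`. -/
theorem exists_act_mem_closure (hσ : (phaseDiagram σ.1.slicing).Nontrivial)
    {A : Set (BlownUpDisk σ.1.slicing)} {τ : StabData C V} (hτ : τ.charge ≠ 0)
    (hc : τ ∈ closure {ρ | ∃ z, ∃ p ∈ A, ρ = act z (point σ p)}) :
    ∃ z, act z τ ∈ closure (point σ '' A) := by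
  obtain ⟨q, hq, hqτ⟩ := mem_closure_iff_seq_limit.1 hc
  choose z p hp hpq using hq
  obtain rfl : q = fun n => act (z n) (point σ (p n)) := funext hpq
  have hs : Filter.Tendsto (fun n => (act (z n) (point σ (p n))).1) Filter.atTop (𝓝 τ.1) :=
    (continuous_fst.tendsto _).comp hqτ
  have hZ : Filter.Tendsto (fun n => (act (z n) (point σ (p n))).2) Filter.atTop (𝓝 τ.2) :=
    (continuous_snd.tendsto _).comp hqτ
  set c : ℕ → ℂ := fun n => Complex.exp (-(Complex.I * Real.pi * z n)) with hcdef
  obtain ⟨a, -, ha0, ha, -, -⟩ := exists_tendsto_coefficients (c := c)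
    (charge_surjective σ hσ) (fun n => (p n).norm_pt_le) hτ hZ
  have hcn : ∀ n, Real.log ‖c n‖ / Real.pi = (z n).im := fun n => by
    rw [hcdef]
    simp only
    rw [norm_exp_act, norm_mul, norm_ray, mul_one, Complex.norm_real, Real.norm_eq_abs,
      Real.abs_exp, Real.log_exp, mul_div_cancel_left₀ _ Real.pi_ne_zero]
  have him : Filter.Tendsto (fun n => (z n).im) Filter.atTop (𝓝 (Real.log ‖a‖ / Real.pi)) := by
    simpa only [hcn] using (ha.norm.log (norm_ne_zero_iff.2 ha0)).div_const Real.pi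
  obtain ⟨_, ⟨t, -, ht⟩, -⟩ := hσ
  obtain ⟨X, hX, hX0⟩ := exists_of_mem_phases ht
  have hre := tendsto_phiPlus hs hX0
  have hre' : ∀ n, (act (z n) (point σ (p n))).1.1.phiPlus X = (p n).lift t - (z n).re := by
    intro n
    rw [← phiPlus_point σ hX hX0]
    exact phiPlus_act _ _ hX0
  simp only [hre'] at hre
  obtain ⟨R, hR⟩ : ∃ R, ∀ᶠ n in Filter.atTop, z n ∈ Metric.closedBall 0 R := by
    refine ⟨(|t| + 1 / 2 + |τ.1.1.phiPlus X| + 1) + (|Real.log ‖a‖ / Real.pi| + 1), ?_⟩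
    filter_upwards [Metric.tendsto_nhds.1 him 1 one_pos, Metric.tendsto_nhds.1 hre 1 one_pos]
      with n h1 h2
    rw [mem_closedBall_zero_iff]
    refine (Complex.norm_le_abs_re_add_abs_im _).trans (add_le_add ?_ ?_)
    · have h3 := abs_lt.1 h2
      have h4 := abs_le.1 ((p n).abs_lift_sub_le ht)
      rw [abs_le]
      constructor <;> linarith [neg_abs_le t, le_abs_self t, neg_abs_le (τ.1.1.phiPlus X),
        le_abs_self (τ.1.1.phiPlus X)]
    · have h3 := abs_lt.1 h1
      rw [abs_le]
      constructor <;> linarith [neg_abs_le (Real.log ‖a‖ / Real.pi),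
        le_abs_self (Real.log ‖a‖ / Real.pi)]
  obtain ⟨z₀, -, ι, hι, hz⟩ := tendsto_subseq_of_frequently_bounded Metric.isBounded_closedBall
    hR.frequently
  refine ⟨-z₀, mem_closure_of_tendsto ((continuous_act.tendsto (-z₀, τ)).comp
    (hz.neg.prodMk_nhds (hqτ.comp hι.tendsto_atTop))) (Filter.Eventually.of_forall fun n => ?_)⟩
  simp only [Function.comp_apply, act_act, neg_add_cancel, act_zero]
  exact ⟨_, hp _, rfl⟩

theorem mem_of_mem_closure (hσ : (phaseDiagram σ.1.slicing).Nontrivial)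
    {A : Set (BlownUpDisk σ.1.slicing)} (hA : IsClosed A) {τ : StabData C V}
    (hτ : IsLaxStabilityCondition v τ) (hτ0 : τ.charge ≠ 0)
    (hc : τ ∈ closure {ρ | ∃ z, ∃ p ∈ A, ρ = act z (point σ p)}) :
    ∃ z, ∃ p ∈ A, τ = act z (point σ p) := by
  obtain ⟨z, hz⟩ := exists_act_mem_closure σ hσ hτ0 hc
  have h1 : closure (point σ '' A) ⊆ closure (point σ '' {p | ‖p.pt‖ < 1}) := by
    refine closure_minimal ?_ isClosed_closure
    rintro _ ⟨p, -, rfl⟩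
    exact point_mem_closure_interior σ p
  obtain ⟨p, hp⟩ := exists_point_of_mem_closure σ hσ (hτ.act z) (h1 hz)
  refine ⟨-z, p, ?_, by rw [← hp, act_act, neg_add_cancel, act_zero]⟩
  rw [hp] at hz
  rw [← hA.closure_eq, (isInducing_point σ hσ).closure_eq_preimage_closure_image]
  exact hz

end BlownUpDisk

end Topology

end LaxStability

end

noncomputable section

open scoped ZeroObject

set_option linter.unusedSectionVars false

namespace LaxStability

/-! ### Fibres of the charge map -/

section Fibres

variable {C : Type u₁} [Category.{u₂} C] [Preadditive C] [HasZeroObject C] [HasShift C ℤ]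
  [∀ n : ℤ, (shiftFunctor C n).Additive] [Pretriangulated C] [IsTriangulated C]
  {V : Type u₃} [NormedAddCommGroup V] [InnerProductSpace ℝ V] {L : Submodule ℤ V}
  {v : K0 C →+ L}

/-- Equality of the classes in `QStab(C)`. -/
def FibreRel (a b : LStab v) : Prop :=
  b ∈ connectedComponentIn {ρ : LStab v | ρ.1.charge = a.1.charge} a

theorem QStab.mk_eq_iff {a b : LStab v} : QStab.mk v a = QStab.mk v b ↔ FibreRel a b :=
  Quotient.eq

namespace FibreRel

theorem refl (a : LStab v) : FibreRel a a := (lStabSetoid v).refl a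

theorem symm {a b : LStab v} (h : FibreRel a b) : FibreRel b a := (lStabSetoid v).symm h

theorem trans {a b c : LStab v} (h : FibreRel a b) (h' : FibreRel b c) : FibreRel a c :=
  (lStabSetoid v).trans h h'

theorem charge_eq {a b : LStab v} (h : FibreRel a b) : b.1.charge = a.1.charge :=
  connectedComponentIn_subset {ρ : LStab v | ρ.1.charge = a.1.charge} a h

theorem of_isPreconnected {s : Set (LStab v)} (hs : IsPreconnected s) {a b : LStab v}
    (ha : a ∈ s) (hb : b ∈ s) (h : ∀ c ∈ s, c.1.charge = a.1.charge) : FibreRel a b :=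
  hs.subset_connectedComponentIn ha h hb

end FibreRel

theorem sliceEDist_comm (P Q : Slicing C) : sliceEDist P Q = sliceEDist Q P := by
  simp only [sliceEDist, edist_comm]

theorem continuous_charge : Continuous fun τ : LStab v => τ.1.charge :=
  continuous_snd.comp continuous_subtype_val

theorem isClosed_setOf_fibreRel (a : LStab v) : IsClosed {b | FibreRel a b} := by
  have hF : IsClosed {ρ : LStab v | ρ.1.charge = a.1.charge} :=
    isClosed_eq continuous_charge continuous_const
  refine isClosed_of_closure_subset fun b hb => ?_
  have h1 : IsPreconnected (connectedComponentIn {ρ : LStab v | ρ.1.charge = a.1.charge} a) :=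
    isPreconnected_connectedComponentIn
  refine FibreRel.of_isPreconnected h1.closure (subset_closure (FibreRel.refl a)) hb fun c hc => ?_
  exact hF.closure_subset_iff.2 (connectedComponentIn_subset _ _) hc

/-- A property preserved by moves of size less than `δ` in the slicing, at fixed charge, is locally
constant on the fibre, hence constant on components. -/
theorem iff_of_fibreRel {f : LStab v → Prop} {δ : ℝ} (hδ : 0 < δ) {a b : LStab v}
    (hf : ∀ c d : LStab v, c.1.charge = a.1.charge → d.1.charge = a.1.charge →
      sliceEDist c.1.slicing d.1.slicing < ENNReal.ofReal δ → f c → f d)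
    (h : FibreRel a b) : f a ↔ f b := by
  refine IsPreconnected.induction₂ (s := connectedComponentIn
    {ρ : LStab v | ρ.1.charge = a.1.charge} a) isPreconnected_connectedComponentIn
    (fun c d => f c ↔ f d) (fun c hc => ?_) (fun _ _ _ _ _ _ => Iff.trans)
    (fun _ _ _ _ => Iff.symm) (FibreRel.refl a) h
  have h1 : Filter.Tendsto (fun τ : LStab v => τ.1.1) (𝓝 c) (𝓝 c.1.1) :=
    (continuous_fst.comp continuous_subtype_val).tendsto c
  filter_upwards [mem_nhdsWithin_of_mem_nhds (tendsto_slice_iff.1 h1 δ hδ), self_mem_nhdsWithin]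
    with d hd hd'
  have hcc := connectedComponentIn_subset _ _ hc
  have hdd := connectedComponentIn_subset _ _ hd'
  refine ⟨hf c d hcc hdd ?_, hf d c hdd hcc hd⟩
  rwa [sliceEDist_comm]

/-- The action of `ℂ` on lax stability conditions. -/
def actL (z : ℂ) (τ : LStab v) : LStab v :=
  ⟨act z τ.1, τ.2.1.act z, by
    have h := image_closure_subset_closure_image
      (continuous_act.comp (Continuous.prodMk_right (X := ℂ) (Y := StabData C V) z))
      ⟨_, τ.2.2, rfl⟩
    refine closure_mono ?_ h
    rintro _ ⟨ρ, hρ, rfl⟩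
    exact IsStabilityCondition.act hρ z⟩

theorem actL_val (z : ℂ) (τ : LStab v) : (actL z τ).1 = act z τ.1 := rfl

theorem actL_actL (z w : ℂ) (τ : LStab v) : actL z (actL w τ) = actL (z + w) τ :=
  Subtype.ext (act_act z w τ.1)

theorem actL_zero (τ : LStab v) : actL 0 τ = τ := Subtype.ext (act_zero τ.1)

theorem continuous_actL : Continuous fun p : ℂ × LStab v => actL p.1 p.2 :=
  (continuous_act.comp (continuous_fst.prodMk
    (continuous_subtype_val.comp continuous_snd))).subtype_mk _

theorem tendsto_actL {ι : Type*} {l : Filter ι} {y : ι → ℂ} {y₀ : ℂ} {q : ι → LStab v}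
    {τ : LStab v} (hy : Filter.Tendsto y l (𝓝 y₀)) (hq : Filter.Tendsto q l (𝓝 τ)) :
    Filter.Tendsto (fun i => actL (y i) (q i)) l (𝓝 (actL y₀ τ)) := by
  have h1 : Filter.Tendsto (fun p : ℂ × LStab v => actL p.1 p.2) (𝓝 (y₀, τ))
      (𝓝 (actL y₀ τ)) := continuous_actL.tendsto (y₀, τ)
  have h2 : Filter.Tendsto (fun i => (y i, q i)) l (𝓝 (y₀, τ)) := hy.prodMk_nhds hq
  have h3 := h1.comp h2
  exact h3

theorem FibreRel.act {a b : LStab v} (h : FibreRel a b) (z : ℂ) :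
    FibreRel (actL z a) (actL z b) := by
  have h1 : IsPreconnected (actL z '' {b | FibreRel a b}) :=
    isPreconnected_connectedComponentIn.image _
      (continuous_actL.comp (Continuous.prodMk_right z)).continuousOn
  refine of_isPreconnected h1 ⟨a, FibreRel.refl a, rfl⟩ ⟨b, h, rfl⟩ ?_
  rintro _ ⟨c, hc, rfl⟩
  rw [actL_val, actL_val, act_charge, act_charge, charge_eq hc]

/-- A sum of non-negative terms vanishes only if every term does. -/
theorem ExtCl.of_map_cls_eq_zero {𝒮 : ObjectProperty C} (ℓ : V →ₗ[ℝ] ℝ)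
    (h : ∀ S, 𝒮 S → 0 ≤ ℓ (cls v S)) {X : C} (hX : ExtCl 𝒮 X) (h0 : ℓ (cls v X) = 0) :
    ExtCl (fun S => 𝒮 S ∧ ℓ (cls v S) = 0) X := by
  induction hX with
  | zero hz => exact .zero hz
  | ext hE hA hS ih =>
    rw [cls_isExt v hE, map_add] at h0
    have h1 := map_cls_nonneg_of_extCl v ℓ h hA
    have h2 := h _ hS
    exact .ext hE (ih (by linarith)) ⟨hS, by linarith⟩

theorem IsLaxStabilityCondition.exists_ray {τ : StabData C V} (h : IsLaxStabilityCondition v τ)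
    {x : ℝ} {X : C} (hX : τ.slicing.P x X) :
    τ.charge (cls v X) = (‖τ.charge (cls v X)‖ : ℝ) * ray x := by
  by_cases hX0 : IsZero X
  · simp [cls_isZero v hX0]
  · obtain ⟨m, hm, h1⟩ := h.1 x X hX hX0
    rw [h1, ← ray_eq, norm_ofReal_mul_ray hm]

/-- The functional `Re (e^{-iπx} Z)`. -/
def chargeFunctional (Z : V →L[ℝ] ℂ) (x : ℝ) : V →ₗ[ℝ] ℝ :=
  (rayFunctional x).comp (Z : V →ₗ[ℝ] ℂ)

theorem chargeFunctional_apply (Z : V →L[ℝ] ℂ) (x : ℝ) (u : V) :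
    chargeFunctional Z x u = rayFunctional x (Z u) := rfl

theorem IsLaxStabilityCondition.chargeFunctional_eq {τ : StabData C V}
    (h : IsLaxStabilityCondition v τ) {x : ℝ} {X : C} (hX : τ.slicing.P x X) (y : ℝ) :
    chargeFunctional τ.charge y (cls v X) =
      ‖τ.charge (cls v X)‖ * Real.cos (Real.pi * (x - y)) := by
  rw [chargeFunctional_apply]
  conv_lhs => rw [h.exists_ray hX]
  rw [rayFunctional_smul_ray]

theorem cos_pi_mul_pos {t : ℝ} (h : |t| < 1 / 2) : 0 < Real.cos (Real.pi * t) := by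
  have h1 := abs_lt.1 h
  refine Real.cos_pos_of_mem_Ioo ⟨?_, ?_⟩ <;> nlinarith [Real.pi_pos]

theorem cos_pi_mul_nonneg {t : ℝ} (h : |t| ≤ 1 / 2) : 0 ≤ Real.cos (Real.pi * t) := by
  have h1 := abs_le.1 h
  refine Real.cos_nonneg_of_mem_Icc ⟨?_, ?_⟩ <;> nlinarith [Real.pi_pos]

theorem IsLaxStabilityCondition.chargeFunctional_nonneg {τ : StabData C V}
    (h : IsLaxStabilityCondition v τ) {y : ℝ} {I : Set ℝ} (hI : ∀ t ∈ I, |t - y| ≤ 1 / 2) {X : C}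
    (hX : τ.slicing.cl I X) : 0 ≤ chargeFunctional τ.charge y (cls v X) := by
  refine map_cls_nonneg_of_extCl v _ ?_ hX
  rintro S ⟨t, ht, hS⟩
  rw [h.chargeFunctional_eq hS]
  exact mul_nonneg (norm_nonneg _) (cos_pi_mul_nonneg (hI t ht))

/-- An object with phases in an open interval of length one, on which the charge vanishes, is an
extension of massless semistable objects. -/
theorem IsLaxStabilityCondition.extCl_massless {τ : StabData C V}
    (h : IsLaxStabilityCondition v τ) {y : ℝ} {I : Set ℝ} (hI : ∀ t ∈ I, |t - y| < 1 / 2) {X : C}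
    (hX : τ.slicing.cl I X) (h0 : chargeFunctional τ.charge y (cls v X) = 0) :
    ExtCl (fun S => (∃ t ∈ I, τ.slicing.P t S) ∧ τ.charge (cls v S) = 0) X := by
  refine (ExtCl.of_map_cls_eq_zero (chargeFunctional τ.charge y) ?_ hX h0).mono ?_
  · rintro S ⟨t, ht, hS⟩
    rw [h.chargeFunctional_eq hS]
    exact mul_nonneg (norm_nonneg _) (cos_pi_mul_nonneg (hI t ht).le)
  · rintro S ⟨⟨t, ht, hS⟩, h1⟩
    refine ⟨⟨t, ht, hS⟩, ?_⟩
    rw [h.chargeFunctional_eq hS, mul_eq_zero, norm_eq_zero] at h1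
    exact h1.resolve_right (cos_pi_mul_pos (hI t ht)).ne'

/-- A Harder–Narasimhan filtration for `P` is one for `Q`, and the phases in a filtration
characterise the semistable objects. -/
theorem Slicing.eq_of_le {P Q : Slicing C} (h : ∀ φ X, P.P φ X → Q.P φ X) : P = Q := by
  have h1 : ∀ (J : Set ℝ), J.OrdConnected → ∀ X, P.cl J X ↔ Q.cl J X := by
    intro J hJ X
    let F := P.hn X
    let F' : HNFiltration Q.P X :=
      { F with semistable := fun i => h _ _ (F.semistable i) }
    rw [Slicing.cl_phases_iff F hJ, Slicing.cl_phases_iff F' hJ]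
  refine Slicing.ext_P fun φ => funext fun X => propext ?_
  rw [← Slicing.cl_singleton, ← Slicing.cl_singleton]
  exact h1 _ Set.ordConnected_singleton X

/-- A stability condition is locally determined by its charge. -/
theorem eq_of_charge_eq [DiscreteTopology L] {τ ρ : StabData C V} (hτ : IsStabilityCondition v τ)
    (hρ : IsLaxStabilityCondition v ρ) (hZ : ρ.charge = τ.charge)
    (hd : sliceEDist ρ.slicing τ.slicing < ENNReal.ofReal (1 / 4)) : ρ = τ := by
  obtain ⟨k, κ, hP⟩ := hτ.isSupported
  have hd' : sliceEDist τ.slicing ρ.slicing < ENNReal.ofReal (1 / 4) := by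
    rwa [sliceEDist_comm]
  -- It is shown that the `τ`-truncation `A` of `E` above `x` vanishes.
  have hle : ∀ x E, ρ.slicing.P x E → τ.slicing.cl (Set.Ioc (x - 1 / 4) x) E := by
    intro x E hE
    have hE' : τ.slicing.cl (Set.Ioo (x - 1 / 4) (x + 1 / 4)) E :=
      Slicing.cl_of_sliceEDist_lt hd Set.ordConnected_singleton Set.ordConnected_Ioo
        (by
          rintro s rfl t ht
          rw [abs_lt] at ht
          exact ⟨by linarith [ht.2], by linarith [ht.1]⟩) (Slicing.cl_self hE)
    obtain ⟨A, B, hAB, hA, hB⟩ := Slicing.exists_truncation Set.ordConnected_Ioo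
      (isUpperSet_Ioi x) hE'
    have hAρ : ρ.slicing.cl (Set.Ioi (x - 1 / 4)) A :=
      Slicing.cl_of_sliceEDist_lt hd' (Set.ordConnected_Ioo.inter Set.ordConnected_Ioi)
        Set.ordConnected_Ioi (fun s hs t ht => by
          rw [abs_lt] at ht
          have : x < s := hs.2
          exact Set.mem_Ioi.2 (by linarith [ht.2])) hA
    have hBρ : ρ.slicing.cl (Set.Iio (x + 1 / 4)) B :=
      Slicing.cl_of_sliceEDist_lt hd' (Set.ordConnected_Ioo.inter
        (by rw [Set.compl_Ioi]; exact Set.ordConnected_Iic))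
        Set.ordConnected_Iio (fun s hs t ht => by
          rw [abs_lt] at ht
          have : ¬ x < s := hs.2
          exact Set.mem_Iio.2 (by linarith [ht.1])) hB
    obtain ⟨A₁, A₂, hA₁₂, hA₁, hA₂⟩ := Slicing.exists_truncation Set.ordConnected_Ioi
      (isUpperSet_Ioi x) hAρ
    -- The part of `A` with `ρ`-phases above `x` maps trivially to `E` and to `B⟦-1⟧`, hence also to
    -- `A`.
    have hz : IsZero A₁ := by
      refine hA₁₂.isZero_left_of_hom (fun f => ?_) (fun f => ?_)
      · obtain ⟨i, p, h, hT⟩ := hAB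
        have h1 : f ≫ i = 0 := Slicing.cl_hom_eq_zero (I := Set.Ioi (x - 1 / 4) ∩ Set.Ioi x)
          (J := {x}) (fun a ha b hb => by
            rw [Set.mem_singleton_iff] at hb; subst hb; exact ha.2) hA₁ (Slicing.cl_self hE) _
        obtain ⟨g, l, hl⟩ := exists_lift_shift_of_comp_eq_zero hT f h1
        have h2 : l = 0 := Slicing.cl_hom_eq_zero (I := Set.Ioi (x - 1 / 4) ∩ Set.Ioi x)
          (J := Set.Iio (x - 3 / 4)) (fun a ha b hb => by
            have h1 : x < a := ha.2
            have h2 : b < x - 3 / 4 := hb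
            linarith) hA₁
          (Slicing.cl_shift (-1) (fun t ht => by
            have : t < x + 1 / 4 := ht
            exact Set.mem_Iio.2 (by push_cast; linarith)) hBρ) _
        rw [hl, h2, zero_comp]
      · refine Slicing.cl_hom_eq_zero (I := Set.Ioi (x - 1 / 4) ∩ Set.Ioi x)
          (J := Set.Iic (x - 1)) (fun a ha b hb => ?_) hA₁
          (Slicing.cl_shift (-1) (fun t ht => ?_) hA₂) f
        · have h1 : x < a := ha.2
          have h2 : b ≤ x - 1 := hb
          linarith
        · have : ¬ x < t := ht.2
          exact Set.mem_Iic.2 (by push_cast; linarith)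
    obtain ⟨e⟩ := hA₁₂.iso_right hz
    have hA₂' : ρ.slicing.cl (Set.Ioc (x - 1 / 4) x) A := by
      refine (hA₂.of_iso e.symm).mono fun S hS => ?_
      obtain ⟨t, ht, hS⟩ := hS
      exact ⟨t, ⟨ht.1, not_lt.1 ht.2⟩, hS⟩
    -- The `ρ`-phases of `A` lie in `(x - 1/4, x]`, its `τ`-phases in `(x, x + 1/4)`, so the common
    -- charge lies in two opposite closed half-planes. Their shared boundary line meets the
    -- `τ`-phases only in charge zero, and massless objects of `τ` vanish.
    have hA0 : IsZero A := by
      have h1 : 0 ≤ chargeFunctional ρ.charge (x - 1 / 2) (cls v A) :=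
        hρ.chargeFunctional_nonneg (fun t ht => by
          rw [abs_le]; constructor <;> linarith [ht.1, ht.2]) hA₂'
      have h2 : 0 ≤ chargeFunctional τ.charge (x + 1 / 2) (cls v A) :=
        hτ.isLax.chargeFunctional_nonneg (fun t ht => by
          have h3 : x < t := ht.2
          rw [abs_le]; constructor <;> linarith [ht.1.2]) hA
      have h3 : chargeFunctional ρ.charge (x - 1 / 2) (cls v A) =
          -chargeFunctional τ.charge (x + 1 / 2) (cls v A) := by
        rw [hZ, chargeFunctional_apply, chargeFunctional_apply, rayFunctional_apply,
          rayFunctional_apply, show -(x - 1 / 2) = -(x + 1 / 2) + 1 by ring, ray_add, ray_one]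
        simp
      have h4 : chargeFunctional τ.charge (x + 1 / 2) (cls v A) = 0 := by linarith
      have h5 := hτ.isLax.extCl_massless (y := x + 1 / 2)
        (I := Set.Ioo (x - 1 / 4) (x + 1 / 4) ∩ Set.Ioi x) (fun t ht => by
          have h3 : x < t := ht.2
          rw [abs_lt]; constructor <;> linarith [ht.1.2]) hA h4
      have h6 : ∀ S, ((∃ t ∈ Set.Ioo (x - 1 / 4) (x + 1 / 4) ∩ Set.Ioi x, τ.slicing.P t S) ∧
          τ.charge (cls v S) = 0) → IsZero S := by
        rintro S ⟨⟨t, -, hS⟩, h0⟩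
        exact hP.isZero_of_eq_zero hS h0
      clear h1 h2 h3 h4 hA hAρ hA₂' e hAB hA₁₂
      induction h5 with
      | zero h => exact h
      | ext hE hA hS ih => exact hE.isZero₂ ih (h6 _ hS)
    obtain ⟨e'⟩ := hAB.iso_right hA0
    refine (hB.of_iso e'.symm).mono fun S hS => ?_
    obtain ⟨t, ht, hS⟩ := hS
    exact ⟨t, ⟨ht.1.1, not_lt.1 ht.2⟩, hS⟩
  refine Prod.ext (Subtype.ext (Slicing.eq_of_le fun x E hE => ?_)) hZ
  obtain ⟨A, B, hAB, hA, hB⟩ := Slicing.exists_truncation Set.ordConnected_Ioc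
    (isUpperSet_Ici x) (hle x E hE)
  -- The charge of `E` lies on the ray of phase `x`, orthogonal to that of `x - 1/2`; parts of
  -- `τ`-phase below `x` would contribute positively to this functional.
  have h1 : chargeFunctional τ.charge (x - 1 / 2) (cls v E) = 0 := by
    rw [← hZ, hρ.chargeFunctional_eq hE]
    rw [show Real.pi * (x - (x - 1 / 2)) = Real.pi / 2 by ring, Real.cos_pi_div_two, mul_zero]
  have h2 : 0 ≤ chargeFunctional τ.charge (x - 1 / 2) (cls v A) :=
    hτ.isLax.chargeFunctional_nonneg (fun t ht => by
      rw [abs_le]; constructor <;> linarith [ht.1.1, ht.1.2]) hA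
  have h3 : 0 ≤ chargeFunctional τ.charge (x - 1 / 2) (cls v B) :=
    hτ.isLax.chargeFunctional_nonneg (fun t ht => by
      rw [abs_le]; constructor <;> linarith [ht.1.1, ht.1.2]) hB
  rw [cls_isExt v hAB, map_add] at h1
  have h4 := hτ.isLax.extCl_massless (y := x - 1 / 2)
    (I := Set.Ioc (x - 1 / 4) x ∩ (Set.Ici x)ᶜ) (fun t ht => by
      have h3 : ¬ x ≤ t := ht.2
      rw [abs_lt]; constructor <;> linarith [ht.1.1, ht.1.2]) hB (by linarith)
  have hB0 : IsZero B := by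
    clear hB hAB h1 h3
    induction h4 with
    | zero h => exact h
    | ext hE hA hS ih =>
      obtain ⟨⟨t, -, hS⟩, h0⟩ := hS
      exact hE.isZero₂ ih (hP.isZero_of_eq_zero hS h0)
  obtain ⟨e⟩ := hAB.iso_left hB0
  rw [← Slicing.cl_singleton]
  refine (hA.of_iso e).mono fun S hS => ?_
  obtain ⟨t, ht, hS⟩ := hS
  exact ⟨t, le_antisymm ht.1.2 ht.2, hS⟩

theorem FibreRel.eq_of_isStab [DiscreteTopology L] {a b : LStab v}
    (ha : IsStabilityCondition v a.1) (h : FibreRel a b) : b = a := by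
  have h1 := iff_of_fibreRel (f := fun c => c = a) (δ := 1 / 4) (by norm_num)
    (fun c d hc hd hcd h0 => by
      subst h0
      refine Subtype.ext (eq_of_charge_eq ha d.2.1 hd ?_)
      rwa [sliceEDist_comm]) h
  exact h1.1 rfl

end Fibres

end LaxStability

end

noncomputable section

open scoped ZeroObject

set_option linter.unusedSectionVars false

namespace LaxStability

/-! ### Massless objects along fibres -/

section Massless

variable {C : Type u₁} [Category.{u₂} C] [Preadditive C] [HasZeroObject C] [HasShift C ℤ]
  [∀ n : ℤ, (shiftFunctor C n).Additive] [Pretriangulated C] [IsTriangulated C]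
  {V : Type u₃} [NormedAddCommGroup V] [InnerProductSpace ℝ V] {L : Submodule ℤ V}
  {v : K0 C →+ L}

/-- There is a massless semistable object on whose class the map `Z` does not vanish. -/
def HasMassless (v : K0 C →+ L) (Z : V →L[ℝ] ℂ) (τ : StabData C V) : Prop :=
  ∃ x X, τ.slicing.P x X ∧ τ.charge (cls v X) = 0 ∧ Z (cls v X) ≠ 0

theorem Slicing.cl_Ioo_of_sliceEDist_lt {P Q : Slicing C} {ε : ℝ}
    (h : sliceEDist P Q < ENNReal.ofReal ε) {x : ℝ} {X : C} (hX : P.P x X) :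
    Q.cl (Set.Ioo (x - ε) (x + ε)) X :=
  Slicing.cl_of_sliceEDist_lt h Set.ordConnected_singleton Set.ordConnected_Ioo (by
    rintro s rfl t ht
    rw [abs_lt] at ht
    exact ⟨by linarith [ht.2], by linarith [ht.1]⟩) (Slicing.cl_self hX)

/-- With respect to `ρ` the massless object is an extension of massless semistable objects; if `Z`
vanished on all of them, it would vanish on the extension. -/
theorem HasMassless.of_sliceEDist_lt {Z : V →L[ℝ] ℂ} {τ ρ : StabData C V}
    (hρ : IsLaxStabilityCondition v ρ) (hZ : ρ.charge = τ.charge)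
    (hd : sliceEDist τ.slicing ρ.slicing < ENNReal.ofReal (1 / 4)) (h : HasMassless v Z τ) :
    HasMassless v Z ρ := by
  obtain ⟨x, X, hX, h0, hX0⟩ := h
  have h1 := hρ.extCl_massless (y := x) (fun t ht => by
      rw [abs_lt]; constructor <;> linarith [ht.1, ht.2])
    (Slicing.cl_Ioo_of_sliceEDist_lt hd hX)
    (by rw [chargeFunctional_apply, hZ, h0, map_zero])
  by_contra hc
  refine hX0 (map_cls_eq_zero_of_extCl v (Z : V →ₗ[ℝ] ℂ) ?_ h1)
  rintro S ⟨⟨t, -, hS⟩, hS0⟩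
  by_contra hSZ
  exact hc ⟨t, S, hS, hS0, hSZ⟩

theorem FibreRel.hasMassless {Z : V →L[ℝ] ℂ} {a b : LStab v} (h : FibreRel a b)
    (ha : HasMassless v Z a.1) : HasMassless v Z b.1 :=
  (iff_of_fibreRel (f := fun c => HasMassless v Z c.1) (δ := 1 / 4) (by norm_num)
    (fun c d hc hd hcd h0 => h0.of_sliceEDist_lt d.2.1 (hd.trans hc.symm) hcd) h).1 ha

/-- Massless objects remain massless in the limit. -/
theorem IsLaxStabilityCondition.exists_charge_eq_zero {τ : StabData C V}
    (hτ : IsLaxStabilityCondition v τ) : ∃ δ > 0, ∀ ρ : StabData C V,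
      IsLaxStabilityCondition v ρ → ‖ρ.charge - τ.charge‖ < δ →
      sliceEDist ρ.slicing τ.slicing < ENNReal.ofReal (1 / 8) →
      ∀ x X, ρ.slicing.P x X → ρ.charge (cls v X) = 0 → τ.charge (cls v X) = 0 := by
  obtain ⟨K, hK, hs⟩ := hτ.2
  -- `X` is built from `τ`-stable objects `S` whose `ρ`-phases are within `1/4` of `x`, so their
  -- projections to the ray of `x` are non-negative with sum zero and vanish. If `S` were massive
  -- for `τ`, half its mass would be at most `‖cls v S‖ / (4 K)`, hence at most a quarter of its
  -- mass.
  refine ⟨1 / (4 * K), by positivity, fun ρ hρ hZ hd x X hX h0 => ?_⟩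
  have hd' : sliceEDist τ.slicing ρ.slicing < ENNReal.ofReal (1 / 8) := by
    rwa [sliceEDist_comm]
  have h1 : ExtCl (fun S => ∃ t ∈ Set.Ioo (x - 1 / 8) (x + 1 / 8), τ.slicing.IsStable t S) X :=
    (Slicing.cl_Ioo_of_sliceEDist_lt hd hX).bind fun Y ⟨t, ht, hY⟩ =>
      (Slicing.extCl_isStable τ.1.2 hY).mono fun S hS => ⟨t, ht, hS⟩
  have hnn : ∀ S, (∃ t ∈ Set.Ioo (x - 1 / 8) (x + 1 / 8), τ.slicing.IsStable t S) →
      0 ≤ chargeFunctional ρ.charge x (cls v S) := by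
    rintro S ⟨t, ht, hS⟩
    refine hρ.chargeFunctional_nonneg (fun s hs => ?_)
      (Slicing.cl_Ioo_of_sliceEDist_lt hd' hS.choose)
    rw [abs_le]; constructor <;> linarith [ht.1, ht.2, hs.1, hs.2]
  have h2 := ExtCl.of_map_cls_eq_zero (chargeFunctional ρ.charge x) hnn h1
    (by rw [chargeFunctional_apply, h0, map_zero])
  refine map_cls_eq_zero_of_extCl v (τ.charge : V →ₗ[ℝ] ℂ) ?_ h2
  rintro S ⟨⟨t, ht, hS⟩, hS0⟩
  by_contra hne
  have hne' : τ.charge (cls v S) ≠ 0 := hne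
  have h3 := hs t S hS hne'
  have h4 : chargeFunctional τ.charge x (cls v S) =
      ‖τ.charge (cls v S)‖ * Real.cos (Real.pi * (t - x)) := hτ.chargeFunctional_eq hS.choose x
  have h5 : 1 / 2 ≤ Real.cos (Real.pi * (t - x)) := by
    rw [← Real.cos_pi_div_three, ← Real.cos_abs (Real.pi * (t - x)), abs_mul,
      abs_of_pos Real.pi_pos]
    have h6 : |t - x| ≤ 1 / 8 := by
      rw [abs_le]; constructor <;> linarith [ht.1, ht.2]
    exact Real.cos_le_cos_of_nonneg_of_le_pi (by positivity) (by linarith [Real.pi_pos])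
      (by nlinarith [Real.pi_pos])
  have h6 : chargeFunctional τ.charge x (cls v S) ≤ 1 / (4 * K) * ‖cls v S‖ := by
    have h7 : chargeFunctional τ.charge x (cls v S) =
        rayFunctional x (-((ρ.charge - τ.charge) (cls v S))) := by
      rw [sub_apply, neg_sub, map_sub, ← chargeFunctional_apply,
        ← chargeFunctional_apply, hS0, sub_zero]
    rw [h7]
    refine (rayFunctional_le_norm _ _).trans ?_
    rw [norm_neg]
    exact ((ρ.charge - τ.charge).le_opNorm _).trans
      (mul_le_mul_of_nonneg_right hZ.le (norm_nonneg _))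
  have h7 : 0 < ‖τ.charge (cls v S)‖ := norm_pos_iff.2 hne'
  have h8 : ‖τ.charge (cls v S)‖ * (1 / 2) ≤ 1 / (4 * K) * ‖cls v S‖ := by
    refine le_trans ?_ h6
    rw [h4]
    exact mul_le_mul_of_nonneg_left h5 h7.le
  have h9 : 1 / (4 * K) * ‖cls v S‖ = 1 / K * ‖cls v S‖ / 4 := by field_simp
  rw [h9] at h8
  linarith

/-- Up to massless objects, `X` has phases at most `b`. -/
def MassiveBelow (v : K0 C →+ L) (b : ℝ) (X : C) (τ : StabData C V) : Prop :=
  ∃ E W, IsExt E X W ∧ τ.slicing.cl (Set.Ioi b) E ∧ τ.slicing.cl (Set.Iic b) W ∧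
    τ.charge (cls v E) = 0

/-- If `y > b`, there are no non-zero maps from `X` to `W` or from `E⟦1⟧` to `W`, so `W` vanishes
and the massless `E` would be all of the massive `X`. -/
theorem IsLaxStabilityCondition.massiveBelow_iff {τ : StabData C V}
    {b y : ℝ} {X : C} (hX : τ.slicing.P y X) (h0 : τ.charge (cls v X) ≠ 0) :
    MassiveBelow v b X τ ↔ y ≤ b := by
  constructor
  · rintro ⟨E, W, hE, hE1, hW, hE0⟩
    by_contra hy
    push Not at hy
    have hW0 : IsZero W := by
      refine hE.isZero_right_of_hom (fun f => ?_) (fun f => ?_)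
      · exact Slicing.cl_hom_eq_zero (I := {y}) (J := Set.Iic b) (fun s hs t ht => by
          rw [Set.mem_singleton_iff] at hs
          subst hs
          exact lt_of_le_of_lt ht hy) (Slicing.cl_self hX) hW f
      · refine Slicing.cl_hom_eq_zero (I := Set.Ioi (b + 1)) (J := Set.Iic b) (fun s hs t ht => ?_)
          (Slicing.cl_shift 1 (fun t ht => ?_) hE1) hW f
        · have h1 : b + 1 < s := hs
          have h2 : t ≤ b := ht
          linarith
        · have h1 : b < t := ht
          exact Set.mem_Ioi.2 (by push_cast; linarith)
    obtain ⟨e⟩ := hE.iso_left hW0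
    exact h0 (by rw [← cls_iso v e]; exact hE0)
  · intro hy
    refine ⟨0, X, isExt_zero_left (isZero_zero C) X, .zero (isZero_zero C),
      Slicing.cl_single (Set.mem_Iic.2 hy) hX, ?_⟩
    rw [cls_isZero v (isZero_zero C), map_zero]

/-- When the charge takes values in the line orthogonal to the ray of phase `b`, semistable objects
of phase within `1/2` of `b` must be massless. -/
theorem IsLaxStabilityCondition.charge_eq_zero_of_cl {τ : StabData C V}
    (h : IsLaxStabilityCondition v τ) {b : ℝ} (hb : ∀ x, rayFunctional b (τ.charge x) = 0)
    {I : Set ℝ} (hI : ∀ t ∈ I, |t - b| < 1 / 2) {X : C} (hX : τ.slicing.cl I X) :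
    τ.charge (cls v X) = 0 := by
  refine map_cls_eq_zero_of_extCl v (τ.charge : V →ₗ[ℝ] ℂ) ?_ (h.extCl_massless hI hX (hb _))
  rintro S ⟨-, hS⟩
  exact hS

/-- `E` and `W` are truncated again at `b` for `ρ`. The pieces that cross `b` have phases within
`1/8` of `b`, hence are massless, and may be moved to the other side. -/
theorem MassiveBelow.of_sliceEDist_lt {b : ℝ} {X : C} {τ ρ : StabData C V}
    (hρ : IsLaxStabilityCondition v ρ) (hZ : ρ.charge = τ.charge)
    (hb : ∀ x, rayFunctional b (τ.charge x) = 0)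
    (hd : sliceEDist τ.slicing ρ.slicing < ENNReal.ofReal (1 / 8)) (h : MassiveBelow v b X τ) :
    MassiveBelow v b X ρ := by
  obtain ⟨E, W, hE, hE1, hW, hE0⟩ := h
  have hEρ : ρ.slicing.cl (Set.Ioi (b - 1 / 8)) E :=
    Slicing.cl_of_sliceEDist_lt hd Set.ordConnected_Ioi Set.ordConnected_Ioi (fun s hs t ht => by
      rw [abs_lt] at ht
      have h1 : b < s := hs
      exact Set.mem_Ioi.2 (by linarith [ht.2])) hE1
  have hWρ : ρ.slicing.cl (Set.Iio (b + 1 / 8)) W :=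
    Slicing.cl_of_sliceEDist_lt hd Set.ordConnected_Iic Set.ordConnected_Iio (fun s hs t ht => by
      rw [abs_lt] at ht
      have h1 : s ≤ b := hs
      exact Set.mem_Iio.2 (by linarith [ht.1])) hW
  obtain ⟨X₁, X₂, hX₁₂, hX₁, hX₂⟩ := Slicing.exists_truncation Set.ordConnected_Ioi
    (isUpperSet_Ioi b) hEρ
  obtain ⟨W', hW', hX₂W'⟩ := hX₁₂.comp_left hE
  have hW'ρ : ρ.slicing.cl (Set.Iio (b + 1 / 8)) W' := by
    refine Slicing.cl_isExt hX₂W' (Slicing.cl_mono (fun t ht => ?_) hX₂) hWρ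
    have h1 : ¬ b < t := ht.2
    exact Set.mem_Iio.2 (by linarith)
  obtain ⟨W₁, W₂, hW₁₂, hW₁, hW₂⟩ := Slicing.exists_truncation Set.ordConnected_Iio
    (isUpperSet_Ioi b) hW'ρ
  obtain ⟨E', hE', hE'X⟩ := hW'.comp_right hW₁₂
  rw [← hZ] at hb
  have hX₂0 : ρ.charge (cls v X₂) = 0 := hρ.charge_eq_zero_of_cl hb (fun t ht => by
    have h1 : ¬ b < t := ht.2
    have h2 : b - 1 / 8 < t := ht.1
    rw [abs_lt]; constructor <;> linarith) hX₂
  have hW₁0 : ρ.charge (cls v W₁) = 0 := hρ.charge_eq_zero_of_cl hb (fun t ht => by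
    have h1 : b < t := ht.2
    have h2 : t < b + 1 / 8 := ht.1
    rw [abs_lt]; constructor <;> linarith) hW₁
  rw [← hZ, cls_isExt v hX₁₂, map_add, hX₂0, add_zero] at hE0
  refine ⟨E', W₂, hE'X, Slicing.cl_isExt hE' (Slicing.cl_mono Set.inter_subset_right hX₁)
    (Slicing.cl_mono Set.inter_subset_right hW₁), Slicing.cl_mono (fun t ht => ?_) hW₂, ?_⟩
  · have h1 : ¬ b < t := ht.2
    exact not_lt.1 h1
  · rw [cls_isExt v hE', map_add, hE0, hW₁0, add_zero]

theorem FibreRel.massiveBelow_iff {b : ℝ} {X : C} {τ ρ : LStab v} (h : FibreRel τ ρ)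
    (hb : ∀ x, rayFunctional b (τ.1.charge x) = 0) :
    MassiveBelow v b X τ.1 ↔ MassiveBelow v b X ρ.1 :=
  iff_of_fibreRel (f := fun c => MassiveBelow v b X c.1) (δ := 1 / 8) (by norm_num)
    (fun c d hc hd hcd h0 => h0.of_sliceEDist_lt d.2.1 (hd.trans hc.symm)
      (by rwa [hc]) hcd) h

/-- The image of `nMap (bdry φ)` is the real line through the ray of phase `φ + 1/2`. -/
theorem rayFunctional_nMap_boundary (φ : ℝ) (z : ℂ) :
    rayFunctional φ (nMap (bdry φ) z) = 0 := by
  rw [← ray_arg_mul_norm z, ← Complex.real_smul, map_smul, bdry_eq_ray, nMap_ray,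
    rotFactor_boundary, mul_left_comm, ← ray_add, map_smul, add_sub_cancel,
    rayFunctional_smul_ray, add_sub_cancel_left, mul_one_div, Real.cos_pi_div_two]
  simp

end Massless

/-! ### The fibres of the blow-down map lie in single components of the fibres of the charge. -/

namespace BlownUpDisk

variable {C : Type u₁} [Category.{u₂} C] [Preadditive C] [HasZeroObject C] [HasShift C ℤ]
  [∀ n : ℤ, (shiftFunctor C n).Additive] [Pretriangulated C] [IsTriangulated C]
  {V : Type u₃} [NormedAddCommGroup V] [InnerProductSpace ℝ V] {L : Submodule ℤ V}
  {v : K0 C →+ L} [DiscreteTopology L] (σ : Stab v)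

/-- The point of `LStab(C)` given by a point of the blown up disk. -/
def pointL (p : BlownUpDisk σ.1.slicing) : LStab v :=
  ⟨point σ p, isLax_point σ p, point_mem_closure_stab σ p⟩

theorem pointL_val (p : BlownUpDisk σ.1.slicing) : (pointL σ p).1 = point σ p := rfl

theorem continuous_pointL : Continuous (pointL σ) := (continuous_point σ).subtype_mk _

theorem point_eq_of_pt_eq {p q : BlownUpDisk σ.1.slicing} {φ : ℝ} (hp : p.pt = bdry φ)
    (hq : q.pt = bdry φ) (h : bdry φ ∈ blowUpCentre σ.1.slicing → p.angle = q.angle) :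
    point σ p = point σ q := by
  refine Prod.ext (Subtype.ext ?_) ?_
  · exact (point_eq_of_angle σ hp h).trans (point_eq_of_angle σ hq fun _ => rfl).symm
  · change (nMap p.pt).comp _ = (nMap q.pt).comp _
    rw [hp, hq]

theorem point_eq_of_norm_lt {p q : BlownUpDisk σ.1.slicing} (hp : ‖p.pt‖ < 1) (h : p.pt = q.pt) :
    p = q := by
  have hq : ‖q.pt‖ < 1 := h ▸ hp
  rw [eq_ofInterior hp, eq_ofInterior hq]
  simp only [h]

theorem continuous_ofBdry {P : Slicing C} {φ : ℝ} (hφ : bdry φ ∈ quotDiskSet P)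
    (h : ∀ ψ ∈ Set.Icc (0 : ℝ) 1, bdry φ ∈ blowUpCentre P → AllowedPhase P φ ψ) :
    Continuous fun ψ : Set.Icc (0 : ℝ) 1 => ofBdry P φ ψ.1 hφ (h ψ.1 ψ.2) := by
  refine Continuous.subtype_mk (continuous_const.prodMk (continuous_pi fun s => ?_)) _
  by_cases hs : bdry φ = s
  · simp only [if_pos hs]
    exact continuous_const.mul (continuous_ray.comp (continuous_subtype_val.sub continuous_const))
  · simp only [if_neg hs]
    exact continuous_const

/-- Two different phases can be allowed over the same centre only at an isolated phase. Then all of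
`[0, 1]` is allowed and traces a path inside one fibre of the charge. -/
theorem fibreRel_pointL {p q : BlownUpDisk σ.1.slicing} (h : p.pt = q.pt) :
    FibreRel (pointL σ p) (pointL σ q) := by
  by_cases hp : ‖p.pt‖ < 1
  · rw [point_eq_of_norm_lt σ hp h]
    exact FibreRel.refl _
  obtain ⟨φ, hφ⟩ := exists_pt_eq_bdry hp
  have hq : q.pt = bdry φ := h ▸ hφ
  by_cases he : bdry φ ∈ blowUpCentre σ.1.slicing → p.angle = q.angle
  · have h1 : pointL σ p = pointL σ q := Subtype.ext (point_eq_of_pt_eq σ hφ hq he)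
    rw [h1]
    exact FibreRel.refl _
  push Not at he
  obtain ⟨hs, hne⟩ := he
  have hpa := p.allowedPhase hφ hs
  have hqa := q.allowedPhase hq hs
  have hall : ∀ ψ ∈ Set.Icc (0 : ℝ) 1, AllowedPhase σ.1.slicing φ ψ := by
    have hcontra : (∀ ε > 0, ∃ t ∈ σ.1.slicing.phases, t ≠ φ ∧ |t - φ| < ε) →
        (∃ ε > 0, ∀ t ∈ Set.Ioo (φ - ε) φ, t ∉ σ.1.slicing.phases) →
        (∃ ε > 0, ∀ t ∈ Set.Ioo φ (φ + ε), t ∉ σ.1.slicing.phases) → False := by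
      rintro h1 ⟨ε, hε, h2⟩ ⟨ε', hε', h3⟩
      obtain ⟨t, ht, htne, ht'⟩ := h1 (min ε ε') (lt_min hε hε')
      have h4 := abs_lt.1 ht'
      rcases lt_or_gt_of_ne htne with h5 | h5
      · exact h2 t ⟨by linarith [min_le_left ε ε'], h5⟩ ht
      · exact h3 t ⟨h5, by linarith [min_le_right ε ε']⟩ ht
    rcases allowedPhase_iff.1 hpa with ⟨h1, h2, -⟩ | ⟨h1, h2, h3⟩ | ⟨h1, h2, h3⟩
    · exact fun ψ hψ => allowedPhase_iff.2 (.inl ⟨h1, h2, hψ⟩)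
    all_goals
      rcases allowedPhase_iff.1 hqa with ⟨h1', h2', -⟩ | ⟨h1', h2', h3'⟩ | ⟨h1', h2', h3'⟩
      · exact fun ψ hψ => allowedPhase_iff.2 (.inl ⟨h1', h2', hψ⟩)
    · exact absurd (h3.trans h3'.symm) hne
    · exact (hcontra h1 h2 h2').elim
    · exact (hcontra h1 h2' h2).elim
    · exact absurd (h3.trans h3'.symm) hne
  have hφq : bdry φ ∈ quotDiskSet σ.1.slicing := hs.1
  have hc := (continuous_pointL σ).comp (continuous_ofBdry hφq fun ψ hψ _ => hall ψ hψ)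
  have hmem : ∀ r : BlownUpDisk σ.1.slicing, r.pt = bdry φ → pointL σ r ∈ Set.range
      (pointL σ ∘ fun ψ : Set.Icc (0 : ℝ) 1 => ofBdry _ φ ψ.1 hφq fun _ => hall ψ.1 ψ.2) := by
    intro r hr
    refine ⟨⟨r.angle, (r.allowedPhase hr hs).mem_Icc⟩, Subtype.ext ?_⟩
    exact point_eq_of_pt_eq σ rfl hr fun h => ofBdry_angle _ _ h
  refine FibreRel.of_isPreconnected (isPreconnected_range hc) (hmem p hφ) (hmem q hq) ?_
  rintro _ ⟨ψ, rfl⟩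
  change (nMap (bdry φ)).comp _ = (nMap p.pt).comp _
  rw [hφ]

end BlownUpDisk

end LaxStability

end

noncomputable section

open scoped ZeroObject

set_option linter.unusedSectionVars false

namespace LaxStability

/-! ### Limits of fibre components -/

namespace BlownUpDisk

variable {C : Type u₁} [Category.{u₂} C] [Preadditive C] [HasZeroObject C] [HasShift C ℤ]
  [∀ n : ℤ, (shiftFunctor C n).Additive] [Pretriangulated C] [IsTriangulated C]
  {V : Type u₃} [NormedAddCommGroup V] [InnerProductSpace ℝ V] {L : Submodule ℤ V}
  {v : K0 C →+ L} [DiscreteTopology L] (σ : Stab v)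

theorem hasMassless_act_point {p : BlownUpDisk σ.1.slicing}
    (hp : p.pt ∈ blowUpCentre σ.1.slicing) (z : ℂ) :
    HasMassless v σ.1.charge (act z (point σ p)) := by
  obtain ⟨k, κ, hP⟩ := σ.2.isSupported
  obtain ⟨φ, -, hφ⟩ := exists_bdry_eq (norm_eq_one_of_mem_blowUpCentre hp)
  rw [hφ] at hp
  obtain ⟨X, hX, hX0⟩ := exists_of_mem_phases (hP.mem_phases_of_mem_blowUpCentre hp)
  refine ⟨p.lift φ - z.re, X, ?_, ?_, fun h0 => hX0 (hP.isZero_of_eq_zero hX h0)⟩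
  · rw [act_P, sub_add_cancel, point_slicing, Slicing.map_P]
    exact Slicing.cl_single (I := p.lift ⁻¹' {p.lift φ}) rfl hX
  · rw [act_charge, smul_apply]
    have : (point σ p).charge (cls v X) = 0 := by
      change nMap p.pt (σ.1.charge (cls v X)) = 0
      rw [hP.charge_eq _ _ hX, ← Complex.real_smul, map_smul, hφ, bdry_eq_ray, nMap_ray,
        rotFactor_eq_zero_iff.2 rfl]
      simp
    rw [this, smul_zero]

theorem exists_massive (hσ : (phaseDiagram σ.1.slicing).Nontrivial) {p : BlownUpDisk σ.1.slicing}
    {φ : ℝ} (hφ : p.pt = bdry φ) :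
    ∃ X, (point σ p).slicing.P (φ + 1 / 2) X ∧ (point σ p).charge (cls v X) ≠ 0 := by
  obtain ⟨k, κ, hP⟩ := σ.2.isSupported
  obtain ⟨t, ht, htφ⟩ : ∃ t ∈ σ.1.slicing.phases, (t : UnitAddCircle) ≠ φ := by
    obtain ⟨_, ⟨t, rfl, ht⟩, hne⟩ := hσ.exists_ne (φ : UnitAddCircle)
    exact ⟨t, ht, hne⟩
  obtain ⟨m, s, hs, rfl⟩ := exists_int_add_mem_Ico φ t
  rw [Slicing.add_int_mem_phases_iff] at ht
  have hs' : s ∈ Set.Ioo φ (φ + 1) := by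
    refine ⟨lt_of_le_of_ne hs.1 ?_, hs.2⟩
    rintro rfl
    exact htφ (coe_eq_coe_iff.2 ⟨m, rfl⟩)
  obtain ⟨X, hX, hX0⟩ := exists_of_mem_phases ht
  refine ⟨X, ?_, ?_⟩
  · rw [point_slicing, Slicing.map_P, lift_of_eq_bdry hφ]
    exact Slicing.cl_single (I := stepLift φ p.angle ⁻¹' {φ + 1 / 2})
      (stepLift_of_mem_Ioo _ hs') hX
  · change nMap p.pt (σ.1.charge (cls v X)) ≠ 0
    have h0 := hP.κ_pos.trans_le (hP.le_norm _ _ hX hX0)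
    rw [hP.charge_eq _ _ hX, ← Complex.real_smul, map_smul, hφ, bdry_eq_ray, nMap_ray]
    exact smul_ne_zero h0.ne' (mul_ne_zero (ray_ne_zero _) (by
      rw [← bdry_eq_ray]; exact rotFactor_bdry_ne_zero hs'))

/-- The logarithm is only taken of `c n / a`, which tends to `1`, so its branch cut is avoided. -/
theorem exists_tendsto_log {c : ℕ → ℂ} {a : ℂ} (ha : a ≠ 0)
    (hc : Filter.Tendsto c Filter.atTop (𝓝 a)) : ∃ (y : ℕ → ℂ) (y₀ : ℂ),
      Filter.Tendsto y Filter.atTop (𝓝 y₀) ∧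
      (∀ᶠ n in Filter.atTop, Complex.exp (-(Complex.I * Real.pi * y n)) = c n) ∧
      Complex.exp (-(Complex.I * Real.pi * y₀)) = a := by
  have hpi : (Real.pi : ℂ) ≠ 0 := by exact_mod_cast Real.pi_ne_zero
  refine ⟨fun n => Complex.I / Real.pi * (Complex.log a + Complex.log (c n / a)),
    Complex.I / Real.pi * Complex.log a, ?_, ?_, ?_⟩
  · have h1 : Filter.Tendsto (fun n => Complex.log (c n / a)) Filter.atTop (𝓝 0) := by
      have h2 := hc.div_const a
      rw [div_self ha] at h2
      simpa using h2.clog (by simp)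
    simpa using (h1.const_add (Complex.log a)).const_mul (Complex.I / Real.pi)
  · filter_upwards [hc.eventually_ne ha] with n hn
    have : -(Complex.I * Real.pi * (Complex.I / Real.pi * (Complex.log a +
        Complex.log (c n / a)))) = Complex.log a + Complex.log (c n / a) := by
      field_simp
      linear_combination -(Complex.log a + Complex.log (c n / a)) * Complex.I_sq
    rw [this, Complex.exp_add, Complex.exp_log ha, Complex.exp_log (div_ne_zero hn ha),
      mul_div_cancel₀ _ ha]
  · have : -(Complex.I * Real.pi * (Complex.I / Real.pi * Complex.log a)) = Complex.log a := by
      field_simp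
      linear_combination -(Complex.log a) * Complex.I_sq
    rw [this, Complex.exp_log ha]

theorem exp_act_eq_exp_act_iff {z y : ℂ} :
    Complex.exp (-(Complex.I * Real.pi * z)) = Complex.exp (-(Complex.I * Real.pi * y)) ↔
      ∃ k : ℤ, z = y + (2 * k : ℝ) := by
  have hpi : (Real.pi : ℂ) ≠ 0 := by exact_mod_cast Real.pi_ne_zero
  have h0 : Complex.I * Real.pi ≠ 0 := mul_ne_zero Complex.I_ne_zero hpi
  rw [Complex.exp_eq_exp_iff_exists_int]
  constructor
  · rintro ⟨n, hn⟩
    refine ⟨-n, mul_left_cancel₀ h0 ?_⟩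
    push_cast
    linear_combination -hn
  · rintro ⟨k, rfl⟩
    refine ⟨-k, ?_⟩
    push_cast
    ring

theorem eq_of_nMap_eq_zero {w w' ζ : ℂ} (hζ : ζ ≠ 0) (h : nMap w ζ = 0) (h' : nMap w' ζ = 0) :
    w = w' := by
  rw [nMap_apply, sub_eq_zero] at h h'
  exact mul_right_cancel₀ ((map_ne_zero _).2 hζ) (h.symm.trans h')

theorem act_two_mul_int_charge (k : ℤ) (τ : StabData C V) :
    (act ((2 * k : ℝ) : ℂ) τ).charge = τ.charge := by
  have h := exp_act_eq_exp_act_iff.2 ⟨k, (zero_add ((2 * k : ℝ) : ℂ)).symm⟩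
  rw [act_charge, h]
  simp

/-- After the shift the massive object `X` has phase `φ + 1/2 - 2k`; comparing it with the phases `φ
+ m` recovers `k`. -/
theorem massiveBelow_shift_iff {p : BlownUpDisk σ.1.slicing} {φ : ℝ} {X : C}
    (hX : (point σ p).slicing.P (φ + 1 / 2) X) (h0 : (point σ p).charge (cls v X) ≠ 0) (m k : ℤ) :
    MassiveBelow v (φ + m) X (act ((2 * k : ℝ) : ℂ) (point σ p)) ↔ 1 ≤ m + 2 * k := by
  rw [IsLaxStabilityCondition.massiveBelow_iff (y := φ + 1 / 2 - 2 * k)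
    (by rw [act_P, Complex.ofReal_re, sub_add_cancel]; exact hX)
    (by rw [act_two_mul_int_charge]; exact h0)]
  constructor
  · intro h
    have h1 : (0 : ℝ) < ((m + 2 * k : ℤ) : ℝ) := by push_cast; linarith
    have h2 : 0 < m + 2 * k := by exact_mod_cast h1
    omega
  · intro h
    have h1 : (1 : ℝ) ≤ ((m + 2 * k : ℤ) : ℝ) := by exact_mod_cast h
    push_cast at h1
    linarith

/-- Every class over a centre has a massless object on which the original charge is non-zero, and
this object stays massless in the limit. Its original charge is killed by `nMap` at both `(p n).pt`
and `w`, and a non-zero kernel vector determines the parameter. -/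
theorem eventually_pt_eq_of_tendsto (hσ : (phaseDiagram σ.1.slicing).Nontrivial)
    {z : ℕ → ℂ} {p : ℕ → BlownUpDisk σ.1.slicing} (hp : ∀ n, (p n).pt ∈ blowUpCentre σ.1.slicing)
    {q : ℕ → LStab v} {τ : LStab v} (hτ : τ.1.charge ≠ 0)
    (hpq : ∀ n, FibreRel (actL (z n) (pointL σ (p n))) (q n))
    (hqτ : Filter.Tendsto q Filter.atTop (𝓝 τ)) :
    ∃ a w, a ≠ 0 ∧ Filter.Tendsto (fun n => Complex.exp (-(Complex.I * Real.pi * z n)))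
      Filter.atTop (𝓝 a) ∧ ∀ᶠ n in Filter.atTop, (p n).pt = w := by
  have hval : Filter.Tendsto (fun n => (q n).1) Filter.atTop (𝓝 τ.1) :=
    (continuous_subtype_val.tendsto _).comp hqτ
  have hs : Filter.Tendsto (fun n => (q n).1.1) Filter.atTop (𝓝 τ.1.1) :=
    (continuous_fst.tendsto _).comp hval
  have hZ : Filter.Tendsto (fun n => (q n).1.2) Filter.atTop (𝓝 τ.1.2) :=
    (continuous_snd.tendsto _).comp hval
  have hch : ∀ n, (q n).1.2 =
      Complex.exp (-(Complex.I * Real.pi * z n)) • (nMap (p n).pt).comp σ.1.charge :=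
    fun n => (hpq n).charge_eq
  obtain ⟨a, w, ha0, ha, -, hTw⟩ := exists_tendsto_coefficients (charge_surjective σ hσ)
    (fun n => (p n).norm_pt_le) hτ (hZ.congr hch)
  refine ⟨a, w, ha0, ha, ?_⟩
  obtain ⟨δ, hδ, h1⟩ := τ.2.1.exists_charge_eq_zero
  have h2 : ∀ᶠ n in Filter.atTop, ‖(q n).1.charge - τ.1.charge‖ < δ := by
    have := Metric.tendsto_nhds.1 hZ δ hδ
    simpa only [dist_eq_norm] using this
  filter_upwards [h2, tendsto_slice_iff.1 hs (1 / 8) (by norm_num)] with n hn hn'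
  obtain ⟨x, X, hX, h0, hX0⟩ :=
    (hpq n).hasMassless (hasMassless_act_point σ (hp n) (z n))
  have h3 := h1 _ (q n).2.1 hn hn' x X hX h0
  have h4 : (q n).1.2 (cls v X) = 0 := h0
  have h5 : τ.1.2 (cls v X) = 0 := h3
  rw [hch, smul_apply, smul_eq_zero] at h4
  change τ.1.2 = _ at hTw
  rw [hTw, smul_apply, smul_eq_zero] at h5
  exact eq_of_nMap_eq_zero hX0 (h4.resolve_left (Complex.exp_ne_zero _)) (h5.resolve_left ha0)

theorem massiveBelow_iff_of_fibreRel {p : BlownUpDisk σ.1.slicing} {φ : ℝ} {X : C}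
    (hφ : p.pt = bdry φ) (hX : (point σ p).slicing.P (φ + 1 / 2) X)
    (h0 : (point σ p).charge (cls v X) ≠ 0) {k : ℤ} {r : LStab v}
    (hr : FibreRel (actL ((2 * k : ℝ) : ℂ) (pointL σ p)) r) {r₀ : LStab v}
    (hZ : r₀.1.charge = r.1.charge)
    (hd : sliceEDist r.1.slicing r₀.1.slicing < ENNReal.ofReal (1 / 8)) (m : ℤ) :
    MassiveBelow v (φ + m) X r₀.1 ↔ 1 ≤ m + 2 * k := by
  have hch : r.1.charge = (nMap p.pt).comp σ.1.charge := by
    rw [hr.charge_eq, actL_val, act_two_mul_int_charge]; rfl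
  have hb : ∀ x, rayFunctional (φ + m) ((nMap p.pt).comp σ.1.charge x) = 0 := by
    intro x
    have h1 : bdry φ = bdry (φ + m) := bdry_eq_bdry_iff.2 ⟨-m, by push_cast; ring⟩
    rw [hφ, h1]
    exact rayFunctional_nMap_boundary _ _
  rw [← massiveBelow_shift_iff σ hX h0 m k, ← pointL_val, ← actL_val,
    hr.massiveBelow_iff (fun x => by rw [actL_val, act_two_mul_int_charge]; exact hb x)]
  constructor
  · intro h
    exact h.of_sliceEDist_lt r.2.1 hZ.symm (by rw [hZ, hch]; exact hb)
      (by rwa [sliceEDist_comm])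
  · intro h
    exact h.of_sliceEDist_lt r₀.2.1 hZ (by rw [hch]; exact hb) hd

/-- Near the limit all `r n` agree with `r₀` about `MassiveBelow`, so the integer `k` is eventually
constant; the components being closed, `r₀` belongs to the same one. -/
theorem exists_fibreRel_of_tendsto (hσ : (phaseDiagram σ.1.slicing).Nontrivial)
    {p : BlownUpDisk σ.1.slicing} {φ : ℝ} (hφ : p.pt = bdry φ) {r : ℕ → LStab v} {r₀ : LStab v}
    (hr : ∀ᶠ n in Filter.atTop, ∃ k : ℤ, FibreRel (actL ((2 * k : ℝ) : ℂ) (pointL σ p)) (r n))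
    (h : Filter.Tendsto r Filter.atTop (𝓝 r₀)) :
    ∃ k : ℤ, FibreRel (actL ((2 * k : ℝ) : ℂ) (pointL σ p)) r₀ := by
  obtain ⟨X, hX, hX0⟩ := exists_massive σ hσ hφ
  have hs : Filter.Tendsto (fun n => (r n).1.1) Filter.atTop (𝓝 r₀.1.1) :=
    ((continuous_fst.comp continuous_subtype_val).tendsto _).comp h
  have hcharge : ∀ n, (∃ k : ℤ, FibreRel (actL ((2 * k : ℝ) : ℂ) (pointL σ p)) (r n)) →
      (r n).1.charge = (nMap p.pt).comp σ.1.charge := by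
    rintro n ⟨k, hk⟩
    rw [hk.charge_eq, actL_val, act_two_mul_int_charge]; rfl
  have hcharge₀ : r₀.1.charge = (nMap p.pt).comp σ.1.charge :=
    tendsto_nhds_unique ((continuous_charge.tendsto _).comp h)
      (tendsto_const_nhds.congr' (hr.mono fun n hn => (hcharge n hn).symm))
  obtain ⟨N, hN⟩ := Filter.eventually_atTop.1
    (hr.and (tendsto_slice_iff.1 hs (1 / 8) (by norm_num)))
  choose! k hk using fun n hn => (hN n hn).1
  have hiff := fun n hn => massiveBelow_iff_of_fibreRel σ hφ hX hX0 (hk n hn)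
    (hcharge₀.trans (hcharge n (hN n hn).1).symm) (hN n hn).2
  refine ⟨k N, (isClosed_setOf_fibreRel _).mem_of_tendsto h ?_⟩
  filter_upwards [Filter.eventually_ge_atTop N] with n hn
  -- The thresholds `1 - 2k` for the two values of `k` yield the two inequalities between them.
  have h1 := (hiff n hn (1 - 2 * k n)).symm.trans (hiff N le_rfl (1 - 2 * k n))
  have h2 := (hiff n hn (1 - 2 * k N)).symm.trans (hiff N le_rfl (1 - 2 * k N))
  have hkN : k n = k N := by omega
  have := hk n hn
  rwa [hkN] at this

/-- Subtracting a convergent choice of logarithm from `z n` leaves even integers over a fixed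
centre. -/
theorem exists_fibreRel_of_mem_closure (hσ : (phaseDiagram σ.1.slicing).Nontrivial)
    {A : Set (BlownUpDisk σ.1.slicing)} (hA : ∀ p ∈ A, p.pt ∈ blowUpCentre σ.1.slicing)
    {τ : LStab v} (hτ : τ.1.charge ≠ 0)
    (hc : τ ∈ closure {ρ | ∃ z, ∃ p ∈ A, FibreRel (actL z (pointL σ p)) ρ}) :
    ∃ z, ∃ p ∈ A, FibreRel (actL z (pointL σ p)) τ := by
  obtain ⟨q, hq, hqτ⟩ := mem_closure_iff_seq_limit.1 hc
  choose z p hp hpq using hq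
  obtain ⟨a, w, ha0, ha, hpw⟩ :=
    eventually_pt_eq_of_tendsto σ hσ (fun n => hA _ (hp n)) hτ hpq hqτ
  obtain ⟨y, y₀, hy, hyc, hya⟩ := exists_tendsto_log ha0 ha
  have hρ : Filter.Tendsto (fun n => actL (-(y n)) (q n)) Filter.atTop (𝓝 (actL (-y₀) τ)) :=
    tendsto_actL hy.neg hqτ
  obtain ⟨N, hN⟩ := hpw.exists
  obtain ⟨φ, -, hφ⟩ := exists_bdry_eq (norm_eq_one_of_mem_blowUpCentre (hA _ (hp N)))
  have hev : ∀ᶠ n in Filter.atTop, ∃ k : ℤ,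
      FibreRel (actL ((2 * k : ℝ) : ℂ) (pointL σ (p N))) (actL (-(y n)) (q n)) := by
    filter_upwards [hpw, hyc] with n h1 h2
    obtain ⟨k, hk⟩ := exp_act_eq_exp_act_iff.1 h2.symm
    refine ⟨k, ((fibreRel_pointL σ (hN.trans h1.symm)).act _).trans ?_⟩
    have h3 := (hpq n).act (-(y n))
    rw [actL_actL, hk, neg_add_cancel_left] at h3
    exact h3
  obtain ⟨k, hk⟩ := exists_fibreRel_of_tendsto σ hσ hφ hev hρ
  have h1 := hk.act y₀
  rw [actL_actL, actL_actL, add_neg_cancel, actL_zero] at h1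
  exact ⟨_, p N, hp N, h1⟩

end BlownUpDisk

end LaxStability

end

noncomputable section

open scoped ZeroObject

set_option linter.unusedSectionVars false

namespace LaxStability

/-! ### The quotients by the action of `ℂ` -/

section Quotients

variable {C : Type u₁} [Category.{u₂} C] [Preadditive C] [HasZeroObject C] [HasShift C ℤ]
  [∀ n : ℤ, (shiftFunctor C n).Additive] [Pretriangulated C] [IsTriangulated C]
  {V : Type u₃} [NormedAddCommGroup V] [InnerProductSpace ℝ V] {L : Submodule ℤ V}

theorem exists_charge_cls_ne_zero [DiscreteTopology L] [IsZLattice ℝ L] {v : K0 C →+ L} (hv : Function.Surjective v)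
    {Z : V →L[ℝ] ℂ} (hZ : Z ≠ 0) : ∃ X : C, Z (cls v X) ≠ 0 := by
  by_contra! h
  have h1 : ∀ a : K0 C, Z (v a : V) = 0 := by
    intro a
    let F : K0 C →+ ℂ := (Z : V →ₗ[ℝ] ℂ).toAddMonoidHom.comp (L.subtype.toAddMonoidHom.comp v)
    have : F.comp (QuotientAddGroup.mk' _) = 0 := by
      refine FreeAbelianGroup.lift_ext _ _ fun X => ?_
      exact h X
    obtain ⟨b, rfl⟩ := QuotientAddGroup.mk'_surjective _ a
    exact DFunLike.congr_fun this b
  have h2 : (L : Set V) ⊆ LinearMap.ker (Z : V →ₗ[ℝ] ℂ) := by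
    intro x hx
    obtain ⟨a, ha⟩ := hv ⟨x, hx⟩
    have := h1 a
    rw [ha] at this
    exact this
  have h3 := Submodule.span_le.2 h2
  rw [IsZLattice.span_top] at h3
  refine hZ (ContinuousLinearMap.ext fun x => ?_)
  exact h3 (Submodule.mem_top (x := x))

variable {v : K0 C →+ L}

/-- If every mass is zero, the charge vanishes on the classes of all objects, which span `V`. So
`QStab(C)^*` is cut out by the open condition of non-zero charge. -/
theorem exists_mass_pos_iff [DiscreteTopology L] [IsZLattice ℝ L] (hv : Function.Surjective v) {τ : StabData C V} :
    (∃ X : C, 0 < mass v τ X) ↔ τ.charge ≠ 0 := by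
  constructor
  · rintro ⟨X, hX⟩ h0
    rw [mass, h0] at hX
    simp at hX
  · intro h
    obtain ⟨X, hX⟩ := exists_charge_cls_ne_zero hv h
    refine ⟨X, lt_of_le_of_ne (Finset.sum_nonneg fun i _ => norm_nonneg _) fun h0 => hX ?_⟩
    have h1 := (Finset.sum_eq_zero_iff_of_nonneg fun i _ => norm_nonneg _).1 h0.symm
    have h2 : ∀ k (hk : k < (τ.slicing.hn X).n + 1),
        τ.charge (cls v ((τ.slicing.hn X).obj ⟨k, hk⟩)) = 0 := by
      intro k
      induction k with
      | zero =>
        intro hk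
        exact (congrArg τ.charge (cls_isZero v (τ.slicing.hn X).isZero_zero)).trans (map_zero _)
      | succ k ih =>
        intro hk
        have h3 := (τ.slicing.hn X).isExt_step ⟨k, by omega⟩
        have h4 := cls_isExt v h3
        have h5 := h1 ⟨k, by omega⟩ (Finset.mem_univ _)
        rw [norm_eq_zero] at h5
        have h6 : τ.charge (cls v ((τ.slicing.hn X).obj
            (Fin.castSucc ⟨k, by omega⟩))) = 0 := ih _
        change τ.charge (cls v ((τ.slicing.hn X).obj (Fin.succ ⟨k, by omega⟩))) = 0
        rw [h4, map_add, h5, h6, add_zero]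
    obtain ⟨e⟩ := (τ.slicing.hn X).iso_last
    rw [← cls_iso v e]
    exact h2 _ _

/-- The subset of `QStab(C)` underlying `QStab(C)^*`. -/
def starSet (v : K0 C →+ L) : Set (QStab v) :=
  {q | ∃ τ : LStab v, q = QStab.mk v τ ∧ ∃ X : C, 0 < mass v τ.1 X}

theorem mk_mem_starSet_iff [DiscreteTopology L] [IsZLattice ℝ L] (hv : Function.Surjective v) {τ : LStab v} :
    QStab.mk v τ ∈ starSet v ↔ τ.1.charge ≠ 0 := by
  constructor
  · rintro ⟨ρ, h, hρ⟩
    rw [← (QStab.mk_eq_iff.1 h).charge_eq]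
    exact (exists_mass_pos_iff hv).1 hρ
  · exact fun h => ⟨τ, rfl, (exists_mass_pos_iff hv).2 h⟩

/-- The class of a lax stability condition in `QStab(C)^*`. -/
def qStar (τ : LStab v) (h : QStab.mk v τ ∈ starSet v) : QStabStar v := ⟨QStab.mk v τ, h⟩

theorem exists_eq_qStar (q : QStabStar v) : ∃ τ h, q = qStar τ h := by
  obtain ⟨τ, hτ, h⟩ := q.2
  exact ⟨τ, ⟨τ, rfl, h⟩, Subtype.ext hτ⟩

/-- Because `starSet v` is open, the restricted quotient map is still a quotient map, and closedness
can be tested on `LStab v`. -/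
theorem isClosed_of_qStar [DiscreteTopology L] [IsZLattice ℝ L] (hv : Function.Surjective v) {T : Set (QStabStar v)}
    (h : ∀ τ : LStab v, ∀ hτ : QStab.mk v τ ∈ starSet v,
      τ ∈ closure {ρ | ∃ hρ, qStar ρ hρ ∈ T} → qStar τ hτ ∈ T) : IsClosed T := by
  have hq : Topology.IsQuotientMap (QStab.mk v) := isQuotientMap_quotient_mk'
  have ho : IsOpen (starSet v) := by
    rw [← hq.isOpen_preimage]
    have : QStab.mk v ⁻¹' starSet v = {τ : LStab v | τ.1.charge ≠ 0} :=
      Set.ext fun τ => mk_mem_starSet_iff hv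
    rw [this]
    exact isOpen_ne.preimage continuous_charge
  have hq' := hq.restrictPreimage_isOpen ho
  refine (hq'.isClosed_preimage (s := T)).1 ?_
  rw [← isOpen_compl_iff, isOpen_iff_mem_nhds]
  rintro ⟨τ, hτ⟩ hn
  have h1 : τ ∉ closure {ρ | ∃ hρ, qStar ρ hρ ∈ T} := fun hc => hn (h τ hτ hc)
  have h2 := isClosed_closure.isOpen_compl.mem_nhds (Set.mem_compl h1)
  refine Filter.mem_of_superset (continuous_subtype_val.continuousAt.preimage_mem_nhds h2) ?_
  rintro ⟨ρ, hρ⟩ hρ' hρT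
  exact hρ' (subset_closure ⟨hρ, hρT⟩)

theorem continuous_qStar {X : Type*} [TopologicalSpace X] {f : X → LStab v} (hf : Continuous f)
    (h : ∀ x, QStab.mk v (f x) ∈ starSet v) : Continuous fun x => qStar (f x) (h x) :=
  (continuous_quotient_mk'.comp hf).subtype_mk _

theorem sameCOrbit_iff_actL {τ ρ : LStab v} : SameCOrbit τ.1 ρ.1 ↔ ∃ z, ρ = actL z τ := by
  rw [sameCOrbit_iff]
  exact exists_congr fun z => ⟨fun h => Subtype.ext h, fun h => congrArg Subtype.val h⟩

/-- The class of a lax stability condition in `QStab(C)^* / ℂ`. -/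
def mkC (τ : LStab v) (h : QStab.mk v τ ∈ starSet v) : QStabStarModC v := Quot.mk _ (qStar τ h)

/-- The relation defining the quotient is already an equivalence relation, because the action
carries components of fibres to components of fibres. -/
theorem mkC_eq_iff {τ ρ : LStab v} {hτ : QStab.mk v τ ∈ starSet v}
    {hρ : QStab.mk v ρ ∈ starSet v} : mkC τ hτ = mkC ρ hρ ↔ ∃ z, FibreRel (actL z τ) ρ := by
  have heq : Equivalence fun p q : QStabStar v =>
      ∃ σ τ : LStab v, p.1 = QStab.mk v σ ∧ q.1 = QStab.mk v τ ∧ SameCOrbit σ.1 τ.1 := by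
    refine ⟨fun q => ?_, ?_, ?_⟩
    · obtain ⟨τ, h, rfl⟩ := exists_eq_qStar q
      exact ⟨τ, τ, rfl, rfl, sameCOrbit_iff_actL.2 ⟨0, (actL_zero τ).symm⟩⟩
    · rintro p q ⟨σ, τ, h1, h2, h3⟩
      obtain ⟨z, rfl⟩ := sameCOrbit_iff_actL.1 h3
      refine ⟨_, _, h2, h1, sameCOrbit_iff_actL.2 ⟨-z, ?_⟩⟩
      rw [actL_actL, neg_add_cancel, actL_zero]
    · rintro p q r ⟨σ, τ, h1, h2, h3⟩ ⟨σ', τ', h1', h2', h3'⟩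
      obtain ⟨z, rfl⟩ := sameCOrbit_iff_actL.1 h3
      obtain ⟨z', rfl⟩ := sameCOrbit_iff_actL.1 h3'
      refine ⟨σ, actL (z' + z) σ, h1, ?_, sameCOrbit_iff_actL.2 ⟨_, rfl⟩⟩
      rw [h2', QStab.mk_eq_iff, ← actL_actL]
      exact (QStab.mk_eq_iff.1 (h1'.symm.trans h2)).act z'
  rw [mkC, mkC, Quot.eq, heq.eqvGen_iff]
  constructor
  · rintro ⟨σ', τ', h1, h2, h3⟩
    obtain ⟨z, rfl⟩ := sameCOrbit_iff_actL.1 h3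
    exact ⟨z, ((QStab.mk_eq_iff.1 h1).act z).trans (QStab.mk_eq_iff.1 h2).symm⟩
  · rintro ⟨z, hz⟩
    exact ⟨τ, actL z τ, rfl, (QStab.mk_eq_iff.2 hz).symm, sameCOrbit_iff_actL.2 ⟨z, rfl⟩⟩

theorem isClosed_of_mkC [DiscreteTopology L] [IsZLattice ℝ L] (hv : Function.Surjective v) {T : Set (QStabStarModC v)}
    (h : ∀ τ : LStab v, ∀ hτ : QStab.mk v τ ∈ starSet v,
      τ ∈ closure {ρ | ∃ hρ, mkC ρ hρ ∈ T} → mkC τ hτ ∈ T) : IsClosed T := by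
  rw [← isQuotientMap_quot_mk.isClosed_preimage]
  exact isClosed_of_qStar hv h

theorem stabModC_mk_eq_iff {τ ρ : Stab v} :
    (Quot.mk _ τ : StabModC v) = Quot.mk _ ρ ↔ ∃ z, ρ.1 = act z τ.1 := by
  have heq : Equivalence fun σ τ : Stab v => SameCOrbit σ.1 τ.1 := by
    refine ⟨fun τ => sameCOrbit_iff.2 ⟨0, (act_zero τ.1).symm⟩, ?_, ?_⟩
    · intro σ τ h
      obtain ⟨z, h⟩ := sameCOrbit_iff.1 h
      refine sameCOrbit_iff.2 ⟨-z, ?_⟩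
      rw [h, act_act, neg_add_cancel, act_zero]
    · intro σ τ ρ h h'
      obtain ⟨z, h⟩ := sameCOrbit_iff.1 h
      obtain ⟨z', h'⟩ := sameCOrbit_iff.1 h'
      refine sameCOrbit_iff.2 ⟨z' + z, ?_⟩
      rw [h', h, act_act]
  rw [Quot.eq, heq.eqvGen_iff, sameCOrbit_iff]

end Quotients

end LaxStability

end

noncomputable section

open scoped ZeroObject

set_option linter.unusedSectionVars false

namespace LaxStability

/-! ### The closed embeddings of the disks -/

theorem QuotDisk.eq_of_pt {C : Type u₁} [Category.{u₂} C] [Preadditive C] [HasZeroObject C]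
    [HasShift C ℤ] [∀ n : ℤ, (shiftFunctor C n).Additive] [Pretriangulated C] {P : Slicing C}
    {w w' : QuotDisk P} (h : w.pt = w'.pt) : w = w' := by
  cases w
  cases w'
  simpa using h

namespace BlownUpDisk

variable {C : Type u₁} [Category.{u₂} C] [Preadditive C] [HasZeroObject C] [HasShift C ℤ]
  [∀ n : ℤ, (shiftFunctor C n).Additive] [Pretriangulated C] [IsTriangulated C]
  {V : Type u₃} [NormedAddCommGroup V] [InnerProductSpace ℝ V] {L : Submodule ℤ V}
  [DiscreteTopology L] {v : K0 C →+ L} (σ : Stab v)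

theorem nMap_comp_ne_zero {Z : V →L[ℝ] ℂ} (hZ : Function.Surjective Z) (w : ℂ) :
    (nMap w).comp Z ≠ 0 := by
  intro h
  obtain ⟨x₁, hx₁⟩ := hZ 1
  obtain ⟨x₂, hx₂⟩ := hZ Complex.I
  have h1 := DFunLike.congr_fun h x₁
  have h2 := DFunLike.congr_fun h x₂
  rw [ContinuousLinearMap.comp_apply, nMap_apply] at h1 h2
  rw [hx₁] at h1
  rw [hx₂] at h2
  simp only [map_one, Complex.conj_I, zero_apply] at h1 h2
  have h3 : (2 : ℂ) = 0 := by
    linear_combination h1 - Complex.I * h2 + (1 + w) * Complex.I_sq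
  norm_num at h3

theorem eq_of_smul_nMap_comp_eq {Z : V →L[ℝ] ℂ} (hZ : Function.Surjective Z) {c w w' : ℂ}
    (h : c • (nMap w).comp Z = (nMap w').comp Z) : w = w' := by
  obtain ⟨x₁, hx₁⟩ := hZ 1
  obtain ⟨x₂, hx₂⟩ := hZ Complex.I
  have h1 := DFunLike.congr_fun h x₁
  have h2 := DFunLike.congr_fun h x₂
  rw [smul_apply, ContinuousLinearMap.comp_apply, ContinuousLinearMap.comp_apply, nMap_apply,
    nMap_apply, smul_eq_mul] at h1 h2
  rw [hx₁] at h1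
  rw [hx₂] at h2
  simp only [map_one, Complex.conj_I] at h1 h2
  have h3 : c = 1 := by
    linear_combination (h1 - Complex.I * h2) / 2 + ((c - 1) / 2 + (c * w - w') / 2) * Complex.I_sq
  rw [h3] at h1
  linear_combination -h1

theorem charge_pointL_ne_zero (hσ : (phaseDiagram σ.1.slicing).Nontrivial)
    (p : BlownUpDisk σ.1.slicing) : (pointL σ p).1.charge ≠ 0 :=
  nMap_comp_ne_zero (charge_surjective σ hσ) p.pt

theorem surjective_blowDown : Function.Surjective (blowDown σ.1.slicing) := by
  intro w
  obtain ⟨k, κ, hP⟩ := σ.2.isSupported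
  by_cases h : ‖w.pt‖ < 1
  · exact ⟨ofInterior _ w.pt h, QuotDisk.eq_of_pt rfl⟩
  · obtain ⟨φ, -, hφ⟩ := exists_bdry_eq
      (le_antisymm (norm_le_one_of_mem_quotDiskSet w.mem) (not_lt.1 h))
    have hq : bdry φ ∈ quotDiskSet σ.1.slicing := hφ ▸ w.mem
    by_cases hs : bdry φ ∈ blowUpCentre σ.1.slicing
    · obtain ⟨ψ, hψ⟩ := hP.exists_allowedPhase hs
      exact ⟨ofBdry _ φ ψ hq fun _ => hψ, QuotDisk.eq_of_pt hφ.symm⟩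
    · exact ⟨ofBdry _ φ 0 hq fun h => absurd h hs, QuotDisk.eq_of_pt hφ.symm⟩

theorem eq_actL_of_fibreRel {p : BlownUpDisk σ.1.slicing} (hp : p.pt ∈ diskSet σ.1.slicing) {z : ℂ}
    {ρ : LStab v} (h : FibreRel (actL z (pointL σ p)) ρ) : ρ = actL z (pointL σ p) :=
  h.eq_of_isStab ((isStab_point σ hp).act z)

theorem pt_eq_of_fibreRel (hσ : (phaseDiagram σ.1.slicing).Nontrivial)
    {p q : BlownUpDisk σ.1.slicing} {z : ℂ}
    (h : FibreRel (actL z (pointL σ p)) (pointL σ q)) : p.pt = q.pt :=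
  eq_of_smul_nMap_comp_eq (charge_surjective σ hσ) h.charge_eq.symm

/-- Over `diskSet` the components are single points and ordinary closures suffice; over the centres
the argument with massless objects applies. -/
theorem exists_fibreRel_of_mem_closure' (hσ : (phaseDiagram σ.1.slicing).Nontrivial)
    {A : Set (BlownUpDisk σ.1.slicing)} (hA : IsClosed A) {τ : LStab v} (hτ : τ.1.charge ≠ 0)
    (hc : τ ∈ closure {ρ | ∃ z, ∃ p ∈ A, FibreRel (actL z (pointL σ p)) ρ}) :
    ∃ z, ∃ p ∈ A, FibreRel (actL z (pointL σ p)) τ := by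
  have hsub : {ρ : LStab v | ∃ z, ∃ p ∈ A, FibreRel (actL z (pointL σ p)) ρ} ⊆
      {ρ | ∃ z, ∃ p ∈ A, ρ = actL z (pointL σ p)} ∪
        {ρ | ∃ z, ∃ p ∈ A ∩ {p | p.pt ∈ blowUpCentre σ.1.slicing},
          FibreRel (actL z (pointL σ p)) ρ} := by
    rintro ρ ⟨z, p, hp, h⟩
    by_cases hd : p.pt ∈ diskSet σ.1.slicing
    · exact .inl ⟨z, p, hp, eq_actL_of_fibreRel σ hd h⟩
    · exact .inr ⟨z, p, ⟨hp, p.2.2.1, hd⟩, h⟩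
  have hc' := closure_mono hsub hc
  rw [closure_union] at hc'
  rcases hc' with hc' | hc'
  · have h1 : τ.1 ∈ closure {ρ | ∃ z, ∃ p ∈ A, ρ = act z (point σ p)} := by
      refine closure_mono ?_ (image_closure_subset_closure_image continuous_subtype_val
        ⟨τ, hc', rfl⟩)
      rintro _ ⟨_, ⟨z, p, hp, rfl⟩, rfl⟩
      exact ⟨z, p, hp, rfl⟩
    obtain ⟨z, p, hp, h2⟩ := mem_of_mem_closure σ hσ hA τ.2.1 hτ h1
    have h3 : τ = actL z (pointL σ p) := Subtype.ext h2
    exact ⟨z, p, hp, h3 ▸ FibreRel.refl _⟩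
  · obtain ⟨z, p, hp, h⟩ := exists_fibreRel_of_mem_closure σ hσ (fun p hp => hp.2) hτ hc'
    exact ⟨z, p, hp.1, h⟩

/-- A convergent sequence over blow-up centres is eventually over one centre, so the part over the
centres is closed. -/
theorem isOpen_setOf_pt_mem_diskSet (hσ : (phaseDiagram σ.1.slicing).Nontrivial) :
    IsOpen {p : BlownUpDisk σ.1.slicing | p.pt ∈ diskSet σ.1.slicing} := by
  rw [← isClosed_compl_iff, ← closure_subset_iff_isClosed]
  intro p hp
  have := (isInducing_point σ hσ).firstCountableTopology
  obtain ⟨q, hq, hlim⟩ := mem_closure_iff_seq_limit.1 hp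
  obtain ⟨-, w, -, -, hw⟩ := eventually_pt_eq_of_tendsto σ hσ (z := fun _ => 0)
    (fun n => ⟨(q n).2.2.1, hq n⟩) (charge_pointL_ne_zero σ hσ p)
    (fun n => by rw [actL_zero]; exact FibreRel.refl _)
    (((continuous_pointL σ).tendsto p).comp hlim)
  have h1 : Filter.Tendsto (fun n => (q n).pt) Filter.atTop (𝓝 p.pt) :=
    (continuous_pt.tendsto p).comp hlim
  have h2 : p.pt = w := tendsto_nhds_unique h1 (tendsto_const_nhds.congr'
    (hw.mono fun n hn => hn.symm))
  obtain ⟨N, hN⟩ := hw.exists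
  have h3 : (q N).pt ∉ diskSet σ.1.slicing := hq N
  rwa [hN, ← h2] at h3

/-! ### The closed embedding into `QStab(C)^* / ℂ`. -/

section Star

variable [IsZLattice ℝ L] (hv : Function.Surjective v)
  (hσ : (phaseDiagram σ.1.slicing).Nontrivial)

include hv hσ in
theorem mk_pointL_mem (p : BlownUpDisk σ.1.slicing) : QStab.mk v (pointL σ p) ∈ starSet v :=
  (mk_mem_starSet_iff hv).2 (charge_pointL_ne_zero σ hσ p)

/-- The map from the disk to `QStab(C)^* / ℂ`. -/
def toStar (w : QuotDisk σ.1.slicing) : QStabStarModC v :=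
  mkC (pointL σ (Function.surjInv (surjective_blowDown σ) w)) (mk_pointL_mem σ hv hσ _)

theorem toStar_blowDown (p : BlownUpDisk σ.1.slicing) :
    toStar σ hv hσ (blowDown _ p) = mkC (pointL σ p) (mk_pointL_mem σ hv hσ p) := by
  refine mkC_eq_iff.2 ⟨0, ?_⟩
  rw [actL_zero]
  exact fibreRel_pointL σ (congrArg QuotDisk.pt (Function.surjInv_eq (surjective_blowDown σ) _))

theorem continuous_toStar : Continuous (toStar σ hv hσ) := by
  refine continuous_coinduced_dom.2 ?_
  have h1 : toStar σ hv hσ ∘ blowDown _ = fun p => Quot.mk _ (qStar (pointL σ p)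
      (mk_pointL_mem σ hv hσ p)) := funext fun p => toStar_blowDown σ hv hσ p
  rw [h1]
  exact continuous_quot_mk.comp (continuous_qStar (continuous_pointL σ) _)

theorem injective_toStar : Function.Injective (toStar σ hv hσ) := by
  intro w w' h
  obtain ⟨p, rfl⟩ := surjective_blowDown σ w
  obtain ⟨q, rfl⟩ := surjective_blowDown σ w'
  rw [toStar_blowDown, toStar_blowDown] at h
  obtain ⟨z, hz⟩ := mkC_eq_iff.1 h
  exact QuotDisk.eq_of_pt (pt_eq_of_fibreRel σ hσ hz)

theorem isClosedEmbedding_toStar : Topology.IsClosedEmbedding (toStar σ hv hσ) := by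
  refine .of_continuous_injective_isClosedMap (continuous_toStar σ hv hσ)
    (injective_toStar σ hv hσ) fun K hK => isClosed_of_mkC hv fun τ hτ hc => ?_
  have hA : IsClosed (blowDown σ.1.slicing ⁻¹' K) := hK.preimage continuous_coinduced_rng
  have hsub : {ρ : LStab v | ∃ hρ, mkC ρ hρ ∈ toStar σ hv hσ '' K} ⊆
      {ρ | ∃ z, ∃ p ∈ blowDown σ.1.slicing ⁻¹' K, FibreRel (actL z (pointL σ p)) ρ} := by
    rintro ρ ⟨hρ, w, hw, h⟩
    obtain ⟨p, rfl⟩ := surjective_blowDown σ w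
    rw [toStar_blowDown] at h
    obtain ⟨z, hz⟩ := mkC_eq_iff.1 h
    exact ⟨z, p, hw, hz⟩
  obtain ⟨z, p, hp, h⟩ := exists_fibreRel_of_mem_closure' σ hσ hA
    ((mk_mem_starSet_iff hv).1 hτ) (closure_mono hsub hc)
  refine ⟨_, hp, ?_⟩
  rw [toStar_blowDown]
  exact mkC_eq_iff.2 ⟨z, h⟩

end Star

/-- The point of `Stab(C)` given by a point of the blown up disk which is not over a centre. -/
def pointS (p : BlownUpDisk σ.1.slicing) (hp : p.pt ∈ diskSet σ.1.slicing) : Stab v :=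
  ⟨point σ p, isStab_point σ hp⟩

theorem pointS_congr {p q : BlownUpDisk σ.1.slicing} (hp : p.pt ∈ diskSet σ.1.slicing)
    (hq : q.pt ∈ diskSet σ.1.slicing) (h : p.pt = q.pt) : pointS σ p hp = pointS σ q hq := by
  have h1 : pointL σ q = pointL σ p :=
    (fibreRel_pointL σ h).eq_of_isStab (isStab_point σ hp)
  exact Subtype.ext (congrArg Subtype.val h1).symm

theorem surjInv_pt (w : QuotDisk σ.1.slicing) :
    (Function.surjInv (surjective_blowDown σ) w).pt = w.pt :=
  congrArg QuotDisk.pt (Function.surjInv_eq (surjective_blowDown σ) w)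

/-- The map from the disk to `Stab(C) / ℂ`. -/
def toStab (w : ClassicalDisk σ.1.slicing) : StabModC v :=
  Quot.mk _ (pointS σ (Function.surjInv (surjective_blowDown σ) w.1)
    (by rw [surjInv_pt]; exact w.2))

theorem toStab_blowDown (p : BlownUpDisk σ.1.slicing) (hp : p.pt ∈ diskSet σ.1.slicing) :
    toStab σ ⟨blowDown _ p, hp⟩ = Quot.mk _ (pointS σ p hp) :=
  congrArg (Quot.mk _) (pointS_congr σ _ _ (surjInv_pt σ _))

theorem isQuotientMap_blowDown_classical (hσ : (phaseDiagram σ.1.slicing).Nontrivial) :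
    Topology.IsQuotientMap
      (Set.restrictPreimage {w : QuotDisk σ.1.slicing | w.pt ∈ diskSet σ.1.slicing}
        (blowDown σ.1.slicing)) := by
  have hq : Topology.IsQuotientMap (blowDown σ.1.slicing) := ⟨⟨rfl⟩, surjective_blowDown σ⟩
  exact hq.restrictPreimage_isOpen (hq.isOpen_preimage.1 (isOpen_setOf_pt_mem_diskSet σ hσ))

theorem continuous_toStab (hσ : (phaseDiagram σ.1.slicing).Nontrivial) :
    Continuous (toStab σ) := by
  refine (isQuotientMap_blowDown_classical σ hσ).continuous_iff.2 ?_
  have h1 : toStab σ ∘ Set.restrictPreimage {w : QuotDisk σ.1.slicing | w.pt ∈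
      diskSet σ.1.slicing} (blowDown σ.1.slicing) = fun p => Quot.mk _ (pointS σ p.1 p.2) :=
    funext fun p => toStab_blowDown σ p.1 p.2
  rw [h1]
  exact continuous_quot_mk.comp
    (((continuous_point σ).comp continuous_subtype_val).subtype_mk _)

theorem injective_toStab (hσ : (phaseDiagram σ.1.slicing).Nontrivial) :
    Function.Injective (toStab σ) := by
  rintro ⟨w, hw⟩ ⟨w', hw'⟩ h
  obtain ⟨p, rfl⟩ := surjective_blowDown σ w
  obtain ⟨q, rfl⟩ := surjective_blowDown σ w'
  obtain ⟨z, hz⟩ := stabModC_mk_eq_iff.1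
    ((toStab_blowDown σ p hw).symm.trans (h.trans (toStab_blowDown σ q hw')))
  have h1 : pointL σ q = actL z (pointL σ p) := Subtype.ext hz
  have h2 : FibreRel (actL z (pointL σ p)) (pointL σ q) := by
    rw [h1]
    exact FibreRel.refl _
  exact Subtype.ext (QuotDisk.eq_of_pt (pt_eq_of_fibreRel σ hσ h2))

theorem charge_ne_zero_of_isStab (hσ : (phaseDiagram σ.1.slicing).Nontrivial) {τ : StabData C V}
    (hτ : IsStabilityCondition v τ) : τ.charge ≠ 0 := by
  intro h0
  obtain ⟨k, κ, hP⟩ := hτ.isSupported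
  obtain ⟨_, ⟨t, -, ht⟩, -⟩ := hσ
  obtain ⟨X, -, hX0⟩ := exists_of_mem_phases ht
  obtain ⟨A, B, -, hA, hA0, -⟩ := Slicing.exists_top_factor (P := τ.slicing) hX0
  exact hA0 (hP.isZero_of_eq_zero hA (by rw [h0]; rfl))

theorem isClosedEmbedding_toStab (hσ : (phaseDiagram σ.1.slicing).Nontrivial) :
    Topology.IsClosedEmbedding (toStab σ) := by
  refine .of_continuous_injective_isClosedMap (continuous_toStab σ hσ)
    (injective_toStab σ hσ) fun K hK => ?_
  set A : Set (BlownUpDisk σ.1.slicing) := {p | ∃ h : p.pt ∈ diskSet σ.1.slicing,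
    (⟨blowDown _ p, h⟩ : ClassicalDisk σ.1.slicing) ∈ K} with hAdef
  have hA : ∀ p ∈ closure A, p.pt ∈ diskSet σ.1.slicing → p ∈ A := by
    intro p hp hpd
    refine ⟨hpd, ?_⟩
    by_contra hK'
    obtain ⟨U, hU, hUK⟩ := isOpen_induced_iff.1 hK.isOpen_compl
    have h1 : blowDown σ.1.slicing p ∈ U := by
      have : (⟨blowDown _ p, hpd⟩ : ClassicalDisk σ.1.slicing) ∈ Subtype.val ⁻¹' U := by
        rw [hUK]; exact hK'
      exact this
    obtain ⟨q, hqU, hqd, hqK⟩ := mem_closure_iff.1 hp _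
      (hU.preimage continuous_coinduced_rng) h1
    have h2 : (⟨blowDown _ q, hqd⟩ : ClassicalDisk σ.1.slicing) ∈ Subtype.val ⁻¹' U := hqU
    rw [hUK] at h2
    exact h2 hqK
  rw [← isQuotientMap_quot_mk.isClosed_preimage, ← closure_subset_iff_isClosed]
  intro τ hτ
  have h1 : τ.1 ∈ closure {ρ | ∃ z, ∃ p ∈ closure A, ρ = act z (point σ p)} := by
    refine closure_mono ?_ (image_closure_subset_closure_image continuous_subtype_val
      ⟨τ, hτ, rfl⟩)
    rintro _ ⟨ρ, ⟨⟨w, hw⟩, hwK, h⟩, rfl⟩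
    obtain ⟨p, rfl⟩ := surjective_blowDown σ w
    obtain ⟨z, hz⟩ := stabModC_mk_eq_iff.1 ((toStab_blowDown σ p hw).symm.trans h)
    exact ⟨z, p, subset_closure ⟨hw, hwK⟩, hz⟩
  obtain ⟨z, p, hp, h2⟩ := mem_of_mem_closure σ hσ isClosed_closure τ.2.isLax
    (charge_ne_zero_of_isStab σ hσ τ.2) h1
  -- A limit that is a stability condition cannot lie over a blow-up centre.
  have hpd : p.pt ∈ diskSet σ.1.slicing := by
    by_contra h
    refine not_isStab_point σ h ?_
    have h3 := τ.2.act (-z)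
    rwa [h2, act_act, neg_add_cancel, act_zero] at h3
  obtain ⟨h, hpK⟩ := hA p hp hpd
  refine ⟨_, hpK, ?_⟩
  rw [toStab_blowDown]
  exact stabModC_mk_eq_iff.2 ⟨z, h2⟩

end BlownUpDisk

end LaxStability

end

noncomputable section

open scoped ZeroObject

set_option linter.unusedSectionVars false

namespace LaxStability

/-! ### Orbits of the universal cover of `GL₂⁺(ℝ)` -/

theorem det_eq_im (S : ℂ →ₗ[ℝ] ℂ) :
    LinearMap.det S = ((starRingEnd ℂ) (S 1) * S Complex.I).im := by
  rw [← LinearMap.det_toMatrix Complex.basisOneI, Matrix.det_fin_two]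
  simp [LinearMap.toMatrix_apply]
  ring

/-- A real linear map is `a z + b conj z`, with determinant `‖a‖ ^ 2 - ‖b‖ ^ 2`; positivity makes `w
= -b / a` a point of the open disk. -/
theorem exists_eq_smul_nMap (S : ℂ →L[ℝ] ℂ) (hS : 0 < LinearMap.det (S : ℂ →ₗ[ℝ] ℂ)) :
    ∃ a w : ℂ, a ≠ 0 ∧ ‖w‖ < 1 ∧ S = a • nMap w := by
  rw [det_eq_im] at hS
  change 0 < ((starRingEnd ℂ) (S 1) * S Complex.I).im at hS
  set p := S 1
  set q := S Complex.I
  have h1 : ‖p - Complex.I * q‖ ^ 2 - ‖p + Complex.I * q‖ ^ 2 =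
      4 * ((starRingEnd ℂ) p * q).im := by
    rw [Complex.sq_norm, Complex.sq_norm, Complex.normSq_apply, Complex.normSq_apply]
    simp
    ring
  have h2 : ‖p + Complex.I * q‖ < ‖p - Complex.I * q‖ :=
    lt_of_pow_lt_pow_left₀ 2 (norm_nonneg _) (by linarith)
  have h3 : p - Complex.I * q ≠ 0 := norm_pos_iff.1 ((norm_nonneg _).trans_lt h2)
  refine ⟨(p - Complex.I * q) / 2, -((p + Complex.I * q) / (p - Complex.I * q)),
    div_ne_zero h3 two_ne_zero, ?_, ?_⟩
  · rw [norm_neg, norm_div, div_lt_one (norm_pos_iff.2 h3)]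
    exact h2
  · ext z
    have h4 : S z = z.re * p + z.im * q := by
      conv_lhs => rw [← Complex.re_add_im z, ← mul_one (z.re : ℂ), map_add, ← Complex.real_smul,
        ← Complex.real_smul, map_smul, map_smul, Complex.real_smul, Complex.real_smul]
    rw [h4, smul_apply, nMap_apply, smul_eq_mul]
    conv_rhs => rw [← Complex.re_add_im z]
    simp only [map_add, map_mul, Complex.conj_ofReal, Complex.conj_I]
    have h5 : (p - Complex.I * q) * ((p + Complex.I * q) / (p - Complex.I * q)) =
        p + Complex.I * q := mul_div_cancel₀ _ h3
    linear_combination (z.im * q) * Complex.I_sq - (z.re - z.im * Complex.I) / 2 * h5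

theorem eq_of_pos_mul_ray_eq {r s x y : ℝ} (hr : 0 < r) (hs : 0 < s)
    (h : (r : ℂ) * ray x = s * ray y) : ∃ n : ℤ, x = y + 2 * n := by
  have h1 : r = s := by
    rw [← norm_ofReal_mul_ray hr.le x, h, norm_ofReal_mul_ray hs.le]
  rw [h1] at h
  exact ray_eq_ray_iff.1 (mul_left_cancel₀ (by exact_mod_cast hs.ne') h)

/-- A monotone lift of the identity of `ℝ / 2ℤ` is a translation. -/
theorem exists_eq_add_two_mul {F : ℝ → ℝ} (hF : Monotone F) (hF1 : ∀ t, F (t + 1) = F t + 1)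
    (h : ∀ t, ∃ n : ℤ, t = F t + 2 * n) : ∃ n : ℤ, ∀ t, t = F t + 2 * n := by
  choose n hn using h
  have h0 : ∀ t ∈ Set.Ico (0 : ℝ) 1, n t = n 0 := by
    intro t ht
    have h1 := hF ht.1
    have h2 := hF ht.2.le
    have h3 := hF1 0
    rw [zero_add] at h3
    have h4 := hn t
    have h5 := hn 0
    have h6 : ((n t - n 0 : ℤ) : ℝ) < 1 := by push_cast; linarith [ht.2]
    have h7 : ((-1 : ℤ) : ℝ) < ((n t - n 0 : ℤ) : ℝ) := by push_cast; linarith [ht.1]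
    have h8 : n t - n 0 < 1 := by exact_mod_cast h6
    have h9 : -1 < n t - n 0 := by exact_mod_cast h7
    omega
  have hint : ∀ (m : ℤ) t, F (t + m) = F t + m := by
    intro m
    induction m using Int.induction_on with
    | zero => simp
    | succ i ih => intro t; push_cast; rw [← add_assoc, hF1]; push_cast at ih; rw [ih]; ring
    | pred i ih =>
      intro t
      have := hF1 (t + ((-i - 1 : ℤ) : ℝ))
      push_cast at this ih ⊢
      rw [show t + (-(i : ℝ) - 1) + 1 = t + -i by ring, ih] at this
      linarith
  refine ⟨n 0, fun t => ?_⟩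
  obtain ⟨m, s, hs, rfl⟩ := exists_int_add_mem_Ico 0 t
  rw [zero_add] at hs
  rw [hint, ← h0 s hs]
  linarith [hn s]

theorem surjective_phaseFun {w : ℂ} (hw : ‖w‖ < 1) : Function.Surjective (phaseFun w) := by
  intro y
  have h1 := abs_lt.1 (abs_phaseFun_sub_lt hw (y - 1))
  have h2 := abs_lt.1 (abs_phaseFun_sub_lt hw (y + 1))
  obtain ⟨t, -, ht⟩ := intermediate_value_Icc (by linarith : y - 1 ≤ y + 1)
    (continuous_phaseFun hw).continuousOn (show y ∈ Set.Icc _ _ from ⟨by linarith, by linarith⟩)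
  exact ⟨t, ht⟩

section Orbits

variable {C : Type u₁} [Category.{u₂} C] [Preadditive C] [HasZeroObject C] [HasShift C ℤ]
  [∀ n : ℤ, (shiftFunctor C n).Additive] [Pretriangulated C] [IsTriangulated C]
  {V : Type u₃} [NormedAddCommGroup V] [InnerProductSpace ℝ V] {L : Submodule ℤ V}
  [DiscreteTopology L] {v : K0 C →+ L} (σ : Stab v)

/-- With `T⁻¹ = a • nMap w`, the composite of `θ` with `phaseFun w` and the rotation by `arg a`
lifts the identity on rays, so it is a translation by an even integer. -/
theorem InGOrbit.exists_eq_act {τ : StabData C V} (h : InGOrbit σ.1 τ) :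
    ∃ z, ∃ p : BlownUpDisk σ.1.slicing, ‖p.pt‖ < 1 ∧ τ = act z (BlownUpDisk.point σ p) := by
  obtain ⟨g, hP, hZ⟩ := h
  have hdet : 0 < LinearMap.det ((g.T.symm : ℂ →L[ℝ] ℂ) : ℂ →ₗ[ℝ] ℂ) := by
    have h1 : LinearMap.det (g.T.toLinearEquiv : ℂ →ₗ[ℝ] ℂ) *
        LinearMap.det (g.T.toLinearEquiv.symm : ℂ →ₗ[ℝ] ℂ) = 1 :=
      LinearEquiv.det_mul_det_symm _
    have h2 := g.det_pos
    by_contra hc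
    have h3 : LinearMap.det (g.T.toLinearEquiv.symm : ℂ →ₗ[ℝ] ℂ) ≤ 0 := not_lt.1 hc
    nlinarith
  obtain ⟨a, w, ha, hw, hS⟩ := exists_eq_smul_nMap _ hdet
  set α := Complex.arg a / Real.pi
  obtain ⟨n, hn⟩ := exists_eq_add_two_mul (F := fun t => α + phaseFun w (g.θ t))
    (((strictMono_phaseFun hw).comp g.θ_mono).monotone.const_add α)
    (fun t => by simp only [g.θ_add_one, phaseFun_add_one, add_assoc]) (by
      intro t
      obtain ⟨r, hr, h1⟩ := g.compat t
      have h2 : g.T.symm ((r : ℂ) * ray (g.θ t)) = ray t := by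
        rw [ray_eq, ← h1, ContinuousLinearEquiv.symm_apply_apply, ray_eq]
      rw [← Complex.real_smul, map_smul, Complex.real_smul] at h2
      have h3 : g.T.symm (ray (g.θ t)) = a * nMap w (ray (g.θ t)) :=
        DFunLike.congr_fun hS (ray (g.θ t))
      rw [h3, nMap_ray_eq, ← ray_arg_mul_norm a] at h2
      have hr0 : 0 < ‖rotFactor w (g.θ t)‖ := norm_pos_iff.2 fun h0 => by
        have := rotFactor_re_pos hw (g.θ t)
        rw [h0] at this
        exact lt_irrefl _ this
      refine eq_of_pos_mul_ray_eq one_pos (s := r * ‖a‖ * ‖rotFactor w (g.θ t)‖)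
        (mul_pos (mul_pos hr (norm_pos_iff.2 ha)) hr0) ?_
      rw [← h2, ray_add]
      push_cast
      ring)
  -- The real part undoes the rotation and that translation; the imaginary part produces the modulus
  -- of `a`.
  refine ⟨⟨-(α + 2 * n), Real.log ‖a‖ / Real.pi⟩, BlownUpDisk.ofInterior _ w hw, hw,
    stabData_ext (fun φ => ?_) ?_⟩
  · rw [hP, act_P, BlownUpDisk.point_slicing, BlownUpDisk.lift_of_norm_lt (p :=
      BlownUpDisk.ofInterior _ w hw) hw, Slicing.map_P, ← Slicing.cl_singleton]
    congr 1
    ext t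
    rw [Set.mem_singleton_iff, Set.mem_preimage, Set.mem_singleton_iff]
    change _ ↔ phaseFun w t = _
    have h1 := hn φ
    constructor
    · rintro rfl
      linarith
    · intro h
      exact (strictMono_phaseFun hw).injective (by linarith)
  · rw [hZ, hS, act_charge, norm_exp_act]
    have h1 : ((Real.exp (Real.pi * (Real.log ‖a‖ / Real.pi)) : ℝ) : ℂ) *
        ray (-(-(α + 2 * n))) = a := by
      rw [mul_div_cancel₀ _ Real.pi_ne_zero, Real.exp_log (norm_pos_iff.2 ha), neg_neg,
        ray_eq_ray_iff.2 ⟨n, rfl⟩]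
      exact ray_arg_mul_norm a
    rw [h1]
    rfl

/-- The group element has `T` inverse to the scaled `nMap w`, and `θ` the translation by `z.re`
followed by the inverse of `phaseFun w`. -/
theorem inGOrbit_act_point {p : BlownUpDisk σ.1.slicing} (hp : ‖p.pt‖ < 1) (z : ℂ) :
    InGOrbit σ.1 (act z (BlownUpDisk.point σ p)) := by
  set w := p.pt
  set c := Complex.exp (-(Complex.I * Real.pi * z)) with hc
  have hc0 : c ≠ 0 := Complex.exp_ne_zero _
  set S : ℂ →L[ℝ] ℂ := c • nMap w with hSdef
  have hSapp : ∀ x, S x = c * nMap w x := fun x => rfl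
  have hinj : Function.Injective (S : ℂ →ₗ[ℝ] ℂ) := by
    refine (injective_iff_map_eq_zero _).2 fun x hx => ?_
    have h1 : nMap w x = 0 := (mul_eq_zero.1 hx).resolve_left hc0
    rw [nMap_apply, sub_eq_zero] at h1
    have h2 := congrArg norm h1
    rw [norm_mul, RCLike.norm_conj] at h2
    by_contra h0
    have := norm_pos_iff.2 h0
    nlinarith
  set E : ℂ ≃L[ℝ] ℂ := (LinearEquiv.ofInjectiveEndo (S : ℂ →ₗ[ℝ] ℂ) hinj).toContinuousLinearEquiv
  have hE : ∀ x, E x = S x := fun x => rfl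
  have hdetS : 0 < LinearMap.det (E.toLinearEquiv : ℂ →ₗ[ℝ] ℂ) := by
    rw [det_eq_im]
    change 0 < ((starRingEnd ℂ) (S 1) * S Complex.I).im
    rw [hSapp, hSapp, map_mul]
    have h1 : (starRingEnd ℂ) c * (starRingEnd ℂ) (nMap w 1) * (c * nMap w Complex.I) =
        (‖c‖ ^ 2 : ℝ) * ((starRingEnd ℂ) (nMap w 1) * nMap w Complex.I) := by
      rw [← Complex.normSq_eq_norm_sq, ← Complex.mul_conj]
      ring
    rw [h1, Complex.im_ofReal_mul, im_conj_nMap_mul]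
    have h2 : 0 < 1 - ‖w‖ ^ 2 := by nlinarith [norm_nonneg w]
    have h3 := norm_pos_iff.2 hc0
    simp only [map_one, one_mul, Complex.I_im, mul_one]
    positivity
  let O := StrictMono.orderIsoOfSurjective (phaseFun w) (strictMono_phaseFun hp)
    (surjective_phaseFun hp)
  have hO : ∀ t, phaseFun w (O.symm t) = t := O.apply_symm_apply
  refine ⟨⟨E.symm, fun t => O.symm (t + z.re), ?_, fun s t hst => O.symm.strictMono
    (by linarith), fun t => ?_, fun t => ?_⟩, fun φ => ?_, ?_⟩
  · have h1 : LinearMap.det (E.toLinearEquiv : ℂ →ₗ[ℝ] ℂ) *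
        LinearMap.det (E.toLinearEquiv.symm : ℂ →ₗ[ℝ] ℂ) = 1 :=
      LinearEquiv.det_mul_det_symm _
    by_contra hc
    have h3 : LinearMap.det (E.toLinearEquiv.symm : ℂ →ₗ[ℝ] ℂ) ≤ 0 := not_lt.1 hc
    nlinarith
  · refine (strictMono_phaseFun hp).injective ?_
    rw [hO, phaseFun_add_one, hO]
    ring
  · have hr0 : 0 < ‖rotFactor w (O.symm (t + z.re))‖ := norm_pos_iff.2 fun h0 => by
      have := rotFactor_re_pos hp (O.symm (t + z.re))
      rw [h0] at this
      exact lt_irrefl _ this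
    set m := Real.exp (Real.pi * z.im) * ‖rotFactor w (O.symm (t + z.re))‖
    have hm : 0 < m := by positivity
    refine ⟨m⁻¹, inv_pos.2 hm, ?_⟩
    rw [ContinuousLinearEquiv.symm_apply_eq, ← ray_eq, ← ray_eq, ← Complex.real_smul, map_smul,
      hE, hSapp, nMap_ray_eq, hO, hc, norm_exp_act, ray_add, ray_neg, Complex.real_smul]
    have hm' : (m : ℂ) ≠ 0 := by exact_mod_cast hm.ne'
    have hmm : (m : ℂ) = (Real.exp (Real.pi * z.im) : ℂ) *
        ‖rotFactor w (O.symm (t + z.re))‖ := by push_cast [m]; rfl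
    rw [Complex.ofReal_inv]
    field_simp [ray_ne_zero]
    rw [hmm]
  · rw [act_P, BlownUpDisk.point_slicing, BlownUpDisk.lift_of_norm_lt hp, Slicing.map_P,
      ← Slicing.cl_singleton]
    congr 1
    ext t
    rw [Set.mem_singleton_iff, Set.mem_preimage, Set.mem_singleton_iff]
    change phaseFun w t = _ ↔ t = O.symm (φ + z.re)
    constructor
    · intro h
      exact (strictMono_phaseFun hp).injective (by rw [hO, h])
    · rintro rfl
      exact hO _
  · ext x
    rfl

theorem forall_mem_diskSet_iff {P : Slicing C} :
    (∀ w ∈ diskSet P, ‖w‖ < 1) ↔ Dense (phaseDiagram P) := by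
  rw [dense_phaseDiagram_iff]
  constructor
  · intro h φ ε hε
    by_contra! hc
    have := h (bdry φ) (bdry_mem_diskSet_iff.2 ⟨ε, hε, hc⟩)
    rw [norm_bdry] at this
    exact lt_irrefl _ this
  · intro h w hw
    by_contra h1
    obtain ⟨φ, -, rfl⟩ := exists_bdry_eq (le_antisymm
      (norm_le_one_of_mem_quotDiskSet (diskSet_subset_quotDiskSet hw)) (not_lt.1 h1))
    obtain ⟨ε, hε, h2⟩ := bdry_mem_diskSet_iff.1 hw
    obtain ⟨t, ht, ht'⟩ := h φ ε hε
    exact (h2 t ht).not_gt ht'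

/-- Either gap condition includes an interval of positive length without phases, which density
excludes. -/
theorem forall_mem_quotDiskSet_iff {P : Slicing C} :
    (∀ w ∈ quotDiskSet P, ‖w‖ < 1) ↔ Dense (phaseDiagram P) := by
  constructor
  · intro h
    exact forall_mem_diskSet_iff.1 fun w hw => h w (diskSet_subset_quotDiskSet hw)
  · intro h w hw
    rw [dense_phaseDiagram_iff] at h
    by_contra h1
    obtain ⟨φ, -, rfl⟩ := exists_bdry_eq (le_antisymm
      (norm_le_one_of_mem_quotDiskSet hw) (not_lt.1 h1))
    obtain ⟨ε, hε, h2 | h2⟩ := bdry_mem_quotDiskSet_iff.1 hw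
    · obtain ⟨t, ht, ht'⟩ := h (φ - ε / 2) (ε / 2) (by positivity)
      rw [abs_lt] at ht'
      exact h2.1 t ⟨by linarith [ht'.1], by linarith [ht'.2]⟩ ht
    · obtain ⟨t, ht, ht'⟩ := h (φ + ε / 2) (ε / 2) (by positivity)
      rw [abs_lt] at ht'
      exact h2.1 t ⟨by linarith [ht'.1], by linarith [ht'.2]⟩ ht

/-! ### Orbit closures as images of the disks, and closed orbits. -/

namespace BlownUpDisk

theorem image_toStab : toStab σ '' {w | ‖w.1.pt‖ < 1} = orbitStabModC v σ := by
  ext x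
  constructor
  · rintro ⟨⟨w, hw⟩, hlt, rfl⟩
    obtain ⟨p, rfl⟩ := surjective_blowDown σ w
    refine ⟨pointS σ p hw, ?_, toStab_blowDown σ p hw⟩
    have := inGOrbit_act_point σ (p := p) hlt 0
    rwa [act_zero] at this
  · rintro ⟨τ, hτ, rfl⟩
    obtain ⟨z, p, hp, h⟩ := InGOrbit.exists_eq_act σ hτ
    have hd : p.pt ∈ diskSet σ.1.slicing := .inl (by simpa using hp)
    refine ⟨⟨blowDown _ p, hd⟩, hp, ?_⟩
    exact (toStab_blowDown σ p hd).trans (stabModC_mk_eq_iff.2 ⟨z, h⟩)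

theorem dense_setOf_norm_lt : Dense {w : QuotDisk σ.1.slicing | ‖w.pt‖ < 1} := by
  obtain ⟨k, κ, hP⟩ := σ.2.isSupported
  refine ((surjective_blowDown σ).denseRange.dense_image continuous_coinduced_rng
    (dense_interior σ.1.slicing hP)).mono ?_
  rintro _ ⟨p, hp, rfl⟩
  exact hp

theorem dense_setOf_norm_lt_classical (hσ : (phaseDiagram σ.1.slicing).Nontrivial) :
    Dense {w : ClassicalDisk σ.1.slicing | ‖w.1.pt‖ < 1} := by
  have hq : Topology.IsQuotientMap (blowDown σ.1.slicing) := ⟨⟨rfl⟩, surjective_blowDown σ⟩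
  have ho : IsOpen {w : QuotDisk σ.1.slicing | w.pt ∈ diskSet σ.1.slicing} :=
    hq.isOpen_preimage.1 (isOpen_setOf_pt_mem_diskSet σ hσ)
  exact (dense_setOf_norm_lt σ).preimage ho.isOpenMap_subtype_val

theorem closure_orbitStabModC (hσ : (phaseDiagram σ.1.slicing).Nontrivial) :
    closure (orbitStabModC v σ) = Set.range (toStab σ) := by
  rw [← image_toStab, (isClosedEmbedding_toStab σ hσ).closure_image_eq,
    (dense_setOf_norm_lt_classical σ hσ).closure_eq, Set.image_univ]

/-- The orbit is the full preimage of its image modulo `ℂ`, so it is closed exactly when the disk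
has no boundary point. -/
theorem isClosed_orbitStab_iff (hσ : (phaseDiagram σ.1.slicing).Nontrivial) :
    IsClosed (orbitStab v σ) ↔ Dense (phaseDiagram σ.1.slicing) := by
  have hpre : Quot.mk _ ⁻¹' orbitStabModC v σ = orbitStab v σ := by
    ext τ
    refine ⟨?_, fun h => ⟨τ, h, rfl⟩⟩
    rintro ⟨ρ, hρ, h⟩
    obtain ⟨z, h⟩ := stabModC_mk_eq_iff.1 h.symm
    obtain ⟨z', p, hp, hρ⟩ := InGOrbit.exists_eq_act σ hρ
    change InGOrbit σ.1 τ.1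
    rw [h, hρ, act_act]
    exact inGOrbit_act_point σ hp _
  rw [← hpre, isQuotientMap_quot_mk.isClosed_preimage, ← closure_subset_iff_isClosed,
    closure_orbitStabModC σ hσ, ← image_toStab, ← forall_mem_diskSet_iff]
  constructor
  · intro h w hw
    obtain ⟨w', hw', h'⟩ := h ⟨⟨⟨w, diskSet_subset_quotDiskSet hw⟩, hw⟩, rfl⟩
    rw [injective_toStab σ hσ h'] at hw'
    exact hw'
  · rintro h _ ⟨w, rfl⟩
    exact ⟨w, h _ w.2, rfl⟩

section Star

variable [IsZLattice ℝ L] (hv : Function.Surjective v)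
  (hσ : (phaseDiagram σ.1.slicing).Nontrivial)

theorem image_toStar : toStar σ hv hσ '' {w | ‖w.pt‖ < 1} = orbitQStabStarModC v σ := by
  ext x
  constructor
  · rintro ⟨w, hlt, rfl⟩
    obtain ⟨p, rfl⟩ := surjective_blowDown σ w
    refine ⟨qStar (pointL σ p) (mk_pointL_mem σ hv hσ p), ⟨pointL σ p, ?_, rfl⟩,
      toStar_blowDown σ hv hσ p⟩
    have := inGOrbit_act_point σ (p := p) hlt 0
    rwa [act_zero] at this
  · rintro ⟨q, ⟨τ, hτ, hq⟩, rfl⟩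
    obtain ⟨z, p, hp, h⟩ := InGOrbit.exists_eq_act σ hτ
    refine ⟨blowDown _ p, hp, ?_⟩
    rw [toStar_blowDown]
    have h1 : q = qStar τ (hq ▸ q.2) := Subtype.ext hq
    have h2 : τ = actL z (pointL σ p) := Subtype.ext h
    rw [h1]
    refine mkC_eq_iff.2 ⟨z, ?_⟩
    rw [h2]
    exact FibreRel.refl _

theorem closure_orbitQStabStarModC :
    closure (orbitQStabStarModC v σ) = Set.range (toStar σ hv hσ) := by
  rw [← image_toStar σ hv hσ, (isClosedEmbedding_toStar σ hv hσ).closure_image_eq,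
    (dense_setOf_norm_lt σ).closure_eq, Set.image_univ]

include hv hσ in
theorem isClosed_orbitQStabStar_iff :
    IsClosed (orbitQStabStar v σ) ↔ Dense (phaseDiagram σ.1.slicing) := by
  have hpre : Quot.mk _ ⁻¹' orbitQStabStarModC v σ = orbitQStabStar v σ := by
    ext q
    refine ⟨?_, fun h => ⟨q, h, rfl⟩⟩
    rintro ⟨q', ⟨τ, hτ, hq'⟩, h⟩
    obtain ⟨ρ, hρ, rfl⟩ := exists_eq_qStar q
    have h1 : q' = qStar τ (hq' ▸ q'.2) := Subtype.ext hq'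
    rw [h1] at h
    obtain ⟨z, hz⟩ := mkC_eq_iff.1 h.symm
    obtain ⟨z', p, hp, h2⟩ := InGOrbit.exists_eq_act σ hτ
    refine ⟨actL z τ, ?_, (QStab.mk_eq_iff.2 hz).symm⟩
    rw [actL_val, h2, act_act]
    exact inGOrbit_act_point σ hp _
  rw [← hpre, isQuotientMap_quot_mk.isClosed_preimage, ← closure_subset_iff_isClosed,
    closure_orbitQStabStarModC σ hv hσ, ← image_toStar σ hv hσ, ← forall_mem_quotDiskSet_iff]
  constructor
  · intro h w hw
    obtain ⟨w', hw', h'⟩ := h ⟨⟨w, hw⟩, rfl⟩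
    rw [injective_toStar σ hv hσ h'] at hw'
    exact hw'
  · rintro h _ ⟨w, rfl⟩
    exact ⟨w, h _ w.mem, rfl⟩

/-- The disk is homeomorphic to the closure of the orbit in `QStab(C)^* / ℂ`. -/
def homeoStar : QuotDisk σ.1.slicing ≃ₜ closure (orbitQStabStarModC v σ) :=
  (isClosedEmbedding_toStar σ hv hσ).isEmbedding.toHomeomorph.trans
    (Homeomorph.setCongr (closure_orbitQStabStarModC σ hv hσ).symm)

end Star

/-- The classical disk is homeomorphic to the closure of the orbit in `Stab(C) / ℂ`. -/
def homeoStab (hσ : (phaseDiagram σ.1.slicing).Nontrivial) :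
    ClassicalDisk σ.1.slicing ≃ₜ closure (orbitStabModC v σ) :=
  (isClosedEmbedding_toStab σ hσ).isEmbedding.toHomeomorph.trans
    (Homeomorph.setCongr (closure_orbitStabModC σ hσ).symm)

end BlownUpDisk

end Orbits

end LaxStability

end

noncomputable section

open scoped ZeroObject

set_option linter.unusedSectionVars false

namespace LaxStability

/-! ### Normalised representatives of the orbits -/

open Classical in
/-- The factor which turns `nMap w` into `discMap w`. -/
def normFactor (w : ℂ) : ℂ := if w = 1 then Complex.I / 2 else (1 - w)⁻¹

theorem discMap_eq (w : ℂ) : discMap w = normFactor w • nMap w := by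
  ext z
  rw [smul_apply, nMap_apply, normFactor, smul_eq_mul]
  have h2 : discMap w z = z.re * (if w = 1 then (0 : ℂ) else 1) +
      z.im * (if w = 1 then (-1 : ℂ) else toUpper w) := by
    by_cases h : w = 1 <;> simp [discMap, h]
  rw [h2]
  conv_rhs => rw [← Complex.re_add_im z]
  simp only [map_add, map_mul, Complex.conj_ofReal, Complex.conj_I]
  by_cases h : w = 1
  · subst h
    simp only [if_true]
    linear_combination (-(z.im : ℂ)) * Complex.I_sq
  · have h1 : (1 : ℂ) - w ≠ 0 := sub_ne_zero.2 (Ne.symm h)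
    simp only [if_neg h]
    rw [toUpper]
    field_simp
    ring

theorem exists_exp_act_eq {r x : ℝ} (hr : 0 < r) :
    ∃ z : ℂ, z.re = x ∧ Complex.exp (-(Complex.I * Real.pi * z)) = r * ray (-x) := by
  refine ⟨x + Complex.I * (Real.log r / Real.pi : ℝ), by simp, ?_⟩
  have h1 : (Real.pi : ℂ) ≠ 0 := by exact_mod_cast Real.pi_ne_zero
  have h2 : (r : ℂ) = Complex.exp (Real.log r : ℝ) := by
    rw [← Complex.ofReal_exp, Real.exp_log hr]
  rw [h2, ray, ← Complex.exp_add]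
  congr 1
  rw [Complex.ofReal_neg, Complex.ofReal_div, mul_add]
  field_simp
  linear_combination (-(Real.log r : ℂ)) * Complex.I_sq

/-- The normalisation `M_w(1) = 1` fixes phase `0`, so the translation must be by `phaseFun w 0`. -/
theorem exists_normFactor_of_norm_lt {w : ℂ} (hw : ‖w‖ < 1) :
    ∃ z : ℂ, z.re = phaseFun w 0 ∧
      Complex.exp (-(Complex.I * Real.pi * z)) = normFactor w := by
  have h1 : w ≠ 1 := by rintro rfl; simp at hw
  have h0 : rotFactor w 0 ≠ 0 := fun h => by
    simpa [h] using rotFactor_re_pos hw 0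
  obtain ⟨z, hz, h⟩ := exists_exp_act_eq (x := phaseFun w 0) (inv_pos.2 (norm_pos_iff.2 h0))
  refine ⟨z, hz, h.trans ?_⟩
  have h2 := nMap_ray_eq w 0
  rw [ray_zero, nMap_apply, map_one, mul_one] at h2
  rw [normFactor, if_neg h1, h2, ray_neg, mul_inv, Complex.ofReal_inv]

/-- Translation by `φ - 1/2` moves the plateau value `φ + 1/2` to `1` and the value `φ - 1/2 + ψ` to
`ψ`. At `φ = 0` the factor is the exceptional `I / 2`; otherwise phase `1` lies on the plateau and
yields the factor. -/
theorem exists_normFactor_bdry {φ : ℝ} (hφ : φ ∈ Set.Ico (0 : ℝ) 1) :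
    ∃ z : ℂ, z.re = φ - 1 / 2 ∧
      Complex.exp (-(Complex.I * Real.pi * z)) = normFactor (bdry φ) := by
  rcases hφ.1.eq_or_lt with rfl | h0
  · obtain ⟨z, hz, h⟩ := exists_exp_act_eq (x := 0 - 1 / 2) (one_half_pos (α := ℝ))
    refine ⟨z, hz, h.trans ?_⟩
    have h1 : ray (1 / 2) = Complex.I := by
      rw [ray_eq', show ((Real.pi * (1 / 2) : ℝ) : ℂ) = Real.pi / 2 by push_cast; ring,
        Complex.exp_pi_div_two_mul_I]
    rw [normFactor, if_pos (by simp [bdry]), zero_sub, neg_neg, h1]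
    push_cast
    ring
  · have hm : (1 : ℝ) ∈ Set.Ioo φ (φ + 1) := ⟨hφ.2, by linarith⟩
    have h1 : bdry φ ≠ 1 := fun h => by
      have h2 : bdry φ = bdry 0 := h.trans (by simp [bdry])
      obtain ⟨n, hn⟩ := bdry_eq_bdry_iff.1 h2
      have h3 : (0 : ℝ) < n := by linarith
      have h4 : (n : ℝ) < 1 := by linarith [hφ.2]
      have h5 : 0 < n := by exact_mod_cast h3
      have h6 : n < 1 := by exact_mod_cast h4
      omega
    have h2 := nMap_ray_eq (ray (2 * φ)) 1
    have h3 : ray (φ + 1 / 2) = -ray (φ - 1 / 2) := by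
      rw [show φ + 1 / 2 = φ - 1 / 2 + 1 by ring, ray_add, ray_one, mul_neg_one]
    rw [phaseFun_boundary hm, h3, nMap_apply, ray_one, map_neg, map_one, ← bdry_eq_ray] at h2
    set r := ‖rotFactor (bdry φ) 1‖
    have h4 : 1 - bdry φ = r * ray (φ - 1 / 2) := by linear_combination -h2
    have hr : 0 < r := by
      refine lt_of_le_of_ne (norm_nonneg _) fun h => h1 ?_
      rw [← h, Complex.ofReal_zero, zero_mul, sub_eq_zero] at h4
      exact h4.symm
    obtain ⟨z, hz, h⟩ := exists_exp_act_eq (x := φ - 1 / 2) (inv_pos.2 hr)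
    refine ⟨z, hz, h.trans ?_⟩
    rw [normFactor, if_neg h1, h4, ray_neg, mul_inv, Complex.ofReal_inv]

theorem eq_of_bdry_eq {φ φ' : ℝ} (hφ : φ ∈ Set.Ico (0 : ℝ) 1) (hφ' : φ' ∈ Set.Ico (0 : ℝ) 1)
    (h : bdry φ = bdry φ') : φ = φ' := by
  obtain ⟨n, hn⟩ := bdry_eq_bdry_iff.1 h
  have h3 : ((-1 : ℤ) : ℝ) < n := by push_cast; linarith [hφ.1, hφ'.2]
  have h4 : (n : ℝ) < (1 : ℤ) := by push_cast; linarith [hφ.2, hφ'.1]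
  have h5 : -1 < n := by exact_mod_cast h3
  have h6 : n < 1 := by exact_mod_cast h4
  obtain rfl : n = 0 := by omega
  simpa using hn

theorem stepLift_eq_cases {φ ψ θ t : ℝ} (hψ : ψ ∈ Set.Icc (0 : ℝ) 1) (hθ : θ ∈ Set.Ioc (0 : ℝ) 1)
    (h : stepLift φ ψ t = θ + (φ - 1 / 2)) :
    (∃ n : ℤ, t = φ + n ∧ θ = ψ + n) ∨ (θ = 1 ∧ t ∈ Set.Ioo φ (φ + 1)) := by
  obtain ⟨n, s, hs, rfl⟩ := exists_int_add_mem_Ico φ t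
  rw [(stepLift φ ψ).map_add_int] at h
  rcases stepLift_mem_Icc hψ hs with ⟨rfl, h1⟩ | ⟨h0, h1⟩
  · exact .inl ⟨n, rfl, by linarith⟩
  · right
    rw [h1] at h
    have h3 : ((-1 : ℤ) : ℝ) < n := by push_cast; linarith [hθ.1]
    have h4 : (n : ℝ) < (1 : ℤ) := by push_cast; linarith [hθ.2]
    have h5 : -1 < n := by exact_mod_cast h3
    have h6 : n < 1 := by exact_mod_cast h4
    obtain rfl : n = 0 := by omega
    simp only [Int.cast_zero, add_zero] at h ⊢
    exact ⟨by linarith, h0, hs.2⟩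

section Representatives

variable {C : Type u₁} [Category.{u₂} C] [Preadditive C] [HasZeroObject C] [HasShift C ℤ]
  [∀ n : ℤ, (shiftFunctor C n).Additive] [Pretriangulated C] [IsTriangulated C]
  {V : Type u₃} [NormedAddCommGroup V] [InnerProductSpace ℝ V] {L : Submodule ℤ V}
  [DiscreteTopology L] {v : K0 C →+ L} (σ : Stab v)

namespace BlownUpDisk

theorem act_point_charge {p : BlownUpDisk σ.1.slicing} {z : ℂ}
    (hz : Complex.exp (-(Complex.I * Real.pi * z)) = normFactor p.pt) :
    (act z (point σ p)).charge = (discMap p.pt).comp σ.1.charge := by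
  rw [act_charge, hz, discMap_eq, point_charge, ContinuousLinearMap.smul_comp]

theorem act_point_P {p : BlownUpDisk σ.1.slicing} {φ ψ : ℝ} {z : ℂ} (hz : z.re = φ - 1 / 2)
    (hp : p.pt = bdry φ) (h : bdry φ ∈ blowUpCentre σ.1.slicing → p.angle = ψ) (θ : ℝ) :
    (act z (point σ p)).slicing.P θ =
      σ.1.slicing.cl (stepLift φ ψ ⁻¹' {θ + (φ - 1 / 2)}) := by
  rw [act_P, point_eq_of_angle σ hp h, hz, Slicing.map_P]

theorem isSigma_of_norm_lt {p : BlownUpDisk σ.1.slicing} (hp : ‖p.pt‖ < 1) :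
    ∃ z, IsSigma σ.1 p.pt (act z (point σ p)) := by
  obtain ⟨z, hz, hz'⟩ := exists_normFactor_of_norm_lt hp
  refine ⟨z, act_point_charge σ hz', fun _ => ?_, fun φ _ h => ?_⟩
  · change ((σ.1.slicing.map p.lift).map (shiftLift (-z.re))).interval _ = _
    rw [Slicing.map_interval _ Set.ordConnected_Ioc, Slicing.map_interval _
      (Set.ordConnected_Ioc.preimage_mono (shiftLift _).monotone), lift_of_norm_lt hp]
    congr 1
    ext t
    have h1 : phaseFun p.pt 1 = phaseFun p.pt 0 + 1 := by rw [← phaseFun_add_one, zero_add]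
    have hs := strictMono_phaseFun hp
    simp only [Set.mem_preimage, shiftLift_apply, phaseLift_apply, hz, Set.mem_Ioc]
    have h4 := hs.lt_iff_lt (a := 0) (b := t)
    have h5 := hs.le_iff_le (a := t) (b := 1)
    rw [← h4, ← h5, h1]
    constructor <;> rintro ⟨h2, h3⟩ <;> constructor <;> linarith
  · rw [h, norm_bdry] at hp
    exact (lt_irrefl _ hp).elim

theorem isSigma_of_eq_bdry {p : BlownUpDisk σ.1.slicing} {φ : ℝ} (hφ : φ ∈ Set.Ico (0 : ℝ) 1)
    (hp : p.pt = bdry φ) (hd : bdry φ ∈ diskSet σ.1.slicing) :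
    ∃ z, IsSigma σ.1 p.pt (act z (point σ p)) := by
  obtain ⟨z, hz, hz'⟩ := exists_normFactor_bdry hφ
  -- Since `φ` is not a phase, any `ψ` may be used; `1/2` keeps the value at `φ + ℤ` off the slice
  -- of phase `1`.
  have hψ : (1 / 2 : ℝ) ∈ Set.Icc (0 : ℝ) 1 := by constructor <;> norm_num
  have hP := act_point_P (ψ := 1 / 2) σ hz hp fun h => absurd hd h.2
  have h0 : ∀ n : ℤ, φ + n ∉ σ.1.slicing.phases := fun n hn => by
    obtain ⟨ε, hε, h⟩ := bdry_mem_diskSet_iff.1 hd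
    have := h φ ((Slicing.add_int_mem_phases_iff n).1 hn)
    rw [sub_self, abs_zero] at this
    linarith
  refine ⟨z, act_point_charge σ (hz'.trans (by rw [hp])), fun h => ?_, fun φ' hφ' h => ?_⟩
  · rw [hp, norm_bdry] at h
    exact (lt_irrefl _ h).elim
  obtain rfl := eq_of_bdry_eq hφ hφ' (hp.symm.trans h)
  refine ⟨?_, ?_, fun θ hθ => ?_⟩
  · by_contra hn
    exact h0 0 (by rw [Int.cast_zero, add_zero]; exact hn)
  · rw [hP, Slicing.interval_eq_cl Set.ordConnected_Ioc]
    funext X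
    refine propext ⟨Slicing.cl_mono fun t ht => ?_, fun h => Slicing.cl_mono (fun t ht => ?_)
      (Slicing.cl_inter_phases h)⟩
    · rcases stepLift_eq_cases hψ (Set.right_mem_Ioc.2 one_pos) ht with ⟨n, -, hn⟩ | ⟨-, h⟩
      · have h2 : ((2 * n : ℤ) : ℝ) = (1 : ℤ) := by push_cast; linarith
        have h3 : 2 * n = 1 := by exact_mod_cast h2
        omega
      · exact Set.Ioo_subset_Ioc_self h
    · have h1 : t ≠ φ + 1 := by
        rintro rfl
        exact h0 1 (by simpa using ht.2)
      rw [Set.mem_preimage, stepLift_of_mem_Ioo _ ⟨ht.1.1, lt_of_le_of_ne ht.1.2 h1⟩,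
        Set.mem_singleton_iff]
      ring
  · intro X hX
    rw [hP] at hX
    refine Slicing.isZero_of_cl (fun t ht => ?_) hX
    rcases stepLift_eq_cases hψ (Set.Ioo_subset_Ioc_self hθ) ht with ⟨n, rfl, -⟩ | ⟨h, -⟩
    · exact not_not.1 (h0 n)
    · exact absurd h hθ.2.ne

theorem exists_isSigma {p : BlownUpDisk σ.1.slicing} (hd : p.pt ∈ diskSet σ.1.slicing) :
    ∃ z, IsSigma σ.1 p.pt (act z (point σ p)) := by
  by_cases hp : ‖p.pt‖ < 1
  · exact isSigma_of_norm_lt σ hp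
  · obtain ⟨φ, hφ, h⟩ := exists_bdry_eq (pt_eq_bdry_of_not_lt hp)
    exact isSigma_of_eq_bdry σ hφ h (h ▸ hd)

theorem isSigmaPsi_act_point {p : BlownUpDisk σ.1.slicing} {φ ψ : ℝ} {z : ℂ}
    (hz : z.re = φ - 1 / 2) (hz' : Complex.exp (-(Complex.I * Real.pi * z)) = normFactor (bdry φ))
    (hp : p.pt = bdry φ) (h : p.angle = ψ) (hψ : ψ ∈ Set.Icc (0 : ℝ) 1)
    (h0 : φ ∈ σ.1.slicing.phases) : IsSigmaPsi σ.1 φ ψ (act z (point σ p)) := by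
  have hP := act_point_P σ hz hp fun _ => h
  refine ⟨h0, hp ▸ act_point_charge σ (hz'.trans (by rw [hp])), ?_, ?_, fun θ hθ h1 h2 X hX => ?_⟩
  · rw [hP, Slicing.interval_eq_cl Set.ordConnected_Ioo]
    intro X
    refine Slicing.cl_mono fun t ht => ?_
    rw [Set.mem_preimage, stepLift_of_mem_Ioo _ ht, Set.mem_singleton_iff]
    ring
  · rw [hP]
    intro X
    refine Slicing.cl_single ?_
    rw [Set.mem_preimage, stepLift_self hψ, Set.mem_singleton_iff]
    ring
  · rw [hP] at hX
    refine Slicing.isZero_of_cl (fun t ht => ?_) hX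
    rcases stepLift_eq_cases hψ hθ ht with ⟨n, -, h3⟩ | ⟨h3, -⟩
    · have h4 := lt_of_le_of_ne hθ.2 h1
      have h5 : ((-1 : ℤ) : ℝ) < n := by push_cast; linarith [hθ.1, hψ.2]
      have h6 : (n : ℝ) < (1 : ℤ) := by push_cast; linarith [hψ.1]
      have h7 : -1 < n := by exact_mod_cast h5
      have h8 : n < 1 := by exact_mod_cast h6
      obtain rfl : n = 0 := by omega
      exact absurd (by simpa using h3) h2
    · exact absurd h3 h1

theorem exists_isSigma_toStab [IsZLattice ℝ L] (hv : Function.Surjective v)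
    (hσ : (phaseDiagram σ.1.slicing).Nontrivial) (w : ClassicalDisk σ.1.slicing) :
    ∃ (τ : Stab v) (τ' : LStab v), τ'.1 = τ.1 ∧ IsSigma σ.1 w.1.pt τ.1 ∧
      IsClassOf v (toStar σ hv hσ w.1) τ' ∧ toStab σ w = Quot.mk _ τ := by
  obtain ⟨⟨w, hw'⟩, hw⟩ := w
  obtain ⟨p, hp⟩ := surjective_blowDown σ ⟨w, hw'⟩
  obtain rfl : p.pt = w := congrArg QuotDisk.pt hp
  obtain ⟨z, hz⟩ := exists_isSigma σ (p := p) hw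
  have h1 : QStab.mk v (actL z (pointL σ p)) ∈ starSet v := by
    rw [mk_mem_starSet_iff hv, actL_val, act_charge]
    exact smul_ne_zero (Complex.exp_ne_zero _) (charge_pointL_ne_zero σ hσ p)
  refine ⟨⟨act z (point σ p), (isStab_point σ hw).act z⟩, actL z (pointL σ p), rfl, hz,
    ⟨qStar _ h1, rfl, (toStar_blowDown σ hv hσ p).trans (mkC_eq_iff.2 ⟨z, .refl _⟩)⟩,
    (toStab_blowDown σ p hw).trans (stabModC_mk_eq_iff.2 ⟨z, rfl⟩)⟩

theorem exists_isSigmaPsi_toStar [IsZLattice ℝ L] (hv : Function.Surjective v)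
    (hσ : (phaseDiagram σ.1.slicing).Nontrivial) (w : QuotDisk σ.1.slicing)
    (hw : w.pt ∉ diskSet σ.1.slicing) :
    ∃ φ ∈ Set.Ico (0 : ℝ) 1, w.pt = bdry φ ∧ (∃ ψ : ℝ, AllowedPhase σ.1.slicing φ ψ) ∧
      ∃ q : QStabStar v, toStar σ hv hσ w = Quot.mk _ q ∧
        ∀ ψ : ℝ, AllowedPhase σ.1.slicing φ ψ →
          ∃ τ : LStab v, IsSigmaPsi σ.1 φ ψ τ.1 ∧ q.1 = QStab.mk v τ := by
  obtain ⟨k, κ, hP⟩ := σ.2.isSupported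
  obtain ⟨w, hq⟩ := w
  change w ∉ _ at hw
  have hw1 : ‖w‖ = 1 := by
    refine le_antisymm (norm_le_one_of_mem_quotDiskSet hq) (not_lt.1 fun h => hw (.inl ?_))
    simpa using h
  obtain ⟨φ, hφ, rfl⟩ := exists_bdry_eq hw1
  have hs : bdry φ ∈ blowUpCentre σ.1.slicing := ⟨hq, hw⟩
  obtain ⟨ψ₀, hψ₀⟩ := hP.exists_allowedPhase hs
  obtain ⟨z, hz, hz'⟩ := exists_normFactor_bdry hφ
  set p := ofBdry σ.1.slicing φ ψ₀ hq fun _ => hψ₀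
  have h1 : QStab.mk v (actL z (pointL σ p)) ∈ starSet v := by
    rw [mk_mem_starSet_iff hv, actL_val, act_charge]
    exact smul_ne_zero (Complex.exp_ne_zero _) (charge_pointL_ne_zero σ hσ p)
  refine ⟨φ, hφ, rfl, ⟨ψ₀, hψ₀⟩, qStar _ h1,
    (toStar_blowDown σ hv hσ p).trans (mkC_eq_iff.2 ⟨z, .refl _⟩), fun ψ hψ => ?_⟩
  refine ⟨actL z (pointL σ (ofBdry σ.1.slicing φ ψ hq fun _ => hψ)), ?_, ?_⟩
  · exact isSigmaPsi_act_point σ hz hz' rfl (ofBdry_angle hq _ hs) hψ.mem_Icc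
      (hP.mem_phases_of_mem_blowUpCentre hs)
  · exact QStab.mk_eq_iff.2 ((fibreRel_pointL σ (p := p)
      (q := ofBdry σ.1.slicing φ ψ hq fun _ => hψ) rfl).act z)

end BlownUpDisk

end Representatives

end LaxStability

end

/-! ### Assembly of the statement. -/

theorem mainTheorem11
    {C : Type u₁} [Category.{u₂} C] [Preadditive C] [HasZeroObject C] [HasShift C ℤ]
    [∀ n : ℤ, (shiftFunctor C n).Additive] [Pretriangulated C] [IsTriangulated C]
    {V : Type u₃} [NormedAddCommGroup V] [InnerProductSpace ℝ V] [FiniteDimensional ℝ V]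
    (L : Submodule ℤ V) [DiscreteTopology L] [IsZLattice ℝ L]
    (v : LaxStability.K0 C →+ L) (hv : Function.Surjective v)
    (σ : LaxStability.Stab v)
    (hσ : (LaxStability.phaseDiagram σ.1.slicing).Nontrivial) :
    LaxStability.diskSet σ.1.slicing ⊆ LaxStability.quotDiskSet σ.1.slicing ∧
    (∃ (Ψ : LaxStability.QuotDisk σ.1.slicing ≃ₜ closure (LaxStability.orbitQStabStarModC v σ))
      (Ψ₀ : LaxStability.ClassicalDisk σ.1.slicing ≃ₜ closure (LaxStability.orbitStabModC v σ)),
      (∀ w : LaxStability.ClassicalDisk σ.1.slicing,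
        ∃ (τ : LaxStability.Stab v) (τ' : LaxStability.LStab v), τ'.1 = τ.1 ∧
          LaxStability.IsSigma σ.1 w.1.pt τ.1 ∧
          LaxStability.IsClassOf v (Ψ w.1).1 τ' ∧ (Ψ₀ w).1 = Quot.mk _ τ) ∧
      (∀ w : LaxStability.QuotDisk σ.1.slicing, w.pt ∉ LaxStability.diskSet σ.1.slicing →
        ∃ φ ∈ Set.Ico (0 : ℝ) 1, w.pt = LaxStability.bdry φ ∧
          (∃ ψ : ℝ, LaxStability.AllowedPhase σ.1.slicing φ ψ) ∧
          ∃ q : LaxStability.QStabStar v, (Ψ w).1 = Quot.mk _ q ∧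
            ∀ ψ : ℝ, LaxStability.AllowedPhase σ.1.slicing φ ψ →
              ∃ τ : LaxStability.LStab v, LaxStability.IsSigmaPsi σ.1 φ ψ τ.1 ∧
                q.1 = LaxStability.QStab.mk v τ)) ∧
    (IsClosed (LaxStability.orbitStab v σ) ↔ Dense (LaxStability.phaseDiagram σ.1.slicing)) ∧
    (IsClosed (LaxStability.orbitQStabStar v σ) ↔
      Dense (LaxStability.phaseDiagram σ.1.slicing)) := by
  exact ⟨LaxStability.diskSet_subset_quotDiskSet,
    ⟨LaxStability.BlownUpDisk.homeoStar σ hv hσ, LaxStability.BlownUpDisk.homeoStab σ hσ,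
      LaxStability.BlownUpDisk.exists_isSigma_toStab σ hv hσ,
      LaxStability.BlownUpDisk.exists_isSigmaPsi_toStar σ hv hσ⟩,
    LaxStability.BlownUpDisk.isClosed_orbitStab_iff σ hσ,
    LaxStability.BlownUpDisk.isClosed_orbitQStabStar_iff σ hv hσ⟩
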